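/- Let $A\to M$ be a smooth real vector bundle of finite rank over a smooth manifold (Hausdorff, second countable, finite-dimensional), let $\Pi A$ be the supermanifold with function algebra $\Gamma(\bigwedge^{\cdot}A^*)$, and let $\mathcal E=T^*\Pi A\cong T^*\Pi A^*$. Let $\mathcal C=\bigoplus_{k,l}\mathcal C^{k,l}$ be the bigraded algebra of polynomial functions on $\mathcal E$: in Darboux coordinates $(x^i,\xi^a,p_i,\theta_a)$ given by coordinates on $M$ and a local frame of $A$, the generators $x^i,\xi^a,\theta_a,p_i$ have bidegrees $(0,0),(0,1),(1,0),(1,1)$. The canonical Poisson bracket $\{\cdot,\cdot\}$ has bidegree $(-1,-1)$ and is normalized by $\{p_i,x^j\}=\delta_i^j$, $\{\theta_a,\xi^b\}=\delta_a^b$. Functions on $\Pi A$ and $\Pi A^*$, i.e. elements of $\Gamma(\bigwedge^{\cdot}A^*)=\mathcal C^{0,\cdot}$ and $\Gamma(\bigwedge^{\cdot}A)=\mathcal C^{\cdot,0}$, are regarded as functions on $\mathcal E$. A *quasi-Lie bialgebroid structure* on $(A,A^*)$ is a triple $\mu\in\mathcal C^{1,2}$, $\gamma\in\mathcal C^{2,1}$,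 $\phi\in\mathcal C^{0,3}=\Gamma(\bigwedge^3A^*)$ such that $\Theta=\mu+\gamma+\phi$ satisfies $\{\Theta,\Theta\}=0$. Put $d_\gamma=\{\gamma,\cdot\}$ and $[\cdot,\cdot]_\mu=\{\{\cdot,\mu\},\cdot\}$ on $\Gamma(\bigwedge^{\cdot}A)$, and $d_\mu=\{\mu,\cdot\}$ and $[\cdot,\cdot]_\gamma=\{\{\cdot,\gamma\},\cdot\}$ on $\Gamma(\bigwedge^{\cdot}A^*)$. A *differential quasi-Gerstenhaber algebra structure* on $\Gamma(\bigwedge^{\cdot}A)$ is an $L_\infty$-structure $\{l_k\}_{k\ge1}$ on $\Gamma(\bigwedge^{\cdot}A)[1]$, that is, graded skew-symmetric $\mathbb R$-multilinear maps $l_k$ of degree $2-k$ with $$\sum_{i=1}^n(-1)^i\sum_{\sigma}\chi(\sigma;x)\,l_{n-i+1}\bigl(l_i(x_{\sigma(1)},\dots,x_{\sigma(i)}),x_{\sigma(i+1)},\dots,x_{\sigma(n)}\bigr)=0\qquad(n\ge1),$$ where $\sigma$ runs over the $(i,n-i)$-unshuffles and $\chi$ is the sign of $\sigma$ times the Koszul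 sign, such that each $l_k$ is a graded derivation of the exterior multiplication in each argument and $l_k=0$ for $k>3$. A *quasi-differential Gerstenhaber algebra structure* on $\Gamma(\bigwedge^{\cdot}A^*)$ consists of a Gerstenhaber bracket $[\cdot,\cdot]$ (of degree $-1$, satisfying the graded Leibniz and Jacobi identities), a degree $+1$ derivation $\delta$ of both the exterior product and the bracket, and $\phi\in\Gamma(\bigwedge^3A^*)$ with $\delta^2+[\phi,\cdot]=0$ and $\delta\phi=0$. Then: 1. For $\mu,\gamma,\phi$ of bidegrees $(1,2),(2,1),(0,3)$, the equation $\{\Theta,\Theta\}=0$ is equivalent to $$\tfrac12\{\mu,\mu\}+\{\gamma,\phi\}=0,\quad\{\gamma,\gamma\}=0,\quad\{\mu,\gamma\}=0,\quad\{\mu,\phi\}=0.$$ 2. Quasi-Lie bialgebroid structures on $(A,A^*)$ are in one-to-one correspondence with differential quasi-Gerstenhaber algebra structures on $\Gamma(\bigwedge^{\cdot}A)$: each $(\mu,\gamma,\phi)$ corresponds to exactly one $\{l_k\}$, and each $\{l_k\}$ to exactly one $(\mu,\gamma,\phi)$, such that $l_1=d_\gamma$, $l_2=[\cdot,\cdot]_\mu$,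 and $l_3(X,Y,Z)=\phi(X,Y,Z)=-\{X,\{Y,\{Z,\phi\}\}\}$ for $X,Y,Z\in\Gamma(A)$. 3. In every differential quasi-Gerstenhaber algebra structure on $\Gamma(\bigwedge^{\cdot}A)$, write $d=l_1$, $[\cdot,\cdot]=l_2$, $\phi=l_3$, and let $a$ and $a_*$ be the anchors, $a(X)f=[X,f]$ and $a_*(\alpha)f=\langle\alpha,df\rangle$. Then for all $X,Y,Z,W\in\Gamma(A)$: $\;a([X,Y])=[a(X),a(Y)]+a_*\phi(X,Y)$; $$[[X,Y],Z]+[[Y,Z],X]+[[Z,X],Y]=d(\phi(X,Y,Z))+\phi(dX,Y,Z)-\phi(dY,X,Z)+\phi(dZ,X,Y);$$ $$\begin{aligned}&[\phi(X,Y,Z),W]-[\phi(X,Y,W),Z]+[\phi(X,Z,W),Y]-[\phi(Y,Z,W),X]\\&-\bigl(\phi([X,Y],Z,W)-\phi([X,Z],Y,W)+\phi([X,W],Y,Z)\\&\qquad+\phi([Y,Z],X,W)-\phi([Y,W],X,Z)+\phi([Z,W],X,Y)\bigr)=0.\end{aligned}$$ 4. Dually, quasi-Lie bialgebroid structures on $(A,A^*)$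 are in one-to-one correspondence with quasi-differential Gerstenhaber algebra structures $([\cdot,\cdot],\delta,\phi)$ on $\Gamma(\bigwedge^{\cdot}A^*)$, via $[\cdot,\cdot]=[\cdot,\cdot]_\gamma$, $\delta=d_\mu$ and the same $\phi$; in particular $d_\mu^2+[\phi,\cdot]_\gamma=0$ and $d_\mu\phi=0$. -/

import Mathlib

open scoped Manifold ContDiff DirectSum

noncomputable section

namespace QuasiLieBialg

/-! ### Smooth sections as a module over smooth functions -/

section Sections

variable {E : Type*} [NormedAddCommGroup E] [NormedSpace ℝ E]
  {M : Type*} [TopologicalSpace M] [ChartedSpace E M]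
  {F : Type*} [NormedAddCommGroup F] [NormedSpace ℝ F]
  {A : M → Type*} [TopologicalSpace (Bundle.TotalSpace F A)]
  [∀ x, AddCommGroup (A x)] [∀ x, Module ℝ (A x)] [∀ x, TopologicalSpace (A x)]
  [FiberBundle F A] [VectorBundle ℝ F A]

instance sectionSMul :
    SMul C^∞⟮𝓘(ℝ, E), M; 𝓘(ℝ, ℝ), ℝ⟯ Cₛ^∞⟮𝓘(ℝ, E); F, A⟯ :=
  ⟨fun f s => ⟨fun x => f x • s x, f.contMDiff.smul_section s.contMDiff⟩⟩

theorem section_smul_apply (f : C^∞⟮𝓘(ℝ, E), M; 𝓘(ℝ, ℝ), ℝ⟯)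
    (s : Cₛ^∞⟮𝓘(ℝ, E); F, A⟯) (x : M) : (f • s) x = f x • s x := rfl

/-- The pointwise action of smooth functions on smooth sections. -/
instance sectionModule :
    Module C^∞⟮𝓘(ℝ, E), M; 𝓘(ℝ, ℝ), ℝ⟯ Cₛ^∞⟮𝓘(ℝ, E); F, A⟯ where
  one_smul s := by ext x; exact one_smul ℝ (s x)
  mul_smul f g s := by ext x; exact mul_smul (f x) (g x) (s x)
  smul_zero f := by ext x; exact smul_zero (f x)
  smul_add f s t := by ext x; exact smul_add (f x) (s x) (t x)
  add_smul f g s := by ext x; exact add_smul (f x) (g x) (s x)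
  zero_smul s := by ext x; exact zero_smul ℝ (s x)

instance sectionScalarTower :
    IsScalarTower ℝ C^∞⟮𝓘(ℝ, E), M; 𝓘(ℝ, ℝ), ℝ⟯ Cₛ^∞⟮𝓘(ℝ, E); F, A⟯ :=
  ⟨fun c f s => by ext x; exact smul_assoc c (f x) (s x)⟩

end Sections

/-! ### Exterior algebras, graded by the integers -/

section Ext

variable {R : Type*} [CommRing R] [Algebra ℝ R] {N : Type*} [AddCommGroup N] [Module ℝ N]
  [Module R N] [IsScalarTower ℝ R N]

variable (R N) in
/-- The component of degree `j` of `⋀ N`, as a real subspace; it is `0` for `j < 0`. -/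
def extDeg : ℤ → Submodule ℝ (ExteriorAlgebra R N)
  | Int.ofNat n => (⋀[R]^n N).restrictScalars ℝ
  | Int.negSucc _ => ⊥

theorem mem_extDeg_natCast {n : ℕ} {x : ExteriorAlgebra R N} :
    x ∈ extDeg R N (n : ℤ) ↔ x ∈ ⋀[R]^n N := Iff.rfl

theorem extDeg_cases {j : ℤ} {x : ExteriorAlgebra R N} (hx : x ∈ extDeg R N j) :
    x = 0 ∨ ∃ n : ℕ, j = n ∧ x ∈ ⋀[R]^n N := by
  rcases j with n | n
  · exact Or.inr ⟨n, rfl, hx⟩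
  · exact Or.inl hx

theorem extDeg_mul {i j : ℤ} {x y : ExteriorAlgebra R N} (hx : x ∈ extDeg R N i)
    (hy : y ∈ extDeg R N j) : x * y ∈ extDeg R N (i + j) := by
  rcases extDeg_cases hx with rfl | ⟨m, rfl, hx⟩
  · simp
  rcases extDeg_cases hy with rfl | ⟨n, rfl, hy⟩
  · simp
  rw [← Nat.cast_add, mem_extDeg_natCast]
  exact SetLike.mul_mem_graded (A := fun i : ℕ => ⋀[R]^i N) hx hy

theorem one_mem_extDeg : (1 : ExteriorAlgebra R N) ∈ extDeg R N 0 :=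
  SetLike.one_mem_graded (fun i : ℕ => ⋀[R]^i N)

theorem ext_hom_ext {D D' : Module.End ℝ (ExteriorAlgebra R N)}
    (h : ∀ (j : ℤ), ∀ x ∈ extDeg R N j, D x = D' x) : D = D' := by
  ext x
  induction x using DirectSum.Decomposition.inductionOn fun i => ⋀[R]^i N with
  | zero => simp
  | add _ _ h₁ h₂ => rw [map_add, map_add, h₁, h₂]
  | @homogeneous i m => exact h i m.1 m.2

theorem ι_mul_comm (a : N) {j : ℕ} {y : ExteriorAlgebra R N} (hy : y ∈ ⋀[R]^j N) :
    y * ExteriorAlgebra.ι R a = (j : ℤ).negOnePow • (ExteriorAlgebra.ι R a * y) := by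
  induction hy using Submodule.pow_induction_on_left' with
  | algebraMap r => simp [Algebra.commutes]
  | add x y i _ _ hx hy => rw [add_mul, hx, hy, mul_add, smul_add]
  | mem_mul m hm i x _ hx =>
    obtain ⟨b, rfl⟩ := hm
    have h := ExteriorAlgebra.ι_add_mul_swap (R := R) b a
    rw [mul_assoc, hx, mul_smul_comm, ← mul_assoc, ← mul_assoc, eq_neg_of_add_eq_zero_left h]
    push_cast
    rw [Int.negOnePow_succ]
    simp

/-- Graded commutativity of the exterior algebra. -/
theorem ext_mul_comm {i j : ℤ} {x y : ExteriorAlgebra R N} (hx : x ∈ extDeg R N i)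
    (hy : y ∈ extDeg R N j) : y * x = (i * j).negOnePow • (x * y) := by
  rcases extDeg_cases hx with rfl | ⟨m, rfl, hx⟩
  · simp
  rcases extDeg_cases hy with rfl | ⟨n, rfl, hy⟩
  · simp
  clear * - hx hy
  change x ∈ LinearMap.range (ExteriorAlgebra.ι R : N →ₗ[R] ExteriorAlgebra R N) ^ m at hx
  induction hx using Submodule.pow_induction_on_left' with
  | algebraMap r => simp [Algebra.commutes]
  | add x x' i _ _ h h' => rw [mul_add, h, h', add_mul, smul_add]
  | mem_mul a ha i x _ h =>
    obtain ⟨b, rfl⟩ := ha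
    rw [← mul_assoc, ι_mul_comm b hy, smul_mul_assoc, mul_assoc, h, mul_smul_comm, smul_smul,
      ← Int.negOnePow_add, ← mul_assoc]
    congr 2
    push_cast
    ring

end Ext

/-! ### Differential operators on an exterior algebra and their supercommutators -/

section DiffOp

variable {R : Type*} [CommRing R] [Algebra ℝ R] {N : Type*} [AddCommGroup N] [Module ℝ N]
  [Module R N] [IsScalarTower ℝ R N]

/-- The supercommutator `PQ - (-1)^{m m'} QP` of operators `P`, `Q` of degrees `m`, `m'`. -/
def scomm (m m' : ℤ) (P Q : Module.End ℝ (ExteriorAlgebra R N)) :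
    Module.End ℝ (ExteriorAlgebra R N) :=
  P * Q - (m * m').negOnePow • (Q * P)

theorem negOnePow_smul_comp (u : ℤ) (P Q : Module.End ℝ (ExteriorAlgebra R N)) :
    P * (u.negOnePow • Q) = u.negOnePow • (P * Q) := mul_smul_comm _ _ _

theorem scomm_add_left (m m' : ℤ) (P P' Q : Module.End ℝ (ExteriorAlgebra R N)) :
    scomm m m' (P + P') Q = scomm m m' P Q + scomm m m' P' Q := by
  simp only [scomm, add_mul, mul_add, smul_add]; abel

theorem scomm_add_right (m m' : ℤ) (P Q Q' : Module.End ℝ (ExteriorAlgebra R N)) :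
    scomm m m' P (Q + Q') = scomm m m' P Q + scomm m m' P Q' := by
  simp only [scomm, add_mul, mul_add, smul_add]; abel

theorem scomm_smul_left (m m' : ℤ) (c : ℝ) (P Q : Module.End ℝ (ExteriorAlgebra R N)) :
    scomm m m' (c • P) Q = c • scomm m m' P Q := by
  simp only [scomm, smul_mul_assoc, mul_smul_comm, smul_sub, smul_comm c]

theorem scomm_smul_right (m m' : ℤ) (c : ℝ) (P Q : Module.End ℝ (ExteriorAlgebra R N)) :
    scomm m m' P (c • Q) = c • scomm m m' P Q := by
  simp only [scomm, smul_mul_assoc, mul_smul_comm, smul_sub, smul_comm c]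

theorem scomm_zero_left (m m' : ℤ) (Q : Module.End ℝ (ExteriorAlgebra R N)) :
    scomm m m' 0 Q = 0 := by simp [scomm]

theorem scomm_zero_right (m m' : ℤ) (P : Module.End ℝ (ExteriorAlgebra R N)) :
    scomm m m' P 0 = 0 := by simp [scomm]

theorem scomm_mul (m m' j : ℤ) (P Q A : Module.End ℝ (ExteriorAlgebra R N)) :
    scomm (m + m') j (P * Q) A =
      P * scomm m' j Q A + (m' * j).negOnePow • (scomm m j P A * Q) := by
  simp only [scomm, mul_sub, sub_mul, smul_sub, negOnePow_smul_comp, smul_mul_assoc, smul_smul,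
    ← Int.negOnePow_add, mul_assoc, add_mul]
  rw [add_comm (m' * j) (m * j)]
  abel

theorem scomm_jacobi (m m' j : ℤ) (P Q A : Module.End ℝ (ExteriorAlgebra R N)) :
    scomm (m + m') j (scomm m m' P Q) A =
      scomm m (m' + j) P (scomm m' j Q A) +
        (m' * j).negOnePow • scomm (m + j) m' (scomm m j P A) Q := by
  have h1 : ((m + m') * j).negOnePow = (m * j).negOnePow * (m' * j).negOnePow := by
    rw [add_mul, Int.negOnePow_add]
  have h2 : (m * (m' + j)).negOnePow = (m * m').negOnePow * (m * j).negOnePow := by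
    rw [mul_add, Int.negOnePow_add]
  have h3 : ((m + j) * m').negOnePow = (m * m').negOnePow * (m' * j).negOnePow := by
    rw [add_mul, Int.negOnePow_add, mul_comm j m']
  simp only [scomm, h1, h2, h3]
  rcases Int.units_eq_one_or (m * m').negOnePow with u | u <;>
  rcases Int.units_eq_one_or (m * j).negOnePow with v | v <;>
  rcases Int.units_eq_one_or (m' * j).negOnePow with w | w <;>
  simp only [u, v, w, mul_one, mul_neg, neg_neg, one_smul, Units.neg_smul,
    mul_sub, sub_mul, mul_assoc, sub_neg_eq_add, mul_add, add_mul, neg_add, neg_sub] <;> abel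

variable (R N) in
/-- `diffOp R N n m` is the space of real differential operators on the supercommutative algebra
`⋀ N`, homogeneous of degree `m` and of order strictly less than `n`: the supercommutator with
multiplication by every homogeneous element has order strictly less than `n - 1`. -/
def diffOp : ℕ → ℤ → Submodule ℝ (Module.End ℝ (ExteriorAlgebra R N))
  | 0, _ => ⊥
  | n + 1, m =>
    { carrier := {P | (∀ i, ∀ x ∈ extDeg R N i, P x ∈ extDeg R N (i + m)) ∧
        ∀ j, ∀ a ∈ extDeg R N j, scomm m j P (LinearMap.mulLeft ℝ a) ∈ diffOp n (m + j)}
      zero_mem' := ⟨fun i x _ => Submodule.zero_mem _, fun j a _ => by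
        rw [scomm_zero_left]; exact Submodule.zero_mem _⟩
      add_mem' := fun hP hQ =>
        ⟨fun i x hx => Submodule.add_mem _ (hP.1 i x hx) (hQ.1 i x hx), fun j a ha => by
          rw [scomm_add_left]; exact Submodule.add_mem _ (hP.2 j a ha) (hQ.2 j a ha)⟩
      smul_mem' := fun c P hP =>
        ⟨fun i x hx => Submodule.smul_mem _ c (hP.1 i x hx), fun j a ha => by
          rw [scomm_smul_left]; exact Submodule.smul_mem _ c (hP.2 j a ha)⟩ }

theorem mem_diffOp_succ {n : ℕ} {m : ℤ} {P : Module.End ℝ (ExteriorAlgebra R N)} :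
    P ∈ diffOp R N (n + 1) m ↔ (∀ i, ∀ x ∈ extDeg R N i, P x ∈ extDeg R N (i + m)) ∧
      ∀ j, ∀ a ∈ extDeg R N j, scomm m j P (LinearMap.mulLeft ℝ a) ∈ diffOp R N n (m + j) :=
  Iff.rfl

theorem diffOp_degree {n : ℕ} {m : ℤ} {P : Module.End ℝ (ExteriorAlgebra R N)}
    (hP : P ∈ diffOp R N n m) {i : ℤ} {x : ExteriorAlgebra R N} (hx : x ∈ extDeg R N i) :
    P x ∈ extDeg R N (i + m) := by
  cases n with
  | zero => rw [(Submodule.mem_bot ℝ).1 hP]; exact Submodule.zero_mem _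
  | succ n => exact hP.1 i x hx

theorem negOnePow_smul_mem {V : Type*} [AddCommGroup V] [Module ℝ V] (S : Submodule ℝ V)
    (u : ℤ) {x : V} (hx : x ∈ S) : u.negOnePow • x ∈ S := by
  rcases Int.even_or_odd u with h | h
  · rwa [Int.negOnePow_even _ h, one_smul]
  · rw [Int.negOnePow_odd _ h, Units.neg_smul, one_smul]; exact S.neg_mem hx

theorem diffOp_mono {n n' : ℕ} (h : n ≤ n') (m : ℤ) : diffOp R N n m ≤ diffOp R N n' m := by
  induction n generalizing n' m with
  | zero => exact bot_le
  | succ n ih =>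
    obtain ⟨k, rfl⟩ : ∃ k, n' = k + 1 := ⟨n' - 1, by omega⟩
    exact fun P hP => ⟨hP.1, fun j a ha => ih (by omega) _ (hP.2 j a ha)⟩

theorem diffOp_mul {a b c : ℕ} (h : a + b ≤ c + 1) {m m' : ℤ}
    {P Q : Module.End ℝ (ExteriorAlgebra R N)} (hP : P ∈ diffOp R N a m)
    (hQ : Q ∈ diffOp R N b m') : P * Q ∈ diffOp R N c (m + m') := by
  induction c generalizing a b m m' P Q with
  | zero =>
    rcases Nat.eq_zero_or_pos a with rfl | ha
    · rw [(Submodule.mem_bot ℝ).1 hP, zero_mul]; exact Submodule.zero_mem _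
    · obtain rfl : b = 0 := by omega
      rw [(Submodule.mem_bot ℝ).1 hQ, mul_zero]; exact Submodule.zero_mem _
  | succ c ih =>
    rcases a with _ | a
    · rw [(Submodule.mem_bot ℝ).1 hP, zero_mul]; exact Submodule.zero_mem _
    rcases b with _ | b
    · rw [(Submodule.mem_bot ℝ).1 hQ, mul_zero]; exact Submodule.zero_mem _
    refine ⟨fun i x hx => ?_, fun j x hx => ?_⟩
    · have := diffOp_degree hP (diffOp_degree hQ hx)
      rwa [add_assoc, add_comm m' m] at this
    · rw [scomm_mul]
      refine Submodule.add_mem _ ?_ (negOnePow_smul_mem _ _ ?_)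
      · rw [add_assoc]; exact ih (by omega) hP (hQ.2 j x hx)
      · rw [add_right_comm]; exact ih (by omega) (hP.2 j x hx) hQ

/-- Operators of order `0` are left multiplications. -/
theorem eq_mulLeft_of_mem_diffOp_one {m : ℤ} {P : Module.End ℝ (ExteriorAlgebra R N)}
    (hP : P ∈ diffOp R N 1 m) : P = LinearMap.mulLeft ℝ (P 1) := by
  refine ext_hom_ext fun j x hx => ?_
  have h := (Submodule.mem_bot ℝ).1 (hP.2 j x hx)
  have h1 : P 1 ∈ extDeg R N m := by
    have := diffOp_degree hP one_mem_extDeg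
    rwa [zero_add] at this
  have h2 := LinearMap.congr_fun h 1
  simp only [scomm, LinearMap.sub_apply, Module.End.mul_apply, LinearMap.mulLeft_apply, mul_one,
    LinearMap.smul_apply, LinearMap.zero_apply, sub_eq_zero] at h2
  rw [h2, LinearMap.mulLeft_apply, ext_mul_comm h1 hx, smul_smul, ← Int.negOnePow_add]
  rw [Int.negOnePow_even _ ⟨_, rfl⟩, one_smul]

theorem scomm_mulLeft {i j : ℤ} {x y : ExteriorAlgebra R N} (hx : x ∈ extDeg R N i)
    (hy : y ∈ extDeg R N j) : scomm i j (LinearMap.mulLeft ℝ x) (LinearMap.mulLeft ℝ y) = 0 := by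
  ext z
  simp only [scomm, LinearMap.sub_apply, Module.End.mul_apply, LinearMap.mulLeft_apply,
    LinearMap.smul_apply, LinearMap.zero_apply]
  rw [← mul_assoc, ← mul_assoc, ext_mul_comm hx hy, smul_mul_assoc, smul_smul,
    ← Int.negOnePow_add, Int.negOnePow_even _ ⟨_, rfl⟩, one_smul, sub_self]

theorem mulLeft_mem_diffOp {i : ℤ} {x : ExteriorAlgebra R N} (hx : x ∈ extDeg R N i) :
    LinearMap.mulLeft ℝ x ∈ diffOp R N 1 i :=
  ⟨fun j y hy => by rw [add_comm]; exact extDeg_mul hx hy,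
    fun j y hy => by rw [scomm_mulLeft hx hy]; exact Submodule.zero_mem _⟩

/-- The supercommutator of operators of orders `k` and `k'` has order at most `k + k' - 1`. -/
theorem diffOp_scomm {a b c : ℕ} (h : a + b ≤ c + 2) {m m' : ℤ}
    {P Q : Module.End ℝ (ExteriorAlgebra R N)} (hP : P ∈ diffOp R N a m)
    (hQ : Q ∈ diffOp R N b m') : scomm m m' P Q ∈ diffOp R N c (m + m') := by
  induction c generalizing a b m m' P Q with
  | zero =>
    rcases a with _ | a
    · rw [(Submodule.mem_bot ℝ).1 hP, scomm_zero_left]; exact Submodule.zero_mem _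
    rcases b with _ | b
    · rw [(Submodule.mem_bot ℝ).1 hQ, scomm_zero_right]; exact Submodule.zero_mem _
    obtain ⟨rfl, rfl⟩ : a = 0 ∧ b = 0 := by omega
    have h1 : P 1 ∈ extDeg R N m := by
      simpa using diffOp_degree hP one_mem_extDeg
    have h2 : Q 1 ∈ extDeg R N m' := by
      simpa using diffOp_degree hQ one_mem_extDeg
    rw [eq_mulLeft_of_mem_diffOp_one hP, eq_mulLeft_of_mem_diffOp_one hQ, scomm_mulLeft h1 h2]
    exact Submodule.zero_mem _
  | succ c ih =>
    rcases a with _ | a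
    · rw [(Submodule.mem_bot ℝ).1 hP, scomm_zero_left]; exact Submodule.zero_mem _
    rcases b with _ | b
    · rw [(Submodule.mem_bot ℝ).1 hQ, scomm_zero_right]; exact Submodule.zero_mem _
    refine ⟨fun i x hx => ?_, fun j x hx => ?_⟩
    · refine Submodule.sub_mem _ ?_ (negOnePow_smul_mem _ _ ?_)
      · have := diffOp_degree hP (diffOp_degree hQ hx)
        rwa [add_assoc, add_comm m' m] at this
      · have := diffOp_degree hQ (diffOp_degree hP hx)
        rwa [add_assoc] at this
    · rw [scomm_jacobi]
      refine Submodule.add_mem _ ?_ (negOnePow_smul_mem _ _ ?_)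
      · rw [add_assoc]; exact ih (by omega) hP (hQ.2 j x hx)
      · rw [add_right_comm]; exact ih (by omega) (hP.2 j x hx) hQ

end DiffOp

/-! ### Subquotients of a real vector space -/

section Subquotient

variable {V : Type*} [AddCommGroup V] [Module ℝ V]

/-- The quotient `S / (S ∩ L)` of two subspaces of a real vector space. -/
def Subquot (S L : Submodule ℝ V) : Type _ := S ⧸ L.submoduleOf S

instance (S L : Submodule ℝ V) : AddCommGroup (Subquot S L) :=
  inferInstanceAs (AddCommGroup (S ⧸ L.submoduleOf S))

instance (S L : Submodule ℝ V) : Module ℝ (Subquot S L) :=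
  inferInstanceAs (Module ℝ (S ⧸ L.submoduleOf S))

/-- The class of an element of `S`. -/
def Subquot.mk {S : Submodule ℝ V} (L : Submodule ℝ V) (x : V) (hx : x ∈ S) : Subquot S L :=
  Submodule.Quotient.mk ⟨x, hx⟩

/-- A linear map with values in `S`, composed with the projection to the subquotient. -/
def Subquot.ofMap {W : Type*} [AddCommGroup W] [Module ℝ W] {S : Submodule ℝ V}
    (L : Submodule ℝ V) (f : W →ₗ[ℝ] V) (h : ∀ w, f w ∈ S) : W →ₗ[ℝ] Subquot S L :=
  (L.submoduleOf S).mkQ ∘ₗ f.codRestrict S h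

theorem Subquot.ofMap_apply {W : Type*} [AddCommGroup W] [Module ℝ W] {S : Submodule ℝ V}
    (L : Submodule ℝ V) (f : W →ₗ[ℝ] V) (h : ∀ w, f w ∈ S) (w : W) :
    Subquot.ofMap L f h w = Subquot.mk L (f w) (h w) := rfl

/-- The bilinear map on subquotients induced by a bilinear map. -/
def Subquot.map₂ {S L S' L' S'' L'' : Submodule ℝ V} (β : V →ₗ[ℝ] V →ₗ[ℝ] V)
    (h : ∀ x ∈ S, ∀ y ∈ S', β x y ∈ S'') (hl : ∀ x ∈ L, ∀ y ∈ S', β x y ∈ L'')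
    (hr : ∀ x ∈ S, ∀ y ∈ L', β x y ∈ L'') :
    Subquot S L →ₗ[ℝ] Subquot S' L' →ₗ[ℝ] Subquot S'' L'' :=
  Submodule.liftQ (L.submoduleOf S)
    (Submodule.liftQ (L'.submoduleOf S')
      (LinearMap.mk₂ ℝ (fun (y : S') (x : S) => Subquot.mk L'' (β x.1 y.1) (h x.1 x.2 y.1 y.2))
        (fun y y' x => congrArg (L''.submoduleOf S'').mkQ
          (Subtype.ext ((β x.1).map_add y.1 y'.1)))
        (fun c y x => congrArg (L''.submoduleOf S'').mkQ
          (Subtype.ext ((β x.1).map_smul c y.1)))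
        (fun y x x' => congrArg (L''.submoduleOf S'').mkQ
          (Subtype.ext (LinearMap.map_add₂ β x.1 x'.1 y.1)))
        (fun c y x => congrArg (L''.submoduleOf S'').mkQ
          (Subtype.ext (LinearMap.map_smul₂ β c x.1 y.1))))
      (fun y hy => LinearMap.mem_ker.2 (LinearMap.ext fun x =>
        (Submodule.Quotient.mk_eq_zero _).2 (hr x.1 x.2 y.1 hy)))).flip
    (fun x hx => LinearMap.mem_ker.2 (LinearMap.ext fun y => by
      obtain ⟨y, rfl⟩ := Submodule.Quotient.mk_surjective _ y
      exact (Submodule.Quotient.mk_eq_zero _).2 (hl x.1 hx y.1 y.2)))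

theorem Subquot.map₂_mk {S L S' L' S'' L'' : Submodule ℝ V} (β : V →ₗ[ℝ] V →ₗ[ℝ] V)
    (h : ∀ x ∈ S, ∀ y ∈ S', β x y ∈ S'') (hl : ∀ x ∈ L, ∀ y ∈ S', β x y ∈ L'')
    (hr : ∀ x ∈ S, ∀ y ∈ L', β x y ∈ L'') {x y : V} (hx : x ∈ S) (hy : y ∈ S') :
    Subquot.map₂ β h hl hr (Subquot.mk L x hx) (Subquot.mk L' y hy) =
      Subquot.mk L'' (β x y) (h x hx y hy) := rfl

end Subquotient

/-! ### Polynomial functions on `T^*ΠA` and their Poisson bracket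

Throughout, `R` stands for `C^∞(M)` and `P` for `Γ(A)`, where `A` is a vector bundle of finite rank
on the manifold `M`.  Then `P` is a finitely generated projective `R`-module, `Γ(A^*)` is its dual
module, and `Γ(⋀A)`, `Γ(⋀A^*)` are the exterior algebras of `P` and of its dual over `R`. -/

section Functions

variable (R : Type*) [CommRing R] [Algebra ℝ R] (P : Type*) [AddCommGroup P] [Module ℝ P]
  [Module R P] [IsScalarTower ℝ R P]

/-- The functions on `ΠA^*`, i.e. the multisections `Γ(⋀A)`. -/
abbrev Multi := ExteriorAlgebra R P

/-- The functions on `ΠA`, i.e. the forms `Γ(⋀A^*)`. -/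
abbrev Form := ExteriorAlgebra R (Module.Dual R P)

/-- Differential operators on `ΠA` of order at most `k` and of degree `l - k`. -/
def ops (k l : ℤ) : Submodule ℝ (Module.End ℝ (Form R P)) :=
  diffOp R (Module.Dual R P) (k + 1).toNat (l - k)

/-- Differential operators on `ΠA` of order at most `k - 1` and of degree `l - k`. -/
def lowerOps (k l : ℤ) : Submodule ℝ (Module.End ℝ (Form R P)) :=
  diffOp R (Module.Dual R P) k.toNat (l - k)

/-- Functions of bidegree `(k, l)` on `T^*ΠA`.  A function on a cotangent bundle which is
homogeneous polynomial of degree `k` along the fibres is the same as the principal symbol of a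
differential operator of order `k` on the base, here `ΠA`.  In Darboux coordinates
`(x, ξ, p, θ)` the symbols of `ξ^a`, `∂/∂ξ^a`, `∂/∂x^i` are `ξ^a`, `θ_a`, `p_i`, of bidegrees
`(0,1)`, `(1,0)`, `(1,1)`. -/
abbrev Fun (k l : ℤ) : Type _ := Subquot (ops R P k l) (lowerOps R P k l)

/-- The algebra `𝒞` of polynomial functions on `T^*ΠA`, as a bigraded vector space. -/
abbrev Ham := ⨁ b : ℤ × ℤ, Fun R P b.1 b.2

variable {R P}

theorem scomm_mem {a b c : ℕ} (h : 0 < a → 0 < b → a + b ≤ c + 2) {m m' n : ℤ} (hn : m + m' = n)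
    {D D' : Module.End ℝ (Form R P)} (hD : D ∈ diffOp R (Module.Dual R P) a m)
    (hD' : D' ∈ diffOp R (Module.Dual R P) b m') :
    scomm m m' D D' ∈ diffOp R (Module.Dual R P) c n := by
  subst hn
  rcases Nat.eq_zero_or_pos a with rfl | ha
  · rw [(Submodule.mem_bot ℝ).1 hD, scomm_zero_left]; exact Submodule.zero_mem _
  rcases Nat.eq_zero_or_pos b with rfl | hb
  · rw [(Submodule.mem_bot ℝ).1 hD', scomm_zero_right]; exact Submodule.zero_mem _
  exact diffOp_scomm (h ha hb) hD hD'

theorem scomm_mem_ops {k l k' l' : ℤ} {D D' : Module.End ℝ (Form R P)} (hD : D ∈ ops R P k l)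
    (hD' : D' ∈ ops R P k' l') :
    scomm (l - k) (l' - k') D D' ∈ ops R P (k + k' - 1) (l + l' - 1) :=
  scomm_mem (by omega) (by ring) hD hD'

theorem scomm_mem_lowerOps_left {k l k' l' : ℤ} {D D' : Module.End ℝ (Form R P)}
    (hD : D ∈ lowerOps R P k l) (hD' : D' ∈ ops R P k' l') :
    scomm (l - k) (l' - k') D D' ∈ lowerOps R P (k + k' - 1) (l + l' - 1) :=
  scomm_mem (by omega) (by ring) hD hD'

theorem scomm_mem_lowerOps_right {k l k' l' : ℤ} {D D' : Module.End ℝ (Form R P)}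
    (hD : D ∈ ops R P k l) (hD' : D' ∈ lowerOps R P k' l') :
    scomm (l - k) (l' - k') D D' ∈ lowerOps R P (k + k' - 1) (l + l' - 1) :=
  scomm_mem (by omega) (by ring) hD hD'

variable (R P) in
/-- The supercommutator of operators of degrees `m`, `m'` as a bilinear map. -/
def scommBilin (m m' : ℤ) :
    Module.End ℝ (Form R P) →ₗ[ℝ] Module.End ℝ (Form R P) →ₗ[ℝ] Module.End ℝ (Form R P) :=
  LinearMap.mk₂ ℝ (scomm m m') (scomm_add_left m m') (scomm_smul_left m m')
    (scomm_add_right m m') (scomm_smul_right m m')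

variable (R P) in
/-- The canonical Poisson bracket of homogeneous functions on `T^*ΠA`: the bracket of two symbols
is the symbol of the supercommutator. It has bidegree `(-1,-1)`, and `{p_i, x^j} = δ_i^j`,
`{θ_a, ξ^b} = δ_a^b`. -/
def funBracket (k l k' l' : ℤ) :
    Fun R P k l →ₗ[ℝ] Fun R P k' l' →ₗ[ℝ] Fun R P (k + k' - 1) (l + l' - 1) :=
  Subquot.map₂ (scommBilin R P (l - k) (l' - k'))
    (fun _ hx _ hy => scomm_mem_ops hx hy)
    (fun _ hx _ hy => scomm_mem_lowerOps_left hx hy)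
    (fun _ hx _ hy => scomm_mem_lowerOps_right hx hy)

variable (R P) in
/-- The function of bidegree `(k, l)`, as an element of `𝒞`. -/
def Fun.toHam (k l : ℤ) : Fun R P k l →ₗ[ℝ] Ham R P :=
  DirectSum.lof ℝ (ℤ × ℤ) (fun b => Fun R P b.1 b.2) (k, l)

variable (R P) in
/-- The canonical Poisson bracket on `𝒞`. -/
def poisson : Ham R P →ₗ[ℝ] Ham R P →ₗ[ℝ] Ham R P :=
  DirectSum.toModule ℝ (ℤ × ℤ) _ fun b =>
    (DirectSum.toModule ℝ (ℤ × ℤ) _ fun b' =>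
      ((funBracket R P b.1 b.2 b'.1 b'.2).compr₂
        (Fun.toHam R P (b.1 + b'.1 - 1) (b.2 + b'.2 - 1))).flip).flip

theorem poisson_toHam (k l k' l' : ℤ) (f : Fun R P k l) (g : Fun R P k' l') :
    poisson R P (Fun.toHam R P k l f) (Fun.toHam R P k' l' g) =
      Fun.toHam R P (k + k' - 1) (l + l' - 1) (funBracket R P k l k' l' f g) := by
  simp [poisson, Fun.toHam]

/-! ### Multisections and forms as functions on `T^*ΠA` -/

variable (R P) in
/-- Contraction of forms with multisections: `X₁ ∧ ⋯ ∧ X_k` acts as `ι_{X₁} ∘ ⋯ ∘ ι_{X_k}`. -/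
def contract : Multi R P →ₐ[R] Module.End R (Form R P) :=
  ExteriorAlgebra.lift R ⟨CliffordAlgebra.contractLeft ∘ₗ Module.Dual.eval R P,
    fun _ => LinearMap.ext fun a => CliffordAlgebra.contractLeft_contractLeft _ a⟩

theorem contract_ι (X : P) (a : Form R P) :
    contract R P (ExteriorAlgebra.ι R X) a =
      CliffordAlgebra.contractLeft (Module.Dual.eval R P X) a := by
  simp [contract]

theorem contractLeft_ext_mul (d : Module.Dual R (Module.Dual R P)) {j : ℕ} {a : Form R P}
    (ha : a ∈ ⋀[R]^j (Module.Dual R P)) (b : Form R P) :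
    CliffordAlgebra.contractLeft d (a * b) = CliffordAlgebra.contractLeft d a * b +
      (j : ℤ).negOnePow • (a * CliffordAlgebra.contractLeft d b) := by
  induction ha using Submodule.pow_induction_on_left' with
  | algebraMap r =>
    simp [CliffordAlgebra.contractLeft_algebraMap_mul, CliffordAlgebra.contractLeft_algebraMap]
  | add x y i _ _ hx hy => rw [add_mul, map_add, hx, hy, map_add, add_mul, add_mul, smul_add]; abel
  | mem_mul m hm i x _ hx =>
    obtain ⟨α, rfl⟩ := hm
    have h := CliffordAlgebra.contractLeft_ι_mul (Q := (0 : QuadraticForm R (Module.Dual R P))) d α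
    rw [mul_assoc, h, h, hx]
    push_cast
    rw [Int.negOnePow_succ, mul_add, mul_smul_comm, sub_mul, smul_mul_assoc, mul_assoc, mul_assoc,
      Units.neg_smul]
    abel

theorem contractLeft_mem (d : Module.Dual R (Module.Dual R P)) {j : ℕ} {a : Form R P}
    (ha : a ∈ ⋀[R]^j (Module.Dual R P)) :
    CliffordAlgebra.contractLeft d a ∈ extDeg R (Module.Dual R P) ((j : ℤ) - 1) := by
  induction ha using Submodule.pow_induction_on_left' with
  | algebraMap r => rw [CliffordAlgebra.contractLeft_algebraMap]; exact Submodule.zero_mem _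
  | add x y i _ _ hx hy => rw [map_add]; exact Submodule.add_mem _ hx hy
  | mem_mul m hm i x hx' hx =>
    obtain ⟨α, rfl⟩ := hm
    have h := CliffordAlgebra.contractLeft_ι_mul (Q := (0 : QuadraticForm R (Module.Dual R P))) d α
    rw [h]
    push_cast
    rw [add_sub_cancel_right]
    refine Submodule.sub_mem _ ?_ ?_
    · exact mem_extDeg_natCast.2 (Submodule.smul_mem _ _ hx')
    · have h1 : ExteriorAlgebra.ι R α ∈ extDeg R (Module.Dual R P) 1 := by
        change _ ∈ LinearMap.range (ExteriorAlgebra.ι R) ^ 1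
        rw [pow_one]; exact ⟨α, rfl⟩
      have := extDeg_mul h1 hx
      rwa [add_sub_cancel] at this

theorem contract_ι_mem (X : P) :
    (contract R P (ExteriorAlgebra.ι R X)).restrictScalars ℝ ∈
      diffOp R (Module.Dual R P) 2 (-1) := by
  have hd : ∀ i, ∀ x ∈ extDeg R (Module.Dual R P) i,
      contract R P (ExteriorAlgebra.ι R X) x ∈ extDeg R (Module.Dual R P) (i + -1) := by
    intro i x hx
    rcases extDeg_cases hx with rfl | ⟨n, rfl, hx⟩
    · rw [map_zero]; exact Submodule.zero_mem _
    · rw [contract_ι]; exact contractLeft_mem _ hx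
  refine ⟨hd, fun j a ha => ?_⟩
  have key : scomm (-1) j ((contract R P (ExteriorAlgebra.ι R X)).restrictScalars ℝ)
      (LinearMap.mulLeft ℝ a) =
        LinearMap.mulLeft ℝ (contract R P (ExteriorAlgebra.ι R X) a) := by
    ext b
    simp only [scomm, LinearMap.sub_apply, Module.End.mul_apply, LinearMap.mulLeft_apply,
      LinearMap.smul_apply, LinearMap.restrictScalars_apply]
    rcases extDeg_cases ha with rfl | ⟨n, rfl, ha⟩
    · simp
    · rw [contract_ι, contract_ι, contract_ι, contractLeft_ext_mul _ ha, neg_one_mul,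
        Int.negOnePow_neg, add_sub_cancel_right]
  rw [key, add_comm]
  exact mulLeft_mem_diffOp (by simpa [add_comm] using hd j a ha)

theorem contract_mem {k : ℕ} {x : Multi R P} (hx : x ∈ ⋀[R]^k P) :
    (contract R P x).restrictScalars ℝ ∈ diffOp R (Module.Dual R P) (k + 1) (-k) := by
  induction hx using Submodule.pow_induction_on_left' with
  | algebraMap r =>
    have h : (contract R P (algebraMap R _ r)).restrictScalars ℝ =
        LinearMap.mulLeft ℝ (algebraMap R (Form R P) r) := by
      ext b
      rw [AlgHom.commutes]
      simp [Algebra.smul_def]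
    rw [h]
    exact mulLeft_mem_diffOp (mem_extDeg_natCast.2
      (SetLike.algebraMap_mem_graded (fun i : ℕ => ⋀[R]^i (Module.Dual R P)) r))
  | add x y i _ _ hx hy => rw [map_add]; exact Submodule.add_mem _ hx hy
  | mem_mul m hm i x _ hx =>
    obtain ⟨X, rfl⟩ := hm
    rw [map_mul]
    have := diffOp_mul (c := i + 1 + 1) (by omega) (contract_ι_mem X) hx
    rw [show (-1 : ℤ) + -(i : ℤ) = -((i.succ : ℕ) : ℤ) by push_cast; ring] at this
    exact this

variable (R P) in
/-- The pull-back `Γ(⋀^k A) → 𝒞^{k,0}`. -/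
def hbarDeg (k : ℕ) : ⋀[R]^k P →ₗ[ℝ] Fun R P k 0 :=
  Subquot.ofMap (lowerOps R P k 0)
    ({ toFun := fun x => (contract R P x.1).restrictScalars ℝ
       map_add' := fun x y => by rw [Submodule.coe_add, map_add]; rfl
       map_smul' := fun c x => by
        ext a
        change contract R P (c • x.1) a = c • contract R P x.1 a
        rw [← algebraMap_smul R c x.1, map_smul, LinearMap.smul_apply, algebraMap_smul] } :
      ⋀[R]^k P →ₗ[ℝ] Module.End ℝ (Form R P))
    (fun x => by
      have := contract_mem x.2
      rw [← zero_sub] at this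
      exact this)

variable (R P) in
/-- The pull-back `Γ(⋀^k A^*) → 𝒞^{0,k}`. -/
def vbarDeg (k : ℕ) : ⋀[R]^k (Module.Dual R P) →ₗ[ℝ] Fun R P 0 k :=
  Subquot.ofMap (lowerOps R P 0 k)
    ((LinearMap.mul ℝ (Form R P)) ∘ₗ ((⋀[R]^k (Module.Dual R P)).subtype.restrictScalars ℝ))
    (fun x => by
      have := mulLeft_mem_diffOp (mem_extDeg_natCast.2 x.2)
      rw [← sub_zero (k : ℤ)] at this
      exact this)

variable (R P) in
/-- The pull-back of functions along the projection of `T^*ΠA = T^*ΠA^*` to `ΠA^*`. -/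
def hbar : Multi R P →ₗ[ℝ] Ham R P :=
  (DirectSum.toModule ℝ ℕ (Ham R P) fun k => Fun.toHam R P k 0 ∘ₗ hbarDeg R P k) ∘ₗ
    (DirectSum.decomposeLinearEquiv (fun k : ℕ => ⋀[R]^k P)).toLinearMap.restrictScalars ℝ

variable (R P) in
/-- The pull-back of functions along the projection of `T^*ΠA` to `ΠA`. -/
def vbar : Form R P →ₗ[ℝ] Ham R P :=
  (DirectSum.toModule ℝ ℕ (Ham R P) fun k => Fun.toHam R P 0 k ∘ₗ vbarDeg R P k) ∘ₗ
    (DirectSum.decomposeLinearEquiv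
      (fun k : ℕ => ⋀[R]^k (Module.Dual R P))).toLinearMap.restrictScalars ℝ

end Functions

/-! ### Strongly homotopy Lie algebras -/

section LInfty

/-- The sign `χ(σ; x)` of the rearrangement `(x_{σ 0}, …, x_{σ (n-1)})` of homogeneous elements
of degrees `d`: every inversion contributes `-(-1)^{|x||y|}`, so that `χ` is the product of the
sign of `σ` and the Koszul sign. -/
def chi {n : ℕ} (d : Fin n → ℤ) (σ : Equiv.Perm (Fin n)) : ℤˣ :=
  ∏ a, ∏ b, if a < b ∧ σ b < σ a then -(d (σ a) * d (σ b)).negOnePow else 1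

/-- `σ` is an `(i, n - i)`-unshuffle: it is increasing on the first `i` and on the last `n - i`
positions. -/
def IsUnshuffle {n : ℕ} (i : ℕ) (σ : Equiv.Perm (Fin n)) : Prop :=
  ∀ a b : Fin n, a < b → ((b : ℕ) < i ∨ i ≤ (a : ℕ)) → σ a < σ b

variable {V : Type*} [AddCommGroup V] [Module ℝ V]

open Classical in
/-- The sum over `(i, n - i)`-unshuffles, `i = p + 1`, of
`χ(σ; x) l_{n-i+1}(l_i(x_{σ 0}, …, x_{σ (i-1)}), x_{σ i}, …, x_{σ (n-1)})`. -/
def nested (l : ∀ k : ℕ, MultilinearMap ℝ (fun _ : Fin k => V) V) {n : ℕ} (p : Fin n)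
    (x : Fin n → V) (d : Fin n → ℤ) : V :=
  ∑ σ : Equiv.Perm (Fin n), if IsUnshuffle (p + 1) σ then
    chi d σ • l (n - (p + 1) + 1) (Fin.cons
      (l (p + 1) fun a => x (σ ⟨a, by omega⟩))
      (fun b : Fin (n - (p + 1)) => x (σ ⟨p + 1 + b, by omega⟩)))
  else 0

/-- A strongly homotopy Lie (`L_∞`) structure on the graded real vector space with homogeneous
components `gr i`: graded skew-symmetric `k`-linear operations `l k` of degree `2 - k`, for
`k ≥ 1`, satisfying the higher Jacobi identities
`∑_{i=1}^n (-1)^i ∑_σ χ(σ; x) l_{n-i+1}(l_i(x_{σ 0}, …), …) = 0` for all `n ≥ 1`.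
(With `l k` replaced by `(-1)^{(k-1)(k-2)/2} l k` the sign `(-1)^i` becomes, up to an overall sign,
the sign `(-1)^{i(n-i)}` which is also in use.) -/
structure LInftyAlgebra (gr : ℤ → Submodule ℝ V) where
  /-- the operations; there is no operation `l_0` -/
  l : ∀ k : ℕ, MultilinearMap ℝ (fun _ : Fin k => V) V
  l_zero : l 0 = 0
  degree : ∀ (k : ℕ) (x : Fin k → V) (d : Fin k → ℤ), (∀ i, x i ∈ gr (d i)) →
    l k x ∈ gr (∑ i, d i + (2 - k))
  skew : ∀ (k : ℕ) (x : Fin k → V) (d : Fin k → ℤ), (∀ i, x i ∈ gr (d i)) →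
    ∀ σ : Equiv.Perm (Fin k), l k (fun i => x (σ i)) = chi d σ • l k x
  jacobi : ∀ (n : ℕ) (x : Fin n → V) (d : Fin n → ℤ), (∀ i, x i ∈ gr (d i)) →
    ∑ p : Fin n, ((p : ℤ) + 1).negOnePow • nested l p x d = 0

end LInfty

/-! ### The three structures -/

section Structures

variable (R : Type*) [CommRing R] [Algebra ℝ R] (P : Type*) [AddCommGroup P] [Module ℝ P]
  [Module R P] [IsScalarTower ℝ R P]

variable {R P} in
/-- The cubic Hamiltonian `Θ = μ + γ + φ`. -/
def theta (μ : Fun R P 1 2) (γ : Fun R P 2 1) (φ : Fun R P 0 3) : Ham R P :=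
  Fun.toHam R P 1 2 μ + Fun.toHam R P 2 1 γ + Fun.toHam R P 0 3 φ

/-- A quasi-Lie bialgebroid structure on `(A, A^*)`: functions `μ`, `γ`, `φ` on `T^*ΠA` of
bidegrees `(1,2)`, `(2,1)`, `(0,3)` such that `Θ = μ + γ + φ` satisfies `{Θ, Θ} = 0`. -/
@[ext]
structure QuasiLieBialgebroid where
  μ : Fun R P 1 2
  γ : Fun R P 2 1
  φ : Fun R P 0 3
  self_commuting : poisson R P (theta μ γ φ) (theta μ γ φ) = 0

/-- `Γ(⋀A)[1]`: the component of degree `i` is `Γ(⋀^{i+1}A)`. -/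
def shiftedDeg (i : ℤ) : Submodule ℝ (Multi R P) := extDeg R P (i + 1)

/-- A differential quasi-Gerstenhaber algebra structure on `Γ(⋀A)`: an `L_∞` structure on
`Γ(⋀A)[1]` with `l_k = 0` for `k > 3` and each `l_k` a graded derivation of the (undeformed)
exterior multiplication in its last, hence by skew-symmetry in each, argument. -/
structure DiffQuasiGerstenhaber extends LInftyAlgebra (shiftedDeg R P) where
  derivation : ∀ (k : ℕ) (x : Fin k → Multi R P) (d : Fin k → ℤ),
    (∀ i, x i ∈ shiftedDeg R P (d i)) → ∀ (e : ℤ) (y z : Multi R P), y ∈ extDeg R P e →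
    l (k + 1) (Fin.snoc x (y * z)) = l (k + 1) (Fin.snoc x y) * z +
      ((∑ i, d i + (2 - ((k : ℤ) + 1))) * e).negOnePow • (y * l (k + 1) (Fin.snoc x z))
  higher_zero : ∀ k, 3 < k → l k = 0

/-- A quasi-differential Gerstenhaber algebra structure on `Γ(⋀A^*)`: a Gerstenhaber bracket
`[·,·]` (of degree `-1`), a derivation `δ` of degree `1` of both the exterior product and the
bracket, and `φ ∈ Γ(⋀³A^*)` with `δ² + [φ, ·] = 0` and `δφ = 0`. -/
@[ext]
structure QuasiDiffGerstenhaber where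
  bracket : Form R P →ₗ[ℝ] Form R P →ₗ[ℝ] Form R P
  δ : Form R P →ₗ[ℝ] Form R P
  φ : Form R P
  bracket_degree : ∀ i j : ℤ, ∀ a ∈ extDeg R (Module.Dual R P) i,
    ∀ b ∈ extDeg R (Module.Dual R P) j, bracket a b ∈ extDeg R (Module.Dual R P) (i + j - 1)
  bracket_skew : ∀ i j : ℤ, ∀ a ∈ extDeg R (Module.Dual R P) i,
    ∀ b ∈ extDeg R (Module.Dual R P) j,
    bracket a b = -(((i - 1) * (j - 1)).negOnePow • bracket b a)
  bracket_leibniz : ∀ i j : ℤ, ∀ a ∈ extDeg R (Module.Dual R P) i,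
    ∀ b ∈ extDeg R (Module.Dual R P) j, ∀ c,
    bracket a (b * c) = bracket a b * c + ((i - 1) * j).negOnePow • (b * bracket a c)
  bracket_jacobi : ∀ i j : ℤ, ∀ a ∈ extDeg R (Module.Dual R P) i,
    ∀ b ∈ extDeg R (Module.Dual R P) j, ∀ c,
    bracket a (bracket b c) =
      bracket (bracket a b) c + ((i - 1) * (j - 1)).negOnePow • bracket b (bracket a c)
  δ_degree : ∀ i : ℤ, ∀ a ∈ extDeg R (Module.Dual R P) i,
    δ a ∈ extDeg R (Module.Dual R P) (i + 1)
  δ_mul : ∀ i : ℤ, ∀ a ∈ extDeg R (Module.Dual R P) i, ∀ b,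
    δ (a * b) = δ a * b + i.negOnePow • (a * δ b)
  δ_bracket : ∀ i : ℤ, ∀ a ∈ extDeg R (Module.Dual R P) i, ∀ b,
    δ (bracket a b) = bracket (δ a) b + (i - 1).negOnePow • bracket a (δ b)
  φ_degree : φ ∈ extDeg R (Module.Dual R P) 3
  δ_sq : ∀ a, δ (δ a) + bracket φ a = 0
  δ_φ : δ φ = 0

variable {R P}

/-- The quasi-Lie bialgebroid `Q` and the differential quasi-Gerstenhaber algebra `S` correspond
to each other: `l₁ = d_γ = {γ, ·}`, `l₂ = [·,·]_μ = {{·, μ}, ·}`, and `l₃ = φ`, that is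
`l₃(X, Y, Z) = φ(X, Y, Z) = -{X, {Y, {Z, φ}}}` for `X, Y, Z ∈ Γ(A)`. -/
structure Corresponds (Q : QuasiLieBialgebroid R P) (S : DiffQuasiGerstenhaber R P) : Prop where
  l_one : ∀ x, hbar R P (S.l 1 ![x]) = poisson R P (Fun.toHam R P 2 1 Q.γ) (hbar R P x)
  l_two : ∀ x y, hbar R P (S.l 2 ![x, y]) =
    poisson R P (poisson R P (hbar R P x) (Fun.toHam R P 1 2 Q.μ)) (hbar R P y)
  l_three : ∀ X Y Z : P,
    hbar R P (S.l 3 ![ExteriorAlgebra.ι R X, ExteriorAlgebra.ι R Y, ExteriorAlgebra.ι R Z]) =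
      -poisson R P (hbar R P (ExteriorAlgebra.ι R X))
        (poisson R P (hbar R P (ExteriorAlgebra.ι R Y))
          (poisson R P (hbar R P (ExteriorAlgebra.ι R Z)) (Fun.toHam R P 0 3 Q.φ)))

/-- The quasi-Lie bialgebroid `Q` and the quasi-differential Gerstenhaber algebra `T` correspond
to each other: the bracket is `[·,·]_γ = {{·, γ}, ·}`, the quasi-differential is
`d_μ = {μ, ·}`, and the two elements `φ` agree. -/
structure DuallyCorresponds (Q : QuasiLieBialgebroid R P) (T : QuasiDiffGerstenhaber R P) :
    Prop where
  bracket : ∀ a b, vbar R P (T.bracket a b) =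
    poisson R P (poisson R P (vbar R P a) (Fun.toHam R P 2 1 Q.γ)) (vbar R P b)
  δ : ∀ a, vbar R P (T.δ a) = poisson R P (Fun.toHam R P 1 2 Q.μ) (vbar R P a)
  φ : vbar R P T.φ = Fun.toHam R P 0 3 Q.φ

/-- The relations between the anchor `a(X) = [X, ·]` of `A`, the anchor `a_*(α) = ⟨α, d·⟩` of
`A^*`, the bracket `[·,·] = l₂`, the differential `d = l₁` and `φ = l₃`, on sections
`X, Y, Z, W` of `A` and functions `f` on `M`. -/
structure SectionRelations (S : DiffQuasiGerstenhaber R P) : Prop where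
  /-- `a([X,Y]) f = [a(X), a(Y)] f + a_*(φ(X,Y)) f` -/
  anchor : ∀ (X Y : P) (f : R),
    let x := ExteriorAlgebra.ι R X
    let y := ExteriorAlgebra.ι R Y
    let g := algebraMap R (Multi R P) f
    S.l 2 ![S.l 2 ![x, y], g] =
      S.l 2 ![x, S.l 2 ![y, g]] - S.l 2 ![y, S.l 2 ![x, g]] + S.l 3 ![x, y, S.l 1 ![g]]
  /-- `[[X,Y],Z] + [[Y,Z],X] + [[Z,X],Y] = d(φ(X,Y,Z)) + φ(dX,Y,Z) - φ(dY,X,Z) + φ(dZ,X,Y)` -/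
  jacobiator : ∀ X Y Z : P,
    let x := ExteriorAlgebra.ι R X
    let y := ExteriorAlgebra.ι R Y
    let z := ExteriorAlgebra.ι R Z
    S.l 2 ![S.l 2 ![x, y], z] + S.l 2 ![S.l 2 ![y, z], x] + S.l 2 ![S.l 2 ![z, x], y] =
      S.l 1 ![S.l 3 ![x, y, z]] +
        (S.l 3 ![S.l 1 ![x], y, z] - S.l 3 ![S.l 1 ![y], x, z] + S.l 3 ![S.l 1 ![z], x, y])
  /-- the coherence condition between `[·,·]` and `φ` -/
  coherence : ∀ X Y Z W : P,
    let x := ExteriorAlgebra.ι R X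
    let y := ExteriorAlgebra.ι R Y
    let z := ExteriorAlgebra.ι R Z
    let w := ExteriorAlgebra.ι R W
    (S.l 2 ![S.l 3 ![x, y, z], w] - S.l 2 ![S.l 3 ![x, y, w], z] +
        S.l 2 ![S.l 3 ![x, z, w], y] - S.l 2 ![S.l 3 ![y, z, w], x]) -
      (S.l 3 ![S.l 2 ![x, y], z, w] - S.l 3 ![S.l 2 ![x, z], y, w] +
        S.l 3 ![S.l 2 ![x, w], y, z] + S.l 3 ![S.l 2 ![y, z], x, w] -
        S.l 3 ![S.l 2 ![y, w], x, z] + S.l 3 ![S.l 2 ![z, w], x, y]) = 0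

end Structures

end QuasiLieBialg

end

open scoped Manifold ContDiff DirectSum

noncomputable section

set_option linter.unusedSectionVars false

namespace QuasiLieBialg

/-! Shortcuts for instance search. -/

-- A function of bidegree (k,l) is the symbol of an operator on forms of order at most k and degree
-- l - k, so Poisson brackets are computed as supercommutators of representing operators: D for μ, G
-- for γ, F for φ. An operator of order less than n cannot lower the degree by n
-- (`eq_zero_of_mem_diffOp`). Hence 𝒞^{k,l} vanishes for l < 0, and in 𝒞^{k,0} there are no lower
-- order terms to divide out. If Γ(A) has a finite dual basis (a `Frame`), Euler's identity shows
-- that 𝒞^{k,0} consists exactly of the contractions with Γ(⋀^k A) (`Frame.exists_contractOp_eq`,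
-- `Frame.contractOp_eq_zero`).
--
-- The operations l_k are derived brackets: up to sign, l_k(x_1,…,x_k) is the iterated commutator
-- `iter` of the k-th of G, D, F with the contractions by x_1,…,x_k. Each such commutator lowers l
-- by one, so an operator of bidegree (3-k,k) becomes a multisection after k arguments and dies
-- after k+1. The Leibniz rule expands an iterated commutator of [Φ_i,Φ_j], i + j = n + 1, on n
-- arguments into a sum over subsets of the arguments. Only the subsets that saturate one of the two
-- factors survive, and they form the sum over unshuffles of nested operations. So twice the n-th
-- Jacobi expression is, up to sign, the bidegree (4-n,n) component of {Θ,Θ} evaluated on the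
-- arguments (`contractOp_jacobi`). Since a symbol is determined by its iterated brackets with
-- functions and sections (`Frame.mem_lowerOps_of_iter`), the Jacobi identities for all n are
-- equivalent to {Θ,Θ} = 0.
--
-- It remains to realise given multiderivations l_1, l_2, l_3 by operators. They are determined by
-- their values on functions and sections. Their anchors are derivations of functions, which lift to
-- forms by differentiating coefficients in the frame; after subtraction of the lift the defect is
-- linear over functions, and wedging it with the coframe gives the correcting operator. The
-- identities for sections are the Jacobi identities with three and four arguments, written out.
--
-- Dually, [a,b]_γ is the double commutator of G with multiplication by a and b, and the
-- Gerstenhaber identities are Jacobi identities for commutators with obstructions [G,G], [D,G] and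
-- ½[D,D] + [G,F]. A biderivation of forms is generated by a second order operator, found again as
-- an anchor part plus a tensorial part.
--
-- The frame comes from geometry. Over a compact set dim M + rank A sections span all fibres,
-- because a count of Hausdorff dimensions allows surplus sections to be projected away. Over the
-- shells of a compact exhaustion two glued families of such sections suffice. The Gram map ∑ s_j ⊗
-- s_j of a spanning family is invertible, and its inverse gives the dual basis.

local instance extSemiring {R : Type*} [CommRing R] {N : Type*} [AddCommGroup N] [Module R N] :
    Semiring (ExteriorAlgebra R N) := inferInstance

local instance extAddCommMonoid {R : Type*} [CommRing R] {N : Type*} [AddCommGroup N] [Module R N] :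
    AddCommMonoid (ExteriorAlgebra R N) := inferInstance

local instance extAddCommGroup {R : Type*} [CommRing R] {N : Type*} [AddCommGroup N] [Module R N] :
    AddCommGroup (ExteriorAlgebra R N) := inferInstance

local instance extAlgebra {R : Type*} [CommRing R] {N : Type*} [AddCommGroup N] [Module R N] :
    Algebra R (ExteriorAlgebra R N) := inferInstance

local instance extRealModule {R : Type*} [CommRing R] [Algebra ℝ R] {N : Type*} [AddCommGroup N]
    [Module ℝ N] [Module R N] [IsScalarTower ℝ R N] :
    Module ℝ (ExteriorAlgebra R N) := inferInstance

local instance dualRealModule {R : Type*} [CommRing R] [Algebra ℝ R] {N : Type*} [AddCommGroup N]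
    [Module ℝ N] [Module R N] [IsScalarTower ℝ R N] :
    Module ℝ (Module.Dual R N) := inferInstance

local instance dualScalarTower {R : Type*} [CommRing R] [Algebra ℝ R] {N : Type*} [AddCommGroup N]
    [Module ℝ N] [Module R N] [IsScalarTower ℝ R N] :
    IsScalarTower ℝ R (Module.Dual R N) := inferInstance

/-! ### Generators of an exterior algebra and tests for the order of an operator -/

section ExteriorGenerators

variable {R : Type*} [CommRing R] [Algebra ℝ R] {N : Type*} [AddCommGroup N] [Module ℝ N]
  [Module R N] [IsScalarTower ℝ R N]

theorem algebraMap_mem_extDeg (r : R) : algebraMap R (ExteriorAlgebra R N) r ∈ extDeg R N 0 :=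
  mem_extDeg_natCast.2 (SetLike.algebraMap_mem_graded (fun i : ℕ => ⋀[R]^i N) r)

theorem ι_mem_extDeg (a : N) : ExteriorAlgebra.ι R a ∈ extDeg R N 1 := by
  change _ ∈ LinearMap.range (ExteriorAlgebra.ι R) ^ 1
  rw [pow_one]
  exact ⟨a, rfl⟩

theorem exists_algebraMap_eq {x : ExteriorAlgebra R N} (hx : x ∈ extDeg R N 0) :
    ∃ r : R, x = algebraMap R _ r := by
  change x ∈ LinearMap.range (ExteriorAlgebra.ι R) ^ 0 at hx
  rw [pow_zero] at hx
  obtain ⟨r, rfl⟩ := Submodule.mem_one.1 hx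
  exact ⟨r, rfl⟩

theorem exists_ι_eq {x : ExteriorAlgebra R N} (hx : x ∈ extDeg R N 1) :
    ∃ a : N, x = ExteriorAlgebra.ι R a := by
  change x ∈ LinearMap.range (ExteriorAlgebra.ι R) ^ 1 at hx
  rw [pow_one] at hx
  obtain ⟨r, rfl⟩ := hx
  exact ⟨r, rfl⟩

theorem eq_zero_of_mem_extDeg_neg {x : ExteriorAlgebra R N} {j : ℤ} (hx : x ∈ extDeg R N j)
    (hj : j < 0) : x = 0 := by
  rcases extDeg_cases hx with h | ⟨n, rfl, -⟩
  · exact h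
  · omega

theorem ext_induction {p : ExteriorAlgebra R N → Prop} (h0 : p 0)
    (hadd : ∀ x y, p x → p y → p (x + y))
    (hom : ∀ (j : ℕ), ∀ x ∈ extDeg R N j, p x) (x : ExteriorAlgebra R N) : p x := by
  induction x using DirectSum.Decomposition.inductionOn fun i => ⋀[R]^i N with
  | zero => exact h0
  | add _ _ h₁ h₂ => exact hadd _ _ h₁ h₂
  | @homogeneous i m => exact hom i m.1 m.2

/-- The integer `u` enters only through the sign and no degree of `D` is assumed, so this applies to
any operation with all arguments but one frozen. -/
theorem derivation_ext (u : ℤ) {D D' : Module.End ℝ (ExteriorAlgebra R N)}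
    (hD : ∀ e, ∀ y ∈ extDeg R N e, ∀ z, D (y * z) = D y * z + (u * e).negOnePow • (y * D z))
    (hD' : ∀ e, ∀ y ∈ extDeg R N e, ∀ z, D' (y * z) = D' y * z + (u * e).negOnePow • (y * D' z))
    (h0 : ∀ r, D (algebraMap R _ r) = D' (algebraMap R _ r))
    (h1 : ∀ a, D (ExteriorAlgebra.ι R a) = D' (ExteriorAlgebra.ι R a)) : D = D' := by
  refine ext_hom_ext fun j x hx => ?_
  rcases extDeg_cases hx with rfl | ⟨n, rfl, hx⟩
  · simp
  clear * - hx hD hD' h0 h1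
  change x ∈ LinearMap.range (ExteriorAlgebra.ι R : N →ₗ[R] ExteriorAlgebra R N) ^ n at hx
  induction hx using Submodule.pow_induction_on_left' with
  | algebraMap r => exact h0 r
  | add x y i _ _ hx hy => rw [map_add, map_add, hx, hy]
  | mem_mul m hm i x _ hx =>
    obtain ⟨a, rfl⟩ := hm
    rw [hD 1 _ (ι_mem_extDeg a), hD' 1 _ (ι_mem_extDeg a), h1, hx]

theorem negOnePow_mul_self (u : ℤ) : u.negOnePow * u.negOnePow = 1 := by
  rw [← Int.negOnePow_add, Int.negOnePow_even _ ⟨_, rfl⟩]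

theorem negOnePow_congr {u v : ℤ} (h : Even (u - v)) : u.negOnePow = v.negOnePow :=
  (Int.negOnePow_eq_iff u v).2 h

theorem scomm_swap (m m' : ℤ) (P Q : Module.End ℝ (ExteriorAlgebra R N)) :
    scomm m m' P Q = -((m * m').negOnePow • scomm m' m Q P) := by
  simp only [scomm, smul_sub, smul_smul, mul_comm m' m, negOnePow_mul_self, one_smul, neg_sub]

theorem scomm_mul_right (m m' j : ℤ) (P Q A : Module.End ℝ (ExteriorAlgebra R N)) :
    scomm m (m' + j) P (Q * A) =
      scomm m m' P Q * A + (m * m').negOnePow • (Q * scomm m j P A) := by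
  simp only [scomm, mul_sub, sub_mul, smul_sub, negOnePow_smul_comp, smul_mul_assoc, smul_smul,
    ← Int.negOnePow_add, mul_assoc, mul_add]
  abel

theorem scomm_jacobi_right (m m' j : ℤ) (P Q A : Module.End ℝ (ExteriorAlgebra R N)) :
    scomm m (m' + j) P (scomm m' j Q A) =
      scomm (m + m') j (scomm m m' P Q) A +
        (m * m').negOnePow • scomm m' (m + j) Q (scomm m j P A) := by
  have h1 : ((m + m') * j).negOnePow = (m * j).negOnePow * (m' * j).negOnePow := by
    rw [add_mul, Int.negOnePow_add]
  have h2 : (m * (m' + j)).negOnePow = (m * m').negOnePow * (m * j).negOnePow := by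
    rw [mul_add, Int.negOnePow_add]
  have h3 : (m' * (m + j)).negOnePow = (m * m').negOnePow * (m' * j).negOnePow := by
    rw [mul_add, Int.negOnePow_add, mul_comm m m']
  simp only [scomm, h1, h2, h3]
  rcases Int.units_eq_one_or (m * m').negOnePow with u | u <;>
  rcases Int.units_eq_one_or (m * j).negOnePow with v | v <;>
  rcases Int.units_eq_one_or (m' * j).negOnePow with w | w <;>
  simp only [u, v, w, mul_one, mul_neg, neg_neg, one_smul, Units.neg_smul,
    mul_sub, sub_mul, mul_assoc, sub_neg_eq_add, mul_add, add_mul, neg_add, neg_sub] <;> abel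

theorem scomm_neg_left (m m' : ℤ) (P Q : Module.End ℝ (ExteriorAlgebra R N)) :
    scomm m m' (-P) Q = -scomm m m' P Q := by
  rw [← neg_one_smul ℝ P, scomm_smul_left]
  exact neg_one_smul ℝ (scomm m m' P Q)

theorem scomm_neg_right (m m' : ℤ) (P Q : Module.End ℝ (ExteriorAlgebra R N)) :
    scomm m m' P (-Q) = -scomm m m' P Q := by
  rw [← neg_one_smul ℝ Q, scomm_smul_right]
  exact neg_one_smul ℝ (scomm m m' P Q)

theorem scomm_units_smul_left (m m' : ℤ) (u : ℤˣ) (P Q : Module.End ℝ (ExteriorAlgebra R N)) :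
    scomm m m' (u • P) Q = u • scomm m m' P Q := by
  rcases Int.units_eq_one_or u with rfl | rfl
  · simp only [one_smul]
  · simp only [Units.neg_smul, one_smul, scomm_neg_left]

theorem scomm_units_smul_right (m m' : ℤ) (u : ℤˣ) (P Q : Module.End ℝ (ExteriorAlgebra R N)) :
    scomm m m' P (u • Q) = u • scomm m m' P Q := by
  rcases Int.units_eq_one_or u with rfl | rfl
  · simp only [one_smul]
  · simp only [Units.neg_smul, one_smul, scomm_neg_right]

theorem scomm_sum_left {κ : Type*} (s : Finset κ) (m m' : ℤ)
    (P : κ → Module.End ℝ (ExteriorAlgebra R N)) (Q : Module.End ℝ (ExteriorAlgebra R N)) :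
    scomm m m' (∑ i ∈ s, P i) Q = ∑ i ∈ s, scomm m m' (P i) Q := by
  simp only [scomm, Finset.sum_mul, Finset.mul_sum, Finset.smul_sum, Finset.sum_sub_distrib]

theorem scomm_sum_right {κ : Type*} (s : Finset κ) (m m' : ℤ)
    (P : κ → Module.End ℝ (ExteriorAlgebra R N)) (Q : Module.End ℝ (ExteriorAlgebra R N)) :
    scomm m m' Q (∑ i ∈ s, P i) = ∑ i ∈ s, scomm m m' Q (P i) := by
  simp only [scomm, Finset.sum_mul, Finset.mul_sum, Finset.smul_sum, Finset.sum_sub_distrib]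

theorem mulLeft_mul_mulLeft (x y : ExteriorAlgebra R N) :
    LinearMap.mulLeft ℝ x * LinearMap.mulLeft ℝ y = LinearMap.mulLeft ℝ (x * y) :=
  (LinearMap.mulLeft_mul ℝ _ x y).symm

theorem mulLeft_add' (x y : ExteriorAlgebra R N) :
    LinearMap.mulLeft ℝ (x + y) = LinearMap.mulLeft ℝ x + LinearMap.mulLeft ℝ y :=
  map_add (LinearMap.mul ℝ _) x y

/-- By [P,xy] = [P,x]y ± x[P,y], and because composing with a multiplication does not raise the
order, commutators with functions and elements of degree one control all others. -/
theorem scomm_mulLeft_mem_of_generators {n : ℕ} {m : ℤ} {P : Module.End ℝ (ExteriorAlgebra R N)}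
    (h0 : ∀ r : R, scomm m 0 P (LinearMap.mulLeft ℝ (algebraMap R _ r)) ∈ diffOp R N n m)
    (h1 : ∀ a : N, scomm m 1 P (LinearMap.mulLeft ℝ (ExteriorAlgebra.ι R a)) ∈
      diffOp R N n (m + 1)) (j : ℤ) {a : ExteriorAlgebra R N} (ha : a ∈ extDeg R N j) :
    scomm m j P (LinearMap.mulLeft ℝ a) ∈ diffOp R N n (m + j) := by
  rcases extDeg_cases ha with rfl | ⟨k, rfl, ha⟩
  · have : LinearMap.mulLeft ℝ (0 : ExteriorAlgebra R N) = 0 := map_zero (LinearMap.mul ℝ _)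
    rw [this, scomm_zero_right]
    exact Submodule.zero_mem _
  clear * - ha h0 h1
  change a ∈ LinearMap.range (ExteriorAlgebra.ι R : N →ₗ[R] ExteriorAlgebra R N) ^ k at ha
  induction ha using Submodule.pow_induction_on_left' with
  | algebraMap r => simpa using h0 r
  | add x y i _ _ hx hy =>
    rw [mulLeft_add', scomm_add_right]
    exact Submodule.add_mem _ hx hy
  | mem_mul b hb i x hx' hx =>
    obtain ⟨b, rfl⟩ := hb
    have e : ((i.succ : ℕ) : ℤ) = 1 + i := by push_cast; ring
    rw [← mulLeft_mul_mulLeft, e, scomm_mul_right]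
    refine Submodule.add_mem _ ?_ (negOnePow_smul_mem _ _ ?_)
    · have := diffOp_mul (c := n) le_rfl (h1 b) (mulLeft_mem_diffOp (mem_extDeg_natCast.2 hx'))
      rwa [add_assoc] at this
    · have := diffOp_mul (c := n) (by omega) (mulLeft_mem_diffOp (ι_mem_extDeg (R := R) b)) hx
      rwa [add_left_comm] at this

theorem mem_diffOp_of_generators {n : ℕ} {m : ℤ} {P : Module.End ℝ (ExteriorAlgebra R N)}
    (hP : ∀ i, ∀ x ∈ extDeg R N i, P x ∈ extDeg R N (i + m))
    (h0 : ∀ r : R, scomm m 0 P (LinearMap.mulLeft ℝ (algebraMap R _ r)) ∈ diffOp R N n m)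
    (h1 : ∀ a : N, scomm m 1 P (LinearMap.mulLeft ℝ (ExteriorAlgebra.ι R a)) ∈
      diffOp R N n (m + 1)) : P ∈ diffOp R N (n + 1) m :=
  ⟨hP, fun j _ ha => scomm_mulLeft_mem_of_generators h0 h1 j ha⟩

/-- An operator of order less than `n` cannot lower the degree by `n`. -/
theorem eq_zero_of_mem_diffOp {n : ℕ} {m : ℤ} (h : m ≤ -n) {P : Module.End ℝ (ExteriorAlgebra R N)}
    (hP : P ∈ diffOp R N n m) : P = 0 := by
  induction n generalizing m P with
  | zero => exact (Submodule.mem_bot ℝ).1 hP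
  | succ n ih =>
    push_cast at h
    -- Commutators with generators have smaller order and degree at most m + 1, so they vanish by
    -- induction. Then P is multiplication by `P 1`, an element of negative degree.
    have h1 : P ∈ diffOp R N 1 m := by
      refine mem_diffOp_of_generators hP.1 (fun r => ?_) fun a => ?_
      · rw [ih (m := m + 0) (by omega) (hP.2 0 _ (algebraMap_mem_extDeg r))]
        exact Submodule.zero_mem _
      · rw [ih (by omega) (hP.2 1 _ (ι_mem_extDeg a))]
        exact Submodule.zero_mem _
    have h2 : P 1 = 0 := by
      refine eq_zero_of_mem_extDeg_neg (diffOp_degree hP one_mem_extDeg) (by omega)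
    rw [eq_mulLeft_of_mem_diffOp_one h1, h2]
    exact map_zero (LinearMap.mul ℝ _)

/-- An operator that lowers the degree by its order is linear over functions: commuting it with a
function lowers the order but keeps the degree. -/
theorem scomm_algebraMap_eq_zero {n : ℕ} {m : ℤ} (h : m ≤ -n)
    {P : Module.End ℝ (ExteriorAlgebra R N)} (hP : P ∈ diffOp R N (n + 1) m) (r : R) :
    scomm m 0 P (LinearMap.mulLeft ℝ (algebraMap R _ r)) = 0 :=
  eq_zero_of_mem_diffOp (by omega) (hP.2 0 _ (algebraMap_mem_extDeg r))

/-- The commutator with a derivation-like operator is its value. -/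
theorem scomm_mulLeft_of_mem_two {m : ℤ} {P : Module.End ℝ (ExteriorAlgebra R N)}
    (hP : P ∈ diffOp R N 2 m) (h1 : P 1 = 0) {j : ℤ} {a : ExteriorAlgebra R N}
    (ha : a ∈ extDeg R N j) :
    scomm m j P (LinearMap.mulLeft ℝ a) = LinearMap.mulLeft ℝ (P a) := by
  rw [eq_mulLeft_of_mem_diffOp_one (hP.2 j a ha)]
  congr 1
  simp [scomm, h1]

/-- An operator whose supercommutator with a multiplication is a multiplication is a
derivation. -/
theorem apply_mul_of_scomm {m j : ℤ} {P : Module.End ℝ (ExteriorAlgebra R N)}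
    {a b : ExteriorAlgebra R N}
    (h : scomm m j P (LinearMap.mulLeft ℝ a) = LinearMap.mulLeft ℝ b) (z : ExteriorAlgebra R N) :
    P (a * z) = b * z + (m * j).negOnePow • (a * P z) := by
  have := LinearMap.congr_fun h z
  simp only [scomm, LinearMap.sub_apply, Module.End.mul_apply, LinearMap.mulLeft_apply,
    LinearMap.smul_apply, sub_eq_iff_eq_add] at this
  exact this

end ExteriorGenerators

/-! ### Finite dual bases and the Euler identity -/

/-- A finite dual basis of a module: `X = ∑ ε_i(X) e_i` for all `X`. -/
structure Frame (R : Type*) [CommRing R] (P : Type*) [AddCommGroup P] [Module R P]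
    (κ : Type*) [Fintype κ] where
  e : κ → P
  ε : κ → Module.Dual R P
  sum_smul : ∀ X, ∑ i, ε i X • e i = X

namespace Frame

variable {R : Type*} [CommRing R] {P : Type*} [AddCommGroup P] [Module R P] {κ : Type*} [Fintype κ]

/-- The dual basis of the dual module. -/
def dual (B : Frame R P κ) : Frame R (Module.Dual R P) κ where
  e := B.ε
  ε := fun i => Module.Dual.eval R P (B.e i)
  sum_smul := fun α => by
    ext X
    conv_rhs => rw [← B.sum_smul X]
    simp [mul_comm]

/-- The Euler identity. -/
theorem euler (B : Frame R P κ) {k : ℕ} {x : ExteriorAlgebra R P} (hx : x ∈ ⋀[R]^k P) :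
    ∑ i, ExteriorAlgebra.ι R (B.e i) * CliffordAlgebra.contractLeft (B.ε i) x = (k : R) • x := by
  induction hx using Submodule.pow_induction_on_left' with
  | algebraMap r => simp [CliffordAlgebra.contractLeft_algebraMap]
  | add x y i _ _ hx hy => simp only [map_add, mul_add, Finset.sum_add_distrib, hx, hy, smul_add]
  | mem_mul m hm i x hx' hx =>
    obtain ⟨X, rfl⟩ := hm
    have h := fun d => CliffordAlgebra.contractLeft_ι_mul (Q := (0 : QuadraticForm R P)) d X x
    -- Exchanging ι(e_i) with ι(X) makes the two minus signs cancel. The pairing terms add up to ι(∑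
    -- ε_i(X) e_i) x = ι(X) x, which raises the eigenvalue by one.
    have h1 : ∀ i, ExteriorAlgebra.ι R (B.e i) *
        CliffordAlgebra.contractLeft (B.ε i) (ExteriorAlgebra.ι R X * x) =
        ExteriorAlgebra.ι R (B.ε i X • B.e i) * x +
          ExteriorAlgebra.ι R X * (ExteriorAlgebra.ι R (B.e i) *
            CliffordAlgebra.contractLeft (B.ε i) x) := by
      intro i
      have h2 := ExteriorAlgebra.ι_add_mul_swap (R := R) (B.e i) X
      refine (congrArg (ExteriorAlgebra.ι R (B.e i) * ·) (h (B.ε i))).trans ?_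
      have h3 := eq_neg_of_add_eq_zero_left h2
      change ExteriorAlgebra.ι R (B.e i) * (_ - ExteriorAlgebra.ι R X * _) = _
      rw [mul_sub, ← mul_assoc, h3, map_smul, mul_smul_comm, smul_mul_assoc, neg_mul,
        sub_neg_eq_add, mul_assoc]
    rw [Finset.sum_congr rfl fun i _ => h1 i, Finset.sum_add_distrib, ← Finset.sum_mul, ← map_sum,
      B.sum_smul, ← Finset.mul_sum, hx, mul_smul_comm]
    push_cast
    rw [add_smul, one_smul, add_comm]

end Frame

/-! ### Multisections as the operators that lower the degree by their order -/

section Contractions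

variable {R : Type*} [CommRing R] [Algebra ℝ R] {P : Type*} [AddCommGroup P] [Module ℝ P]
  [Module R P] [IsScalarTower ℝ R P]

/-- Multiplication by a form, as an operator. -/
abbrev mulOp (a : Form R P) : Module.End ℝ (Form R P) := LinearMap.mulLeft ℝ a

variable (R P) in
/-- Contraction with a multisection, as an operator. -/
def contractOp : Multi R P →ₗ[ℝ] Module.End ℝ (Form R P) where
  toFun x := (contract R P x).restrictScalars ℝ
  map_add' x y := by rw [map_add]; rfl
  map_smul' c x := by
    ext a
    change contract R P (c • x) a = c • contract R P x a
    rw [← algebraMap_smul R c x, map_smul, LinearMap.smul_apply, algebraMap_smul]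

theorem contractOp_apply (x : Multi R P) (a : Form R P) :
    contractOp R P x a = contract R P x a := rfl

theorem contractOp_mul (x y : Multi R P) :
    contractOp R P (x * y) = contractOp R P x * contractOp R P y := by
  ext a
  rw [contractOp_apply, map_mul]
  rfl

theorem contractOp_algebraMap (r : R) :
    contractOp R P (algebraMap R _ r) = mulOp (algebraMap R _ r) := by
  ext a
  rw [contractOp_apply, AlgHom.commutes]
  simp [Algebra.smul_def]

theorem contractOp_smul (r : R) (x : Multi R P) :
    contractOp R P (r • x) = mulOp (algebraMap R _ r) * contractOp R P x := by
  rw [Algebra.smul_def, contractOp_mul, contractOp_algebraMap]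

theorem contractOp_mem_nat {k : ℕ} {x : Multi R P} (hx : x ∈ ⋀[R]^k P) :
    contractOp R P x ∈ diffOp R (Module.Dual R P) (k + 1) (-k) := contract_mem hx

theorem contractOp_mem {k : ℤ} {x : Multi R P} (hx : x ∈ extDeg R P k) :
    contractOp R P x ∈ ops R P k 0 := by
  rcases extDeg_cases hx with rfl | ⟨n, rfl, hx⟩
  · rw [map_zero]; exact Submodule.zero_mem _
  · rw [ops, zero_sub]; exact contractOp_mem_nat hx

theorem scomm_contractOp {i j : ℤ} {x y : Multi R P} (hx : x ∈ extDeg R P i)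
    (hy : y ∈ extDeg R P j) : scomm (-i) (-j) (contractOp R P x) (contractOp R P y) = 0 := by
  have h := congrArg (contractOp R P) (ext_mul_comm hy hx)
  rw [contractOp_mul] at h
  rw [scomm, ← contractOp_mul, ext_mul_comm hy hx, neg_mul_neg, ← contractOp_mul]
  rcases Int.units_eq_one_or (i * j).negOnePow with u | u <;> rw [mul_comm j i, u] <;> simp

/-- Contraction of forms with a section. -/
abbrev ins (X : P) : Module.End ℝ (Form R P) := contractOp R P (ExteriorAlgebra.ι R X)

theorem ins_mem (X : P) : ins X ∈ diffOp R (Module.Dual R P) 2 (-1) := contract_ι_mem X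

theorem ins_apply (X : P) (a : Form R P) :
    ins X a = CliffordAlgebra.contractLeft (Module.Dual.eval R P X) a := contract_ι X a

theorem ins_one (X : P) : ins X (1 : Form R P) = 0 := by
  rw [ins_apply]; exact CliffordAlgebra.contractLeft_one _ _

theorem ins_ι (X : P) (α : Module.Dual R P) :
    ins X (ExteriorAlgebra.ι R α) = algebraMap R _ (α X) := by
  rw [ins_apply]; exact CliffordAlgebra.contractLeft_ι _ _ _

theorem scomm_ins_mulOp (X : P) {j : ℤ} {a : Form R P} (ha : a ∈ extDeg R (Module.Dual R P) j) :
    scomm (-1) j (ins X) (mulOp a) = mulOp (ins X a) :=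
  scomm_mulLeft_of_mem_two (ins_mem X) (ins_one X) ha

theorem ins_degree (X : P) {j : ℤ} {a : Form R P} (ha : a ∈ extDeg R (Module.Dual R P) j) :
    ins X a ∈ extDeg R (Module.Dual R P) (j - 1) := diffOp_degree (ins_mem X) ha

/-- Forms of positive degree are determined by their contractions. -/
theorem eq_zero_of_ins_eq_zero {κ : Type*} [Fintype κ] (B : Frame R P κ) {k : ℤ} (hk : 0 < k)
    {a : Form R P} (ha : a ∈ extDeg R (Module.Dual R P) k) (h : ∀ X, ins X a = 0) : a = 0 := by
  rcases extDeg_cases ha with rfl | ⟨n, rfl, ha⟩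
  · rfl
  have h1 := B.dual.euler ha
  have h2 : ∀ i, CliffordAlgebra.contractLeft (B.dual.ε i) a = 0 := fun i => by
    have := h (B.e i)
    rwa [ins_apply] at this
  simp only [h2, mul_zero, Finset.sum_const_zero] at h1
  have h3 : (n : ℝ) • a = 0 := by
    rw [h1, ← algebraMap_smul R (n : ℝ) a, map_natCast]
  exact (smul_eq_zero.1 h3).resolve_left (by exact_mod_cast hk.ne')

/-- Commutators with functions vanish here for reasons of degree, so D is a multiplication, and
there is no form of negative degree to multiply by. -/
theorem eq_zero_of_scomm_ι {k : ℕ} {D : Module.End ℝ (Form R P)}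
    (hD : D ∈ diffOp R (Module.Dual R P) (k + 2) (-(k + 1)))
    (h : ∀ α, scomm (-(k + 1)) 1 D (mulOp (ExteriorAlgebra.ι R α)) = 0) : D = 0 := by
  have h1 : D ∈ diffOp R (Module.Dual R P) 1 (-(k + 1)) := by
    refine mem_diffOp_of_generators hD.1 (fun r => ?_) fun a => ?_
    · rw [scomm_algebraMap_eq_zero (n := k + 1) (by push_cast; omega) hD]
      exact Submodule.zero_mem _
    · rw [h]; exact Submodule.zero_mem _
  exact eq_zero_of_mem_diffOp (by push_cast; omega) h1

/-- The Euler identity for operators which lower the degree by their order. -/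
theorem Frame.euler_op {κ : Type*} [Fintype κ] (B : Frame R P κ) {k : ℕ}
    {D : Module.End ℝ (Form R P)} (hD : D ∈ diffOp R (Module.Dual R P) (k + 1) (-k)) :
    ∑ i, scomm (-k) 1 D (mulOp (ExteriorAlgebra.ι R (B.ε i))) * ins (B.e i) = (k : ℝ) • D := by
  induction k generalizing D with
  | zero =>
    have h : ∀ i, scomm (-(0 : ℕ)) 1 D (mulOp (ExteriorAlgebra.ι R (B.ε i))) = 0 := fun i =>
      (Submodule.mem_bot ℝ).1 (hD.2 1 _ (ι_mem_extDeg _))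
    simp only [h]
    simp
  | succ k ih =>
    have e1 : (-((k + 1 : ℕ) : ℤ)) = -(k + 1) := by push_cast; ring
    have e2 : (-(k + 1) + 1 : ℤ) = -k := by ring
    rw [e1] at hD ⊢
    have hi : ∀ α, scomm (-(k + 1)) 1 D (mulOp (ExteriorAlgebra.ι R α)) ∈
        diffOp R (Module.Dual R P) (k + 1) (-k) := fun α => by
      have := hD.2 1 _ (ι_mem_extDeg (R := R) α)
      rwa [e2] at this
    -- Both sides have order at most k + 1 and degree -(k+1), so it suffices to commute with a
    -- one-form α. This gives the induction hypothesis for [D,α] and one more copy of [D,α].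
    rw [← sub_eq_zero]
    refine eq_zero_of_scomm_ι (k := k) ?_ fun α => ?_
    · refine Submodule.sub_mem _ (Submodule.sum_mem _ fun i _ => ?_) (Submodule.smul_mem _ _ hD)
      have := diffOp_mul (c := k + 2) (by omega) (hi (B.ε i)) (ins_mem (B.e i))
      rwa [← neg_add] at this
    · have h1 : ∀ i, scomm (-(k + 1)) 1 (scomm (-(k + 1)) 1 D
          (mulOp (ExteriorAlgebra.ι R (B.ε i))) * ins (B.e i)) (mulOp (ExteriorAlgebra.ι R α)) =
          scomm (-(k + 1)) 1 D (mulOp (ExteriorAlgebra.ι R (α (B.e i) • B.ε i))) +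
          scomm (-k) 1 (scomm (-(k + 1)) 1 D (mulOp (ExteriorAlgebra.ι R α)))
            (mulOp (ExteriorAlgebra.ι R (B.ε i))) * ins (B.e i) := by
        intro i
        have h2 := scomm_mul (-k) (-1) 1 (scomm (-(k + 1)) 1 D
          (mulOp (ExteriorAlgebra.ι R (B.ε i)))) (ins (B.e i)) (mulOp (ExteriorAlgebra.ι R α))
        rw [show (-(k : ℤ) + -1) = -(k + 1) by ring] at h2
        rw [h2, scomm_ins_mulOp _ (ι_mem_extDeg α), ins_ι]
        have h3 := scomm_jacobi (-(k + 1)) 1 1 D (mulOp (ExteriorAlgebra.ι R (B.ε i)))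
          (mulOp (ExteriorAlgebra.ι R α))
        rw [scomm_mulLeft (ι_mem_extDeg _) (ι_mem_extDeg _), scomm_zero_right, zero_add, e2] at h3
        rw [h3]
        -- Both D and [D,ε_i] commute with functions, which allows the coefficient α(e_i) to be
        -- carried into the commutator.
        have h4 : scomm (-(k + 1)) 0 D (mulOp (algebraMap R (Form R P) (α (B.e i)))) = 0 :=
          scomm_algebraMap_eq_zero (n := k + 1) (by push_cast; omega) hD _
        have h5 : mulOp (ExteriorAlgebra.ι R (α (B.e i) • B.ε i)) =
            mulOp (algebraMap R (Form R P) (α (B.e i))) *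
              mulOp (ExteriorAlgebra.ι R (B.ε i)) := by
          rw [mulLeft_mul_mulLeft, map_smul, Algebra.smul_def]
        have h6 := scomm_mul_right (-(k + 1)) 0 1 D (mulOp (algebraMap R (Form R P) (α (B.e i))))
          (mulOp (ExteriorAlgebra.ι R (B.ε i)))
        rw [zero_add, h4, zero_mul, zero_add, mul_zero, Int.negOnePow_zero, one_smul] at h6
        have h7 := scomm_algebraMap_eq_zero (n := k) (by omega) (hi (B.ε i)) (α (B.e i))
        have h8 : scomm (-(k + 1)) 1 D (mulOp (ExteriorAlgebra.ι R (B.ε i))) *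
            mulOp (algebraMap R (Form R P) (α (B.e i))) =
            mulOp (algebraMap R (Form R P) (α (B.e i))) *
              scomm (-(k + 1)) 1 D (mulOp (ExteriorAlgebra.ι R (B.ε i))) := by
          rw [scomm, mul_zero, Int.negOnePow_zero, one_smul, sub_eq_zero] at h7
          exact h7
        rw [h5, h6, h8, smul_mul_assoc, smul_smul, ← Int.negOnePow_add]
        rw [Int.negOnePow_even _ ⟨0, by ring⟩, one_smul]
      have h9 : scomm (-(k + 1)) 1 D (mulOp (ExteriorAlgebra.ι R α)) =
          ∑ i, scomm (-(k + 1)) 1 D (mulOp (ExteriorAlgebra.ι R (α (B.e i) • B.ε i))) := by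
        rw [← scomm_sum_right]
        congr 1
        conv_lhs => rw [← B.dual.sum_smul α]
        rw [map_sum]
        exact map_sum (LinearMap.mul ℝ (Form R P)) _ _
      rw [sub_eq_add_neg, scomm_add_left, scomm_neg_left, scomm_smul_left, scomm_sum_left,
        Finset.sum_congr rfl fun i _ => h1 i, Finset.sum_add_distrib, ← h9, ih (hi α)]
      push_cast
      rw [add_smul, one_smul]
      abel

/-- Euler's identity writes D as 1/(k+1) times ∑ [D,ε_i] ∘ ι_{e_i}. The commutators have one order
less and are contractions by induction. -/
theorem Frame.exists_contractOp_eq {κ : Type*} [Fintype κ] (B : Frame R P κ) {k : ℕ}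
    {D : Module.End ℝ (Form R P)} (hD : D ∈ diffOp R (Module.Dual R P) (k + 1) (-k)) :
    ∃ x ∈ extDeg R P k, contractOp R P x = D := by
  induction k generalizing D with
  | zero =>
    have h : D 1 ∈ extDeg R (Module.Dual R P) 0 := by
      have := diffOp_degree hD one_mem_extDeg
      simpa using this
    obtain ⟨r, hr⟩ := exists_algebraMap_eq h
    refine ⟨algebraMap R _ r, algebraMap_mem_extDeg r, ?_⟩
    rw [contractOp_algebraMap, ← hr]
    exact (eq_mulLeft_of_mem_diffOp_one hD).symm
  | succ k ih =>
    have e2 : (-((k + 1 : ℕ) : ℤ) + 1) = -k := by push_cast; ring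
    have hi : ∀ i, ∃ y ∈ extDeg R P k, contractOp R P y =
        scomm (-(k + 1 : ℕ)) 1 D (mulOp (ExteriorAlgebra.ι R (B.ε i))) := fun i => by
      have := hD.2 1 _ (ι_mem_extDeg (R := R) (B.ε i))
      rw [e2] at this
      exact ih this
    choose y hy hyD using hi
    refine ⟨((k + 1 : ℕ) : ℝ)⁻¹ • ∑ i, y i * ExteriorAlgebra.ι R (B.e i),
      Submodule.smul_mem _ _ (Submodule.sum_mem _ fun i _ => ?_), ?_⟩
    · have := extDeg_mul (hy i) (ι_mem_extDeg (R := R) (B.e i))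
      exact_mod_cast this
    · rw [map_smul, map_sum]
      simp only [contractOp_mul, hyD]
      rw [B.euler_op hD, smul_smul, inv_mul_cancel₀ (by positivity), one_smul]

theorem Frame.exists_contractOp_eq_int {κ : Type*} [Fintype κ] (B : Frame R P κ) {k : ℤ}
    {D : Module.End ℝ (Form R P)} (hD : D ∈ ops R P k 0) :
    ∃ x ∈ extDeg R P k, contractOp R P x = D := by
  rcases lt_or_ge k 0 with hk | hk
  · refine ⟨0, Submodule.zero_mem _, ?_⟩
    rw [ops, show (k + 1).toNat = 0 by omega] at hD
    rw [map_zero, (Submodule.mem_bot ℝ).1 hD]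
  · lift k to ℕ using hk
    rw [ops, zero_sub] at hD
    exact B.exists_contractOp_eq hD

/-- Contracting a multisection with α becomes a commutator of operators. This carries the vanishing
of `contractOp R P x` over to all contractions of x, as needed for an induction on the degree. -/
theorem contractOp_contractLeft (α : Module.Dual R P) {k : ℕ} {x : Multi R P}
    (hx : x ∈ ⋀[R]^k P) : contractOp R P (CliffordAlgebra.contractLeft α x) =
      scomm 1 (-k) (mulOp (ExteriorAlgebra.ι R α)) (contractOp R P x) := by
  induction hx using Submodule.pow_induction_on_left' with
  | algebraMap r =>
    rw [CliffordAlgebra.contractLeft_algebraMap, map_zero, contractOp_algebraMap]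
    have := scomm_mulLeft (ι_mem_extDeg (R := R) α) (algebraMap_mem_extDeg (R := R) r)
    rw [Nat.cast_zero, neg_zero]
    exact this.symm
  | add x y i _ _ hx hy => rw [map_add, map_add, hx, hy, map_add, scomm_add_right]
  | mem_mul m hm i x hx' hx =>
    obtain ⟨X, rfl⟩ := hm
    have h := CliffordAlgebra.contractLeft_ι_mul (Q := (0 : QuadraticForm R P)) α X x
    refine (congrArg (contractOp R P) h).trans ?_
    change contractOp R P (_ - ExteriorAlgebra.ι R X * _) = _
    have h2 := scomm_mul_right 1 (-1) (-i) (mulOp (ExteriorAlgebra.ι R α)) (ins X)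
      (contractOp R P x)
    rw [show (-((i.succ : ℕ) : ℤ)) = -1 + -i by push_cast; ring, contractOp_mul, h2, ← hx,
      scomm_swap, scomm_ins_mulOp _ (ι_mem_extDeg α), ins_ι, map_sub, contractOp_smul,
      contractOp_mul]
    simp [sub_eq_add_neg]

theorem contractLeft_mem_extDeg (α : Module.Dual R P) {k : ℕ} {x : Multi R P}
    (hx : x ∈ ⋀[R]^k P) : CliffordAlgebra.contractLeft α x ∈ extDeg R P ((k : ℤ) - 1) := by
  induction hx using Submodule.pow_induction_on_left' with
  | algebraMap r => rw [CliffordAlgebra.contractLeft_algebraMap]; exact Submodule.zero_mem _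
  | add x y i _ _ hx hy => rw [map_add]; exact Submodule.add_mem _ hx hy
  | mem_mul m hm i x hx' hx =>
    obtain ⟨X, rfl⟩ := hm
    have h := CliffordAlgebra.contractLeft_ι_mul (Q := (0 : QuadraticForm R P)) α X x
    rw [h]
    push_cast
    rw [add_sub_cancel_right]
    refine Submodule.sub_mem _ (mem_extDeg_natCast.2 (Submodule.smul_mem _ _ hx')) ?_
    have := extDeg_mul (ι_mem_extDeg (R := R) X) hx
    rwa [add_sub_cancel] at this

/-- The contractions of x with the coframe act as zero too, hence vanish by induction, and Euler's
identity leaves (k+1)x = 0. -/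
theorem Frame.contractOp_eq_zero_nat {κ : Type*} [Fintype κ] (B : Frame R P κ) {k : ℕ}
    {x : Multi R P} (hx : x ∈ ⋀[R]^k P) (h : contractOp R P x = 0) : x = 0 := by
  induction k generalizing x with
  | zero =>
    obtain ⟨r, rfl⟩ := exists_algebraMap_eq (mem_extDeg_natCast.2 hx)
    have h1 := LinearMap.congr_fun h (1 : Form R P)
    rw [contractOp_algebraMap, LinearMap.mulLeft_apply, mul_one, LinearMap.zero_apply] at h1
    rw [(ExteriorAlgebra.algebraMap_inj _ _ _).1 (h1.trans (map_zero (algebraMap R _)).symm),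
      map_zero]
  | succ k ih =>
    have h1 := B.euler hx
    have h2 : ∀ i, CliffordAlgebra.contractLeft (B.ε i) x = 0 := fun i => by
      refine ih ?_ ?_
      · have := contractLeft_mem_extDeg (B.ε i) hx
        rwa [Nat.cast_succ, add_sub_cancel_right] at this
      · rw [contractOp_contractLeft _ hx, h, scomm_zero_right]
    simp only [h2, mul_zero, Finset.sum_const_zero] at h1
    have h3 : ((k + 1 : ℕ) : ℝ) • x = 0 := by
      rw [h1, ← algebraMap_smul R ((k + 1 : ℕ) : ℝ) x, map_natCast]
    exact (smul_eq_zero.1 h3).resolve_left (by positivity)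

theorem Frame.contractOp_eq_zero {κ : Type*} [Fintype κ] (B : Frame R P κ) {k : ℤ}
    {x : Multi R P} (hx : x ∈ extDeg R P k) (h : contractOp R P x = 0) : x = 0 := by
  rcases extDeg_cases hx with rfl | ⟨n, rfl, hx⟩
  · rfl
  · exact B.contractOp_eq_zero_nat hx h

theorem Frame.contractOp_inj {κ : Type*} [Fintype κ] (B : Frame R P κ) {k : ℤ}
    {x y : Multi R P} (hx : x ∈ extDeg R P k) (hy : y ∈ extDeg R P k)
    (h : contractOp R P x = contractOp R P y) : x = y :=
  sub_eq_zero.1 (B.contractOp_eq_zero (Submodule.sub_mem _ hx hy) (by rw [map_sub, h, sub_self]))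

end Contractions

/-! ### Iterated commutators with contractions -/

section IteratedCommutators

variable {R : Type*} [CommRing R] [Algebra ℝ R] {P : Type*} [AddCommGroup P] [Module ℝ P]
  [Module R P] [IsScalarTower ℝ R P]

theorem ops_eq_bot {k l : ℤ} (hl : l < 0) : ops R P k l = ⊥ := by
  refine (Submodule.eq_bot_iff _).2 fun D hD => ?_
  rcases lt_or_ge k 0 with hk | hk
  · rw [ops, show (k + 1).toNat = 0 by omega] at hD
    exact (Submodule.mem_bot ℝ).1 hD
  · exact eq_zero_of_mem_diffOp (n := (k + 1).toNat) (m := l - k) (by omega) hD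

/-- For l = 0 the quotient defining 𝒞^{k,l} is trivial: an operator of order less than k and degree
-k is zero. Saturated brackets are therefore operators and not only symbols. -/
theorem lowerOps_eq_bot {k l : ℤ} (hl : l ≤ 0) : lowerOps R P k l = ⊥ := by
  refine (Submodule.eq_bot_iff _).2 fun D hD => ?_
  rcases lt_or_ge k 0 with hk | hk
  · rw [lowerOps, show k.toNat = 0 by omega] at hD
    exact (Submodule.mem_bot ℝ).1 hD
  · exact eq_zero_of_mem_diffOp (n := k.toNat) (m := l - k) (by omega) hD

/-- The iterated supercommutator `[…[[Φ, x₁], x₂], …]` with contractions; a pair `(k, x)` stands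
for a multisection of degree `k`. -/
def iter : ℤ → Module.End ℝ (Form R P) → List (ℤ × Multi R P) → Module.End ℝ (Form R P)
  | _, Φ, [] => Φ
  | m, Φ, a :: L => iter (m - a.1) (scomm m (-a.1) Φ (contractOp R P a.2)) L

/-- The entries are homogeneous of the given degrees. -/
def Homog (L : List (ℤ × Multi R P)) : Prop := ∀ a ∈ L, a.2 ∈ extDeg R P a.1

/-- The total degree. -/
def totalDeg (L : List (ℤ × Multi R P)) : ℤ := (L.map Prod.fst).sum

theorem totalDeg_cons (a : ℤ × Multi R P) (L : List (ℤ × Multi R P)) :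
    totalDeg (a :: L) = a.1 + totalDeg L := by simp [totalDeg]

theorem totalDeg_nil : totalDeg ([] : List (ℤ × Multi R P)) = 0 := rfl

theorem Homog.head {a : ℤ × Multi R P} {L : List (ℤ × Multi R P)} (h : Homog (a :: L)) :
    a.2 ∈ extDeg R P a.1 := h a List.mem_cons_self

theorem Homog.tail {a : ℤ × Multi R P} {L : List (ℤ × Multi R P)} (h : Homog (a :: L)) :
    Homog L := fun b hb => h b (List.mem_cons_of_mem _ hb)

theorem Homog.cons {a : ℤ × Multi R P} {L : List (ℤ × Multi R P)} (ha : a.2 ∈ extDeg R P a.1)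
    (h : Homog L) : Homog (a :: L) := by
  intro b hb
  rcases List.mem_cons.1 hb with rfl | hb
  · exact ha
  · exact h b hb

theorem Homog.nil : Homog ([] : List (ℤ × Multi R P)) := fun _ h => by simp at h

theorem iter_zero (m : ℤ) (L : List (ℤ × Multi R P)) : iter m 0 L = 0 := by
  induction L generalizing m with
  | nil => rfl
  | cons a L ih => rw [iter, scomm_zero_left, ih]

theorem iter_add (m : ℤ) (Φ Ψ : Module.End ℝ (Form R P)) (L : List (ℤ × Multi R P)) :
    iter m (Φ + Ψ) L = iter m Φ L + iter m Ψ L := by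
  induction L generalizing m Φ Ψ with
  | nil => rfl
  | cons a L ih => rw [iter, scomm_add_left, ih]; rfl

theorem iter_smul (m : ℤ) (c : ℝ) (Φ : Module.End ℝ (Form R P)) (L : List (ℤ × Multi R P)) :
    iter m (c • Φ) L = c • iter m Φ L := by
  induction L generalizing m Φ with
  | nil => rfl
  | cons a L ih => rw [iter, scomm_smul_left, ih]; rfl

theorem iter_units_smul (m : ℤ) (u : ℤˣ) (Φ : Module.End ℝ (Form R P))
    (L : List (ℤ × Multi R P)) : iter m (u • Φ) L = u • iter m Φ L := by
  induction L generalizing m Φ with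
  | nil => rfl
  | cons a L ih => rw [iter, scomm_units_smul_left, ih]; rfl

theorem iter_neg (m : ℤ) (Φ : Module.End ℝ (Form R P)) (L : List (ℤ × Multi R P)) :
    iter m (-Φ) L = -iter m Φ L := by
  induction L generalizing m Φ with
  | nil => rfl
  | cons a L ih => rw [iter, scomm_neg_left, ih]; rfl

theorem iter_sum {κ : Type*} (s : Finset κ) (m : ℤ) (Φ : κ → Module.End ℝ (Form R P))
    (L : List (ℤ × Multi R P)) : iter m (∑ i ∈ s, Φ i) L = ∑ i ∈ s, iter m (Φ i) L := by
  induction L generalizing m Φ with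
  | nil => rfl
  | cons a L ih => rw [iter, scomm_sum_left, ih]; rfl

theorem iter_append (m : ℤ) (Φ : Module.End ℝ (Form R P)) (L L' : List (ℤ × Multi R P)) :
    iter m Φ (L ++ L') = iter (m - totalDeg L) (iter m Φ L) L' := by
  induction L generalizing m Φ with
  | nil => rw [totalDeg_nil, sub_zero]; rfl
  | cons a L ih => rw [List.cons_append, iter, ih, totalDeg_cons, sub_sub]; rfl

theorem iter_mem_ops {k l : ℤ} {Φ : Module.End ℝ (Form R P)} (hΦ : Φ ∈ ops R P k l) {m : ℤ}
    (hm : m = l - k) {L : List (ℤ × Multi R P)} (hL : Homog L) :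
    iter m Φ L ∈ ops R P (k + totalDeg L - L.length) (l - L.length) := by
  induction L generalizing m Φ k l with
  | nil => simpa [iter, totalDeg_nil] using hΦ
  | cons a L ih =>
    have h := scomm_mem_ops hΦ (contractOp_mem hL.head)
    have h1 := ih h (m := m - a.1) (by rw [hm]; ring) hL.tail
    rw [zero_sub, ← hm] at h1
    rw [iter, totalDeg_cons, List.length_cons]
    push_cast
    convert h1 using 2 <;> ring

theorem iter_mem_lowerOps {k l : ℤ} {Φ : Module.End ℝ (Form R P)} (hΦ : Φ ∈ lowerOps R P k l)
    {m : ℤ} (hm : m = l - k) {L : List (ℤ × Multi R P)} (hL : Homog L) :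
    iter m Φ L ∈ lowerOps R P (k + totalDeg L - L.length) (l - L.length) := by
  induction L generalizing m Φ k l with
  | nil => simpa [iter, totalDeg_nil] using hΦ
  | cons a L ih =>
    have h := scomm_mem_lowerOps_left hΦ (contractOp_mem hL.head)
    have h1 := ih h (m := m - a.1) (by rw [hm]; ring) hL.tail
    rw [zero_sub, ← hm] at h1
    rw [iter, totalDeg_cons, List.length_cons]
    push_cast
    convert h1 using 2 <;> ring

theorem iter_eq_zero_of_mem_lowerOps {k l : ℤ} {Φ : Module.End ℝ (Form R P)}
    (hΦ : Φ ∈ lowerOps R P k l) {m : ℤ} (hm : m = l - k) {L : List (ℤ × Multi R P)}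
    (hL : Homog L) (hl : l ≤ L.length) : iter m Φ L = 0 := by
  have := iter_mem_lowerOps hΦ hm hL
  rw [lowerOps_eq_bot (by omega)] at this
  exact (Submodule.mem_bot ℝ).1 this

theorem iter_eq_zero_of_length {k l : ℤ} {Φ : Module.End ℝ (Form R P)}
    (hΦ : Φ ∈ ops R P k l) {m : ℤ} (hm : m = l - k) {L : List (ℤ × Multi R P)}
    (hL : Homog L) (hl : l < L.length) : iter m Φ L = 0 := by
  have := iter_mem_ops hΦ hm hL
  rw [ops_eq_bot (by omega)] at this
  exact (Submodule.mem_bot ℝ).1 this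

/-- Contractions supercommute, so the Jacobi identity exchanges neighbouring arguments with the
plain Koszul sign. -/
theorem iter_swap (m : ℤ) (Φ : Module.End ℝ (Form R P)) {a b : ℤ × Multi R P}
    (ha : a.2 ∈ extDeg R P a.1) (hb : b.2 ∈ extDeg R P b.1) (L : List (ℤ × Multi R P)) :
    iter m Φ (a :: b :: L) = (a.1 * b.1).negOnePow • iter m Φ (b :: a :: L) := by
  rw [iter, iter, iter, iter, ← iter_units_smul, sub_right_comm m b.1 a.1]
  congr 1
  have := scomm_jacobi m (-a.1) (-b.1) Φ (contractOp R P a.2) (contractOp R P b.2)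
  rw [scomm_contractOp ha hb, scomm_zero_right, zero_add, neg_mul_neg] at this
  exact this

/-- Moves a contraction from behind all arguments to the front. This turns the commutator of two
iterated brackets into an insertion in the first slot. -/
theorem scomm_iter (m : ℤ) (Φ : Module.End ℝ (Form R P)) {b : ℤ × Multi R P}
    (hb : b.2 ∈ extDeg R P b.1) {L : List (ℤ × Multi R P)} (hL : Homog L) :
    scomm (m - totalDeg L) (-b.1) (iter m Φ L) (contractOp R P b.2) =
      (b.1 * totalDeg L).negOnePow • iter m Φ (b :: L) := by
  induction L generalizing m Φ with
  | nil => rw [totalDeg_nil, mul_zero, Int.negOnePow_zero, one_smul, sub_zero]; rfl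
  | cons a L ih =>
    have := ih (m - a.1) (scomm m (-a.1) Φ (contractOp R P a.2)) hL.tail
    rw [totalDeg_cons, ← sub_sub]
    refine this.trans ?_
    change _ • iter m Φ (a :: b :: L) = _
    rw [iter_swap m Φ hL.head hb, smul_smul, ← Int.negOnePow_add]
    congr 2
    ring

/-- A generator of the algebra of multisections: a function or a section. -/
def IsGen (a : ℤ × Multi R P) : Prop :=
  (∃ r : R, a = (0, algebraMap R _ r)) ∨ ∃ X : P, a = (1, ExteriorAlgebra.ι R X)

theorem IsGen.mem {a : ℤ × Multi R P} (h : IsGen a) : a.2 ∈ extDeg R P a.1 := by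
  rcases h with ⟨r, rfl⟩ | ⟨X, rfl⟩
  · exact algebraMap_mem_extDeg r
  · exact ι_mem_extDeg X

/-- The Jacobi identity moves α past each argument. Its commutator with a section X is the function
α(X), so a section in the list is replaced by a function; this is why functions must be admitted as
generators in the hypothesis. -/
theorem iter_scomm_ι {l : ℕ} {m : ℤ} {K : Module.End ℝ (Form R P)}
    (h : ∀ L : List (ℤ × Multi R P), L.length = l → (∀ a ∈ L, IsGen a) → iter m K L = 0)
    (α : Module.Dual R P) (L : List (ℤ × Multi R P)) (hL : L.length = l)
    (hg : ∀ a ∈ L, IsGen a) :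
    iter (m + 1) (scomm m 1 K (mulOp (ExteriorAlgebra.ι R α))) L = 0 := by
  induction l generalizing m K L with
  | zero =>
    have h0 := h [] rfl (by simp)
    rw [iter] at h0
    rw [h0, scomm_zero_left, iter_zero]
  | succ l ih =>
    rcases L with _ | ⟨a, L⟩
    · simp at hL
    have hL' : L.length = l := by simpa using hL
    have hg' : ∀ b ∈ L, IsGen b := fun b hb => hg b (List.mem_cons_of_mem _ hb)
    have ha := hg a List.mem_cons_self
    have key := scomm_jacobi m 1 (-a.1) K (mulOp (ExteriorAlgebra.ι R α)) (contractOp R P a.2)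
    rw [iter, key, iter_add, iter_units_smul]
    have h2 : iter (m + 1 - a.1) (scomm (m + -a.1) 1 (scomm m (-a.1) K (contractOp R P a.2))
        (mulOp (ExteriorAlgebra.ι R α))) L = 0 := by
      have := ih (m := m - a.1) (K := scomm m (-a.1) K (contractOp R P a.2))
        (fun L' hl hg'' => h (a :: L') (by rw [List.length_cons, hl]) (by
          intro b hb
          rcases List.mem_cons.1 hb with rfl | hb
          · exact ha
          · exact hg'' b hb)) L hL' hg'
      rwa [← sub_eq_add_neg, add_sub_right_comm]
    rw [h2, smul_zero, add_zero]
    rcases ha with ⟨r, rfl⟩ | ⟨X, rfl⟩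
    · have := scomm_mulLeft (ι_mem_extDeg (R := R) α)
        (algebraMap_mem_extDeg (N := Module.Dual R P) r)
      dsimp only
      rw [contractOp_algebraMap, neg_zero, this, scomm_zero_right, iter_zero]
    · have h3 : scomm 1 (-1) (mulOp (ExteriorAlgebra.ι R α))
          (contractOp R P (ExteriorAlgebra.ι R X)) =
          contractOp R P (algebraMap R _ (α X)) := by
        rw [scomm_swap, scomm_ins_mulOp _ (ι_mem_extDeg α), ins_ι, contractOp_algebraMap]
        simp
      have h4 := h ((0, algebraMap R _ (α X)) :: L) (by rw [List.length_cons, hL']) (by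
        intro b hb
        rcases List.mem_cons.1 hb with rfl | hb
        · exact Or.inl ⟨_, rfl⟩
        · exact hg' b hb)
      dsimp only
      rw [h3, add_sub_cancel_right, add_neg_cancel]
      rw [iter] at h4
      simpa using h4

theorem Frame.mulOp_eq_zero_of_iter {κ : Type*} [Fintype κ] (B : Frame R P κ) {l : ℕ}
    {a : Form R P} (ha : a ∈ extDeg R (Module.Dual R P) l)
    (h : ∀ L : List (ℤ × Multi R P), L.length = l → (∀ a ∈ L, IsGen a) → iter l (mulOp a) L = 0) :
    a = 0 := by
  induction l generalizing a with
  | zero =>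
    have := LinearMap.congr_fun (h [] rfl (by simp)) 1
    rwa [iter, LinearMap.mulLeft_apply, mul_one] at this
  | succ l ih =>
    refine eq_zero_of_ins_eq_zero B (by positivity) ha fun X => ?_
    have h1 := ins_degree X ha
    rw [Nat.cast_succ, add_sub_cancel_right] at h1
    refine ih h1 fun L hl hg => ?_
    have h2 := h ((1, ExteriorAlgebra.ι R X) :: L) (by rw [List.length_cons, hl]) (by
      intro b hb
      rcases List.mem_cons.1 hb with rfl | hb
      · exact Or.inr ⟨_, rfl⟩
      · exact hg b hb)
    rw [iter, scomm_swap, scomm_ins_mulOp _ ha, iter_neg, iter_units_smul] at h2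
    have h3 := (smul_eq_zero_iff_eq _).1 (neg_eq_zero.1 h2)
    rw [Nat.cast_succ, add_sub_cancel_right] at h3
    exact h3

/-- A function on `T^*ΠA` is determined by its iterated brackets with the functions on the base
and the sections. -/
theorem Frame.mem_lowerOps_of_iter {κ : Type*} [Fintype κ] (B : Frame R P κ) {k : ℤ} {l : ℕ}
    {K : Module.End ℝ (Form R P)} (hK : K ∈ ops R P k l)
    (h : ∀ L : List (ℤ × Multi R P), L.length = l → (∀ a ∈ L, IsGen a) → iter (l - k) K L = 0) :
    K ∈ lowerOps R P k l := by
  rcases lt_or_ge k 0 with hk | hk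
  · rw [ops, show (k + 1).toNat = 0 by omega] at hK
    rw [(Submodule.mem_bot ℝ).1 hK]
    exact Submodule.zero_mem _
  lift k to ℕ using hk
  -- Induction on the order: [K,f] has bidegree (k-1,l-1) and [K,α] has bidegree (k-1,l), and both
  -- inherit the vanishing of iterated brackets. When l = 0 the commutator [K,f] vanishes by degree.
  -- At order zero K is a form, which is recovered from its contractions.
  induction k generalizing l K with
  | zero =>
    rw [ops, show (((0 : ℕ) : ℤ) + 1).toNat = 1 by rfl] at hK
    have h1 := eq_mulLeft_of_mem_diffOp_one hK
    have h2 := diffOp_degree hK one_mem_extDeg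
    rw [Nat.cast_zero, sub_zero, zero_add] at h2
    have h3 : K 1 = 0 := by
      refine B.mulOp_eq_zero_of_iter h2 fun L hl hg => ?_
      have := h L hl hg
      rw [h1, Nat.cast_zero, sub_zero] at this
      exact this
    rw [h1, h3]
    have : LinearMap.mulLeft ℝ (0 : Form R P) = 0 := map_zero (LinearMap.mul ℝ _)
    rw [this]
    exact Submodule.zero_mem _
  | succ k ih =>
    rw [ops, show (((k + 1 : ℕ) : ℤ) + 1).toNat = k + 1 + 1 by omega] at hK
    rw [lowerOps, show ((k + 1 : ℕ) : ℤ).toNat = k + 1 by omega]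
    refine mem_diffOp_of_generators hK.1 (fun r => ?_) fun α => ?_
    · have h1 := hK.2 0 _ (algebraMap_mem_extDeg r)
      rcases l with _ | l
      · rw [eq_zero_of_mem_diffOp (by push_cast; omega) h1]
        exact Submodule.zero_mem _
      · have e : ((l + 1 : ℕ) : ℤ) - ((k + 1 : ℕ) : ℤ) = l - k := by push_cast; ring
        rw [e] at h1 h ⊢
        have h2 := ih (l := l) (K := scomm (l - k) 0 K (mulOp (algebraMap R (Form R P) r)))
          (by rw [ops, show ((k : ℤ) + 1).toNat = k + 1 by omega]; simpa using h1) ?_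
        · rwa [lowerOps, Int.toNat_natCast] at h2
        · intro L hl hg
          have := h ((0, algebraMap R _ r) :: L) (by rw [List.length_cons, hl]) (by
            intro b hb
            rcases List.mem_cons.1 hb with rfl | hb
            · exact Or.inl ⟨_, rfl⟩
            · exact hg b hb)
          rwa [iter, contractOp_algebraMap, sub_zero, neg_zero] at this
    · have h1 := hK.2 1 _ (ι_mem_extDeg α)
      have e : (l : ℤ) - ((k + 1 : ℕ) : ℤ) + 1 = l - k := by push_cast; ring
      rw [e] at h1 ⊢
      have h2 := ih (l := l) (K := scomm (l - ((k + 1 : ℕ) : ℤ)) 1 K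
        (mulOp (ExteriorAlgebra.ι R α)))
        (by rw [ops, show ((k : ℤ) + 1).toNat = k + 1 by omega]; exact h1) ?_
      · rwa [lowerOps, Int.toNat_natCast] at h2
      · intro L hl hg
        rw [← e]
        exact iter_scomm_ι h α L hl hg

end IteratedCommutators

/-! ### Unshuffles as subsets of the arguments -/

section Unshuffles

/-- The sublist of the values of `a` on the places where `s` takes the value `b`. -/
def part {α : Type*} (b : Bool) : ∀ {n : ℕ}, (Fin n → α) → (Fin n → Bool) → List α
  | 0, _, _ => []
  | _ + 1, a, s =>
    if s 0 = b then a 0 :: part b (fun i => a i.succ) fun i => s i.succ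
    else part b (fun i => a i.succ) fun i => s i.succ

theorem part_eq_map_filter {α : Type*} (b : Bool) {n : ℕ} (a : Fin n → α) (s : Fin n → Bool) :
    part b a s = ((List.finRange n).filter (s · == b)).map a := by
  induction n with
  | zero => rfl
  | succ n ih =>
    rw [part, ih, List.finRange_succ, List.filter_cons, List.filter_map]
    by_cases h : s 0 = b <;> simp [h, Function.comp_def]

theorem part_eq_map {α : Type*} (b : Bool) {n : ℕ} (a : Fin n → α) (s : Fin n → Bool) :
    part b a s = (part b id s).map a := by
  rw [part_eq_map_filter, part_eq_map_filter, List.map_id]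

theorem mem_part (b : Bool) {n : ℕ} (s : Fin n → Bool) (i : Fin n) :
    i ∈ part b id s ↔ s i = b := by
  simp [part_eq_map_filter]

theorem sortedLT_part (b : Bool) {n : ℕ} (s : Fin n → Bool) : (part b id s).SortedLT := by
  rw [part_eq_map_filter, List.map_id]
  exact ((List.sortedLT_finRange n).pairwise.filter _).sortedLT

theorem length_part_add {α : Type*} {n : ℕ} (a : Fin n → α) (s : Fin n → Bool) :
    (part true a s).length + (part false a s).length = n := by
  induction n with
  | zero => rfl
  | succ n ih =>
    have := ih (fun i => a i.succ) fun i => s i.succ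
    rcases h : s 0 <;> simp [part, h] <;> omega

theorem length_part {α β : Type*} (b : Bool) {n : ℕ} (a : Fin n → α) (a' : Fin n → β)
    (s : Fin n → Bool) : (part b a s).length = (part b a' s).length := by
  rw [part_eq_map, part_eq_map b a', List.length_map, List.length_map]

theorem part_not {α : Type*} (b : Bool) {n : ℕ} (a : Fin n → α) (s : Fin n → Bool) :
    part b a (fun i => !s i) = part (!b) a s := by
  induction n with
  | zero => rfl
  | succ n ih =>
    have := ih (fun i => a i.succ) fun i => s i.succ
    rcases h : s 0 <;> cases b <;> simp_all [part]

/-- The indicator of the image of the first `i` places. -/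
def headSet {n : ℕ} (i : ℕ) (σ : Equiv.Perm (Fin n)) (a : Fin n) : Bool := decide ((σ⁻¹ a : ℕ) < i)

theorem headSet_apply {n : ℕ} (i : ℕ) (σ : Equiv.Perm (Fin n)) (a : Fin n) :
    headSet i σ (σ a) = decide ((a : ℕ) < i) := by simp [headSet]

/-- Both lists are strictly increasing and have the same members; the unshuffle condition is what
makes the second one increasing. -/
theorem part_true_headSet {n i : ℕ} (hi : i ≤ n) {σ : Equiv.Perm (Fin n)} (hσ : IsUnshuffle i σ) :
    part true id (headSet i σ) = List.ofFn fun a : Fin i => σ ⟨a, by omega⟩ := by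
  refine (sortedLT_part _ _).eq_of_mem_iff (List.sortedLT_ofFn_iff.2 fun a b hab => ?_) fun x => ?_
  · exact hσ _ _ hab (Or.inl b.2)
  · rw [mem_part, List.mem_ofFn, headSet, decide_eq_true_iff]
    constructor
    · intro h
      exact ⟨⟨(σ⁻¹ x : ℕ), h⟩, by simp⟩
    · rintro ⟨a, rfl⟩
      simp

theorem part_false_headSet {n i : ℕ} {σ : Equiv.Perm (Fin n)}
    (hσ : IsUnshuffle i σ) :
    part false id (headSet i σ) = List.ofFn fun b : Fin (n - i) => σ ⟨i + b, by omega⟩ := by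
  refine (sortedLT_part _ _).eq_of_mem_iff (List.sortedLT_ofFn_iff.2 fun a b hab => ?_) fun x => ?_
  · refine hσ _ _ ?_ (Or.inr (Nat.le_add_right _ _))
    have : (a : ℕ) < b := hab
    exact Fin.mk_lt_mk.2 (by omega)
  · rw [mem_part, List.mem_ofFn, headSet, decide_eq_false_iff_not, not_lt]
    constructor
    · intro h
      refine ⟨⟨(σ⁻¹ x : ℕ) - i, by omega⟩, ?_⟩
      have e : (⟨i + ((σ⁻¹ x : ℕ) - i), by omega⟩ : Fin n) = σ⁻¹ x :=
        Fin.ext (Nat.add_sub_cancel' h)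
      exact (congrArg σ e).trans (by simp)
    · rintro ⟨a, rfl⟩
      simp

theorem headSet_injective {n i : ℕ} (hi : i ≤ n) {σ τ : Equiv.Perm (Fin n)}
    (hσ : IsUnshuffle i σ) (hτ : IsUnshuffle i τ) (h : headSet i σ = headSet i τ) : σ = τ := by
  have h1 := part_true_headSet hi hσ
  rw [h, part_true_headSet hi hτ] at h1
  have h2 := part_false_headSet hσ
  rw [h, part_false_headSet hτ] at h2
  have h1 := List.ofFn_injective h1
  have h2 := List.ofFn_injective h2
  ext a
  rcases lt_or_ge (a : ℕ) i with ha | ha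
  · exact congrArg Fin.val (congrFun h1 ⟨a, ha⟩).symm
  · have := congrFun h2 ⟨a - i, by omega⟩
    simp only [Nat.add_sub_cancel' ha] at this
    exact congrArg Fin.val this.symm

/-- The permutation enumerates s in increasing order and then its complement in increasing order. -/
theorem exists_headSet_eq {n i : ℕ} (s : Fin n → Bool) (hs : (part true id s).length = i) :
    ∃ σ : Equiv.Perm (Fin n), IsUnshuffle i σ ∧ headSet i σ = s := by
  have hlen : (part true id s ++ part false id s).length = n := by
    rw [List.length_append, length_part_add]
  have hnd : (part true id s ++ part false id s).Nodup := by
    refine List.nodup_append'.2 ⟨(sortedLT_part _ _).nodup, (sortedLT_part _ _).nodup, ?_⟩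
    intro x h1 h2
    rw [mem_part] at h1 h2
    simp [h1] at h2
  have hmem : ∀ x, x ∈ part true id s ++ part false id s := fun x => by
    rw [List.mem_append, mem_part, mem_part]
    cases s x <;> simp
  set σ : Equiv.Perm (Fin n) := (finCongr hlen.symm).trans (hnd.getEquivOfForallMemList _ hmem)
    with hσ
  have hget : ∀ a : Fin n, σ a = (part true id s ++ part false id s)[(a : ℕ)] := fun a => rfl
  refine ⟨σ, fun a b hab h => ?_, funext fun x => ?_⟩
  · rcases h with h | h
    · rw [hget, hget, List.getElem_append_left (by omega), List.getElem_append_left (by omega)]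
      exact (sortedLT_part true s).getElem_lt_getElem_of_lt hab
    · have : (a : ℕ) < b := hab
      rw [hget, hget, List.getElem_append_right (by omega), List.getElem_append_right (by omega)]
      exact (sortedLT_part false s).getElem_lt_getElem_of_lt (by omega)
  · obtain ⟨a, rfl⟩ := σ.surjective x
    rw [headSet_apply]
    rcases lt_or_ge (a : ℕ) i with h | h
    · rw [decide_eq_true h, eq_comm, ← mem_part, hget, List.getElem_append_left (by omega)]
      exact List.getElem_mem _
    · rw [decide_eq_false (by omega), eq_comm, ← mem_part, hget,
        List.getElem_append_right (by omega)]
      exact List.getElem_mem _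

-- An unshuffle is determined by the image of its first i places. Sums over subsets, unlike sums
-- over unshuffles, split recursively according to the membership of the first index.
open Classical in
theorem sum_unshuffle {W : Type*} [AddCommMonoid W] {n i : ℕ} (hi : i ≤ n)
    (f : Equiv.Perm (Fin n) → W) (g : (Fin n → Bool) → W)
    (hfg : ∀ σ, IsUnshuffle i σ → f σ = g (headSet i σ)) :
    ∑ σ : Equiv.Perm (Fin n), (if IsUnshuffle i σ then f σ else 0) =
      ∑ s : Fin n → Bool, if (part true id s).length = i then g s else 0 := by
  rw [← Finset.sum_filter, ← Finset.sum_filter]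
  refine Finset.sum_bij (fun σ _ => headSet i σ) (fun σ hσ => ?_) (fun σ hσ τ hτ h => ?_)
    (fun s hs => ?_) fun σ hσ => ?_
  · rw [Finset.mem_filter] at hσ ⊢
    refine ⟨Finset.mem_univ _, ?_⟩
    rw [part_true_headSet hi hσ.2, List.length_ofFn]
  · exact headSet_injective hi (Finset.mem_filter.1 hσ).2 (Finset.mem_filter.1 hτ).2 h
  · obtain ⟨σ, hσ, h⟩ := exists_headSet_eq s (Finset.mem_filter.1 hs).2
    exact ⟨σ, Finset.mem_filter.2 ⟨Finset.mem_univ _, hσ⟩, h⟩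
  · exact hfg σ (Finset.mem_filter.1 hσ).2

theorem sum_bool_succ {W : Type*} [AddCommMonoid W] {n : ℕ} (f : (Fin (n + 1) → Bool) → W) :
    ∑ s, f s = ∑ s : Fin n → Bool, (f (Fin.cons true s) + f (Fin.cons false s)) := by
  rw [← (Fin.consEquiv fun _ => Bool).sum_comp, Fintype.sum_prod_type, Fintype.sum_bool,
    ← Finset.sum_add_distrib]
  rfl

theorem sum_bool_not {W : Type*} [AddCommMonoid W] {n : ℕ} (f : (Fin n → Bool) → W) :
    ∑ s, f s = ∑ s : Fin n → Bool, f fun i => !s i :=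
  (Equiv.sum_comp (Equiv.piCongrRight fun _ => Equiv.boolNot) f).symm

/-- The exponent of the sign of the unshuffle with head `s`. -/
def chiExp : ∀ {n : ℕ}, (Fin n → ℤ) → (Fin n → Bool) → ℤ
  | 0, _, _ => 0
  | n + 1, d, s =>
    (if s 0 then 0 else ∑ a : Fin n, if s a.succ then d 0 * d a.succ + 1 else 0) +
      chiExp (fun i => d i.succ) fun i => s i.succ

theorem negOnePow_sum {κ : Type*} (t : Finset κ) (f : κ → ℤ) :
    (∑ i ∈ t, f i).negOnePow = ∏ i ∈ t, (f i).negOnePow := by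
  classical
  induction t using Finset.induction_on with
  | empty => simp
  | insert a t ha ih => rw [Finset.sum_insert ha, Finset.prod_insert ha, Int.negOnePow_add, ih]

/-- The pairs that contribute are those with the larger index in the head and the smaller one in the
tail. The recursion in `chiExp` collects, for each tail element, the head elements behind it. -/
theorem negOnePow_chiExp {n : ℕ} (d : Fin n → ℤ) (s : Fin n → Bool) :
    (chiExp d s).negOnePow =
      ∏ u, ∏ v, if v < u ∧ s u = true ∧ s v = false then -(d u * d v).negOnePow else 1 := by
  induction n with
  | zero => simp [chiExp]
  | succ n ih =>
    rw [chiExp, Int.negOnePow_add, ih, Fin.prod_univ_succ]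
    have h0 : ∏ v, (if v < 0 ∧ s 0 = true ∧ s v = false then -(d 0 * d v).negOnePow else 1) = 1 :=
      Finset.prod_eq_one fun v _ => by simp
    have h1 : ∀ u : Fin n, ∏ v, (if v < u.succ ∧ s u.succ = true ∧ s v = false then
        -(d u.succ * d v).negOnePow else 1) =
        (if s 0 then 0 else if s u.succ then d 0 * d u.succ + 1 else 0 : ℤ).negOnePow *
        ∏ v : Fin n, if v < u ∧ s u.succ = true ∧ s v.succ = false then
          -(d u.succ * d v.succ).negOnePow else 1 := fun u => by
      rw [Fin.prod_univ_succ]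
      congr 1
      · rcases h : s 0 <;> rcases h' : s u.succ <;> simp [Int.negOnePow_succ, mul_comm]
      · simp
    rw [h0, one_mul, Finset.prod_congr rfl fun u _ => h1 u, Finset.prod_mul_distrib,
      ← negOnePow_sum]
    rcases h : s 0 <;> simp

/-- An unshuffle inverts no pair inside its head or inside its tail, so only the mixed pairs are
left in the sign. -/
theorem chi_unshuffle {n i : ℕ} (d : Fin n → ℤ) {σ : Equiv.Perm (Fin n)} (hσ : IsUnshuffle i σ) :
    chi d σ = (chiExp d (headSet i σ)).negOnePow := by
  rw [negOnePow_chiExp, chi]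
  refine Fintype.prod_equiv σ _ _ fun a => Fintype.prod_equiv σ _ _ fun b => ?_
  simp only [headSet_apply, decide_eq_true_iff, decide_eq_false_iff_not,
    not_lt]
  refine if_congr ⟨fun h => ⟨h.2, ?_⟩, fun h => ⟨Fin.lt_def.2 (by omega), h.1⟩⟩ rfl rfl
  by_contra h'
  have hab : (a : ℕ) < b := h.1
  have := hσ a b h.1 (by omega)
  exact lt_asymm this h.2

end Unshuffles

/-! ### The Leibniz expansion and the higher Jacobi identities -/

section HigherJacobi

variable {R : Type*} [CommRing R] [Algebra ℝ R] {P : Type*} [AddCommGroup P] [Module ℝ P]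
  [Module R P] [IsScalarTower ℝ R P]

/-- The exponent of the Koszul sign of the rearrangement given by `s`. -/
def koszulExp : ∀ {n : ℕ}, (Fin n → ℤ × Multi R P) → (Fin n → Bool) → ℤ
  | 0, _, _ => 0
  | _ + 1, a, s =>
    (if s 0 then 0 else (a 0).1 * totalDeg (part true (fun i => a i.succ) fun i => s i.succ)) +
      koszulExp (fun i => a i.succ) fun i => s i.succ

/-- The exponent of the sign which relates symmetric and skew-symmetric operations. -/
def decExp : List (ℤ × Multi R P) → ℤ
  | [] => 0
  | a :: L => a.1 * L.length + decExp L

/-- Every pair with one member in s and one in the complement is inverted by exactly one of the two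
orders, head first or tail first. -/
theorem koszulExp_add_not {n : ℕ} (a : Fin n → ℤ × Multi R P) (s : Fin n → Bool) :
    koszulExp a s + koszulExp a (fun i => !s i) =
      totalDeg (part true a s) * totalDeg (part false a s) := by
  induction n with
  | zero => simp [koszulExp, part, totalDeg]
  | succ n ih =>
    have h := ih (fun i => a i.succ) fun i => s i.succ
    rw [koszulExp, koszulExp, part_not]
    rcases h0 : s 0 <;> simp only [part, h0, totalDeg_cons, Bool.not_true, Bool.not_false, if_true,
      if_false, Bool.false_eq_true, Bool.true_eq_false] <;> linear_combination h

/-- The décalage: `chiExp` uses the shifted degrees d = |a| - 1 and signs of permutations,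
`koszulExp` the unshifted degrees only. The `decExp` terms, together with the one that accounts for
the inner operation in front of the tail, convert one into the other. -/
theorem even_chiExp {n : ℕ} (a : Fin n → ℤ × Multi R P) (d : Fin n → ℤ)
    (hd : ∀ i, (a i).1 = d i + 1) (s : Fin n → Bool) :
    Even (chiExp d s + decExp (part true a s) + decExp (part false a s) +
      totalDeg (part true a s) * (part false a s).length -
        (koszulExp a s + decExp (List.ofFn a))) := by
  induction n with
  | zero => simp [koszulExp, part, totalDeg, chiExp, decExp]
  | succ n ih =>
    obtain ⟨w, hw⟩ := ih (fun i => a i.succ) (fun i => d i.succ) (fun i => hd i.succ)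
      fun i => s i.succ
    have hlen := length_part_add (fun i => a i.succ) fun i : Fin n => s i.succ
    have hsum : ∀ (n : ℕ) (a : Fin n → ℤ × Multi R P) (d : Fin n → ℤ),
        (∀ i, (a i).1 = d i + 1) → ∀ (s : Fin n → Bool) (c : ℤ),
        ∑ i, (if s i then c * d i + 1 else 0) =
          c * totalDeg (part true a s) + (1 - c) * (part true a s).length := by
      intro n
      induction n with
      | zero => intros; simp [part, totalDeg]
      | succ n ih =>
        intro a d hd s c
        have := ih (fun i => a i.succ) (fun i => d i.succ) (fun i => hd i.succ)
          (fun i => s i.succ) c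
        rw [Fin.sum_univ_succ, this]
        rcases h0 : s 0 <;> simp only [part, h0, totalDeg_cons, if_true, if_false,
          Bool.false_eq_true, hd, List.length_cons] <;> push_cast <;> ring
    have hs := hsum n _ _ (fun i => hd i.succ) (fun i => s i.succ) (d 0)
    have hlen' : ((part true (fun i => a i.succ) fun i : Fin n => s i.succ).length : ℤ) +
      (part false (fun i => a i.succ) fun i : Fin n => s i.succ).length = n := by
      exact_mod_cast hlen
    rcases h0 : s 0
    · refine ⟨w - d 0 * (part true (fun i => a i.succ) fun i : Fin n => s i.succ).length, ?_⟩
      simp only [chiExp, koszulExp, part, h0, if_true, if_false, List.ofFn_succ,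
        Bool.false_eq_true, hd, List.length_cons, decExp, List.length_ofFn, hs]
      push_cast
      linear_combination hw - (-d 0 - 1) * hlen'
    · refine ⟨w, ?_⟩
      simp only [chiExp, koszulExp, part, h0, totalDeg_cons, if_true, if_false, List.ofFn_succ,
        Bool.true_eq_false, hd, decExp, List.length_ofFn]
      linear_combination hw - (-d 0 - 1) * hlen'

/-- The Leibniz rule for iterated commutators. -/
theorem iter_scomm (m m' : ℤ) (Φ Ψ : Module.End ℝ (Form R P)) {n : ℕ}
    (a : Fin n → ℤ × Multi R P) :
    iter (m + m') (scomm m m' Φ Ψ) (List.ofFn a) = ∑ s : Fin n → Bool,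
      (koszulExp a s - m' * totalDeg (part true a s)).negOnePow •
        scomm (m - totalDeg (part true a s)) (m' - totalDeg (part false a s))
          (iter m Φ (part true a s)) (iter m' Ψ (part false a s)) := by
  induction n generalizing m m' Φ Ψ with
  | zero => simp [koszulExp, part, totalDeg, iter]
  | succ n ih =>
    have h1 := ih m (m' - (a 0).1) Φ (scomm m' (-(a 0).1) Ψ (contractOp R P (a 0).2))
      fun i => a i.succ
    have h2 := ih (m - (a 0).1) m' (scomm m (-(a 0).1) Φ (contractOp R P (a 0).2)) Ψ
      fun i => a i.succ
    rw [List.ofFn_succ, iter, scomm_jacobi, iter_add, iter_units_smul, ← sub_eq_add_neg,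
      ← sub_eq_add_neg]
    rw [← add_sub_assoc] at h1
    rw [sub_add_eq_add_sub] at h2
    rw [h1, h2, sum_bool_succ, Finset.sum_add_distrib, add_comm, Finset.smul_sum]
    congr 1
    · refine Finset.sum_congr rfl fun s _ => ?_
      simp only [koszulExp, part, Fin.cons_zero, Fin.cons_succ, if_true, totalDeg_cons, smul_smul,
        ← Int.negOnePow_add, Bool.true_eq_false, if_false, zero_add, iter, sub_sub]
      congr 2
      ring
    · refine Finset.sum_congr rfl fun s _ => ?_
      simp only [koszulExp, part, Fin.cons_zero, Fin.cons_succ, if_true, totalDeg_cons,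
        Bool.false_eq_true, if_false, iter, sub_sub]
      congr 2
      ring

variable {l : ∀ k : ℕ, MultilinearMap ℝ (fun _ : Fin k => Multi R P) (Multi R P)}

/-- The value of the operations on the entries of a list. -/
def opList (l : ∀ k : ℕ, MultilinearMap ℝ (fun _ : Fin k => Multi R P) (Multi R P))
    (L : List (ℤ × Multi R P)) : Multi R P := l L.length fun i => (L.get i).2

/-- Lists hide the dependence of `l k` on its arity, so that inserting or appending an argument
needs no casts. -/
theorem apply_eq_opList {n : ℕ} (x : Fin n → Multi R P) (L : List (ℤ × Multi R P))
    (h : L.length = n) (hx : ∀ i : Fin n, x i = (L.get (i.cast h.symm)).2) :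
    l n x = opList l L := by
  subst h
  exact congrArg _ (funext hx)

/-- The operations `l_k` are the derived brackets of the operators `Φ_k`. -/
def IsDerived (l : ∀ k : ℕ, MultilinearMap ℝ (fun _ : Fin k => Multi R P) (Multi R P))
    (ε : ℕ → ℤˣ) (Φ : ℕ → Module.End ℝ (Form R P)) : Prop :=
  ∀ L : List (ℤ × Multi R P), Homog L → contractOp R P (opList l L) =
    ε L.length • (decExp L).negOnePow • iter (2 * L.length - 3) (Φ L.length) L

theorem homog_part (b : Bool) {n : ℕ} {a : Fin n → ℤ × Multi R P}
    (ha : ∀ i, (a i).2 ∈ extDeg R P (a i).1) (s : Fin n → Bool) : Homog (part b a s) := by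
  intro y hy
  rw [part_eq_map, List.mem_map] at hy
  obtain ⟨i, -, rfl⟩ := hy
  exact ha i

/-- The part of the Leibniz expansion of `[Φ_i, Φ_j]` in which `Φ_i` is saturated. -/
def insertion (Φ : ℕ → Module.End ℝ (Form R P)) (i j : ℕ) {n : ℕ} (a : Fin n → ℤ × Multi R P)
    (s : Fin n → Bool) : Module.End ℝ (Form R P) :=
  iter (2 * j - 3 - (totalDeg (part true a s) - (2 * i - 3)))
    (scomm (2 * j - 3) (-(totalDeg (part true a s) - (2 * i - 3))) (Φ j)
      (iter (2 * i - 3) (Φ i) (part true a s))) (part false a s)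

/-- The nested operations as a sum over subsets of the arguments. -/
theorem nested_eq_sum {n : ℕ} (p : Fin n) (x : Fin n → Multi R P) (d : Fin n → ℤ)
    (a : Fin n → ℤ × Multi R P) (ha : ∀ i, (a i).2 = x i) (c : (Fin n → Bool) → ℤ) :
    nested l p x d = ∑ s : Fin n → Bool, if (part true id s).length = p + 1 then
      (chiExp d s).negOnePow •
        opList l ((c s, opList l (part true a s)) :: part false a s) else 0 := by
  refine sum_unshuffle (by omega) _ _ fun σ hσ => ?_
  rw [chi_unshuffle d hσ]
  congr 1
  have h1 : part true a (headSet (p + 1) σ) =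
      List.ofFn fun i : Fin (p + 1) => a (σ ⟨i, by omega⟩) := by
    rw [part_eq_map, part_true_headSet (by omega) hσ, List.map_ofFn]
    rfl
  have h2 : part false a (headSet (p + 1) σ) =
      List.ofFn fun i : Fin (n - (p + 1)) => a (σ ⟨p + 1 + i, by omega⟩) := by
    rw [part_eq_map, part_false_headSet hσ, List.map_ofFn]
    rfl
  refine apply_eq_opList _ _ ?_ fun i => ?_
  · rw [List.length_cons, h2, List.length_ofFn]
  · refine Fin.cases ?_ (fun j => ?_) i
    · refine apply_eq_opList _ _ (by rw [h1, List.length_ofFn]) fun i => ?_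
      rw [List.get_eq_getElem, List.getElem_of_eq h1, List.getElem_ofFn]
      exact (ha _).symm
    · refine Eq.trans ?_ (congrArg Prod.snd (List.getElem_of_eq h2 _)).symm
      simp [ha]

/-- All signs of a nested term are gathered here: one factor common to every term of the n-th
identity, the Koszul sign of the subset, and ε-factors that depend only on the two arities. -/
theorem contractOp_nested {ε : ℕ → ℤˣ} {Φ : ℕ → Module.End ℝ (Form R P)}
    (hl : IsDerived l ε Φ)
    (hdeg : ∀ L, Homog L → opList l L ∈ extDeg R P (totalDeg L - (2 * L.length - 3)))
    {n : ℕ} (p : Fin n) (x : Fin n → Multi R P) (d : Fin n → ℤ)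
    (hx : ∀ i, x i ∈ extDeg R P (d i + 1)) :
    contractOp R P (((p : ℤ) + 1).negOnePow • nested l p x d) =
      (decExp (List.ofFn fun i => (d i + 1, x i)) + n).negOnePow •
        ((ε (p + 1) * ε (n - p)) • ∑ s : Fin n → Bool,
          if (part true id s).length = p + 1 then
            (koszulExp (fun i => (d i + 1, x i)) s).negOnePow •
              insertion Φ (p + 1) (n - p) (fun i => (d i + 1, x i)) s else 0) := by
  set a : Fin n → ℤ × Multi R P := fun i => (d i + 1, x i) with ha
  have key := nested_eq_sum (l := l) p x d a (fun _ => rfl) fun s =>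
    totalDeg (part true a s) - (2 * (part true a s).length - 3)
  rw [key, Finset.smul_sum, map_sum, Finset.smul_sum, Finset.smul_sum]
  refine Finset.sum_congr rfl fun s _ => ?_
  split_ifs with hs
  swap
  · simp
  have hT : Homog (part true a s) := homog_part true hx s
  have hF : Homog (part false a s) := homog_part false hx s
  have hlT : (part true a s).length = p + 1 := by rw [length_part true a id, hs]
  have hlF : (part false a s).length + 1 = n - p := by
    have := length_part_add a s
    omega
  have hunits : ∀ (u : ℤˣ) (y : Multi R P), contractOp R P (u • y) = u • contractOp R P y := by
    intro u y
    rcases Int.units_eq_one_or u with rfl | rfl <;> simp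
  rw [hunits, hunits, hl _ (Homog.cons (hdeg _ hT) hF), iter, hl _ hT, scomm_units_smul_right,
    scomm_units_smul_right, iter_units_smul, iter_units_smul, List.length_cons, hlF, hlT]
  have hc : ((n - p : ℕ) : ℤ) = (part false a s).length + 1 := by rw [← hlF]; push_cast; ring
  have hn : (n : ℤ) = p + 1 + (part false a s).length := by have := p.2; omega
  obtain ⟨w, hw⟩ := even_chiExp a d (fun i => rfl) s
  -- With i = p + 1, the inner operation has degree |T| - (2i-3), and the odd number 2i-3
  -- contributes (-1)^{n-i} through the length of the tail. Together with the (-1)^i of the Jacobi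
  -- identity this is (-1)^n for every i.
  have hsign : ((p : ℤ) + 1).negOnePow * ((chiExp d s).negOnePow *
      ((decExp ((totalDeg (part true a s) - (2 * ((p + 1 : ℕ) : ℤ) - 3),
        opList l (part true a s)) :: part false a s)).negOnePow *
        (decExp (part true a s)).negOnePow)) =
      (decExp (List.ofFn a) + n).negOnePow * (koszulExp a s).negOnePow := by
    rw [← Int.negOnePow_add, ← Int.negOnePow_add, ← Int.negOnePow_add, ← Int.negOnePow_add]
    refine negOnePow_congr ⟨w - p * (part false a s).length, ?_⟩
    rw [decExp, hn]
    push_cast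
    linear_combination hw
  rw [insertion]
  simp only [smul_smul]
  congr 1
  · calc _ = (ε (p + 1) * ε (n - p)) * (((p : ℤ) + 1).negOnePow * ((chiExp d s).negOnePow *
          ((decExp ((totalDeg (part true a s) - (2 * ((p + 1 : ℕ) : ℤ) - 3),
          opList l (part true a s)) :: part false a s)).negOnePow *
          (decExp (part true a s)).negOnePow))) := by
            ac_rfl
      _ = _ := by rw [hsign]; ac_rfl

variable {κ : Type*} [Fintype κ]

/-- Once saturated by its i arguments, Φ_i is the contraction with a multisection, by the frame. It
can then be inserted into Φ_j like any other argument. -/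
theorem scomm_iter_part (B : Frame R P κ) {Φ : ℕ → Module.End ℝ (Form R P)}
    (hΦ : ∀ i : ℕ, Φ i ∈ ops R P (3 - i) i) {n : ℕ} {a : Fin n → ℤ × Multi R P}
    (ha : ∀ i, (a i).2 ∈ extDeg R P (a i).1) (s : Fin n → Bool) {i j : ℕ}
    (hi : (part true a s).length = i) :
    (koszulExp a s - (2 * j - 3) * totalDeg (part true a s)).negOnePow •
      scomm (2 * i - 3 - totalDeg (part true a s)) (2 * j - 3 - totalDeg (part false a s))
        (iter (2 * i - 3) (Φ i) (part true a s)) (iter (2 * j - 3) (Φ j) (part false a s)) =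
      (koszulExp a s).negOnePow • insertion Φ i j a s := by
  have hT : Homog (part true a s) := homog_part true ha s
  have hF : Homog (part false a s) := homog_part false ha s
  have h1 := iter_mem_ops (hΦ i) (m := 2 * i - 3) (by ring) hT
  rw [hi, sub_self, show 3 - (i : ℤ) + totalDeg (part true a s) - i =
    totalDeg (part true a s) - (2 * i - 3) by ring] at h1
  obtain ⟨y, hy, hyT⟩ := B.exists_contractOp_eq_int h1
  have h2 := scomm_iter (2 * j - 3) (Φ j) (b := (_, y)) hy hF
  rw [← hyT, scomm_swap, ← neg_sub (totalDeg (part true a s)), h2, insertion, ← hyT, iter,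
    smul_smul]
  rw [← Units.neg_smul, smul_smul]
  congr 1
  rw [← Int.negOnePow_add, ← Int.negOnePow_succ, ← Int.negOnePow_add]
  refine negOnePow_congr ⟨2 * j * i - 3 * i - 3 * j + 5 + (3 - 2 * j) * totalDeg (part true a s) +
    (totalDeg (part true a s) - (2 * i - 3)) * totalDeg (part false a s), ?_⟩
  ring

/-- Subsets with i elements insert Φ_i into Φ_j, and those with i - 1 elements, whose complements
have j, insert Φ_j into Φ_i. Every other size gives Φ_i or Φ_j more arguments than it can take,
because i + j = n + 1. -/
theorem iter_scomm_eq_insertion (B : Frame R P κ) {Φ : ℕ → Module.End ℝ (Form R P)}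
    (hΦ : ∀ i : ℕ, Φ i ∈ ops R P (3 - i) i) {n : ℕ} {a : Fin n → ℤ × Multi R P}
    (ha : ∀ i, (a i).2 ∈ extDeg R P (a i).1) {i j : ℕ} (hij : i + j = n + 1) :
    iter (2 * i - 3 + (2 * j - 3)) (scomm (2 * i - 3) (2 * j - 3) (Φ i) (Φ j)) (List.ofFn a) =
      (∑ s : Fin n → Bool, if (part true id s).length = i then
        (koszulExp a s).negOnePow • insertion Φ i j a s else 0) +
      ∑ s : Fin n → Bool, if (part true id s).length = j then
        (koszulExp a s).negOnePow • insertion Φ j i a s else 0 := by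
  rw [iter_scomm, sum_bool_not (fun s => if (part true id s).length = j then
        (koszulExp a s).negOnePow • insertion Φ j i a s else 0), ← Finset.sum_add_distrib]
  refine Finset.sum_congr rfl fun s _ => ?_
  have hT : Homog (part true a s) := homog_part true ha s
  have hF : Homog (part false a s) := homog_part false ha s
  have hlen := length_part_add a s
  rw [part_not, length_part true id a, length_part (!true) id a, Bool.not_true]
  rcases lt_trichotomy (part true a s).length i with h | h | h
  · rw [if_neg h.ne, zero_add]
    split_ifs with h'
    · have := scomm_iter_part B hΦ ha (fun k => !s k) (i := j) (j := i)
        (by rw [part_not, Bool.not_true, h'])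
      rw [← this, scomm_swap, part_not, part_not, Bool.not_true, Bool.not_false,
        ← Units.neg_smul, smul_smul, ← Int.negOnePow_succ, ← Int.negOnePow_add]
      congr 1
      refine negOnePow_congr ⟨koszulExp a s - (2 * j - 3) * totalDeg (part true a s) +
        2 * j * i - 3 * i - 3 * j + 5, ?_⟩
      linear_combination -koszulExp_add_not a s
    · rw [iter_eq_zero_of_length (hΦ j) (by ring) hF (by omega), scomm_zero_right, smul_zero]
  · rw [if_pos h, if_neg (by omega), add_zero]
    exact scomm_iter_part B hΦ ha s h
  · rw [if_neg h.ne', if_neg (by omega), add_zero,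
      iter_eq_zero_of_length (hΦ i) (by ring) hT (by omega), scomm_zero_left, smul_zero]

/-- The sum of the commutators `[Φ_i, Φ_j]` with `i + j = n + 1`. -/
def mcOp (ε : ℕ → ℤˣ) (Φ : ℕ → Module.End ℝ (Form R P)) (n : ℕ) : Module.End ℝ (Form R P) :=
  ∑ p : Fin n, (ε (p + 1) * ε (n - p)) •
    scomm (2 * (p + 1 : ℕ) - 3) (2 * (n - p : ℕ) - 3) (Φ (p + 1)) (Φ (n - p))

/-- The higher Jacobi identity for derived brackets. -/
theorem contractOp_jacobi (B : Frame R P κ) {ε : ℕ → ℤˣ} {Φ : ℕ → Module.End ℝ (Form R P)}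
    (hΦ : ∀ i : ℕ, Φ i ∈ ops R P (3 - i) i) (hl : IsDerived l ε Φ)
    (hdeg : ∀ L, Homog L → opList l L ∈ extDeg R P (totalDeg L - (2 * L.length - 3)))
    {n : ℕ} (x : Fin n → Multi R P) (d : Fin n → ℤ) (hx : ∀ i, x i ∈ extDeg R P (d i + 1)) :
    (2 : ℝ) • contractOp R P (∑ p : Fin n, ((p : ℤ) + 1).negOnePow • nested l p x d) =
      (decExp (List.ofFn fun i => (d i + 1, x i)) + n).negOnePow •
        iter (2 * n - 4) (mcOp ε Φ n) (List.ofFn fun i => (d i + 1, x i)) := by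
  set a : Fin n → ℤ × Multi R P := fun i => (d i + 1, x i) with ha
  have h1 : iter (2 * n - 4) (mcOp ε Φ n) (List.ofFn a) = ∑ p : Fin n,
      (ε (p + 1) * ε (n - p)) • ((∑ s : Fin n → Bool, if (part true id s).length = p + 1 then
        (koszulExp a s).negOnePow • insertion Φ (p + 1) (n - p) a s else 0) +
      ∑ s : Fin n → Bool, if (part true id s).length = n - p then
        (koszulExp a s).negOnePow • insertion Φ (n - p) (p + 1) a s else 0) := by
    rw [mcOp, iter_sum]
    refine Finset.sum_congr rfl fun p _ => ?_
    rw [iter_units_smul, ← iter_scomm_eq_insertion B hΦ hx (by omega)]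
    congr 2
    push_cast [Nat.cast_sub p.2.le]
    ring
  -- Reversing p exchanges the two families of insertions, so every nested term is counted twice.
  have h2 : ∀ f : ℕ → ℕ → Module.End ℝ (Form R P),
      ∑ p : Fin n, (ε (p + 1) * ε (n - p)) • (f (p + 1) (n - p) + f (n - p) (p + 1)) =
        (2 : ℝ) • ∑ p : Fin n, (ε (p + 1) * ε (n - p)) • f (p + 1) (n - p) := by
    intro f
    simp only [smul_add, Finset.sum_add_distrib]
    rw [two_smul]
    congr 1
    refine Fintype.sum_equiv Fin.revPerm _ _ fun p => ?_
    rw [Fin.revPerm_apply, Fin.val_rev, show n - (p + 1 : ℕ) + 1 = n - p by omega,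
      show n - (n - (p + 1 : ℕ)) = p + 1 by omega, mul_comm]
  rw [h1, h2 fun i j => ∑ s : Fin n → Bool, if (part true id s).length = i then
        (koszulExp a s).negOnePow • insertion Φ i j a s else 0, map_sum, smul_comm,
    Finset.smul_sum (r := (_ : ℤˣ))]
  congr 1
  exact Finset.sum_congr rfl fun p _ => contractOp_nested hl hdeg p x d hx

end HigherJacobi

/-! ### Symbols of operators and the structure equation by bidegrees -/

section Symbols

variable {R : Type*} [CommRing R] [Algebra ℝ R] {P : Type*} [AddCommGroup P] [Module ℝ P]
  [Module R P] [IsScalarTower ℝ R P]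

/-- The function on `T^*ΠA` given by the symbol of an operator. -/
def symb (k l : ℤ) (D : Module.End ℝ (Form R P)) (h : D ∈ ops R P k l) : Ham R P :=
  Fun.toHam R P k l (Subquot.mk (lowerOps R P k l) D h)

theorem symb_congr {k l k' l' : ℤ} {D D' : Module.End ℝ (Form R P)} {h : D ∈ ops R P k l}
    {h' : D' ∈ ops R P k' l'} (hk : k = k') (hl : l = l') (hD : D = D') :
    symb k l D h = symb k' l' D' h' := by
  subst hk hl hD
  rfl

theorem Fun.exists_rep {k l : ℤ} (f : Fun R P k l) :
    ∃ (D : Module.End ℝ (Form R P)) (h : D ∈ ops R P k l), Subquot.mk (lowerOps R P k l) D h = f := by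
  obtain ⟨⟨D, h⟩, rfl⟩ := Submodule.Quotient.mk_surjective _ f
  exact ⟨D, h, rfl⟩

theorem Subquot.mk_eq_zero {V : Type*} [AddCommGroup V] [Module ℝ V] {S : Submodule ℝ V}
    {L : Submodule ℝ V} {x : V} {hx : x ∈ S} : Subquot.mk L x hx = 0 ↔ x ∈ L :=
  Submodule.Quotient.mk_eq_zero _

theorem Subquot.mk_eq_mk {V : Type*} [AddCommGroup V] [Module ℝ V] {S : Submodule ℝ V}
    {L : Submodule ℝ V} {x y : V} {hx : x ∈ S} {hy : y ∈ S} :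
    Subquot.mk L x hx = Subquot.mk L y hy ↔ x - y ∈ L :=
  Submodule.Quotient.eq _

theorem toHam_injective (k l : ℤ) : Function.Injective (Fun.toHam R P k l) :=
  DirectSum.of_injective (β := fun b : ℤ × ℤ => Fun R P b.1 b.2) (k, l)

theorem symb_eq_zero {k l : ℤ} {D : Module.End ℝ (Form R P)} {h : D ∈ ops R P k l} :
    symb k l D h = 0 ↔ D ∈ lowerOps R P k l := by
  rw [symb, map_eq_zero_iff _ (toHam_injective k l), Subquot.mk_eq_zero]

theorem symb_eq_symb {k l : ℤ} {D D' : Module.End ℝ (Form R P)} {h : D ∈ ops R P k l}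
    {h' : D' ∈ ops R P k l} : symb k l D h = symb k l D' h' ↔ D - D' ∈ lowerOps R P k l := by
  rw [symb, symb, (toHam_injective k l).eq_iff, Subquot.mk_eq_mk]

theorem symb_add {k l : ℤ} {D D' : Module.End ℝ (Form R P)} (h : D ∈ ops R P k l)
    (h' : D' ∈ ops R P k l) :
    symb k l (D + D') (Submodule.add_mem _ h h') = symb k l D h + symb k l D' h' :=
  map_add (Fun.toHam R P k l) (Subquot.mk (lowerOps R P k l) D h)
    (Subquot.mk (lowerOps R P k l) D' h')

theorem symb_smul {k l : ℤ} {D : Module.End ℝ (Form R P)} (c : ℝ) (h : D ∈ ops R P k l) :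
    symb k l (c • D) (Submodule.smul_mem _ c h) = c • symb k l D h :=
  map_smul (Fun.toHam R P k l) c (Subquot.mk (lowerOps R P k l) D h)

theorem poisson_symb {k l k' l' : ℤ} {D D' : Module.End ℝ (Form R P)} (h : D ∈ ops R P k l)
    (h' : D' ∈ ops R P k' l') : poisson R P (symb k l D h) (symb k' l' D' h') =
      symb (k + k' - 1) (l + l' - 1) (scomm (l - k) (l' - k') D D') (scomm_mem_ops h h') := by
  rw [symb, symb, poisson_toHam]
  rfl

theorem hbar_apply {k : ℤ} {x : Multi R P} (hx : x ∈ extDeg R P k) :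
    hbar R P x = symb k 0 (contractOp R P x) (contractOp_mem hx) := by
  rcases extDeg_cases hx with rfl | ⟨n, rfl, hx'⟩
  · rw [map_zero, eq_comm, symb_eq_zero, map_zero]
    exact Submodule.zero_mem _
  · have : DirectSum.decompose (fun k : ℕ => ⋀[R]^k P) x =
        DirectSum.of (fun k : ℕ => ⋀[R]^k P) n ⟨x, hx'⟩ :=
      DirectSum.decompose_of_mem (fun k : ℕ => ⋀[R]^k P) hx'
    simp only [hbar, LinearMap.comp_apply, LinearMap.restrictScalars_apply,
      LinearEquiv.coe_coe, DirectSum.decomposeLinearEquiv_apply, this]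
    exact DirectSum.toModule_lof (M := fun k : ℕ => ⋀[R]^k P) ℝ n ⟨x, hx'⟩

theorem mulOp_mem {k : ℤ} {a : Form R P} (ha : a ∈ extDeg R (Module.Dual R P) k) :
    mulOp a ∈ ops R P 0 k := by
  have := mulLeft_mem_diffOp ha
  rwa [ops, sub_zero]

theorem mulOp_zero : mulOp (0 : Form R P) = 0 := map_zero (LinearMap.mul ℝ (Form R P))

theorem vbar_apply {k : ℤ} {a : Form R P} (ha : a ∈ extDeg R (Module.Dual R P) k) :
    vbar R P a = symb 0 k (mulOp a) (mulOp_mem ha) := by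
  rcases extDeg_cases ha with rfl | ⟨n, rfl, ha'⟩
  · rw [map_zero, eq_comm, symb_eq_zero, mulOp_zero]
    exact Submodule.zero_mem _
  · have : DirectSum.decompose (fun k : ℕ => ⋀[R]^k (Module.Dual R P)) a =
        DirectSum.of (fun k : ℕ => ⋀[R]^k (Module.Dual R P)) n ⟨a, ha'⟩ :=
      DirectSum.decompose_of_mem (fun k : ℕ => ⋀[R]^k (Module.Dual R P)) ha'
    simp only [vbar, LinearMap.comp_apply, LinearMap.restrictScalars_apply,
      LinearEquiv.coe_coe, DirectSum.decomposeLinearEquiv_apply, this]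
    exact DirectSum.toModule_lof (M := fun k : ℕ => ⋀[R]^k (Module.Dual R P)) ℝ n ⟨a, ha'⟩

theorem mulOp_injective : Function.Injective (mulOp : Form R P → Module.End ℝ (Form R P)) :=
  fun a b h => by simpa using LinearMap.congr_fun h (1 : Form R P)

/-- Functions of distinct bidegrees are linearly independent. -/
theorem sum_toHam_eq_zero {b₁ b₂ b₃ b₄ : ℤ × ℤ} (f₁ : Fun R P b₁.1 b₁.2) (f₂ : Fun R P b₂.1 b₂.2)
    (f₃ : Fun R P b₃.1 b₃.2) (f₄ : Fun R P b₄.1 b₄.2) (h12 : b₁ ≠ b₂) (h13 : b₁ ≠ b₃)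
    (h14 : b₁ ≠ b₄) (h23 : b₂ ≠ b₃) (h24 : b₂ ≠ b₄) (h34 : b₃ ≠ b₄) :
    Fun.toHam R P b₁.1 b₁.2 f₁ + Fun.toHam R P b₂.1 b₂.2 f₂ + Fun.toHam R P b₃.1 b₃.2 f₃ +
      Fun.toHam R P b₄.1 b₄.2 f₄ = 0 ↔ f₁ = 0 ∧ f₂ = 0 ∧ f₃ = 0 ∧ f₄ = 0 := by
  constructor
  · intro h
    have key := fun b : ℤ × ℤ => congrArg (fun x : Ham R P => x b) h
    simp only [Fun.toHam, DirectSum.lof_eq_of] at key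
    refine ⟨?_, ?_, ?_, ?_⟩
    · have := key b₁
      simpa [DirectSum.of_eq_of_ne, h12, h13, h14] using this
    · have := key b₂
      simpa [DirectSum.of_eq_of_ne, h12.symm, h23, h24] using this
    · have := key b₃
      simpa [DirectSum.of_eq_of_ne, h13.symm, h23.symm, h34] using this
    · have := key b₄
      simpa [DirectSum.of_eq_of_ne, h14.symm, h24.symm, h34.symm] using this
  · rintro ⟨rfl, rfl, rfl, rfl⟩
    simp

/-- The components in bidegrees (k,0) can be read off separately. There equality of symbols is
equality of operators, and contraction is faithful. -/
theorem hbar_injective {κ : Type*} [Fintype κ] (B : Frame R P κ) :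
    Function.Injective (hbar R P) := by
  have key : ∀ (y : ⨁ k : ℕ, ⋀[R]^k P) (k : ℕ),
      (DirectSum.toModule ℝ ℕ (Ham R P) (fun k => Fun.toHam R P k 0 ∘ₗ hbarDeg R P k) y)
        ((k : ℤ), (0 : ℤ)) = hbarDeg R P k (y k) := by
    intro y k
    induction y using DirectSum.induction_on with
    | zero => simp
    | of i x =>
      rw [← DirectSum.lof_eq_of ℝ, DirectSum.toModule_lof]
      simp only [Fun.toHam, LinearMap.comp_apply, DirectSum.lof_eq_of]
      by_cases h : i = k
      · subst h
        rw [DirectSum.of_eq_same, DirectSum.of_eq_same]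
      · rw [DirectSum.of_eq_of_ne _ _ _ (Ne.symm h), map_zero]
        exact DirectSum.of_eq_of_ne (β := fun b : ℤ × ℤ => Fun R P b.1 b.2) _ _ _ (by
          simpa [eq_comm] using h)
    | add y z hy hz => rw [map_add, DirectSum.add_apply, hy, hz, DirectSum.add_apply, map_add]
  rw [← LinearMap.ker_eq_bot, Submodule.eq_bot_iff]
  intro x hx
  have h1 : DirectSum.decompose (fun k : ℕ => ⋀[R]^k P) x = 0 := by
    refine DFinsupp.ext fun k => ?_
    have h2 := key (DirectSum.decompose (fun k : ℕ => ⋀[R]^k P) x) k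
    have h3 : DirectSum.toModule ℝ ℕ (Ham R P) (fun k => Fun.toHam R P k 0 ∘ₗ hbarDeg R P k)
      (DirectSum.decompose (fun k : ℕ => ⋀[R]^k P) x) = 0 := hx
    rw [h3] at h2
    have h4 : contractOp R P (DirectSum.decompose (fun k : ℕ => ⋀[R]^k P) x k : Multi R P) ∈
        lowerOps R P k 0 := Subquot.mk_eq_zero.1 h2.symm
    rw [lowerOps_eq_bot le_rfl] at h4
    exact Subtype.ext (B.contractOp_eq_zero_nat
      (DirectSum.decompose (fun k : ℕ => ⋀[R]^k P) x k).2 ((Submodule.mem_bot ℝ).1 h4))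
  exact (DirectSum.decomposeAddEquiv (fun k : ℕ => ⋀[R]^k P)).injective
    (h1.trans (map_zero (DirectSum.decomposeAddEquiv (fun k : ℕ => ⋀[R]^k P))).symm)

/-- The operators of the three components of the Hamiltonian. -/
def opSeq (G D F : Module.End ℝ (Form R P)) : ℕ → Module.End ℝ (Form R P)
  | 1 => G
  | 2 => D
  | 3 => F
  | _ => 0

/-- The signs of the derived brackets. -/
def sgnSeq (k : ℕ) : ℤˣ := if k = 2 then -1 else 1

theorem opSeq_mem {G D F : Module.End ℝ (Form R P)} (hG : G ∈ ops R P 2 1) (hD : D ∈ ops R P 1 2)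
    (hF : F ∈ ops R P 0 3) (i : ℕ) : opSeq G D F i ∈ ops R P (3 - i) i := by
  match i with
  | 0 => exact Submodule.zero_mem _
  | 1 => exact hG
  | 2 => exact hD
  | 3 => exact hF
  | _ + 4 => exact Submodule.zero_mem _

theorem mcOp_mem {ε : ℕ → ℤˣ} {Φ : ℕ → Module.End ℝ (Form R P)}
    (hΦ : ∀ i : ℕ, Φ i ∈ ops R P (3 - i) i) (n : ℕ) : mcOp ε Φ n ∈ ops R P (4 - n) n := by
  refine Submodule.sum_mem _ fun p _ => ?_
  have h := scomm_mem_ops (hΦ (p + 1)) (hΦ (n - p))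
  have hp := p.2
  have e : ((n - p : ℕ) : ℤ) = n - p := Nat.cast_sub hp.le
  rw [show (3 - ((p + 1 : ℕ) : ℤ) + (3 - ((n - p : ℕ) : ℤ)) - 1) = 4 - n by push_cast [e]; ring,
    show ((p + 1 : ℕ) : ℤ) + ((n - p : ℕ) : ℤ) - 1 = n by push_cast [e]; ring,
    show ((p + 1 : ℕ) : ℤ) - (3 - ((p + 1 : ℕ) : ℤ)) = 2 * (p + 1 : ℕ) - 3 by ring,
    show ((n - p : ℕ) : ℤ) - (3 - ((n - p : ℕ) : ℤ)) = 2 * (n - p : ℕ) - 3 by ring] at h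
  rcases Int.units_eq_one_or (ε (p + 1) * ε (n - p)) with h1 | h1 <;> rw [h1]
  · rwa [one_smul]
  · rw [Units.neg_smul, one_smul]
    exact Submodule.neg_mem _ h

/-- The operators of μ, γ, φ have the odd degrees 1, -1, 3, so the mixed brackets of the components
of Θ are symmetric and each occurs twice in {Θ,Θ}. -/
theorem scomm_odd (m m' : ℤ) (h : Odd (m * m')) (D D' : Module.End ℝ (Form R P)) :
    scomm m m' D D' = scomm m' m D' D := by
  rw [scomm_swap, Int.negOnePow_odd _ h, Units.neg_smul, one_smul, neg_neg]

theorem poisson_symb_eq {k l k' l' : ℤ} {D D' : Module.End ℝ (Form R P)} (h : D ∈ ops R P k l)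
    (h' : D' ∈ ops R P k' l') {K L m m' : ℤ} (hK : k + k' - 1 = K) (hL : l + l' - 1 = L)
    (hm : l - k = m) (hm' : l' - k' = m') :
    ∃ hmem : scomm m m' D D' ∈ ops R P K L,
      poisson R P (symb k l D h) (symb k' l' D' h') = symb K L (scomm m m' D D') hmem := by
  subst hK hL hm hm'
  exact ⟨_, poisson_symb h h'⟩

theorem sum_symb_eq_zero {D₁ D₂ D₃ D₄ : Module.End ℝ (Form R P)} (h₁ : D₁ ∈ ops R P 1 3)
    (h₂ : D₂ ∈ ops R P 3 1) (h₃ : D₃ ∈ ops R P 2 2) (h₄ : D₄ ∈ ops R P 0 4) :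
    symb 1 3 D₁ h₁ + symb 3 1 D₂ h₂ + symb 2 2 D₃ h₃ + symb 0 4 D₄ h₄ = 0 ↔
      D₁ ∈ lowerOps R P 1 3 ∧ D₂ ∈ lowerOps R P 3 1 ∧ D₃ ∈ lowerOps R P 2 2 ∧
        D₄ ∈ lowerOps R P 0 4 := by
  rw [← Subquot.mk_eq_zero (hx := h₁), ← Subquot.mk_eq_zero (hx := h₂),
    ← Subquot.mk_eq_zero (hx := h₃), ← Subquot.mk_eq_zero (hx := h₄)]
  exact sum_toHam_eq_zero (b₁ := (1, 3)) (b₂ := (3, 1)) (b₃ := (2, 2)) (b₄ := (0, 4)) _ _ _ _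
    (by decide) (by decide) (by decide) (by decide) (by decide) (by decide)

theorem smul_mem_iff_two {V : Type*} [AddCommGroup V] [Module ℝ V] (S : Submodule ℝ V) {x : V} :
    (2 : ℝ) • x ∈ S ↔ x ∈ S := S.smul_mem_iff (by norm_num)

theorem poisson_theta_symb {G D F : Module.End ℝ (Form R P)} (hG : G ∈ ops R P 2 1)
    (hD : D ∈ ops R P 1 2) (hF : F ∈ ops R P 0 3) :
    poisson R P (symb 1 2 D hD + symb 2 1 G hG + symb 0 3 F hF)
      (symb 1 2 D hD + symb 2 1 G hG + symb 0 3 F hF) =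
    (2 : ℝ) • ((1 / 2 : ℝ) • poisson R P (symb 1 2 D hD) (symb 1 2 D hD) +
      poisson R P (symb 2 1 G hG) (symb 0 3 F hF)) + poisson R P (symb 2 1 G hG) (symb 2 1 G hG) +
      (2 : ℝ) • poisson R P (symb 1 2 D hD) (symb 2 1 G hG) +
      (2 : ℝ) • poisson R P (symb 1 2 D hD) (symb 0 3 F hF) := by
  have eFF : poisson R P (symb 0 3 F hF) (symb 0 3 F hF) = 0 := by
    rw [poisson_symb, symb_eq_zero]
    have : scomm (3 - 0) (3 - 0) F F = 0 := (Submodule.mem_bot ℝ).1 (scomm_mem_ops hF hF)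
    rw [this]
    exact Submodule.zero_mem _
  have eGD : poisson R P (symb 2 1 G hG) (symb 1 2 D hD) =
      poisson R P (symb 1 2 D hD) (symb 2 1 G hG) := by
    rw [poisson_symb, poisson_symb]
    exact symb_congr (by norm_num) (by norm_num) (scomm_odd _ _ (by decide) _ _)
  have eFD : poisson R P (symb 0 3 F hF) (symb 1 2 D hD) =
      poisson R P (symb 1 2 D hD) (symb 0 3 F hF) := by
    rw [poisson_symb, poisson_symb]
    exact symb_congr (by norm_num) (by norm_num) (scomm_odd _ _ (by decide) _ _)
  have eFG : poisson R P (symb 0 3 F hF) (symb 2 1 G hG) =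
      poisson R P (symb 2 1 G hG) (symb 0 3 F hF) := by
    rw [poisson_symb, poisson_symb]
    exact symb_congr (by norm_num) (by norm_num) (scomm_odd _ _ (by decide) _ _)
  simp only [map_add, LinearMap.add_apply, eFF, eGD, eFD, eFG]
  module

/-- The components of the structure equation, for representing operators. -/
def MCOps (G D F : Module.End ℝ (Form R P)) : Prop :=
  (1 / 2 : ℝ) • scomm 1 1 D D + scomm (-1) 3 G F ∈ lowerOps R P 1 3 ∧
    scomm (-1) (-1) G G ∈ lowerOps R P 3 1 ∧ scomm 1 (-1) D G ∈ lowerOps R P 2 2 ∧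
    scomm 1 3 D F ∈ lowerOps R P 0 4

section

variable {G D F : Module.End ℝ (Form R P)} (hG : G ∈ ops R P 2 1) (hD : D ∈ ops R P 1 2)
  (hF : F ∈ ops R P 0 3)

/-- The surviving terms have the four distinct bidegrees (1,3), (3,1), (2,2), (0,4), so they vanish
separately; the factors 2 are invertible. -/
theorem poisson_theta_eq_zero_iff :
    poisson R P (symb 1 2 D hD + symb 2 1 G hG + symb 0 3 F hF)
      (symb 1 2 D hD + symb 2 1 G hG + symb 0 3 F hF) = 0 ↔ MCOps G D F := by
  obtain ⟨hDD, eDD⟩ := poisson_symb_eq hD hD (K := 1) (L := 3) (m := 1) (m' := 1)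
    (by norm_num) (by norm_num) (by norm_num) (by norm_num)
  obtain ⟨hGG, eGG⟩ := poisson_symb_eq hG hG (K := 3) (L := 1) (m := -1) (m' := -1)
    (by norm_num) (by norm_num) (by norm_num) (by norm_num)
  obtain ⟨hDG, eDG⟩ := poisson_symb_eq hD hG (K := 2) (L := 2) (m := 1) (m' := -1)
    (by norm_num) (by norm_num) (by norm_num) (by norm_num)
  obtain ⟨hDF, eDF⟩ := poisson_symb_eq hD hF (K := 0) (L := 4) (m := 1) (m' := 3)
    (by norm_num) (by norm_num) (by norm_num) (by norm_num)
  obtain ⟨hGF, eGF⟩ := poisson_symb_eq hG hF (K := 1) (L := 3) (m := -1) (m' := 3)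
    (by norm_num) (by norm_num) (by norm_num) (by norm_num)
  have hmem := Submodule.add_mem _ (Submodule.smul_mem _ (1 / 2 : ℝ) hDD) hGF
  have key := sum_symb_eq_zero (Submodule.smul_mem _ (2 : ℝ) hmem) hGG
    (Submodule.smul_mem _ (2 : ℝ) hDG) (Submodule.smul_mem _ (2 : ℝ) hDF)
  rw [smul_mem_iff_two, smul_mem_iff_two, smul_mem_iff_two] at key
  rw [MCOps, ← key, poisson_theta_symb, eDD, eGG, eDG, eDF, eGF, ← symb_smul, ← symb_add,
    ← symb_smul, ← symb_smul, ← symb_smul]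

theorem poisson_components_iff :
    ((1 / 2 : ℝ) • poisson R P (symb 1 2 D hD) (symb 1 2 D hD) +
        poisson R P (symb 2 1 G hG) (symb 0 3 F hF) = 0 ∧
      poisson R P (symb 2 1 G hG) (symb 2 1 G hG) = 0 ∧
      poisson R P (symb 1 2 D hD) (symb 2 1 G hG) = 0 ∧
      poisson R P (symb 1 2 D hD) (symb 0 3 F hF) = 0) ↔ MCOps G D F := by
  obtain ⟨hDD, eDD⟩ := poisson_symb_eq hD hD (K := 1) (L := 3) (m := 1) (m' := 1)
    (by norm_num) (by norm_num) (by norm_num) (by norm_num)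
  obtain ⟨hGG, eGG⟩ := poisson_symb_eq hG hG (K := 3) (L := 1) (m := -1) (m' := -1)
    (by norm_num) (by norm_num) (by norm_num) (by norm_num)
  obtain ⟨hDG, eDG⟩ := poisson_symb_eq hD hG (K := 2) (L := 2) (m := 1) (m' := -1)
    (by norm_num) (by norm_num) (by norm_num) (by norm_num)
  obtain ⟨hDF, eDF⟩ := poisson_symb_eq hD hF (K := 0) (L := 4) (m := 1) (m' := 3)
    (by norm_num) (by norm_num) (by norm_num) (by norm_num)
  obtain ⟨hGF, eGF⟩ := poisson_symb_eq hG hF (K := 1) (L := 3) (m := -1) (m' := 3)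
    (by norm_num) (by norm_num) (by norm_num) (by norm_num)
  have e : (1 / 2 : ℝ) • poisson R P (symb 1 2 D hD) (symb 1 2 D hD) +
      poisson R P (symb 2 1 G hG) (symb 0 3 F hF) =
      symb 1 3 _ (Submodule.add_mem _ (Submodule.smul_mem _ (1 / 2 : ℝ) hDD) hGF) := by
    rw [eDD, eGF, symb_add (Submodule.smul_mem _ (1 / 2 : ℝ) hDD), symb_smul]
  exact and_congr (by rw [e, symb_eq_zero]) (and_congr (by rw [eGG, symb_eq_zero])
    (and_congr (by rw [eDG, symb_eq_zero]) (by rw [eDF, symb_eq_zero])))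

end

theorem poisson_theta_iff (μ : Fun R P 1 2) (γ : Fun R P 2 1) (φ : Fun R P 0 3) :
    poisson R P (theta μ γ φ) (theta μ γ φ) = 0 ↔
      (1 / 2 : ℝ) • poisson R P (Fun.toHam R P 1 2 μ) (Fun.toHam R P 1 2 μ) +
        poisson R P (Fun.toHam R P 2 1 γ) (Fun.toHam R P 0 3 φ) = 0 ∧
      poisson R P (Fun.toHam R P 2 1 γ) (Fun.toHam R P 2 1 γ) = 0 ∧
      poisson R P (Fun.toHam R P 1 2 μ) (Fun.toHam R P 2 1 γ) = 0 ∧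
      poisson R P (Fun.toHam R P 1 2 μ) (Fun.toHam R P 0 3 φ) = 0 := by
  obtain ⟨D, hD, rfl⟩ := μ.exists_rep
  obtain ⟨G, hG, rfl⟩ := γ.exists_rep
  obtain ⟨F, hF, rfl⟩ := φ.exists_rep
  exact (poisson_theta_eq_zero_iff hG hD hF).trans (poisson_components_iff hG hD hF).symm

/-- The four equations are the cases n = 3, 1, 2, 4, and for n ≥ 5 the order would be negative. The
signs of `sgnSeq` only produce an overall sign for each n, since the terms in a given n agree in the
parity of the number of factors Φ_2. -/
theorem mcOps_iff {G D F : Module.End ℝ (Form R P)} (hG : G ∈ ops R P 2 1)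
    (hD : D ∈ ops R P 1 2) (hF : F ∈ ops R P 0 3) :
    MCOps G D F ↔ ∀ n : ℕ, mcOp sgnSeq (opSeq G D F) n ∈ lowerOps R P (4 - n) n := by
  have h1 : mcOp sgnSeq (opSeq G D F) 1 = scomm (-1) (-1) G G := by
    simp [mcOp, sgnSeq, opSeq]
  have h2 : mcOp sgnSeq (opSeq G D F) 2 = -((2 : ℝ) • scomm 1 (-1) D G) := by
    have := scomm_odd (-1) 1 (by decide) G D
    simp [mcOp, sgnSeq, opSeq, Fin.sum_univ_two, this, two_smul, Units.neg_smul]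
  have h3 : mcOp sgnSeq (opSeq G D F) 3 =
      (2 : ℝ) • ((1 / 2 : ℝ) • scomm 1 1 D D + scomm (-1) 3 G F) := by
    have := scomm_odd 3 (-1) (by decide) F G
    simp [mcOp, sgnSeq, opSeq, Fin.sum_univ_three, this, two_smul]
    abel
  have h4 : mcOp sgnSeq (opSeq G D F) 4 = -((2 : ℝ) • scomm 1 3 D F) := by
    have := scomm_odd 3 1 (by decide) F D
    simp [mcOp, sgnSeq, opSeq, Fin.sum_univ_four, this, two_smul, Units.neg_smul, scomm_zero_left,
      scomm_zero_right]
  have h5 : ∀ n : ℕ, 5 ≤ n → mcOp sgnSeq (opSeq G D F) n = 0 := by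
    intro n hn
    have hm := mcOp_mem (ε := sgnSeq) (opSeq_mem hG hD hF) n
    rw [ops, show (4 - (n : ℤ) + 1).toNat = 0 by omega] at hm
    exact (Submodule.mem_bot ℝ).1 hm
  constructor
  · rintro ⟨a3, a1, a2, a4⟩ n
    match n with
    | 0 => simp [mcOp]
    | 1 => rw [h1]; exact a1
    | 2 => rw [h2]; exact Submodule.neg_mem _ (Submodule.smul_mem _ _ a2)
    | 3 => rw [h3]; exact Submodule.smul_mem _ _ a3
    | 4 => rw [h4]; exact Submodule.neg_mem _ (Submodule.smul_mem _ _ a4)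
    | n + 5 => rw [h5 _ (by omega)]; exact Submodule.zero_mem _
  · intro h
    refine ⟨?_, ?_, ?_, ?_⟩
    · have := h 3
      rw [h3] at this
      exact (smul_mem_iff_two _).1 this
    · have := h 1
      rw [h1] at this
      exact this
    · have := h 2
      rw [h2, Submodule.neg_mem_iff] at this
      exact (smul_mem_iff_two _).1 this
    · have := h 4
      rw [h4, Submodule.neg_mem_iff] at this
      exact (smul_mem_iff_two _).1 this

end Symbols

/-! ### Derived brackets as multiderivations -/

section DerivedBrackets

variable {R : Type*} [CommRing R] [Algebra ℝ R] {P : Type*} [AddCommGroup P] [Module ℝ P]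
  [Module R P] [IsScalarTower ℝ R P]

variable (R P) in
/-- The grading involution of the algebra of multisections. -/
def gradingInv : Multi R P →ₗ[ℝ] Multi R P :=
  (CliffordAlgebra.involute (Q := (0 : QuadraticForm R P))).toLinearMap.restrictScalars ℝ

theorem gradingInv_apply {k : ℤ} {x : Multi R P} (hx : x ∈ extDeg R P k) :
    gradingInv R P x = k.negOnePow • x := by
  rcases extDeg_cases hx with rfl | ⟨n, rfl, hx⟩
  · rw [map_zero, smul_zero]
  change CliffordAlgebra.involute (Q := (0 : QuadraticForm R P)) x = _
  clear * - hx
  induction hx using Submodule.pow_induction_on_left' with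
  | algebraMap r =>
    rw [Nat.cast_zero, Int.negOnePow_zero, one_smul]
    exact AlgHom.commutes _ r
  | add x y i _ _ hx hy => rw [map_add, hx, hy, smul_add]
  | mem_mul m hm i x _ hx =>
    obtain ⟨X, rfl⟩ := hm
    have h : CliffordAlgebra.involute (ExteriorAlgebra.ι R X) = -ExteriorAlgebra.ι R X :=
      CliffordAlgebra.involute_ι X
    rw [map_mul, hx, h]
    push_cast
    rw [Int.negOnePow_succ, Units.neg_smul, mul_smul_comm, neg_mul, smul_neg]

theorem poisson_symb_hbar {k l j K L m : ℤ} {E : Module.End ℝ (Form R P)} (h : E ∈ ops R P k l)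
    {x : Multi R P} (hx : x ∈ extDeg R P j) (hK : k + j - 1 = K) (hL : l - 1 = L)
    (hm : l - k = m) : ∃ hmem : scomm m (-j) E (contractOp R P x) ∈ ops R P K L,
      poisson R P (symb k l E h) (hbar R P x) = symb K L (scomm m (-j) E (contractOp R P x)) hmem := by
  rw [hbar_apply hx]
  exact poisson_symb_eq h _ hK (by rw [add_zero, hL]) hm (zero_sub j)

theorem poisson_hbar_symb {k l j K L m : ℤ} {E : Module.End ℝ (Form R P)} (h : E ∈ ops R P k l)
    {x : Multi R P} (hx : x ∈ extDeg R P j) (hK : j + k - 1 = K) (hL : l - 1 = L)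
    (hm : l - k = m) : ∃ hmem : scomm (-j) m (contractOp R P x) E ∈ ops R P K L,
      poisson R P (hbar R P x) (symb k l E h) = symb K L (scomm (-j) m (contractOp R P x) E) hmem := by
  rw [hbar_apply hx]
  exact poisson_symb_eq _ h hK (by rw [zero_add, hL]) (zero_sub j) hm

section

variable (hinv : Ham R P →ₗ[ℝ] Multi R P) (γ μ φ : Ham R P)

/-- The operation `{γ, x}`. -/
def unaryOp : MultilinearMap ℝ (fun _ : Fin 1 => Multi R P) (Multi R P) where
  toFun x := hinv (poisson R P γ (hbar R P (x 0)))
  map_update_add' {inst} x i a b := by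
    cases Subsingleton.elim inst (instDecidableEqFin 1)
    fin_cases i
    simp
  map_update_smul' {inst} x i a b := by
    cases Subsingleton.elim inst (instDecidableEqFin 1)
    fin_cases i
    simp

/-- The operation `{{x, μ}, y}`. -/
def binaryOp : MultilinearMap ℝ (fun _ : Fin 2 => Multi R P) (Multi R P) where
  toFun x := hinv (poisson R P (poisson R P (hbar R P (x 0)) μ) (hbar R P (x 1)))
  map_update_add' {inst} x i a b := by
    cases Subsingleton.elim inst (instDecidableEqFin 2)
    fin_cases i <;> simp
  map_update_smul' {inst} x i a b := by
    cases Subsingleton.elim inst (instDecidableEqFin 2)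
    fin_cases i <;> simp

/-- The operation `±{{{φ, x}, y}, z}`. -/
def ternaryOp : MultilinearMap ℝ (fun _ : Fin 3 => Multi R P) (Multi R P) where
  toFun x := hinv (poisson R P (poisson R P (poisson R P φ (hbar R P (x 0)))
    (hbar R P (gradingInv R P (x 1)))) (hbar R P (x 2)))
  map_update_add' {inst} x i a b := by
    cases Subsingleton.elim inst (instDecidableEqFin 3)
    fin_cases i <;> simp
  map_update_smul' {inst} x i a b := by
    cases Subsingleton.elim inst (instDecidableEqFin 3)
    fin_cases i <;> simp

/-- The derived brackets. -/
def derivedOps : ∀ k : ℕ, MultilinearMap ℝ (fun _ : Fin k => Multi R P) (Multi R P)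
  | 1 => unaryOp hinv γ
  | 2 => binaryOp hinv μ
  | 3 => ternaryOp hinv φ
  | _ => 0

end

/-- Graded operations of degree `2 - k` on the shifted algebra of multisections. -/
def HasDegree (l : ∀ k : ℕ, MultilinearMap ℝ (fun _ : Fin k => Multi R P) (Multi R P)) : Prop :=
  ∀ L, Homog L → opList l L ∈ extDeg R P (totalDeg L - (2 * L.length - 3))

/-- `hinv` is only a left inverse of `hbar`. A saturated bracket has l = 0 and is therefore a
contraction, so it lies in the range of `hbar`, and nothing is lost by applying `hinv`. -/
theorem derivedOps_spec {κ : Type*} [Fintype κ] (B : Frame R P κ)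
    {hinv : Ham R P →ₗ[ℝ] Multi R P} (hh : ∀ x, hinv (hbar R P x) = x)
    {G D F : Module.End ℝ (Form R P)} (hG : G ∈ ops R P 2 1)
    (hD : D ∈ ops R P 1 2) (hF : F ∈ ops R P 0 3) (L : List (ℤ × Multi R P)) (hL : Homog L) :
    opList (derivedOps hinv (symb 2 1 G hG) (symb 1 2 D hD) (symb 0 3 F hF)) L ∈
        extDeg R P (totalDeg L - (2 * L.length - 3)) ∧
      contractOp R P (opList (derivedOps hinv (symb 2 1 G hG) (symb 1 2 D hD) (symb 0 3 F hF)) L) =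
        sgnSeq L.length • (decExp L).negOnePow •
          iter (2 * L.length - 3) (opSeq G D F L.length) L := by
  have key : ∀ {K : ℤ} {E : Module.End ℝ (Form R P)} (h : E ∈ ops R P K 0),
      hinv (symb K 0 E h) ∈ extDeg R P K ∧ contractOp R P (hinv (symb K 0 E h)) = E := by
    intro K E h
    obtain ⟨y, hy, rfl⟩ := B.exists_contractOp_eq_int h
    rw [← hbar_apply hy, hh]
    exact ⟨hy, rfl⟩
  match L, hL with
  | [], _ =>
    have : opList (derivedOps hinv (symb 2 1 G hG) (symb 1 2 D hD) (symb 0 3 F hF)) [] = 0 := rfl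
    have h2 : opSeq G D F ([] : List (ℤ × Multi R P)).length = 0 := rfl
    rw [this, map_zero, h2, iter_zero, smul_zero, smul_zero]
    exact ⟨Submodule.zero_mem _, rfl⟩
  | [a], hL =>
    have ha := hL a (by simp)
    obtain ⟨hm, e⟩ := poisson_symb_hbar hG ha (K := totalDeg [a] - (2 * (1 : ℕ) - 3)) (L := 0)
      (m := 2 * (1 : ℕ) - 3) (by simp [totalDeg]; ring_nf) (by norm_num) (by norm_num)
    have h1 : opList (derivedOps hinv (symb 2 1 G hG) (symb 1 2 D hD) (symb 0 3 F hF)) [a] =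
        hinv (poisson R P (symb 2 1 G hG) (hbar R P a.2)) := rfl
    rw [h1, e]
    refine ⟨(key hm).1, (key hm).2.trans ?_⟩
    simp [decExp, sgnSeq, iter, opSeq]
  | [a, b], hL =>
    have ha := hL a (by simp)
    have hb := hL b (by simp)
    obtain ⟨hm, e⟩ := poisson_hbar_symb hD ha (K := a.1) (L := 1)
      (m := 1) (by ring) (by norm_num) (by norm_num)
    obtain ⟨hm', e'⟩ := poisson_symb_hbar hm hb (K := totalDeg [a, b] - (2 * (2 : ℕ) - 3)) (L := 0)
      (m := 2 * (2 : ℕ) - 3 - a.1) (by simp [totalDeg]) (by norm_num) (by push_cast; ring)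
    have h1 : opList (derivedOps hinv (symb 2 1 G hG) (symb 1 2 D hD) (symb 0 3 F hF)) [a, b] =
        hinv (poisson R P (poisson R P (hbar R P a.2) (symb 1 2 D hD)) (hbar R P b.2)) := rfl
    rw [h1, e, e']
    refine ⟨(key hm').1, (key hm').2.trans ?_⟩
    -- Turning {x,μ} into {μ,x} costs -(-1)^{|x|}: the minus sign is the value of `sgnSeq` at 2, and
    -- (-1)^{|x|} is the décalage sign of a pair.
    rw [scomm_swap (-a.1), ← Units.neg_smul, scomm_units_smul_left]
    simp [decExp, sgnSeq, iter, opSeq]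
  | [a, b, c], hL =>
    have ha := hL a (by simp)
    have hb := hL b (by simp)
    have hc := hL c (by simp)
    have hb' : b.1.negOnePow • b.2 ∈ extDeg R P b.1 := negOnePow_smul_mem _ _ hb
    obtain ⟨hm, e⟩ := poisson_symb_hbar hF ha (K := a.1 - 1) (L := 2)
      (m := 3) (by ring) (by norm_num) (by norm_num)
    obtain ⟨hm', e'⟩ := poisson_symb_hbar hm hb' (K := a.1 - 1 + b.1 - 1) (L := 1)
      (m := 3 - a.1) (by ring) (by norm_num) (by ring)
    obtain ⟨hm'', e''⟩ := poisson_symb_hbar hm' hc (K := totalDeg [a, b, c] - (2 * (3 : ℕ) - 3))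
      (L := 0) (m := 2 * (3 : ℕ) - 3 - a.1 - b.1) (by simp [totalDeg]; ring_nf) (by norm_num)
      (by push_cast; ring)
    have h1 : opList (derivedOps hinv (symb 2 1 G hG) (symb 1 2 D hD) (symb 0 3 F hF)) [a, b, c] =
        hinv (poisson R P (poisson R P (poisson R P (symb 0 3 F hF) (hbar R P a.2))
          (hbar R P (gradingInv R P b.2))) (hbar R P c.2)) := rfl
    rw [h1, gradingInv_apply hb, e, e', e'']
    refine ⟨(key hm'').1, (key hm'').2.trans ?_⟩
    -- The décalage exponent of a triple is 2|a| + |b|. Its sign is supplied by the grading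
    -- involution on the second argument.
    have hd : (decExp [a, b, c]).negOnePow = b.1.negOnePow :=
      negOnePow_congr ⟨a.1, by simp [decExp]; ring⟩
    have hs : contractOp R P (b.1.negOnePow • b.2) = b.1.negOnePow • contractOp R P b.2 := by
      rcases Int.units_eq_one_or b.1.negOnePow with u | u <;> simp [u]
    rw [hd, hs, scomm_units_smul_right, scomm_units_smul_left]
    simp [sgnSeq, iter, opSeq]
  | a :: b :: c :: d :: L, _ =>
    have : opList (derivedOps hinv (symb 2 1 G hG) (symb 1 2 D hD) (symb 0 3 F hF))
      (a :: b :: c :: d :: L) = 0 := rfl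
    have h2 : opSeq G D F (a :: b :: c :: d :: L).length = 0 := rfl
    rw [this, map_zero, h2, iter_zero, smul_zero, smul_zero]
    exact ⟨Submodule.zero_mem _, rfl⟩

theorem totalDeg_append (L L' : List (ℤ × Multi R P)) :
    totalDeg (L ++ L') = totalDeg L + totalDeg L' := by simp [totalDeg]

theorem decExp_append_singleton (L : List (ℤ × Multi R P)) (b : ℤ × Multi R P) :
    decExp (L ++ [b]) = decExp L + totalDeg L := by
  induction L with
  | nil => simp [decExp, totalDeg]
  | cons a L ih =>
    rw [List.cons_append, decExp, decExp, ih, totalDeg_cons, List.length_append]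
    push_cast [List.length_singleton]
    ring

theorem Homog.append {L L' : List (ℤ × Multi R P)} (h : Homog L) (h' : Homog L') :
    Homog (L ++ L') := fun a ha => (List.mem_append.1 ha).elim (h a) (h' a)

theorem Homog.singleton {a : ℤ × Multi R P} (ha : a.2 ∈ extDeg R P a.1) : Homog [a] :=
  Homog.cons ha Homog.nil

section

variable {κ : Type*} [Fintype κ] (B : Frame R P κ)
  {l : ∀ k : ℕ, MultilinearMap ℝ (fun _ : Fin k => Multi R P) (Multi R P)}
  {ε : ℕ → ℤˣ} {Φ : ℕ → Module.End ℝ (Form R P)}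

theorem contractOp_units_smul (u : ℤˣ) (x : Multi R P) :
    contractOp R P (u • x) = u • contractOp R P x := by
  rcases Int.units_eq_one_or u with rfl | rfl <;> simp

theorem IsDerived.opList_append (hl : IsDerived l ε Φ) {L : List (ℤ × Multi R P)} (hL : Homog L)
    {b : ℤ × Multi R P} (hb : b.2 ∈ extDeg R P b.1) :
    contractOp R P (opList l (L ++ [b])) =
      (ε (L.length + 1) * (decExp L + totalDeg L).negOnePow) •
        scomm (2 * L.length - 1 - totalDeg L) (-b.1)
          (iter (2 * L.length - 1) (Φ (L.length + 1)) L) (contractOp R P b.2) := by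
  rw [hl _ (hL.append (Homog.singleton hb)), iter_append, decExp_append_singleton, smul_smul,
    List.length_append, List.length_singleton]
  rw [show (2 * ((L.length + 1 : ℕ) : ℤ) - 3) = 2 * L.length - 1 by push_cast; ring]
  rfl

-- The last argument enters through one commutator with its contraction. A commutator is a graded
-- derivation of the product of operators, contraction is multiplicative, and faithfulness brings
-- the rule back to multisections.
include B in
theorem IsDerived.derivation (hl : IsDerived l ε Φ) (hdeg : HasDegree l) {k : ℕ}
    (x : Fin k → Multi R P) (d : Fin k → ℤ) (hx : ∀ i, x i ∈ shiftedDeg R P (d i)) (e : ℤ)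
    (y z : Multi R P) (hy : y ∈ extDeg R P e) :
    l (k + 1) (Fin.snoc x (y * z)) = l (k + 1) (Fin.snoc x y) * z +
      ((∑ i, d i + (2 - ((k : ℤ) + 1))) * e).negOnePow • (y * l (k + 1) (Fin.snoc x z)) := by
  have hlin : ∀ w w', l (k + 1) (Fin.snoc x (w + w')) =
      l (k + 1) (Fin.snoc x w) + l (k + 1) (Fin.snoc x w') := fun w w' => by
    have := (l (k + 1)).map_update_add (Fin.snoc x 0) (Fin.last k) w w'
    simpa only [Fin.update_snoc_last] using this
  induction z using ext_induction with
  | h0 =>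
    have h0 : l (k + 1) (Fin.snoc x 0) = 0 :=
      (l (k + 1)).map_coord_zero (Fin.last k) (Fin.snoc_last _ _)
    rw [mul_zero, mul_zero, h0, mul_zero, smul_zero, zero_add]
  | hadd z z' hz hz' =>
    rw [mul_add, hlin, hz, hz', mul_add, hlin, mul_add, smul_add]
    abel
  | hom j z hz =>
    set L : List (ℤ × Multi R P) := List.ofFn fun i => (d i + 1, x i) with hLdef
    have hL : Homog L := by
      intro a ha
      obtain ⟨i, rfl⟩ := List.mem_ofFn.1 ha
      exact hx i
    have hlen : L.length = k := List.length_ofFn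
    have hdL : totalDeg L = ∑ i, d i + k := by
      rw [totalDeg, hLdef, List.map_ofFn, List.sum_ofFn]
      simp [Finset.sum_add_distrib]
    have hop : ∀ (i : ℤ) (w : Multi R P), l (k + 1) (Fin.snoc x w) = opList l (L ++ [(i, w)]) := by
      intro i w
      refine apply_eq_opList _ _ (by simp [hLdef]) fun p => ?_
      refine Fin.lastCases ?_ (fun q => ?_) p
      · simp [hLdef]
      · simp [hLdef]
    have hyz := extDeg_mul hy hz
    have h1 := hl.opList_append hL (b := (e + j, y * z)) hyz
    have h2 := hl.opList_append hL (b := (e, y)) hy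
    have h3 := hl.opList_append hL (b := (j, z)) hz
    have hd : ∀ {i : ℤ} {w : Multi R P}, w ∈ extDeg R P i → opList l (L ++ [(i, w)]) ∈
        extDeg R P (totalDeg L + i - (2 * k - 1)) := by
      intro i w hw
      have := hdeg _ (hL.append (Homog.singleton (a := (i, w)) hw))
      rw [totalDeg_append, List.length_append, List.length_singleton, hlen] at this
      have e : totalDeg L + i - (2 * k - 1) =
          totalDeg L + totalDeg [(i, w)] - (2 * ((k + 1 : ℕ) : ℤ) - 3) := by
        simp only [totalDeg_cons, totalDeg_nil]
        push_cast
        ring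
      rwa [e]
    rw [hop (e + j), hop e, hop j]
    refine B.contractOp_inj (hd hyz) (Submodule.add_mem _ ?_ (negOnePow_smul_mem _ _ ?_)) ?_
    · have := extDeg_mul (hd hy) hz
      rwa [show totalDeg L + e - (2 * k - 1) + j = totalDeg L + (e + j) - (2 * k - 1) by ring]
        at this
    · have := extDeg_mul hy (hd hz)
      rwa [show e + (totalDeg L + j - (2 * k - 1)) = totalDeg L + (e + j) - (2 * k - 1) by ring]
        at this
    · rw [map_add, contractOp_units_smul, contractOp_mul, contractOp_mul, h1, h2, h3]
      dsimp only
      rw [contractOp_mul, neg_add, scomm_mul_right, smul_add, smul_mul_assoc, smul_smul,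
        mul_smul_comm, smul_smul]
      congr 2
      rw [mul_comm]
      congr 1
      refine negOnePow_congr ⟨0, ?_⟩
      rw [hlen, hdL]
      ring

-- `iter` has the Koszul sign (-1)^{ab} under a transposition, while `decExp` changes by b - a.
-- Together they give -(-1)^{(a-1)(b-1)}, the skew sign in the shifted degrees.
include B in
theorem IsDerived.swap (hl : IsDerived l ε Φ) (hdeg : HasDegree l) {L : List (ℤ × Multi R P)}
    (hL : Homog L) {a b : ℤ × Multi R P} (ha : a.2 ∈ extDeg R P a.1) (hb : b.2 ∈ extDeg R P b.1)
    {L' : List (ℤ × Multi R P)} (hL' : Homog L') :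
    opList l (L ++ b :: a :: L') =
      -((a.1 - 1) * (b.1 - 1)).negOnePow • opList l (L ++ a :: b :: L') := by
  have h1 := hL.append (Homog.cons hb (Homog.cons ha hL'))
  have h2 := hL.append (Homog.cons ha (Homog.cons hb hL'))
  have e1 : (L ++ b :: a :: L').length = (L ++ a :: b :: L').length := by simp
  have hd1 := hdeg _ h1
  rw [e1, show totalDeg (L ++ b :: a :: L') = totalDeg (L ++ a :: b :: L') by
    simp only [totalDeg_append, totalDeg_cons]; ring] at hd1
  rw [Units.neg_smul]
  refine B.contractOp_inj hd1 (Submodule.neg_mem _ (negOnePow_smul_mem _ _ (hdeg _ h2))) ?_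
  rw [map_neg, contractOp_units_smul, hl _ h1, hl _ h2, e1, iter_append, iter_append,
    iter_swap _ _ hb ha, ← Units.neg_smul]
  simp only [smul_smul]
  congr 1
  have hdec : decExp (L ++ b :: a :: L') = decExp (L ++ a :: b :: L') + b.1 - a.1 := by
    clear * -
    induction L with
    | nil =>
      simp only [List.nil_append, decExp, List.length_cons]
      push_cast
      ring
    | cons c L ih =>
      rw [List.cons_append, decExp, ih, List.cons_append, decExp]
      simp only [List.length_append, List.length_cons]
      ring
  rw [hdec, ← Int.negOnePow_succ]
  rw [mul_left_comm (Int.negOnePow _) (ε _)]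
  congr 1
  rw [← Int.negOnePow_add, ← Int.negOnePow_add]
  refine negOnePow_congr ⟨b.1 - 1, ?_⟩
  ring

end

end DerivedBrackets

/-! ### Skew-symmetry and the Jacobi identities of derived brackets -/

section DerivedStructure

variable {R : Type*} [CommRing R] [Algebra ℝ R] {P : Type*} [AddCommGroup P] [Module ℝ P]
  [Module R P] [IsScalarTower ℝ R P] {κ : Type*} [Fintype κ] (B : Frame R P κ)
  {l : ∀ k : ℕ, MultilinearMap ℝ (fun _ : Fin k => Multi R P) (Multi R P)}

theorem homog_ofFn {n : ℕ} {x : Fin n → Multi R P} {d : Fin n → ℤ}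
    (hx : ∀ i, x i ∈ shiftedDeg R P (d i)) : Homog (List.ofFn fun i => (d i + 1, x i)) := by
  intro a ha
  obtain ⟨i, rfl⟩ := List.mem_ofFn.1 ha
  exact hx i

theorem apply_eq_opList_ofFn {n : ℕ} (x : Fin n → Multi R P) (d : Fin n → ℤ) :
    l n x = opList l (List.ofFn fun i => (d i + 1, x i)) :=
  apply_eq_opList _ _ List.length_ofFn fun p => by simp

theorem HasDegree.apply (hdeg : HasDegree l) {n : ℕ} {x : Fin n → Multi R P} {d : Fin n → ℤ}
    (hx : ∀ i, x i ∈ shiftedDeg R P (d i)) : l n x ∈ shiftedDeg R P (∑ i, d i + (2 - n)) := by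
  have := hdeg _ (homog_ofFn hx)
  rw [← apply_eq_opList_ofFn, List.length_ofFn] at this
  have e : totalDeg (List.ofFn fun i => (d i + 1, x i)) = ∑ i, d i + n := by
    rw [totalDeg, List.map_ofFn, List.sum_ofFn]
    simp [Finset.sum_add_distrib]
  rw [e] at this
  rw [shiftedDeg]
  convert this using 2
  ring

theorem sum_fin_split {n k : ℕ} (hk : k ≤ n) (f : Fin n → ℤ) :
    ∑ i, f i = ∑ a : Fin k, f ⟨a, by omega⟩ + ∑ b : Fin (n - k), f ⟨k + b, by omega⟩ := by
  obtain ⟨m, rfl⟩ := Nat.exists_eq_add_of_le hk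
  rw [Fin.sum_univ_add]
  congr 1
  exact Fintype.sum_equiv (finCongr (by omega)) _ _ fun b => congrArg f (Fin.ext (by simp))

theorem HasDegree.nested_mem (hdeg : HasDegree l) {n : ℕ} (p : Fin n) {x : Fin n → Multi R P}
    {d : Fin n → ℤ} (hx : ∀ i, x i ∈ shiftedDeg R P (d i)) :
    nested l p x d ∈ shiftedDeg R P (∑ i, d i + (3 - n)) := by
  refine Submodule.sum_mem _ fun σ _ => ?_
  split_ifs with h
  · have hin := hdeg.apply (n := p + 1) (x := fun a => x (σ ⟨a, by omega⟩))
      (d := fun a => d (σ ⟨a, by omega⟩)) fun a => hx _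
    have hout := hdeg.apply (n := n - (p + 1) + 1)
      (x := Fin.cons (l (p + 1) fun a => x (σ ⟨a, by omega⟩))
        (fun b : Fin (n - (p + 1)) => x (σ ⟨p + 1 + b, by omega⟩)))
      (d := Fin.cons (∑ a : Fin (p + 1), d (σ ⟨a, by omega⟩) + (2 - (p + 1 : ℕ)))
        (fun b : Fin (n - (p + 1)) => d (σ ⟨p + 1 + b, by omega⟩)))
      (fun i => Fin.cases hin (fun b => hx _) i)
    have e := sum_fin_split (k := p + 1) p.2 fun i => d (σ i)
    rw [Equiv.sum_comp σ d] at e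
    rw [Fin.sum_univ_succ] at hout
    simp only [Fin.cons_zero, Fin.cons_succ] at hout
    rw [e]
    convert Submodule.smul_of_tower_mem _ (chi d σ) hout using 2
    push_cast [Nat.cast_sub (show (p : ℕ) + 1 ≤ n from p.2)]
    ring
  · exact Submodule.zero_mem _

variable {ε : ℕ → ℤˣ} {Φ : ℕ → Module.End ℝ (Form R P)}

-- Only arities up to three matter. Each of the six permutations of three arguments is written as a
-- product of adjacent transpositions, and the signs are compared with `chi`.
include B in
theorem IsDerived.skew (hl : IsDerived l ε Φ) (hdeg : HasDegree l) (h0 : ∀ k, 3 < k → l k = 0)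
    (k : ℕ) (x : Fin k → Multi R P) (d : Fin k → ℤ) (hx : ∀ i, x i ∈ shiftedDeg R P (d i))
    (σ : Equiv.Perm (Fin k)) : l k (fun i => x (σ i)) = chi d σ • l k x := by
  have hs : ∀ i, ((d i + 1, x i) : ℤ × Multi R P).2 ∈ extDeg R P (d i + 1, x i).1 := hx
  match k with
  | 0 =>
    have : (fun i => x (σ i)) = x := Subsingleton.elim _ _
    rw [this, chi]
    simp
  | 1 =>
    have : (fun i => x (σ i)) = x := funext fun i => congrArg x (Subsingleton.elim _ _)
    rw [this, chi]
    simp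
  | 2 =>
    have hσ : ∀ σ : Equiv.Perm (Fin 2), (σ 0 = 0 ∧ σ 1 = 1) ∨ (σ 0 = 1 ∧ σ 1 = 0) := by decide
    have hw := hl.swap B hdeg Homog.nil (hs 0) (hs 1) Homog.nil
    rw [apply_eq_opList_ofFn x d, apply_eq_opList_ofFn (fun i => x (σ i)) (fun i => d (σ i))]
    simp only [List.ofFn_succ, List.ofFn_zero, Fin.succ_zero_eq_one, List.nil_append,
      add_sub_cancel_right] at hw ⊢
    rcases hσ σ with ⟨e0, e1⟩ | ⟨e0, e1⟩
    · rw [e0, e1]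
      simp [chi, Fin.prod_univ_two, e0, e1]
    · rw [e0, e1, hw]
      simp [chi, Fin.prod_univ_two, e0, e1, mul_comm]
  | 3 =>
    have hσ : ∀ σ : Equiv.Perm (Fin 3), (σ 0 = 0 ∧ σ 1 = 1 ∧ σ 2 = 2) ∨
        (σ 0 = 1 ∧ σ 1 = 0 ∧ σ 2 = 2) ∨ (σ 0 = 0 ∧ σ 1 = 2 ∧ σ 2 = 1) ∨
        (σ 0 = 2 ∧ σ 1 = 0 ∧ σ 2 = 1) ∨ (σ 0 = 1 ∧ σ 1 = 2 ∧ σ 2 = 0) ∨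
        (σ 0 = 2 ∧ σ 1 = 1 ∧ σ 2 = 0) := by decide
    have h1 := fun i j m => hl.swap B hdeg Homog.nil (hs i) (hs j) (Homog.singleton (hs m))
    have h2 := fun i j m => hl.swap B hdeg (Homog.singleton (hs m)) (hs i) (hs j) Homog.nil
    rw [apply_eq_opList_ofFn x d, apply_eq_opList_ofFn (fun i => x (σ i)) (fun i => d (σ i))]
    have e2 : (Fin.succ 1 : Fin 3) = 2 := rfl
    simp only [List.ofFn_succ, List.ofFn_zero, Fin.succ_zero_eq_one, List.nil_append, e2,
      add_sub_cancel_right, List.singleton_append] at h1 h2 ⊢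
    have hc : chi d σ = (if σ 1 < σ 0 then -(d (σ 0) * d (σ 1)).negOnePow else 1) *
        (if σ 2 < σ 0 then -(d (σ 0) * d (σ 2)).negOnePow else 1) *
        (if σ 2 < σ 1 then -(d (σ 1) * d (σ 2)).negOnePow else 1) := by
      simp [chi, Fin.prod_univ_three, mul_assoc]
    rcases hσ σ with ⟨e0, e1, e2⟩ | ⟨e0, e1, e2⟩ | ⟨e0, e1, e2⟩ | ⟨e0, e1, e2⟩ | ⟨e0, e1, e2⟩ |
      ⟨e0, e1, e2⟩ <;> rw [hc, e0, e1, e2]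
    · simp
    · rw [h1 0 1 2, mul_comm (d 1)]
      simp
    · rw [h2 1 2 0, mul_comm (d 2)]
      simp
    · rw [h1 0 2 1, h2 1 2 0, smul_smul, mul_comm (d 2), mul_comm (d 2)]
      simp
    · rw [h2 0 2 1, h1 0 1 2, smul_smul, mul_comm (d 2), mul_comm (d 1)]
      simp [mul_comm]
    · rw [h1 1 2 0, h2 0 2 1, h1 0 1 2, smul_smul, smul_smul, mul_comm (d 2), mul_comm (d 2),
        mul_comm (d 1) (d 0)]
      simp
  | k + 4 =>
    rw [h0 _ (by omega)]
    simp

-- Members of `lowerOps R P (4 - n) n` are killed by n contractions. So the structure equation makes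
-- the contraction by twice the Jacobi expression vanish, and contraction is faithful in each
-- degree.
include B in
theorem IsDerived.jacobi (hl : IsDerived l ε Φ) (hdeg : HasDegree l)
    (hΦ : ∀ i : ℕ, Φ i ∈ ops R P (3 - i) i) (hmc : ∀ n : ℕ, mcOp ε Φ n ∈ lowerOps R P (4 - n) n)
    (n : ℕ) (x : Fin n → Multi R P) (d : Fin n → ℤ) (hx : ∀ i, x i ∈ shiftedDeg R P (d i)) :
    ∑ p : Fin n, ((p : ℤ) + 1).negOnePow • nested l p x d = 0 := by
  refine B.contractOp_eq_zero (k := ∑ i, d i + (3 - n) + 1)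
    (Submodule.sum_mem _ fun p _ => negOnePow_smul_mem _ _ (hdeg.nested_mem p hx)) ?_
  have h := contractOp_jacobi B hΦ hl hdeg x d hx
  rw [iter_eq_zero_of_mem_lowerOps (hmc n) (by ring) (homog_ofFn hx)
    (by rw [List.length_ofFn]), smul_zero] at h
  exact (smul_eq_zero.1 h).resolve_left two_ne_zero

/-- The differential quasi-Gerstenhaber algebra of the derived brackets of three operators. -/
def derivedAlgebra {G D F : Module.End ℝ (Form R P)} (hG : G ∈ ops R P 2 1) (hD : D ∈ ops R P 1 2)
    (hF : F ∈ ops R P 0 3) (hmc : MCOps G D F) (hl : IsDerived l sgnSeq (opSeq G D F))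
    (hdeg : HasDegree l) (hl0 : l 0 = 0) (h0 : ∀ k, 3 < k → l k = 0) :
    DiffQuasiGerstenhaber R P where
  l := l
  l_zero := hl0
  degree _ _ _ hx := hdeg.apply hx
  skew := hl.skew B hdeg h0
  jacobi := hl.jacobi B hdeg (opSeq_mem hG hD hF) ((mcOps_iff hG hD hF).1 hmc)
  derivation _ x d hx := hl.derivation B hdeg x d hx
  higher_zero := h0

end DerivedStructure

/-! ### From quasi-Lie bialgebroids to differential quasi-Gerstenhaber algebras -/

section Correspondence

variable {R : Type*} [CommRing R] [Algebra ℝ R] {P : Type*} [AddCommGroup P] [Module ℝ P]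
  [Module R P] [IsScalarTower ℝ R P] {κ : Type*} [Fintype κ]

/-- Any real-linear left inverse will do. It makes the derived operations multilinear maps on all
multisections at once, and its values off the range of `hbar` play no role. -/
theorem Frame.exists_hbar_leftInverse (B : Frame R P κ) :
    ∃ hinv : Ham R P →ₗ[ℝ] Multi R P, ∀ x, hinv (hbar R P x) = x := by
  obtain ⟨g, hg⟩ := (hbar R P).exists_leftInverse_of_injective
    (LinearMap.ker_eq_bot.2 (hbar_injective B))
  exact ⟨g, fun x => LinearMap.congr_fun hg x⟩

theorem Frame.hbar_leftInverse_symb (B : Frame R P κ) {hinv : Ham R P →ₗ[ℝ] Multi R P}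
    (hh : ∀ x, hinv (hbar R P x) = x) {K : ℤ} {E : Module.End ℝ (Form R P)}
    (h : E ∈ ops R P K 0) : hbar R P (hinv (symb K 0 E h)) = symb K 0 E h := by
  obtain ⟨y, hy, rfl⟩ := B.exists_contractOp_eq_int h
  rw [← hbar_apply hy, hh]

theorem hbar_unaryOp (B : Frame R P κ) {hinv : Ham R P →ₗ[ℝ] Multi R P}
    (hh : ∀ x, hinv (hbar R P x) = x) {G : Module.End ℝ (Form R P)} (hG : G ∈ ops R P 2 1)
    (x : Multi R P) : hbar R P (hinv (poisson R P (symb 2 1 G hG) (hbar R P x))) =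
      poisson R P (symb 2 1 G hG) (hbar R P x) := by
  induction x using ext_induction with
  | h0 => simp only [map_zero]
  | hadd x y hx hy => simp only [map_add, hx, hy]
  | hom j x hx =>
    obtain ⟨hm, e⟩ := poisson_symb_hbar hG hx rfl (sub_self 1) rfl
    rw [e, B.hbar_leftInverse_symb hh]

theorem hbar_binaryOp (B : Frame R P κ) {hinv : Ham R P →ₗ[ℝ] Multi R P}
    (hh : ∀ x, hinv (hbar R P x) = x) {D : Module.End ℝ (Form R P)} (hD : D ∈ ops R P 1 2)
    (x y : Multi R P) :
    hbar R P (hinv (poisson R P (poisson R P (hbar R P x) (symb 1 2 D hD)) (hbar R P y))) =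
      poisson R P (poisson R P (hbar R P x) (symb 1 2 D hD)) (hbar R P y) := by
  induction x using ext_induction with
  | h0 => simp only [map_zero, LinearMap.zero_apply]
  | hadd x x' hx hx' => simp only [map_add, LinearMap.add_apply, hx, hx']
  | hom i x hx =>
    obtain ⟨hm, e⟩ := poisson_hbar_symb hD hx rfl (show (2 : ℤ) - 1 = 1 by norm_num) rfl
    rw [e]
    induction y using ext_induction with
    | h0 => simp only [map_zero]
    | hadd y y' hy hy' => simp only [map_add, hy, hy']
    | hom j y hy =>
      obtain ⟨hm', e'⟩ := poisson_symb_hbar hm hy rfl (sub_self 1) rfl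
      rw [e', B.hbar_leftInverse_symb hh]

/-- Turning the three commutators around costs a total sign -1, and so does reversing the order of
three sections; the two signs cancel. -/
theorem poisson_hbar_hbar_hbar {F : Module.End ℝ (Form R P)} (hF : F ∈ ops R P 0 3) (X Y Z : P) :
    ∃ hm : iter 3 F [(1, ExteriorAlgebra.ι R X), (1, ExteriorAlgebra.ι R Y),
        (1, ExteriorAlgebra.ι R Z)] ∈ ops R P 0 0,
      poisson R P (hbar R P (ExteriorAlgebra.ι R X)) (poisson R P (hbar R P (ExteriorAlgebra.ι R Y))
          (poisson R P (hbar R P (ExteriorAlgebra.ι R Z)) (symb 0 3 F hF))) =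
        symb 0 0 (iter 3 F [(1, ExteriorAlgebra.ι R X), (1, ExteriorAlgebra.ι R Y),
          (1, ExteriorAlgebra.ι R Z)]) hm := by
  obtain ⟨h1, e1⟩ := poisson_hbar_symb hF (ι_mem_extDeg (R := R) Z) (K := 0) (L := 2) (m := 3)
    (by norm_num) (by norm_num) (by norm_num)
  obtain ⟨h2, e2⟩ := poisson_hbar_symb h1 (ι_mem_extDeg (R := R) Y) (K := 0) (L := 1) (m := 2)
    (by norm_num) (by norm_num) (by norm_num)
  obtain ⟨h3, e3⟩ := poisson_hbar_symb h2 (ι_mem_extDeg (R := R) X) (K := 0) (L := 0) (m := 1)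
    (by norm_num) (by norm_num) (by norm_num)
  have key : scomm (-1) 1 (contractOp R P (ExteriorAlgebra.ι R X))
      (scomm (-1) 2 (contractOp R P (ExteriorAlgebra.ι R Y))
        (scomm (-1) 3 (contractOp R P (ExteriorAlgebra.ι R Z)) F)) =
      iter 3 F [(1, ExteriorAlgebra.ι R X), (1, ExteriorAlgebra.ι R Y),
          (1, ExteriorAlgebra.ι R Z)] := by
    have hs : ∀ (m : ℤ) (Ψ : Module.End ℝ (Form R P)) (X Y : P) (L : List (ℤ × Multi R P)),
        iter m Ψ ((1, ExteriorAlgebra.ι R X) :: (1, ExteriorAlgebra.ι R Y) :: L) =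
          -iter m Ψ ((1, ExteriorAlgebra.ι R Y) :: (1, ExteriorAlgebra.ι R X) :: L) := by
      intro m Ψ X Y L
      rw [iter_swap m Ψ (ι_mem_extDeg X) (ι_mem_extDeg Y)]
      simp [Units.neg_smul]
    have hs' : ∀ (m : ℤ) (Ψ : Module.End ℝ (Form R P)) (X Y Z : P),
        iter m Ψ [(1, ExteriorAlgebra.ι R X), (1, ExteriorAlgebra.ι R Y),
            (1, ExteriorAlgebra.ι R Z)] =
          -iter m Ψ [(1, ExteriorAlgebra.ι R X), (1, ExteriorAlgebra.ι R Z),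
            (1, ExteriorAlgebra.ι R Y)] := fun m Ψ X Y Z => hs (m - 1) _ Y Z []
    rw [scomm_swap (-1) 3, scomm_neg_right, scomm_neg_right, scomm_units_smul_right,
      scomm_units_smul_right, scomm_swap (-1) 2, scomm_neg_right, scomm_units_smul_right,
      scomm_swap (-1) 1, hs, hs', hs]
    simp [iter, Units.neg_smul, Int.negOnePow_odd 3 (by decide), Int.negOnePow_even 2 (by decide)]
  rw [e1, e2, e3]
  exact ⟨key ▸ h3, symb_congr rfl rfl key⟩

theorem hbar_ternaryOp (B : Frame R P κ) {hinv : Ham R P →ₗ[ℝ] Multi R P}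
    (hh : ∀ x, hinv (hbar R P x) = x) {F : Module.End ℝ (Form R P)} (hF : F ∈ ops R P 0 3)
    (X Y Z : P) :
    hbar R P (ternaryOp hinv (symb 0 3 F hF)
        ![ExteriorAlgebra.ι R X, ExteriorAlgebra.ι R Y, ExteriorAlgebra.ι R Z]) =
      -poisson R P (hbar R P (ExteriorAlgebra.ι R X))
        (poisson R P (hbar R P (ExteriorAlgebra.ι R Y))
          (poisson R P (hbar R P (ExteriorAlgebra.ι R Z)) (symb 0 3 F hF))) := by
  obtain ⟨h1, e1⟩ := poisson_symb_hbar hF (ι_mem_extDeg (R := R) X) (K := 0) (L := 2) (m := 3)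
    (by norm_num) (by norm_num) (by norm_num)
  obtain ⟨h2, e2⟩ := poisson_symb_hbar h1 (ι_mem_extDeg (R := R) Y) (K := 0) (L := 1) (m := 2)
    (by norm_num) (by norm_num) (by norm_num)
  obtain ⟨h3, e3⟩ := poisson_symb_hbar h2 (ι_mem_extDeg (R := R) Z) (K := 0) (L := 0) (m := 1)
    (by norm_num) (by norm_num) (by norm_num)
  obtain ⟨h4, e4⟩ := poisson_hbar_hbar_hbar hF X Y Z
  have hs : gradingInv R P (ExteriorAlgebra.ι R Y) = -ExteriorAlgebra.ι R Y := by
    rw [gradingInv_apply (ι_mem_extDeg Y)]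
    simp [Units.neg_smul]
  have e5 : poisson R P (poisson R P (poisson R P (symb 0 3 F hF)
        (hbar R P (ExteriorAlgebra.ι R X))) (hbar R P (gradingInv R P (ExteriorAlgebra.ι R Y))))
        (hbar R P (ExteriorAlgebra.ι R Z)) = -symb 0 0 _ h3 := by
    rw [e1, hs, map_neg, map_neg, e2, map_neg, LinearMap.neg_apply, e3]
  have e6 : iter 3 F [(1, ExteriorAlgebra.ι R X), (1, ExteriorAlgebra.ι R Y),
        (1, ExteriorAlgebra.ι R Z)] = scomm 1 (-1) (scomm 2 (-1) (scomm 3 (-1) F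
          (contractOp R P (ExteriorAlgebra.ι R X))) (contractOp R P (ExteriorAlgebra.ι R Y)))
            (contractOp R P (ExteriorAlgebra.ι R Z)) := by
    simp only [iter]; norm_num
  rw [e4, symb_congr (h' := h3) rfl rfl e6, ← B.hbar_leftInverse_symb hh h3, ← map_neg, ← map_neg, ← e5]
  rfl

/-- Every quasi-Lie bialgebroid gives a differential quasi-Gerstenhaber algebra. -/
theorem Frame.exists_corresponds (B : Frame R P κ) (Q : QuasiLieBialgebroid R P) :
    ∃ S : DiffQuasiGerstenhaber R P, Corresponds Q S := by
  obtain ⟨D, hD, hμ⟩ := Q.μ.exists_rep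
  obtain ⟨G, hG, hγ⟩ := Q.γ.exists_rep
  obtain ⟨F, hF, hφ⟩ := Q.φ.exists_rep
  have hmc : MCOps G D F := by
    rw [← poisson_theta_eq_zero_iff hG hD hF, symb, symb, symb, hμ, hγ, hφ]
    exact Q.self_commuting
  obtain ⟨hinv, hh⟩ := B.exists_hbar_leftInverse
  refine ⟨derivedAlgebra B hG hD hF hmc
    (l := derivedOps hinv (symb 2 1 G hG) (symb 1 2 D hD) (symb 0 3 F hF))
    (fun L hL => (derivedOps_spec B hh hG hD hF L hL).2)
    (fun L hL => (derivedOps_spec B hh hG hD hF L hL).1) rfl ?_, ?_, ?_, ?_⟩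
  · intro k hk
    obtain ⟨j, rfl⟩ := Nat.exists_eq_add_of_le' hk
    rfl
  · intro x
    rw [← hγ]
    exact hbar_unaryOp B hh hG x
  · intro x y
    rw [← hμ]
    exact hbar_binaryOp B hh hD x y
  · intro X Y Z
    rw [← hφ]
    exact hbar_ternaryOp B hh hF X Y Z

/-- A graded skew-symmetric operation which is a derivation in its last argument. -/
structure IsSkewDerivation {k : ℕ}
    (f : MultilinearMap ℝ (fun _ : Fin (k + 1) => Multi R P) (Multi R P)) : Prop where
  skew : ∀ (x : Fin (k + 1) → Multi R P) (d : Fin (k + 1) → ℤ),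
    (∀ i, x i ∈ shiftedDeg R P (d i)) →
    ∀ σ : Equiv.Perm (Fin (k + 1)), f (fun i => x (σ i)) = chi d σ • f x
  derivation : ∀ (x : Fin k → Multi R P) (d : Fin k → ℤ),
    (∀ i, x i ∈ shiftedDeg R P (d i)) → ∀ (e : ℤ) (y z : Multi R P), y ∈ extDeg R P e →
    f (Fin.snoc x (y * z)) = f (Fin.snoc x y) * z +
      ((∑ i, d i + (2 - ((k : ℤ) + 1))) * e).negOnePow • (y * f (Fin.snoc x z))

theorem DiffQuasiGerstenhaber.isSkewDerivation (S : DiffQuasiGerstenhaber R P) (k : ℕ) :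
    IsSkewDerivation (S.l (k + 1)) :=
  ⟨S.skew (k + 1), S.derivation k⟩

/-- The restriction of an operation to its last argument. -/
def lastArg {k : ℕ} (f : MultilinearMap ℝ (fun _ : Fin (k + 1) => Multi R P) (Multi R P))
    (x : Fin k → Multi R P) : Module.End ℝ (Multi R P) where
  toFun y := f (Fin.snoc x y)
  map_add' y z := by
    have := f.map_update_add (Fin.snoc x 0) (Fin.last k) y z
    simpa only [Fin.update_snoc_last] using this
  map_smul' c y := by
    have := f.map_update_smul (Fin.snoc x 0) (Fin.last k) c y
    simpa only [Fin.update_snoc_last, RingHom.id_apply] using this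

/-- Skew-symmetry moves any argument to the last place, where the derivation property reduces it to
generators. `h1` treats homogeneous arguments, with s the set of places not yet known to hold
generators; `h2` then removes homogeneity by additivity, again one place at a time. -/
theorem IsSkewDerivation.ext {k : ℕ}
    {f g : MultilinearMap ℝ (fun _ : Fin (k + 1) => Multi R P) (Multi R P)}
    (hf : IsSkewDerivation f) (hg : IsSkewDerivation g)
    (h : ∀ a : Fin (k + 1) → ℤ × Multi R P, (∀ i, IsGen (a i)) →
      f (fun i => (a i).2) = g (fun i => (a i).2)) : f = g := by
  have h1 : ∀ (s : Finset (Fin (k + 1))) (x : Fin (k + 1) → Multi R P) (d : Fin (k + 1) → ℤ),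
      (∀ i, x i ∈ shiftedDeg R P (d i)) → (∀ i ∉ s, IsGen (d i + 1, x i)) → f x = g x := by
    intro s
    induction s using Finset.induction_on with
    | empty => exact fun x d hx hgen => h (fun i => (d i + 1, x i)) fun i => hgen i (by simp)
    | insert i s hi ih =>
      intro x d hx hgen
      have hswap : ∀ (y : Fin (k + 1) → Multi R P) (c : Fin (k + 1) → ℤ),
          (∀ i, y i ∈ shiftedDeg R P (c i)) →
          (f y = g y ↔ f (fun j => y (Equiv.swap i (Fin.last k) j)) =
            g (fun j => y (Equiv.swap i (Fin.last k) j))) := by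
        intro y c hy
        rw [hf.skew y c hy, hg.skew y c hy]
        exact (MulAction.injective (chi c (Equiv.swap i (Fin.last k)))).eq_iff.symm
      rw [hswap x d hx]
      set τ := Equiv.swap i (Fin.last k) with hτ
      have hsnoc : (fun j => x (τ j)) = Fin.snoc (fun j => x (τ (Fin.castSucc j))) (x i) := by
        funext j
        refine Fin.lastCases ?_ (fun q => ?_) j
        · rw [Fin.snoc_last, hτ, Equiv.swap_apply_right]
        · rw [Fin.snoc_castSucc]
      rw [hsnoc]
      have hgen' : ∀ (e : ℤ) (y : Multi R P), IsGen (e, y) →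
          lastArg f (fun j => x (τ (Fin.castSucc j))) y =
            lastArg g (fun j => x (τ (Fin.castSucc j))) y := by
        intro e y hy
        have hu : ∀ j, Function.update x i y j ∈ shiftedDeg R P (Function.update d i (e - 1) j) := by
          intro j
          rcases eq_or_ne j i with rfl | hj
          · rw [Function.update_self, Function.update_self, shiftedDeg, sub_add_cancel]
            exact hy.mem
          · rw [Function.update_of_ne hj, Function.update_of_ne hj]
            exact hx j
        have := ih _ _ hu fun j hj => by
          rcases eq_or_ne j i with rfl | hji
          · rw [Function.update_self, Function.update_self, sub_add_cancel]
            exact hy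
          · rw [Function.update_of_ne hji, Function.update_of_ne hji]
            exact hgen j (by simp [hji, hj])
        rw [hswap _ _ hu] at this
        have e2 : (fun j => Function.update x i y (τ j)) =
            Fin.snoc (fun j => x (τ (Fin.castSucc j))) y := by
          funext j
          refine Fin.lastCases ?_ (fun q => ?_) j
          · rw [Fin.snoc_last, hτ, Equiv.swap_apply_right, Function.update_self]
          · rw [Fin.snoc_castSucc, Function.update_of_ne]
            intro hq
            have h2 := (Equiv.swap_apply_eq_iff (x := i) (y := Fin.last k)).1 hq
            rw [Equiv.swap_apply_left] at h2
            exact (Fin.castSucc_lt_last q).ne h2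
        rw [e2] at this
        exact this
      exact LinearMap.congr_fun (derivation_ext _
        (fun e y hy z => hf.derivation _ _ (fun j => hx (τ (Fin.castSucc j))) e y z hy)
        (fun e y hy z => hg.derivation _ _ (fun j => hx (τ (Fin.castSucc j))) e y z hy)
        (fun r => hgen' 0 _ (Or.inl ⟨r, rfl⟩)) (fun X => hgen' 1 _ (Or.inr ⟨X, rfl⟩))) (x i)
  have h2 : ∀ (s : Finset (Fin (k + 1))) (x : Fin (k + 1) → Multi R P),
      (∀ i ∉ s, ∃ d, x i ∈ shiftedDeg R P d) → f x = g x := by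
    intro s
    induction s using Finset.induction_on with
    | empty =>
      intro x hx
      choose d hd using fun i => hx i (by simp)
      exact h1 Finset.univ x d hd (by simp)
    | insert i s hi ih =>
      intro x hx
      rw [← Function.update_eq_self i x]
      generalize x i = y
      induction y using ext_induction with
      | h0 => rw [f.map_update_zero, g.map_update_zero]
      | hadd y z hy hz => rw [f.map_update_add, g.map_update_add, hy, hz]
      | hom j y hy =>
        refine ih _ fun q hq => ?_
        rcases eq_or_ne q i with rfl | hqi
        · exact ⟨j - 1, by rw [Function.update_self, shiftedDeg, sub_add_cancel]; exact hy⟩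
        · rw [Function.update_of_ne hqi]
          exact hx q (by simp [hqi, hq])
  exact MultilinearMap.ext fun x => h2 Finset.univ x (by simp)

end Correspondence

/-! ### Operators that represent given operations, and their uniqueness -/

section Representation

variable {R : Type*} [CommRing R] [Algebra ℝ R] {P : Type*} [AddCommGroup P] [Module ℝ P]
  [Module R P] [IsScalarTower ℝ R P] {κ : Type*} [Fintype κ]

/-- Graded skew-symmetric multiderivations `l_1`, `l_2`, `l_3`. -/
structure MultiDerivations
    (l : ∀ k : ℕ, MultilinearMap ℝ (fun _ : Fin k => Multi R P) (Multi R P)) : Prop where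
  l_zero : l 0 = 0
  degree : ∀ (k : ℕ) (x : Fin k → Multi R P) (d : Fin k → ℤ), (∀ i, x i ∈ shiftedDeg R P (d i)) →
    l k x ∈ shiftedDeg R P (∑ i, d i + (2 - k))
  isSkewDerivation : ∀ k, IsSkewDerivation (l (k + 1))
  higher_zero : ∀ k, 3 < k → l k = 0

theorem DiffQuasiGerstenhaber.multiDerivations (S : DiffQuasiGerstenhaber R P) :
    MultiDerivations S.l :=
  ⟨S.l_zero, S.degree, S.isSkewDerivation, S.higher_zero⟩

theorem IsDerived.multiDerivations (B : Frame R P κ)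
    {l : ∀ k : ℕ, MultilinearMap ℝ (fun _ : Fin k => Multi R P) (Multi R P)}
    {ε : ℕ → ℤˣ} {Φ : ℕ → Module.End ℝ (Form R P)} (hl : IsDerived l ε Φ)
    (hdeg : HasDegree l) (hl0 : l 0 = 0) (h0 : ∀ k, 3 < k → l k = 0) : MultiDerivations l :=
  ⟨hl0, fun _ _ _ hx => hdeg.apply hx, fun k => ⟨hl.skew B hdeg h0 (k + 1), fun x d hx =>
    hl.derivation B hdeg x d hx⟩, h0⟩

section

variable {l l' : ∀ k : ℕ, MultilinearMap ℝ (fun _ : Fin k => Multi R P) (Multi R P)}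

theorem MultiDerivations.hasDegree (h : MultiDerivations l) : HasDegree l := by
  intro L hL
  have := h.degree L.length (fun i => (L.get i).2) (fun i => (L.get i).1 - 1) fun i => by
    rw [shiftedDeg, sub_add_cancel]
    exact hL _ (L.get_mem i)
  rw [shiftedDeg] at this
  have e : totalDeg L = ∑ i : Fin L.length, (L.get i).1 := by
    rw [totalDeg, ← List.sum_ofFn]
    congr 1
    exact List.ext_get (by simp) fun n _ _ => by simp
  rw [opList, e]
  convert this using 1
  rw [Finset.sum_sub_distrib]
  simp only [Finset.sum_const, Finset.card_univ, Fintype.card_fin, nsmul_eq_mul, mul_one]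
  ring_nf

/-- The value would have negative degree. On generators this leaves l_1, l_2 with at least one
section, and l_3 on three sections. -/
theorem MultiDerivations.eq_zero_of_isGen (h : MultiDerivations l) {n : ℕ}
    {a : Fin n → ℤ × Multi R P} (ha : ∀ i, IsGen (a i)) (hd : ∑ i, (a i).1 < 2 * n - 3) :
    l n (fun i => (a i).2) = 0 := by
  have := h.degree n (fun i => (a i).2) (fun i => (a i).1 - 1) fun i => by
    rw [shiftedDeg, sub_add_cancel]
    exact (ha i).mem
  refine eq_zero_of_mem_extDeg_neg this ?_
  rw [Finset.sum_sub_distrib]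
  simp
  omega

theorem IsGen.fst_nonneg {a : ℤ × Multi R P} (h : IsGen a) : 0 ≤ a.1 ∧ a.1 ≤ 1 := by
  rcases h with ⟨r, rfl⟩ | ⟨X, rfl⟩ <;> simp

theorem IsGen.eq_ι {a : ℤ × Multi R P} (h : IsGen a) (h1 : a.1 = 1) :
    ∃ X, a = (1, ExteriorAlgebra.ι R X) := by
  rcases h with ⟨r, rfl⟩ | h
  · simp at h1
  · exact h

/-- Multiderivations are determined by their values on generators. -/
theorem MultiDerivations.ext (h : MultiDerivations l) (h' : MultiDerivations l')
    (h1 : ∀ a : ℤ × Multi R P, IsGen a → l 1 ![a.2] = l' 1 ![a.2])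
    (h2 : ∀ (X : P) (b : ℤ × Multi R P), IsGen b →
      l 2 ![ExteriorAlgebra.ι R X, b.2] = l' 2 ![ExteriorAlgebra.ι R X, b.2])
    (h3 : ∀ X Y Z : P,
      l 3 ![ExteriorAlgebra.ι R X, ExteriorAlgebra.ι R Y, ExteriorAlgebra.ι R Z] =
        l' 3 ![ExteriorAlgebra.ι R X, ExteriorAlgebra.ι R Y, ExteriorAlgebra.ι R Z]) :
    l = l' := by
  funext k
  match k with
  | 0 => rw [h.l_zero, h'.l_zero]
  | 1 =>
    refine (h.isSkewDerivation 0).ext (h'.isSkewDerivation 0) fun a ha => ?_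
    have e : (fun i => (a i).2) = ![(a 0).2] := by
      funext i
      fin_cases i
      rfl
    rw [e]
    exact h1 _ (ha 0)
  | 2 =>
    refine (h.isSkewDerivation 1).ext (h'.isSkewDerivation 1) fun a ha => ?_
    have e : (fun i => (a i).2) = ![(a 0).2, (a 1).2] := by
      funext i
      fin_cases i <;> rfl
    have hpos : ∀ b : Fin 2 → ℤ × Multi R P, (∀ i, IsGen (b i)) → (b 0).1 = 1 →
        l 2 (fun i => (b i).2) = l' 2 (fun i => (b i).2) := by
      intro b hb hb0
      have e : (fun i => (b i).2) = ![(b 0).2, (b 1).2] := by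
        funext i
        fin_cases i <;> rfl
      obtain ⟨X, hX⟩ := (hb 0).eq_ι hb0
      rw [e, hX]
      exact h2 X _ (hb 1)
    by_cases hc : ∑ i, (a i).1 < 2 * (2 : ℕ) - 3
    · rw [h.eq_zero_of_isGen ha hc, h'.eq_zero_of_isGen ha hc]
    · rw [Fin.sum_univ_two] at hc
      have b0 := (ha 0).fst_nonneg
      have b1 := (ha 1).fst_nonneg
      by_cases h0 : (a 0).1 = 1
      · exact hpos a ha h0
      -- A function in the first place and a section in the second are exchanged by skew-symmetry.
      · have hm : ∀ i, (a i).2 ∈ shiftedDeg R P ((a i).1 - 1) := fun i => by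
          rw [shiftedDeg, sub_add_cancel]
          exact (ha i).mem
        have s := (h.isSkewDerivation 1).skew (fun i => (a i).2) _ hm (Equiv.swap 0 1)
        have s' := (h'.isSkewDerivation 1).skew (fun i => (a i).2) _ hm (Equiv.swap 0 1)
        have := hpos (fun i => a (Equiv.swap 0 1 i)) (fun i => ha _)
          (by rw [Equiv.swap_apply_left]; push_cast at hc; omega)
        exact MulAction.injective _ ((s.symm.trans this).trans s')
  | 3 =>
    refine (h.isSkewDerivation 2).ext (h'.isSkewDerivation 2) fun a ha => ?_
    by_cases hc : ∑ i, (a i).1 < 2 * (3 : ℕ) - 3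
    · rw [h.eq_zero_of_isGen ha hc, h'.eq_zero_of_isGen ha hc]
    · rw [Fin.sum_univ_three] at hc
      have b0 := (ha 0).fst_nonneg
      have b1 := (ha 1).fst_nonneg
      have b2 := (ha 2).fst_nonneg
      push_cast at hc
      obtain ⟨X, hX⟩ := (ha 0).eq_ι (by omega)
      obtain ⟨Y, hY⟩ := (ha 1).eq_ι (by omega)
      obtain ⟨Z, hZ⟩ := (ha 2).eq_ι (by omega)
      have e : (fun i => (a i).2) = ![(a 0).2, (a 1).2, (a 2).2] := by
        funext i
        fin_cases i <;> rfl
      rw [e, hX, hY, hZ]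
      exact h3 X Y Z
  | k + 4 => rw [h.higher_zero _ (by omega), h'.higher_zero _ (by omega)]

end

/-- The operators `G`, `D`, `F` represent the operations `l_1`, `l_2`, `l_3` on generators. -/
structure Represents (l : ∀ k : ℕ, MultilinearMap ℝ (fun _ : Fin k => Multi R P) (Multi R P))
    (G D F : Module.End ℝ (Form R P)) : Prop where
  one : ∀ a : ℤ × Multi R P, IsGen a → contractOp R P (l 1 ![a.2]) = iter (-1) G [a]
  two : ∀ (X : P) (b : ℤ × Multi R P), IsGen b →
    contractOp R P (l 2 ![ExteriorAlgebra.ι R X, b.2]) =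
      iter 1 D [(1, ExteriorAlgebra.ι R X), b]
  three : ∀ X Y Z : P,
    contractOp R P (l 3 ![ExteriorAlgebra.ι R X, ExteriorAlgebra.ι R Y, ExteriorAlgebra.ι R Z]) =
      -iter 3 F [(1, ExteriorAlgebra.ι R X), (1, ExteriorAlgebra.ι R Y),
        (1, ExteriorAlgebra.ι R Z)]

section

variable (B : Frame R P κ) {hinv : Ham R P →ₗ[ℝ] Multi R P} (hh : ∀ x, hinv (hbar R P x) = x)
  {G D F : Module.End ℝ (Form R P)} (hG : G ∈ ops R P 2 1) (hD : D ∈ ops R P 1 2)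
  (hF : F ∈ ops R P 0 3)

include B hh in
theorem derivedOps_represents :
    Represents (derivedOps hinv (symb 2 1 G hG) (symb 1 2 D hD) (symb 0 3 F hF)) G D F where
  one a ha := by
    refine (derivedOps_spec B hh hG hD hF [a] (Homog.singleton ha.mem)).2.trans ?_
    simp [decExp, sgnSeq, iter, opSeq]
  two X b hb := by
    refine (derivedOps_spec B hh hG hD hF [(1, ExteriorAlgebra.ι R X), b]
      (Homog.cons (ι_mem_extDeg X) (Homog.singleton hb.mem))).2.trans ?_
    simp [decExp, sgnSeq, iter, opSeq, Units.neg_smul]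
  three X Y Z := by
    refine (derivedOps_spec B hh hG hD hF [(1, ExteriorAlgebra.ι R X), (1, ExteriorAlgebra.ι R Y),
        (1, ExteriorAlgebra.ι R Z)] (Homog.cons (ι_mem_extDeg X) (Homog.cons (ι_mem_extDeg Y)
          (Homog.singleton (ι_mem_extDeg Z))))).2.trans ?_
    simp [decExp, sgnSeq, iter, opSeq, Units.neg_smul, Int.negOnePow_odd 3 (by decide)]

include B hh in
theorem derivedOps_multiDerivations :
    MultiDerivations (derivedOps hinv (symb 2 1 G hG) (symb 1 2 D hD) (symb 0 3 F hF)) := by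
  refine IsDerived.multiDerivations B (ε := sgnSeq) (Φ := opSeq G D F)
    (fun L hL => (derivedOps_spec B hh hG hD hF L hL).2)
    (fun L hL => (derivedOps_spec B hh hG hD hF L hL).1) rfl ?_
  intro k hk
  obtain ⟨j, rfl⟩ := Nat.exists_eq_add_of_le' hk
  rfl

include B in
theorem MultiDerivations.eq_of_represents
    {l l' : ∀ k : ℕ, MultilinearMap ℝ (fun _ : Fin k => Multi R P) (Multi R P)}
    (h : MultiDerivations l) (h' : MultiDerivations l') (hr : Represents l G D F)
    (hr' : Represents l' G D F) : l = l' := by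
  have hd : ∀ {l : ∀ k : ℕ, MultilinearMap ℝ (fun _ : Fin k => Multi R P) (Multi R P)},
      MultiDerivations l → ∀ L : List (ℤ × Multi R P), (∀ a ∈ L, IsGen a) →
      opList l L ∈ extDeg R P (totalDeg L - (2 * L.length - 3)) := fun h L hL =>
    h.hasDegree L fun a ha => (hL a ha).mem
  refine h.ext h' (fun a ha => ?_) (fun X b hb => ?_) fun X Y Z => ?_
  · have hg : ∀ c ∈ [a], IsGen c := by simpa using ha
    have e : ∀ l : ∀ k : ℕ, MultilinearMap ℝ (fun _ : Fin k => Multi R P) (Multi R P),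
      l 1 ![a.2] = opList l [a] := fun l =>
        apply_eq_opList _ _ rfl fun i => by fin_cases i; rfl
    have c := (hr.one a ha).trans (hr'.one a ha).symm
    rw [e, e] at c ⊢
    exact B.contractOp_inj (hd h _ hg) (hd h' _ hg) c
  · have hg : ∀ c ∈ [(1, ExteriorAlgebra.ι R X), b], IsGen c := by
      simpa using ⟨Or.inr ⟨X, rfl⟩, hb⟩
    have e : ∀ l : ∀ k : ℕ, MultilinearMap ℝ (fun _ : Fin k => Multi R P) (Multi R P),
      l 2 ![ExteriorAlgebra.ι R X, b.2] = opList l [(1, ExteriorAlgebra.ι R X), b] := fun l =>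
        apply_eq_opList _ _ rfl fun i => by fin_cases i <;> rfl
    have c := (hr.two X b hb).trans (hr'.two X b hb).symm
    rw [e, e] at c ⊢
    exact B.contractOp_inj (hd h _ hg) (hd h' _ hg) c
  · have hg : ∀ c ∈ [(1, ExteriorAlgebra.ι R X), (1, ExteriorAlgebra.ι R Y),
        (1, ExteriorAlgebra.ι R Z)], IsGen c := by
      simpa using ⟨Or.inr ⟨X, rfl⟩, Or.inr ⟨Y, rfl⟩, Or.inr ⟨Z, rfl⟩⟩
    have e : ∀ l : ∀ k : ℕ, MultilinearMap ℝ (fun _ : Fin k => Multi R P) (Multi R P),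
      l 3 ![ExteriorAlgebra.ι R X, ExteriorAlgebra.ι R Y, ExteriorAlgebra.ι R Z] =
        opList l [(1, ExteriorAlgebra.ι R X), (1, ExteriorAlgebra.ι R Y),
          (1, ExteriorAlgebra.ι R Z)] := fun l =>
        apply_eq_opList _ _ rfl fun i => by fin_cases i <;> rfl
    have c := (hr.three X Y Z).trans (hr'.three X Y Z).symm
    rw [e, e] at c ⊢
    exact B.contractOp_inj (hd h _ hg) (hd h' _ hg) c

theorem Represents.congr {l l' : ∀ k : ℕ, MultilinearMap ℝ (fun _ : Fin k => Multi R P) (Multi R P)}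
    (h : Represents l G D F) (h1 : ∀ x, l 1 ![x] = l' 1 ![x])
    (h2 : ∀ x y, l 2 ![x, y] = l' 2 ![x, y])
    (h3 : ∀ X Y Z : P,
      l 3 ![ExteriorAlgebra.ι R X, ExteriorAlgebra.ι R Y, ExteriorAlgebra.ι R Z] =
        l' 3 ![ExteriorAlgebra.ι R X, ExteriorAlgebra.ι R Y, ExteriorAlgebra.ι R Z]) :
    Represents l' G D F :=
  ⟨fun a ha => h1 a.2 ▸ h.one a ha, fun X b hb => h2 _ b.2 ▸ h.two X b hb,
    fun X Y Z => h3 X Y Z ▸ h.three X Y Z⟩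

/-- Correspondence speaks of l_1 and l_2 on all multisections, representation of generators only.
The derived operations satisfy both, and multiderivations are determined by their values on
generators. -/
theorem Frame.corresponds_iff (B : Frame R P κ) {Q : QuasiLieBialgebroid R P}
    (hγ : symb 2 1 G hG = Fun.toHam R P 2 1 Q.γ) (hμ : symb 1 2 D hD = Fun.toHam R P 1 2 Q.μ)
    (hφ : symb 0 3 F hF = Fun.toHam R P 0 3 Q.φ) (S : DiffQuasiGerstenhaber R P) :
    Corresponds Q S ↔ Represents S.l G D F := by
  obtain ⟨hinv, hh⟩ := B.exists_hbar_leftInverse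
  constructor
  · intro h
    refine (derivedOps_represents B hh hG hD hF).congr (fun x => ?_) (fun x y => ?_)
      fun X Y Z => ?_
    · have := congrArg hinv (h.l_one x)
      rw [hh, ← hγ] at this
      exact this.symm
    · have := congrArg hinv (h.l_two x y)
      rw [hh, ← hμ] at this
      exact this.symm
    · have := h.l_three X Y Z
      rw [← hφ, ← hbar_ternaryOp B hh hF] at this
      exact (hbar_injective B this).symm
  · intro h
    have e := S.multiDerivations.eq_of_represents B
      (derivedOps_multiDerivations B hh hG hD hF) h (derivedOps_represents B hh hG hD hF)
    refine ⟨fun x => ?_, fun x y => ?_, fun X Y Z => ?_⟩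
    · rw [e, ← hγ]
      exact hbar_unaryOp B hh hG x
    · rw [e, ← hμ]
      exact hbar_binaryOp B hh hD x y
    · rw [e, ← hφ]
      exact hbar_ternaryOp B hh hF X Y Z

end

theorem DiffQuasiGerstenhaber.ext {S S' : DiffQuasiGerstenhaber R P} (h : S.l = S'.l) : S = S' := by
  obtain ⟨⟨l, _, _, _, _⟩, _, _⟩ := S
  obtain ⟨⟨l', _, _, _, _⟩, _, _⟩ := S'
  cases h
  rfl

theorem QuasiLieBialgebroid.exists_rep (Q : QuasiLieBialgebroid R P) :
    ∃ (G D F : Module.End ℝ (Form R P)) (hG : G ∈ ops R P 2 1) (hD : D ∈ ops R P 1 2)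
      (hF : F ∈ ops R P 0 3), symb 2 1 G hG = Fun.toHam R P 2 1 Q.γ ∧
        symb 1 2 D hD = Fun.toHam R P 1 2 Q.μ ∧ symb 0 3 F hF = Fun.toHam R P 0 3 Q.φ := by
  obtain ⟨D, hD, hμ⟩ := Q.μ.exists_rep
  obtain ⟨G, hG, hγ⟩ := Q.γ.exists_rep
  obtain ⟨F, hF, hφ⟩ := Q.φ.exists_rep
  exact ⟨G, D, F, hG, hD, hF, by rw [← hγ]; rfl, by rw [← hμ]; rfl, by rw [← hφ]; rfl⟩

/-- Every quasi-Lie bialgebroid corresponds to exactly one differential quasi-Gerstenhaber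
algebra. -/
theorem Frame.existsUnique_corresponds (B : Frame R P κ) (Q : QuasiLieBialgebroid R P) :
    ∃! S : DiffQuasiGerstenhaber R P, Corresponds Q S := by
  obtain ⟨S, hS⟩ := B.exists_corresponds Q
  refine ⟨S, hS, fun S' hS' => DiffQuasiGerstenhaber.ext ?_⟩
  obtain ⟨G, D, F, hG, hD, hF, hγ, hμ, hφ⟩ := Q.exists_rep
  rw [B.corresponds_iff hG hD hF hγ hμ hφ] at hS
  exact S'.multiDerivations.eq_of_represents B S.multiDerivations
    ((B.corresponds_iff hG hD hF hγ hμ hφ S').1 hS') hS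

/-- A symbol is determined by its iterated brackets with generators. Those not prescribed by
`Represents` either follow by exchanging two arguments or vanish because their order would be
negative. -/
theorem Represents.unique (B : Frame R P κ)
    {l : ∀ k : ℕ, MultilinearMap ℝ (fun _ : Fin k => Multi R P) (Multi R P)}
    {G D F G' D' F' : Module.End ℝ (Form R P)} (hG : G ∈ ops R P 2 1) (hD : D ∈ ops R P 1 2)
    (hF : F ∈ ops R P 0 3) (hG' : G' ∈ ops R P 2 1) (hD' : D' ∈ ops R P 1 2)
    (hF' : F' ∈ ops R P 0 3) (h : Represents l G D F) (h' : Represents l G' D' F') :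
    G - G' ∈ lowerOps R P 2 1 ∧ D - D' ∈ lowerOps R P 1 2 ∧ F - F' ∈ lowerOps R P 0 3 := by
  have hsub : ∀ {m : ℤ} {K K' : Module.End ℝ (Form R P)} {L : List (ℤ × Multi R P)},
      iter m K L = iter m K' L → iter m (K - K') L = 0 := by
    intro m K K' L h
    rw [sub_eq_add_neg, iter_add, iter_neg, h, add_neg_cancel]
  have hlow : ∀ {k : ℤ} {l : ℕ} {m : ℤ} {K : Module.End ℝ (Form R P)} {L : List (ℤ × Multi R P)},
      K ∈ ops R P k l → m = l - k → L.length = l → (∀ a ∈ L, IsGen a) → k + totalDeg L < l →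
      iter m K L = 0 := by
    intro k l m K L hK hm hL hg hlt
    have := iter_mem_ops hK hm (L := L) fun a ha => (hg a ha).mem
    rw [ops, show (k + totalDeg L - (L.length : ℤ) + 1).toNat = 0 by omega] at this
    exact (Submodule.mem_bot ℝ).1 this
  refine ⟨B.mem_lowerOps_of_iter (l := 1) (Submodule.sub_mem _ hG hG') fun L hl hg => ?_,
    B.mem_lowerOps_of_iter (l := 2) (Submodule.sub_mem _ hD hD') fun L hl hg => ?_,
    B.mem_lowerOps_of_iter (l := 3) (Submodule.sub_mem _ hF hF') fun L hl hg => ?_⟩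
  · obtain ⟨a, rfl⟩ := List.length_eq_one_iff.1 hl
    have ha := hg a (by simp)
    exact hsub ((h.one a ha).symm.trans (h'.one a ha))
  · obtain ⟨a, b, rfl⟩ := List.length_eq_two.1 hl
    have ha := hg a (by simp)
    have hb := hg b (by simp)
    have h1 : ∀ {a b : ℤ × Multi R P}, IsGen a → IsGen b → a.1 = 1 →
        iter (2 - 1) (D - D') [a, b] = 0 := by
      intro a b ha hb h1
      obtain ⟨X, rfl⟩ := ha.eq_ι h1
      exact hsub ((h.two X b hb).symm.trans (h'.two X b hb))
    by_cases ha1 : a.1 = 1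
    · exact h1 ha hb ha1
    by_cases hb1 : b.1 = 1
    · refine (iter_swap _ _ ha.mem hb.mem _).trans ?_
      have := h1 hb ha hb1
      rw [show ((2 : ℕ) : ℤ) - 1 = 2 - 1 by norm_num, this, smul_zero]
    · refine hlow (Submodule.sub_mem _ hD hD') rfl hl hg ?_
      have := ha.fst_nonneg
      have := hb.fst_nonneg
      simp only [totalDeg_cons, totalDeg_nil]
      push_cast
      omega
  · obtain ⟨a, b, c, rfl⟩ := List.length_eq_three.1 hl
    by_cases hlt : 0 + totalDeg [a, b, c] < ((3 : ℕ) : ℤ)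
    · exact hlow (Submodule.sub_mem _ hF hF') rfl hl hg hlt
    · have h1 := (hg a (by simp)).fst_nonneg
      have h2 := (hg b (by simp)).fst_nonneg
      have h3 := (hg c (by simp)).fst_nonneg
      simp only [totalDeg_cons, totalDeg_nil] at hlt
      obtain ⟨X, rfl⟩ := (hg a (by simp)).eq_ι (by omega)
      obtain ⟨Y, rfl⟩ := (hg b (by simp)).eq_ι (by omega)
      obtain ⟨Z, rfl⟩ := (hg c (by simp)).eq_ι (by omega)
      exact hsub (neg_injective ((h.three X Y Z).symm.trans (h'.three X Y Z)))

/-- The operations are the derived brackets of G, D, F. Their Jacobi identities on generators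
therefore say that all saturated brackets of `mcOp` with generators vanish, which forces its symbol
to vanish. -/
theorem Represents.mcOps (B : Frame R P κ) {S : DiffQuasiGerstenhaber R P}
    {G D F : Module.End ℝ (Form R P)} (hG : G ∈ ops R P 2 1) (hD : D ∈ ops R P 1 2)
    (hF : F ∈ ops R P 0 3) (h : Represents S.l G D F) : MCOps G D F := by
  obtain ⟨hinv, hh⟩ := B.exists_hbar_leftInverse
  have e := S.multiDerivations.eq_of_represents B
      (derivedOps_multiDerivations B hh hG hD hF) h (derivedOps_represents B hh hG hD hF)
  have hl : IsDerived S.l sgnSeq (opSeq G D F) := by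
    rw [e]
    exact fun L hL => (derivedOps_spec B hh hG hD hF L hL).2
  rw [mcOps_iff hG hD hF]
  intro n
  refine B.mem_lowerOps_of_iter (l := n) (mcOp_mem (opSeq_mem hG hD hF) n) fun L hn hg => ?_
  subst hn
  have hx : ∀ i, (L.get i).2 ∈ shiftedDeg R P ((L.get i).1 - 1) := fun i => by
    rw [shiftedDeg, sub_add_cancel]
    exact (hg _ (L.get_mem i)).mem
  have h1 := contractOp_jacobi B (opSeq_mem hG hD hF) hl S.multiDerivations.hasDegree
    (fun i => (L.get i).2) (fun i => (L.get i).1 - 1) hx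
  rw [S.jacobi _ _ _ hx, map_zero, smul_zero] at h1
  simp only [sub_add_cancel, Prod.mk.eta, List.ofFn_get] at h1
  have h2 := (smul_eq_zero_iff_eq _).1 h1.symm
  rwa [show (L.length : ℤ) - (4 - L.length) = 2 * L.length - 4 by ring]

/-- A differential quasi-Gerstenhaber algebra which is represented by operators corresponds to
exactly one quasi-Lie bialgebroid. -/
theorem Represents.existsUnique (B : Frame R P κ) {S : DiffQuasiGerstenhaber R P}
    {G D F : Module.End ℝ (Form R P)} (hG : G ∈ ops R P 2 1) (hD : D ∈ ops R P 1 2)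
    (hF : F ∈ ops R P 0 3) (h : Represents S.l G D F) :
    ∃! Q : QuasiLieBialgebroid R P, Corresponds Q S := by
  have hmc := h.mcOps B hG hD hF
  rw [← poisson_theta_eq_zero_iff hG hD hF] at hmc
  refine ⟨⟨Subquot.mk _ D hD, Subquot.mk _ G hG, Subquot.mk _ F hF, hmc⟩,
    (B.corresponds_iff hG hD hF rfl rfl rfl S).2 h, fun Q' hQ' => ?_⟩
  obtain ⟨G', D', F', hG', hD', hF', hγ, hμ, hφ⟩ := Q'.exists_rep
  obtain ⟨h1, h2, h3⟩ := ((B.corresponds_iff hG' hD' hF' hγ hμ hφ S).1 hQ').unique B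
    hG' hD' hF' hG hD hF h
  exact QuasiLieBialgebroid.ext (toHam_injective _ _ (hμ.symm.trans (symb_eq_symb.2 h2)))
    (toHam_injective _ _ (hγ.symm.trans (symb_eq_symb.2 h1)))
    (toHam_injective _ _ (hφ.symm.trans (symb_eq_symb.2 h3)))

end Representation

/-! ### Lifting derivations of functions to forms -/

section ExtendedDerivation

variable {R : Type*} [CommRing R] [Algebra ℝ R] {N : Type*} [AddCommGroup N] [Module ℝ N]
  [Module R N] [IsScalarTower ℝ R N]

/-- The exterior algebra with a square-zero parameter adjoined, as a carrier of a second
`R`-algebra structure. -/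
def TwistedExt (R N : Type*) [CommRing R] [AddCommGroup N] [Module R N] : Type _ :=
  TrivSqZeroExt (ExteriorAlgebra R N) (ExteriorAlgebra R N)

instance (R N : Type*) [CommRing R] [AddCommGroup N] [Module R N] : Ring (TwistedExt R N) :=
  inferInstanceAs (Ring (TrivSqZeroExt (ExteriorAlgebra R N) (ExteriorAlgebra R N)))

/-- A derivation of the ground ring and a compatible endomorphism of the module extend to a
derivation of the exterior algebra. -/
theorem exists_extended_derivation (V : R →ₗ[ℝ] R) (hV : ∀ f g, V (f * g) = f * V g + V f * g)
    (c : N →ₗ[ℝ] N) (hc : ∀ (f : R) (a : N), c (f • a) = f • c a + V f • a) :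
    ∃ D : Module.End ℝ (ExteriorAlgebra R N), (∀ x y, D (x * y) = x * D y + D x * y) ∧
      (∀ f, D (algebraMap R _ f) = algebraMap R _ (V f)) ∧
      ∀ a, D (ExteriorAlgebra.ι R a) = ExteriorAlgebra.ι R (c a) := by
  have hV1 : V 1 = 0 := by
    have := hV 1 1
    rw [one_mul, one_mul, mul_one] at this
    exact left_eq_add.1 this
  -- With a square-zero parameter t, the map f ↦ f + t V(f) is a ring homomorphism because V is a
  -- derivation. An algebra map x ↦ x + t D(x) over it is the same as a derivation D that extends V,
  -- and the universal property of the exterior algebra provides it.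
  let i : R →+* TwistedExt R N :=
    { toFun := fun f => (⟨algebraMap R _ f, algebraMap R _ (V f)⟩ :
        ExteriorAlgebra R N × ExteriorAlgebra R N)
      map_one' := Prod.ext (map_one _) (by
        change algebraMap R (ExteriorAlgebra R N) (V 1) = 0
        rw [hV1, map_zero])
      map_zero' := Prod.ext (map_zero _) (by
        change algebraMap R (ExteriorAlgebra R N) (V 0) = 0
        rw [map_zero, map_zero])
      map_add' := fun f g => Prod.ext (map_add _ f g) (by
        change algebraMap R (ExteriorAlgebra R N) (V (f + g)) = algebraMap R _ (V f) +
          algebraMap R _ (V g)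
        rw [map_add, map_add])
      map_mul' := fun f g => Prod.ext (map_mul _ f g) (by
        change algebraMap R (ExteriorAlgebra R N) (V (f * g)) =
          algebraMap R _ f * algebraMap R _ (V g) + algebraMap R _ (V f) * algebraMap R _ g
        rw [hV, map_add, map_mul, map_mul]) }
  let _ : Algebra R (TwistedExt R N) := i.toAlgebra' fun f x => Prod.ext
    (Algebra.commutes f x.1) (by
      change algebraMap R (ExteriorAlgebra R N) f * x.2 + algebraMap R _ (V f) * x.1 =
        x.1 * algebraMap R _ (V f) + x.2 * algebraMap R _ f
      rw [Algebra.commutes, Algebra.commutes, add_comm])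
  let j : N →ₗ[R] TwistedExt R N :=
    { toFun := fun a => (⟨ExteriorAlgebra.ι R a, ExteriorAlgebra.ι R (c a)⟩ :
        ExteriorAlgebra R N × ExteriorAlgebra R N)
      map_add' := fun a b => Prod.ext (map_add _ a b) (by
        change ExteriorAlgebra.ι R (c (a + b)) = ExteriorAlgebra.ι R (c a) +
          ExteriorAlgebra.ι R (c b)
        rw [map_add, map_add])
      map_smul' := fun f a => by
        refine Prod.ext ?_ ?_
        · change ExteriorAlgebra.ι R (f • a) = algebraMap R _ f * ExteriorAlgebra.ι R a
          rw [map_smul, Algebra.smul_def]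
        · change ExteriorAlgebra.ι R (c (f • a)) = algebraMap R _ f * ExteriorAlgebra.ι R (c a) +
            algebraMap R _ (V f) * ExteriorAlgebra.ι R a
          rw [hc, map_add, map_smul, map_smul, Algebra.smul_def, Algebra.smul_def] }
  -- The t-component of the square is the anticommutator of two elements of degree one.
  have hj : ∀ a, j a * j a = 0 := fun a => Prod.ext (ExteriorAlgebra.ι_sq_zero a) (by
    change ExteriorAlgebra.ι R a * ExteriorAlgebra.ι R (c a) +
      ExteriorAlgebra.ι R (c a) * ExteriorAlgebra.ι R a = 0
    exact ExteriorAlgebra.ι_add_mul_swap a (c a))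
  let Ψ : ExteriorAlgebra R N →ₐ[R] TwistedExt R N := ExteriorAlgebra.lift R ⟨j, hj⟩
  have hι : ∀ a, Ψ (ExteriorAlgebra.ι R a) = j a := fun a => ExteriorAlgebra.lift_ι_apply R j hj a
  have hal : ∀ f, Ψ (algebraMap R _ f) = i f := fun f => AlgHom.commutes Ψ f
  let π : TwistedExt R N →+* ExteriorAlgebra R N :=
    { toFun := Prod.fst
      map_one' := rfl
      map_zero' := rfl
      map_add' := fun _ _ => rfl
      map_mul' := fun _ _ => rfl }
  -- Since the first component of `Ψ x` is x, multiplicativity of `Ψ` read in the second component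
  -- is the Leibniz rule.
  have hfst : ∀ x, π (Ψ x) = x := by
    intro x
    induction x using ExteriorAlgebra.induction with
    | algebraMap r => rw [hal]; rfl
    | ι a => rw [hι]; rfl
    | mul x y hx hy => rw [map_mul, map_mul, hx, hy]
    | add x y hx hy => rw [map_add, map_add, hx, hy]
  refine ⟨{ toFun := fun x => (Ψ x).2
            map_add' := fun x y => by rw [map_add]; rfl
            map_smul' := fun r x => ?_ }, fun x y => ?_, fun f => ?_, fun a => ?_⟩
  · have hr : V (algebraMap ℝ R r) = 0 := by
      rw [Algebra.algebraMap_eq_smul_one, map_smul, hV1, smul_zero]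
    have h1 : r • x = algebraMap R _ (algebraMap ℝ R r) * x := by
      rw [← Algebra.smul_def, algebraMap_smul]
    rw [h1, map_mul, hal]
    change algebraMap R (ExteriorAlgebra R N) (algebraMap ℝ R r) * (Ψ x).2 +
      algebraMap R _ (V (algebraMap ℝ R r)) * (Ψ x).1 = r • (Ψ x).2
    rw [hr, map_zero, zero_mul, add_zero, ← Algebra.smul_def, algebraMap_smul]
  · change (Ψ (x * y)).2 = x * (Ψ y).2 + (Ψ x).2 * y
    rw [map_mul]
    change π (Ψ x) * (Ψ y).2 + (Ψ x).2 * π (Ψ y) = _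
    rw [hfst, hfst]
  · change (Ψ _).2 = _
    rw [hal]
    rfl
  · change (Ψ _).2 = _
    rw [hι]
    rfl

theorem derivation_mem_extDeg {D : Module.End ℝ (ExteriorAlgebra R N)} {V : R → R} {c : N → N}
    (hD : ∀ x y, D (x * y) = x * D y + D x * y)
    (h0 : ∀ f, D (algebraMap R _ f) = algebraMap R _ (V f))
    (h1 : ∀ a, D (ExteriorAlgebra.ι R a) = ExteriorAlgebra.ι R (c a)) {j : ℤ}
    {x : ExteriorAlgebra R N} (hx : x ∈ extDeg R N j) : D x ∈ extDeg R N j := by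
  rcases extDeg_cases hx with rfl | ⟨n, rfl, hx⟩
  · rw [map_zero]; exact Submodule.zero_mem _
  clear * - hx hD h0 h1
  induction hx using Submodule.pow_induction_on_left' with
  | algebraMap r => rw [h0]; exact algebraMap_mem_extDeg _
  | add x y i _ _ hx hy => rw [map_add]; exact Submodule.add_mem _ hx hy
  | mem_mul m hm i x hx' hx =>
    obtain ⟨a, rfl⟩ := hm
    rw [hD, h1]
    push_cast
    rw [add_comm (i : ℤ)]
    exact Submodule.add_mem _ (extDeg_mul (ι_mem_extDeg a) hx)
      (extDeg_mul (ι_mem_extDeg _) (mem_extDeg_natCast.2 hx'))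

variable {P : Type*} [AddCommGroup P] [Module ℝ P] [Module R P] [IsScalarTower ℝ R P]
  {κ : Type*} [Fintype κ]

theorem derivation_mem_diffOp {D : Module.End ℝ (ExteriorAlgebra R N)}
    (hD : ∀ x y, D (x * y) = x * D y + D x * y)
    (hdeg : ∀ j, ∀ x ∈ extDeg R N j, D x ∈ extDeg R N j) : D ∈ diffOp R N 2 0 := by
  refine ⟨fun j x hx => by rw [add_zero]; exact hdeg j x hx, fun j a ha => ?_⟩
  have : scomm 0 j D (LinearMap.mulLeft ℝ a) = LinearMap.mulLeft ℝ (D a) := by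
    ext x
    simp only [scomm, LinearMap.sub_apply, Module.End.mul_apply, LinearMap.mulLeft_apply,
      LinearMap.smul_apply]
    rw [hD, zero_mul, Int.negOnePow_zero, one_smul, add_sub_cancel_left]
  rw [this, zero_add]
  exact mulLeft_mem_diffOp (hdeg j a ha)

/-- Every derivation of the ground ring is the symbol of an operator on forms. -/
theorem Frame.exists_lift (B : Frame R P κ) (V : R →ₗ[ℝ] R)
    (hV : ∀ f g, V (f * g) = f * V g + V f * g) :
    ∃ N ∈ ops R P 1 1, ∀ f, scomm 0 0 N (mulOp (algebraMap R _ f)) =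
      mulOp (algebraMap R _ (V f)) := by
  -- The covariant derivative defined by the frame: differentiate the coefficients α(e_i) of α. The
  -- Leibniz rule holds because ∑ α(e_i) ε_i = α, although the frame may have linear relations.
  let c : Module.Dual R P →ₗ[ℝ] Module.Dual R P :=
    { toFun := fun α => ∑ i, V (α (B.e i)) • B.ε i
      map_add' := fun α β => by
        simp only [LinearMap.add_apply, map_add, add_smul, Finset.sum_add_distrib]
      map_smul' := fun r α => by
        simp only [LinearMap.smul_apply, map_smul, smul_assoc, Finset.smul_sum, RingHom.id_apply] }
  obtain ⟨D, hD, h0, h1⟩ := exists_extended_derivation V hV c fun f α => by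
    change ∑ i, V ((f • α) (B.e i)) • B.ε i = f • ∑ i, V (α (B.e i)) • B.ε i + V f • α
    have h : ∑ i, V f • α (B.e i) • B.ε i = V f • α := by
      rw [← Finset.smul_sum]
      exact congrArg (V f • ·) (B.dual.sum_smul α)
    rw [← h, Finset.smul_sum, ← Finset.sum_add_distrib]
    refine Finset.sum_congr rfl fun i _ => ?_
    change V (f * α (B.e i)) • B.ε i = f • V (α (B.e i)) • B.ε i + V f • α (B.e i) • B.ε i
    rw [hV, add_smul, smul_smul, smul_smul]
  refine ⟨D, derivation_mem_diffOp hD fun j x hx => derivation_mem_extDeg hD h0 h1 hx,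
    fun f => ?_⟩
  ext x
  simp only [scomm, LinearMap.sub_apply, Module.End.mul_apply, LinearMap.mulLeft_apply,
    LinearMap.smul_apply]
  rw [hD, mul_zero, Int.negOnePow_zero, one_smul, add_sub_cancel_left, h0]

end ExtendedDerivation

/-! ### Wedging an operator-valued linear map with the coframe -/

section Wedge

variable {R : Type*} [CommRing R] [Algebra ℝ R] {P : Type*} [AddCommGroup P] [Module ℝ P]
  [Module R P] [IsScalarTower ℝ R P] {κ : Type*} [Fintype κ] (B : Frame R P κ)

/-- The operator `∑ ε_i ∘ A(e_i)`. -/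
def Frame.wedge (A : P → Module.End ℝ (Form R P)) : Module.End ℝ (Form R P) :=
  ∑ i, mulOp (ExteriorAlgebra.ι R (B.ε i)) * A (B.e i)

/-- Linearity of an operator valued function over the functions. -/
def Frame.Lin (A : P → Module.End ℝ (Form R P)) : Prop :=
  ∀ X, ∑ i, mulOp (algebraMap R _ (B.ε i X)) * A (B.e i) = A X

theorem Frame.lin_of {A : P → Module.End ℝ (Form R P)} (hadd : ∀ X Y, A (X + Y) = A X + A Y)
    (hsmul : ∀ (r : R) X, A (r • X) = mulOp (algebraMap R _ r) * A X) : B.Lin A := by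
  intro X
  let L : P →+ Module.End ℝ (Form R P) := AddMonoidHom.mk' A hadd
  have : A X = L (∑ i, B.ε i X • B.e i) := by rw [B.sum_smul]; rfl
  rw [this, map_sum]
  exact Finset.sum_congr rfl fun i _ => (hsmul _ _).symm

theorem Frame.lin_contractOp (L : Multi R P →ₗ[ℝ] Multi R P)
    (hL : ∀ (r : R) (X : P), L (algebraMap R _ r * ExteriorAlgebra.ι R X) =
      algebraMap R _ r * L (ExteriorAlgebra.ι R X)) :
    B.Lin fun X => contractOp R P (L (ExteriorAlgebra.ι R X)) :=
  B.lin_of (fun X Y => by rw [map_add, map_add, map_add]) fun r X => by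
    rw [map_smul, Algebra.smul_def, hL, contractOp_mul, contractOp_algebraMap]

variable {B}

theorem Frame.wedge_mem {k l : ℤ} {A : P → Module.End ℝ (Form R P)} (hA : ∀ X, A X ∈ ops R P k l) :
    B.wedge A ∈ ops R P k (l + 1) := by
  refine Submodule.sum_mem _ fun i _ => ?_
  have := diffOp_mul (c := (k + 1).toNat) (by omega) (mulLeft_mem_diffOp (ι_mem_extDeg (B.ε i)))
    (hA (B.e i))
  rw [show (1 : ℤ) + (l - k) = l + 1 - k by ring] at this
  exact this

theorem Frame.wedge_zero : B.wedge (fun _ => (0 : Module.End ℝ (Form R P))) = 0 :=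
  Finset.sum_eq_zero fun _ _ => mul_zero _

theorem Frame.wedge_smul (c : ℝ) (A : P → Module.End ℝ (Form R P)) :
    B.wedge (fun X => c • A X) = c • B.wedge A := by
  simp only [Frame.wedge, mul_smul_comm, Finset.smul_sum]

theorem Frame.Lin.wedge {E : P → P → Module.End ℝ (Form R P)}
    (hE : ∀ Z, B.Lin fun Y => E Y Z) : B.Lin fun Y => B.wedge (E Y) := by
  intro Y
  simp only [Frame.wedge, Finset.mul_sum]
  rw [Finset.sum_comm]
  refine Finset.sum_congr rfl fun i _ => ?_
  have hi := hE (B.e i) Y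
  dsimp only at hi
  rw [← hi, Finset.mul_sum]
  refine Finset.sum_congr rfl fun j _ => ?_
  rw [← mul_assoc, ← mul_assoc, mulLeft_mul_mulLeft, mulLeft_mul_mulLeft, Algebra.commutes]

/-- The commutator hits either A(e_i) or ε_i; in the second case it leaves ∑ ε_i(X) A(e_i), which is
A(X) by linearity. -/
theorem Frame.scomm_wedge_ins {A : P → Module.End ℝ (Form R P)} (hA : B.Lin A) {m M : ℤ}
    (hM : 1 + m = M) (X : P) :
    scomm M (-1) (B.wedge A) (ins X) =
      B.wedge (fun Y => scomm m (-1) (A Y) (ins X)) + m.negOnePow • A X := by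
  subst hM
  have h1 : ∀ i, scomm 1 (-1) (mulOp (ExteriorAlgebra.ι R (B.ε i))) (ins X) =
      mulOp (algebraMap R (Form R P) (B.ε i X)) := by
    intro i
    rw [scomm_swap, scomm_ins_mulOp X (ι_mem_extDeg _), ins_ι]
    simp [Units.neg_smul]
  have h2 : (m * -1).negOnePow = m.negOnePow := negOnePow_congr ⟨-m, by ring⟩
  rw [Frame.wedge, scomm_sum_left, Frame.wedge, ← hA X, Finset.smul_sum,
    ← Finset.sum_add_distrib]
  refine Finset.sum_congr rfl fun i _ => ?_
  rw [scomm_mul, h1, h2]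

theorem Frame.scomm_wedge_function {A : P → Module.End ℝ (Form R P)} {m M : ℤ}
    (hM : 1 + m = M) (f : R) :
    scomm M 0 (B.wedge A) (mulOp (algebraMap R _ f)) =
      B.wedge (fun Y => scomm m 0 (A Y) (mulOp (algebraMap R _ f))) := by
  subst hM
  rw [Frame.wedge, scomm_sum_left, Frame.wedge]
  refine Finset.sum_congr rfl fun i _ => ?_
  rw [scomm_mul, scomm_mulLeft (ι_mem_extDeg _) (algebraMap_mem_extDeg f), zero_mul, smul_zero,
    add_zero]

theorem Frame.scomm_contractOp_of_mem (B : Frame R P κ) {k j : ℤ} {E : Module.End ℝ (Form R P)}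
    (hE : E ∈ ops R P k 0) {x : Multi R P} (hx : x ∈ extDeg R P j) :
    scomm (-k) (-j) E (contractOp R P x) = 0 := by
  obtain ⟨y, hy, rfl⟩ := B.exists_contractOp_eq_int hE
  exact scomm_contractOp hy hx

end Wedge

/-! ### Degree, Leibniz and skew-symmetry rules in arities one to three -/

section OperationRules

variable {R : Type*} [CommRing R] [Algebra ℝ R] {P : Type*} [AddCommGroup P] [Module ℝ P]
  [Module R P] [IsScalarTower ℝ R P] {κ : Type*} [Fintype κ]
  {l : ∀ k : ℕ, MultilinearMap ℝ (fun _ : Fin k => Multi R P) (Multi R P)}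
  (h : MultiDerivations l) {i j k : ℤ} {x y z : Multi R P}

include h

theorem MultiDerivations.mem_one (hx : x ∈ extDeg R P i) : l 1 ![x] ∈ extDeg R P (i + 1) := by
  have := h.degree 1 ![x] ![i - 1] fun a => by
    fin_cases a
    simpa [shiftedDeg] using hx
  simp only [shiftedDeg, Fin.sum_univ_one, Matrix.cons_val_zero] at this
  convert this using 2
  push_cast
  ring

theorem MultiDerivations.mem_two (hx : x ∈ extDeg R P i) (hy : y ∈ extDeg R P j) :
    l 2 ![x, y] ∈ extDeg R P (i + j - 1) := by
  have := h.degree 2 ![x, y] ![i - 1, j - 1] fun a => by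
    fin_cases a
    · simpa [shiftedDeg] using hx
    · simpa [shiftedDeg] using hy
  simp only [shiftedDeg, Fin.sum_univ_two, Matrix.cons_val_zero, Matrix.cons_val_one] at this
  convert this using 2
  push_cast
  ring

theorem MultiDerivations.mem_three (hx : x ∈ extDeg R P i) (hy : y ∈ extDeg R P j)
    (hz : z ∈ extDeg R P k) : l 3 ![x, y, z] ∈ extDeg R P (i + j + k - 3) := by
  have := h.degree 3 ![x, y, z] ![i - 1, j - 1, k - 1] fun a => by
    fin_cases a
    · simpa [shiftedDeg] using hx
    · simpa [shiftedDeg] using hy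
    · simpa [shiftedDeg] using hz
  simp only [shiftedDeg, Fin.sum_univ_three, Matrix.cons_val_zero, Matrix.cons_val_one,
    Matrix.cons_val] at this
  convert this using 2
  push_cast
  ring

theorem MultiDerivations.leibniz_one (hx : x ∈ extDeg R P i) (y : Multi R P) :
    l 1 ![x * y] = l 1 ![x] * y + i.negOnePow • (x * l 1 ![y]) := by
  have e : ∀ w : Multi R P, (Fin.snoc (α := fun _ => Multi R P) ![] w) = ![w] := fun w => by
    funext a
    fin_cases a
    rfl
  have := (h.isSkewDerivation 0).derivation ![] ![] (fun a => a.elim0) i x y hx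
  rw [e, e, e] at this
  refine this.trans ?_
  congr 3
  simp

theorem MultiDerivations.leibniz_two (hx : x ∈ extDeg R P i) (hy : y ∈ extDeg R P j)
    (z : Multi R P) : l 2 ![x, y * z] =
      l 2 ![x, y] * z + ((i - 1) * j).negOnePow • (y * l 2 ![x, z]) := by
  have e : ∀ w : Multi R P, (Fin.snoc (α := fun _ => Multi R P) ![x] w) = ![x, w] := fun w => by
    funext a
    fin_cases a <;> rfl
  have := (h.isSkewDerivation 1).derivation ![x] ![i - 1] (fun a => by
    fin_cases a
    simpa [shiftedDeg] using hx) j y z hy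
  rw [e, e, e] at this
  refine this.trans ?_
  congr 3
  simp

theorem MultiDerivations.leibniz_three {w : Multi R P} (hx : x ∈ extDeg R P i)
    (hy : y ∈ extDeg R P j) (hz : z ∈ extDeg R P k) : l 3 ![x, y, z * w] =
      l 3 ![x, y, z] * w + ((i + j - 3) * k).negOnePow • (z * l 3 ![x, y, w]) := by
  have e : ∀ w : Multi R P, (Fin.snoc (α := fun _ => Multi R P) ![x, y] w) = ![x, y, w] :=
    fun w => by
      funext a
      fin_cases a <;> rfl
  have := (h.isSkewDerivation 2).derivation ![x, y] ![i - 1, j - 1] (fun a => by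
    fin_cases a
    · simpa [shiftedDeg] using hx
    · simpa [shiftedDeg] using hy) k z w hz
  rw [e, e, e] at this
  refine this.trans ?_
  congr 3
  simp only [Fin.sum_univ_two, Matrix.cons_val_zero, Matrix.cons_val_one]
  push_cast
  ring

theorem MultiDerivations.skew_two (hx : x ∈ extDeg R P i) (hy : y ∈ extDeg R P j) :
    l 2 ![y, x] = -(((i - 1) * (j - 1)).negOnePow • l 2 ![x, y]) := by
  have := (h.isSkewDerivation 1).skew ![x, y] ![i - 1, j - 1] (fun a => by
    fin_cases a
    · simpa [shiftedDeg] using hx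
    · simpa [shiftedDeg] using hy) (Equiv.swap 0 1)
  have e : (fun a => ![x, y] (Equiv.swap (0 : Fin 2) 1 a)) = ![y, x] := by
    funext a
    fin_cases a <;> rfl
  rw [e] at this
  rw [this, ← Units.neg_smul]
  congr 1
  simp [chi, Fin.prod_univ_two, mul_comm]

theorem MultiDerivations.skew_three (hx : x ∈ extDeg R P i) (hy : y ∈ extDeg R P j)
    (hz : z ∈ extDeg R P k) :
    l 3 ![y, x, z] = -(((i - 1) * (j - 1)).negOnePow • l 3 ![x, y, z]) := by
  have := (h.isSkewDerivation 2).skew ![x, y, z] ![i - 1, j - 1, k - 1] (fun a => by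
    fin_cases a
    · simpa [shiftedDeg] using hx
    · simpa [shiftedDeg] using hy
    · simpa [shiftedDeg] using hz) (Equiv.swap 0 1)
  have e : (fun a => ![x, y, z] (Equiv.swap (0 : Fin 3) 1 a)) = ![y, x, z] := by
    funext a
    fin_cases a <;> rfl
  rw [e] at this
  rw [this, ← Units.neg_smul]
  congr 1
  have e0 : Equiv.swap (0 : Fin 3) 1 0 = 1 := rfl
  have e1 : Equiv.swap (0 : Fin 3) 1 1 = 0 := rfl
  have e2 : Equiv.swap (0 : Fin 3) 1 2 = 2 := rfl
  simp [chi, Fin.prod_univ_three, e0, e1, e2, mul_comm]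

theorem MultiDerivations.skew_three' (hx : x ∈ extDeg R P i) (hy : y ∈ extDeg R P j)
    (hz : z ∈ extDeg R P k) :
    l 3 ![x, z, y] = -(((j - 1) * (k - 1)).negOnePow • l 3 ![x, y, z]) := by
  have := (h.isSkewDerivation 2).skew ![x, y, z] ![i - 1, j - 1, k - 1] (fun a => by
    fin_cases a
    · simpa [shiftedDeg] using hx
    · simpa [shiftedDeg] using hy
    · simpa [shiftedDeg] using hz) (Equiv.swap 1 2)
  have e : (fun a => ![x, y, z] (Equiv.swap (1 : Fin 3) 2 a)) = ![x, z, y] := by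
    funext a
    fin_cases a <;> rfl
  rw [e] at this
  rw [this, ← Units.neg_smul]
  congr 1
  have e0 : Equiv.swap (1 : Fin 3) 2 0 = 0 := rfl
  have e1 : Equiv.swap (1 : Fin 3) 2 1 = 2 := rfl
  have e2 : Equiv.swap (1 : Fin 3) 2 2 = 1 := rfl
  simp [chi, Fin.prod_univ_three, e0, e1, e2, mul_comm]

end OperationRules

/-! ### Operators representing the differential and the ternary operation -/

section RepresentingOperators

variable {R : Type*} [CommRing R] [Algebra ℝ R] {P : Type*} [AddCommGroup P] [Module ℝ P]
  [Module R P] [IsScalarTower ℝ R P] {κ : Type*} [Fintype κ]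
  {l : ∀ k : ℕ, MultilinearMap ℝ (fun _ : Fin k => Multi R P) (Multi R P)}

theorem Frame.Lin.smul {B : Frame R P κ} {A : P → Module.End ℝ (Form R P)} (hA : B.Lin A) (c : ℝ) :
    B.Lin fun X => c • A X := fun X => by
  simp only [mul_smul_comm, ← Finset.smul_sum]
  rw [hA X]

theorem lastArg_one (f : MultilinearMap ℝ (fun _ : Fin 1 => Multi R P) (Multi R P))
    (y : Multi R P) : lastArg f ![] y = f ![y] :=
  congrArg f (funext fun a => by fin_cases a; rfl)

theorem lastArg_two (f : MultilinearMap ℝ (fun _ : Fin 2 => Multi R P) (Multi R P))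
    (x y : Multi R P) : lastArg f ![x] y = f ![x, y] :=
  congrArg f (funext fun a => by fin_cases a <;> rfl)

theorem lastArg_three (f : MultilinearMap ℝ (fun _ : Fin 3 => Multi R P) (Multi R P))
    (x y z : Multi R P) : lastArg f ![x, y] z = f ![x, y, z] :=
  congrArg f (funext fun a => by fin_cases a <;> rfl)

theorem ins_smul (r : R) (X : P) :
    ins (r • X) = mulOp (algebraMap R (Form R P) r) * ins X := by
  rw [ins, map_smul, contractOp_smul]

theorem ins_add (X Y : P) : ins (R := R) (X + Y) = ins X + ins Y := by
  rw [ins, map_add, map_add]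

theorem scomm_mul_ins (m : ℤ) (G : Module.End ℝ (Form R P)) (r : R) (X : P) :
    scomm m (-1) G (ins (r • X)) = scomm m 0 G (mulOp (algebraMap R _ r)) * ins X +
      mulOp (algebraMap R _ r) * scomm m (-1) G (ins X) := by
  have := scomm_mul_right m 0 (-1) G (mulOp (algebraMap R _ r)) (ins X)
  rw [zero_add, mul_zero, Int.negOnePow_zero, one_smul] at this
  rw [ins_smul, this]

theorem Frame.scomm_ins_of_mem (B : Frame R P κ) {k m : ℤ} {E : Module.End ℝ (Form R P)}
    (hE : E ∈ ops R P k 0) (hm : -k = m) (X : P) : scomm m (-1) E (ins X) = 0 := by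
  subst hm
  exact B.scomm_contractOp_of_mem hE (ι_mem_extDeg X)

theorem Frame.scomm_function_of_mem (B : Frame R P κ) {k m : ℤ} {E : Module.End ℝ (Form R P)}
    (hE : E ∈ ops R P k 0) (hm : -k = m) (f : R) :
    scomm m 0 E (mulOp (algebraMap R _ f)) = 0 := by
  subst hm
  have := B.scomm_contractOp_of_mem hE (algebraMap_mem_extDeg f)
  rwa [neg_zero, contractOp_algebraMap] at this

theorem MultiDerivations.exists_anchor (h : MultiDerivations l) : ∃ V : R →ₗ[ℝ] P,
    (∀ f, l 1 ![algebraMap R _ f] = ExteriorAlgebra.ι R (V f)) ∧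
      ∀ f g, V (f * g) = f • V g + g • V f := by
  have hV : ∀ f : R, ∃ Y : P, l 1 ![algebraMap R _ f] = ExteriorAlgebra.ι R Y := fun f =>
    exists_ι_eq (h.mem_one (algebraMap_mem_extDeg f))
  choose V hV using hV
  have hinj : Function.Injective (ExteriorAlgebra.ι R : P → Multi R P) :=
    ExteriorAlgebra.ι_leftInverse.injective
  refine ⟨{ toFun := V, map_add' := fun f g => hinj ?_, map_smul' := fun r f => hinj ?_ }, hV,
    fun f g => hinj ?_⟩
  · rw [map_add, ← hV, ← hV, ← hV, map_add, ← lastArg_one, ← lastArg_one, ← lastArg_one, map_add]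
  · have e : ExteriorAlgebra.ι R (r • V f) = r • ExteriorAlgebra.ι R (V f) := by
      rw [← algebraMap_smul R r (V f), map_smul, algebraMap_smul]
    have e' : algebraMap R (Multi R P) (r • f) = r • algebraMap R (Multi R P) f := by
      rw [Algebra.algebraMap_eq_smul_one, Algebra.algebraMap_eq_smul_one, smul_assoc]
    rw [RingHom.id_apply, e, ← hV, ← hV, e', ← lastArg_one, ← lastArg_one, map_smul]
  · change ExteriorAlgebra.ι R (V (f * g)) = ExteriorAlgebra.ι R (f • V g + g • V f)
    rw [← hV, map_mul, h.leibniz_one (algebraMap_mem_extDeg f), hV, hV, map_add, map_smul,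
      map_smul, Algebra.smul_def, Algebra.smul_def, Int.negOnePow_zero, one_smul, add_comm,
      Algebra.commutes g]

/-- A derivation of the functions with values in sections is represented by an operator. -/
theorem Frame.exists_lift_section (B : Frame R P κ) (V : R →ₗ[ℝ] P)
    (hV : ∀ f g, V (f * g) = f • V g + g • V f) : ∃ G ∈ ops R P 2 1,
      ∀ f, scomm (-1) 0 G (mulOp (algebraMap R _ f)) = ins (V f) := by
  -- Each component ε_i ∘ V is a derivation of the functions and lifts to forms; composing its lift
  -- with the contraction by e_i gives the operator ∑ N_i ∘ ι_{e_i}.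
  choose N hN hNf using fun i => B.exists_lift ((B.ε i).restrictScalars ℝ ∘ₗ V) fun f g => by
    change B.ε i (V (f * g)) = f * B.ε i (V g) + B.ε i (V f) * g
    rw [hV, map_add, map_smul, map_smul, smul_eq_mul, smul_eq_mul, mul_comm g]
  have hm : ∀ i, N i * ins (B.e i) ∈ diffOp R (Module.Dual R P) 3 (0 + -1) := fun i =>
    diffOp_mul (a := 2) (b := 2) (by norm_num) (hN i) (ins_mem (B.e i))
  refine ⟨∑ i, N i * ins (B.e i), Submodule.sum_mem _ fun i _ => hm i, fun f => ?_⟩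
  rw [ins, ← B.sum_smul (V f), map_sum, map_sum, scomm_sum_left]
  refine Finset.sum_congr rfl fun i _ => ?_
  rw [map_smul, contractOp_smul]
  have h1 := scomm_mul 0 (-1) 0 (N i) (ins (B.e i)) (mulOp (algebraMap R _ f))
  rw [hNf, B.scomm_function_of_mem (contractOp_mem (ι_mem_extDeg (B.e i))) rfl, mul_zero,
    zero_add, zero_add, mul_zero, Int.negOnePow_zero, one_smul] at h1
  exact h1

/-- A lift G0 of the anchor has the right commutators with functions, so its defect E on sections is
linear over functions. The term `B.wedge E` corrects the commutators with sections and does not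
change those with functions. -/
theorem Frame.exists_represents_one (B : Frame R P κ) (h : MultiDerivations l) :
    ∃ G ∈ ops R P 2 1, ∀ a : ℤ × Multi R P, IsGen a →
      contractOp R P (l 1 ![a.2]) = iter (-1) G [a] := by
  obtain ⟨V, hV, hVmul⟩ := h.exists_anchor
  obtain ⟨G0, hG0m, hG0f⟩ := B.exists_lift_section V hVmul
  set E : P → Module.End ℝ (Form R P) := fun X =>
    contractOp R P (lastArg (l 1) ![] (ExteriorAlgebra.ι R X)) - scomm (-1) (-1) G0 (ins X) with hE
  have hEm : ∀ X, E X ∈ ops R P 2 0 := fun X => Submodule.sub_mem _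
    (contractOp_mem (by rw [lastArg_one]; exact h.mem_one (ι_mem_extDeg X)))
    (scomm_mem_ops hG0m (contractOp_mem (ι_mem_extDeg X)))
  have hlin : B.Lin E := by
    refine B.lin_of (fun X Y => ?_) fun r X => ?_
    · simp only [hE]
      rw [ins_add, scomm_add_right, map_add, map_add, map_add]
      abel
    · simp only [hE]
      rw [scomm_mul_ins, hG0f, ins, ← hV, map_smul, lastArg_one, lastArg_one, Algebra.smul_def,
        h.leibniz_one (algebraMap_mem_extDeg r), map_add, contractOp_mul, Int.negOnePow_zero,
        one_smul, contractOp_mul, contractOp_algebraMap, mul_sub]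
      abel
  refine ⟨G0 + B.wedge E, Submodule.add_mem _ hG0m (Frame.wedge_mem hEm), ?_⟩
  rintro a (⟨f, rfl⟩ | ⟨X, rfl⟩)
  · change _ = scomm (-1) (-0) (G0 + B.wedge E) (contractOp R P (algebraMap R _ f))
    rw [neg_zero, contractOp_algebraMap, scomm_add_left, hG0f, ins, ← hV,
      Frame.scomm_wedge_function (m := -2) (by norm_num)]
    simp only [B.scomm_function_of_mem (hEm _) rfl]
    rw [Frame.wedge_zero, add_zero]
  · change _ = scomm (-1) (-1) (G0 + B.wedge E) (ins X)
    rw [scomm_add_left, Frame.scomm_wedge_ins hlin (m := -2) (by norm_num)]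
    simp only [B.scomm_ins_of_mem (hEm _) rfl]
    rw [Frame.wedge_zero, zero_add, Int.negOnePow_even (-2) (by decide), one_smul]
    simp only [hE]
    rw [lastArg_one, add_sub_cancel]

/-- On sections l_3 is a trilinear alternating form c, and F is 1/6 of the triple wedge of c.
Successive commutators with sections produce the factors 3, -2 and 1, so the iterated bracket of F
is -c; this is the sign in the definition of l_3. -/
theorem Frame.exists_represents_three (B : Frame R P κ) (h : MultiDerivations l) :
    ∃ F ∈ ops R P 0 3, ∀ X Y Z : P,
    contractOp R P (l 3 ![ExteriorAlgebra.ι R X, ExteriorAlgebra.ι R Y, ExteriorAlgebra.ι R Z]) =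
      -iter 3 F [(1, ExteriorAlgebra.ι R X), (1, ExteriorAlgebra.ι R Y),
        (1, ExteriorAlgebra.ι R Z)] := by
  set c : P → P → P → Module.End ℝ (Form R P) := fun X Y Z => contractOp R P
    (lastArg (l 3) ![ExteriorAlgebra.ι R X, ExteriorAlgebra.ι R Y] (ExteriorAlgebra.ι R Z)) with hc
  have hcm : ∀ X Y Z, c X Y Z ∈ ops R P 0 0 := fun X Y Z => contractOp_mem (by
    rw [lastArg_three]
    exact h.mem_three (ι_mem_extDeg X) (ι_mem_extDeg Y) (ι_mem_extDeg Z))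
  have hs1 : ∀ X Y Z, c Y X Z = (-1 : ℝ) • c X Y Z := fun X Y Z => by
    simp only [hc]
    rw [lastArg_three, lastArg_three, h.skew_three (ι_mem_extDeg X) (ι_mem_extDeg Y)
      (ι_mem_extDeg Z)]
    simp only [sub_self, mul_zero, Int.negOnePow_zero, one_smul, map_neg]
    exact (neg_one_smul ℝ _).symm
  have hs2 : ∀ X Y Z, c X Z Y = (-1 : ℝ) • c X Y Z := fun X Y Z => by
    simp only [hc]
    rw [lastArg_three, lastArg_three, h.skew_three' (ι_mem_extDeg X) (ι_mem_extDeg Y)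
      (ι_mem_extDeg Z)]
    simp only [sub_self, mul_zero, Int.negOnePow_zero, one_smul, map_neg]
    exact (neg_one_smul ℝ _).symm
  -- Linearity over functions: l_3 of two sections and a function would have degree -1, so the
  -- anchor term in the Leibniz rule is absent.
  have hl3 : ∀ X Y, B.Lin fun Z => c X Y Z := fun X Y =>
    B.lin_contractOp (lastArg (l 3) ![ExteriorAlgebra.ι R X, ExteriorAlgebra.ι R Y]) fun r Z => by
      rw [lastArg_three, lastArg_three, h.leibniz_three (ι_mem_extDeg X) (ι_mem_extDeg Y)
        (algebraMap_mem_extDeg r), eq_zero_of_mem_extDeg_neg (h.mem_three (ι_mem_extDeg X)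
        (ι_mem_extDeg Y) (algebraMap_mem_extDeg r)) (by norm_num), zero_mul, zero_add, mul_zero,
        Int.negOnePow_zero, one_smul]
  have hl2 : ∀ X Z, B.Lin fun Y => c X Y Z := fun X Z => by
    have := (hl3 X Z).smul (-1)
    simpa only [← hs2] using this
  have hl1 : ∀ Y Z, B.Lin fun X => c X Y Z := fun Y Z => by
    have := (hl2 Y Z).smul (-1)
    simpa only [← hs1] using this
  have hw2 : ∀ X, B.Lin fun Y => B.wedge (c X Y) := fun X => Frame.Lin.wedge (hl2 X)
  have hw1 : B.Lin fun X => B.wedge fun Y => B.wedge (c X Y) :=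
    Frame.Lin.wedge fun Y => Frame.Lin.wedge (hl1 Y)
  have e1 : ∀ X Y W, scomm 1 (-1) (B.wedge (c X Y)) (ins W) = c X Y W := fun X Y W => by
    rw [Frame.scomm_wedge_ins (hl3 X Y) (m := 0) (by norm_num)]
    simp only [B.scomm_ins_of_mem (hcm _ _ _) neg_zero]
    rw [Frame.wedge_zero, zero_add, Int.negOnePow_zero, one_smul]
  have e2 : ∀ X W, scomm 2 (-1) (B.wedge fun Y => B.wedge (c X Y)) (ins W) =
      (-2 : ℝ) • B.wedge (c X W) := fun X W => by
    rw [Frame.scomm_wedge_ins (hw2 X) (m := 1) (by norm_num)]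
    simp only [e1, hs2 X W]
    rw [Frame.wedge_smul, Int.negOnePow_odd 1 (by decide), Units.neg_smul, one_smul]
    module
  have e3 : ∀ W, scomm 3 (-1) (B.wedge fun X => B.wedge fun Y => B.wedge (c X Y)) (ins W) =
      (3 : ℝ) • B.wedge fun Y => B.wedge (c W Y) := fun W => by
    rw [Frame.scomm_wedge_ins hw1 (m := 2) (by norm_num)]
    have e4 : ∀ X, B.wedge (c X W) = (-1 : ℝ) • B.wedge (c W X) := fun X => by
      rw [← Frame.wedge_smul]
      congr 1
      funext Z
      exact hs1 W X Z
    simp only [e2, e4]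
    rw [Frame.wedge_smul, Frame.wedge_smul, Int.negOnePow_even 2 (by decide), one_smul]
    module
  refine ⟨(1 / 6 : ℝ) • B.wedge fun X => B.wedge fun Y => B.wedge (c X Y),
    Submodule.smul_mem _ _ (Frame.wedge_mem fun X => Frame.wedge_mem (l := 1) fun Y =>
      Frame.wedge_mem (l := 0) (hcm X Y)), fun X Y Z => ?_⟩
  rw [iter_smul]
  change _ = -((1 / 6 : ℝ) • scomm 1 (-1) (scomm 2 (-1) (scomm 3 (-1) _ (ins X)) (ins Y)) (ins Z))
  rw [e3, scomm_smul_left, e2, scomm_smul_left, scomm_smul_left, e1]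
  simp only [hc]
  rw [lastArg_three]
  module

end RepresentingOperators

/-! ### An operator representing the binary bracket -/

section RepresentingBracket

variable {R : Type*} [CommRing R] [Algebra ℝ R] {P : Type*} [AddCommGroup P] [Module ℝ P]
  [Module R P] [IsScalarTower ℝ R P] {κ : Type*} [Fintype κ]
  {l : ∀ k : ℕ, MultilinearMap ℝ (fun _ : Fin k => Multi R P) (Multi R P)}

theorem add_left_two (f : MultilinearMap ℝ (fun _ : Fin 2 => Multi R P) (Multi R P))
    (x x' y : Multi R P) : f ![x + x', y] = f ![x, y] + f ![x', y] := f.cons_add ![y] x x'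

theorem algebraMap_real_smul (r : ℝ) (f : R) :
    algebraMap R (Multi R P) (r • f) = r • algebraMap R (Multi R P) f := by
  rw [Algebra.algebraMap_eq_smul_one, Algebra.algebraMap_eq_smul_one, smul_assoc]

theorem MultiDerivations.exists_anchor_two (h : MultiDerivations l) (X : P) : ∃ V : R →ₗ[ℝ] R,
    (∀ f, l 2 ![ExteriorAlgebra.ι R X, algebraMap R _ f] = algebraMap R _ (V f)) ∧
      ∀ f g, V (f * g) = f * V g + V f * g := by
  have hV : ∀ f : R, ∃ r : R, l 2 ![ExteriorAlgebra.ι R X, algebraMap R _ f] =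
      algebraMap R _ r := fun f =>
    exists_algebraMap_eq (h.mem_two (ι_mem_extDeg X) (algebraMap_mem_extDeg f))
  choose V hV using hV
  have hinj : Function.Injective (algebraMap R (Multi R P)) :=
    ExteriorAlgebra.algebraMap_leftInverse P |>.injective
  refine ⟨{ toFun := V, map_add' := fun f g => hinj ?_, map_smul' := fun r f => hinj ?_ }, hV,
    fun f g => hinj ?_⟩
  · rw [map_add, ← hV, ← hV, ← hV, map_add, ← lastArg_two, ← lastArg_two, ← lastArg_two, map_add]
  · rw [RingHom.id_apply, algebraMap_real_smul, ← hV, ← hV, algebraMap_real_smul, ← lastArg_two,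
      ← lastArg_two, map_smul]
  · change algebraMap R _ (V (f * g)) = algebraMap R _ (f * V g + V f * g)
    rw [← hV, map_mul, h.leibniz_two (ι_mem_extDeg X) (algebraMap_mem_extDeg f), hV, hV, map_add,
      map_mul, map_mul, mul_zero, Int.negOnePow_zero, one_smul, add_comm]

/-- The bracket of two functions has degree -1 and vanishes, so moving the function to the first
place leaves no derivative of r. -/
theorem MultiDerivations.bracket_smul_function (h : MultiDerivations l) (r f : R) (X : P) :
    l 2 ![ExteriorAlgebra.ι R (r • X), algebraMap R _ f] =
      algebraMap R _ r * l 2 ![ExteriorAlgebra.ι R X, algebraMap R _ f] := by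
  have h1 : ∀ X : P, l 2 ![ExteriorAlgebra.ι R X, algebraMap R _ f] =
      -l 2 ![algebraMap R _ f, ExteriorAlgebra.ι R X] := fun X => by
    rw [h.skew_two (algebraMap_mem_extDeg f) (ι_mem_extDeg X), sub_self, mul_zero,
      Int.negOnePow_zero, one_smul]
  rw [h1, h1, map_smul, Algebra.smul_def, h.leibniz_two (algebraMap_mem_extDeg f)
    (algebraMap_mem_extDeg r), eq_zero_of_mem_extDeg_neg (h.mem_two (algebraMap_mem_extDeg f)
    (algebraMap_mem_extDeg r)) (by norm_num), zero_mul, zero_add, mul_zero, Int.negOnePow_zero,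
    one_smul, mul_neg]

/-- A family of derivations of the functions, linear in a section, is represented by an
operator. -/
theorem Frame.exists_lift_anchor (B : Frame R P κ) (V : P → R →ₗ[ℝ] R)
    (hV : ∀ X f g, V X (f * g) = f * V X g + V X f * g)
    (hlin : ∀ f, B.Lin fun X => mulOp (algebraMap R _ (V X f))) : ∃ D ∈ ops R P 1 2,
      ∀ X f, scomm 0 0 (scomm 1 (-1) D (ins X)) (mulOp (algebraMap R _ f)) =
        mulOp (algebraMap R _ (V X f)) := by
  choose N hN hNf using fun X => B.exists_lift (V X) (hV X)
  refine ⟨B.wedge N, Frame.wedge_mem (l := 1) hN, fun X f => ?_⟩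
  have h1 : scomm 1 0 (B.wedge N) (mulOp (algebraMap R _ f)) =
      B.wedge fun Y => mulOp (algebraMap R _ (V Y f)) := by
    rw [Frame.scomm_wedge_function (m := 0) (by norm_num)]
    simp only [hNf]
  have h2 := iter_swap 1 (B.wedge N) (a := (1, ExteriorAlgebra.ι R X))
    (b := (0, algebraMap R _ f)) (ι_mem_extDeg X) (algebraMap_mem_extDeg f) []
  simp only [iter, contractOp_algebraMap, mul_zero, Int.negOnePow_zero, one_smul, sub_self,
    neg_zero, sub_zero] at h2
  rw [ins, h2, h1, Frame.scomm_wedge_ins (hlin f) (m := 0) (by norm_num), Int.negOnePow_zero,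
    one_smul]
  have h3 : ∀ Y, scomm 0 (-1) (mulOp (algebraMap R (Form R P) (V Y f))) (ins X) = 0 := fun Y => by
    rw [← contractOp_algebraMap]
    exact B.scomm_ins_of_mem (contractOp_mem (algebraMap_mem_extDeg _)) neg_zero X
  simp only [h3]
  rw [Frame.wedge_zero, zero_add]

/-- D0 lifts the anchor, and its defect c on pairs of sections is bilinear over functions and skew.
Commuting the double wedge of c with two sections produces the factors 2 and -1, so the coefficient
-1/2 adds exactly c. -/
theorem Frame.exists_represents_two (B : Frame R P κ) (h : MultiDerivations l) :
    ∃ D ∈ ops R P 1 2, ∀ (X : P) (b : ℤ × Multi R P), IsGen b →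
      contractOp R P (l 2 ![ExteriorAlgebra.ι R X, b.2]) =
        iter 1 D [(1, ExteriorAlgebra.ι R X), b] := by
  choose V hV hVmul using h.exists_anchor_two
  obtain ⟨D0, hD0m, hD0⟩ := B.exists_lift_anchor V hVmul fun f => by
    refine B.lin_of (fun X Y => ?_) fun r X => ?_
    · rw [← contractOp_algebraMap, ← contractOp_algebraMap, ← contractOp_algebraMap, ← hV, ← hV,
        ← hV, map_add, add_left_two, map_add]
    · rw [← contractOp_algebraMap, ← contractOp_algebraMap, ← contractOp_algebraMap, ← hV, ← hV,
        h.bracket_smul_function, contractOp_mul]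
  set c : P → P → Module.End ℝ (Form R P) := fun X Y => contractOp R P
    (lastArg (l 2) ![ExteriorAlgebra.ι R X] (ExteriorAlgebra.ι R Y)) -
      scomm 0 (-1) (scomm 1 (-1) D0 (ins X)) (ins Y) with hc
  have hcm : ∀ X Y, c X Y ∈ ops R P 1 0 := fun X Y => Submodule.sub_mem _
    (contractOp_mem (by rw [lastArg_two]; exact h.mem_two (ι_mem_extDeg X) (ι_mem_extDeg Y)))
    (scomm_mem_ops (k := 1) (l := 1) (scomm_mem_ops hD0m (contractOp_mem (ι_mem_extDeg X)))
      (contractOp_mem (ι_mem_extDeg Y)))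
  have hs : ∀ X Y, c Y X = (-1 : ℝ) • c X Y := fun X Y => by
    have h2 := iter_swap 1 D0 (a := (1, ExteriorAlgebra.ι R Y))
      (b := (1, ExteriorAlgebra.ι R X)) (ι_mem_extDeg Y) (ι_mem_extDeg X) []
    simp only [iter, sub_self, mul_one, Int.negOnePow_one, Units.neg_smul, one_smul] at h2
    simp only [hc]
    rw [lastArg_two, lastArg_two, h.skew_two (ι_mem_extDeg X) (ι_mem_extDeg Y), ins, h2, sub_self,
      mul_zero, Int.negOnePow_zero, one_smul, map_neg]
    module
  have hl2 : ∀ X, B.Lin fun Y => c X Y := fun X => by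
    refine B.lin_of (fun Y Z => ?_) fun r Y => ?_
    · simp only [hc]
      rw [ins_add, scomm_add_right, map_add, map_add, map_add]
      abel
    · simp only [hc]
      rw [scomm_mul_ins, hD0, map_smul, Algebra.smul_def, lastArg_two, lastArg_two,
        h.leibniz_two (ι_mem_extDeg X) (algebraMap_mem_extDeg r), map_add, contractOp_mul,
        mul_zero, Int.negOnePow_zero, one_smul, contractOp_mul, contractOp_algebraMap, hV,
        contractOp_algebraMap, mul_sub]
      abel
  have hl1 : ∀ Y, B.Lin fun X => c X Y := fun Y => by
    have := (hl2 Y).smul (-1)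
    simpa only [← hs] using this
  have e1 : ∀ X W, scomm 0 (-1) (B.wedge (c X)) (ins W) = (-1 : ℝ) • c X W := fun X W => by
    rw [Frame.scomm_wedge_ins (hl2 X) (m := -1) (by norm_num)]
    simp only [B.scomm_ins_of_mem (hcm _ _) rfl]
    rw [Frame.wedge_zero, zero_add, Int.negOnePow_odd (-1) (by decide), Units.neg_smul, one_smul]
    exact (neg_one_smul ℝ _).symm
  have e2 : ∀ W, scomm 1 (-1) (B.wedge fun X => B.wedge (c X)) (ins W) =
      (2 : ℝ) • B.wedge (c W) := fun W => by
    rw [Frame.scomm_wedge_ins (Frame.Lin.wedge hl1) (m := 0) (by norm_num)]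
    simp only [e1, ← hs]
    rw [Int.negOnePow_zero, one_smul]
    exact (two_smul ℝ _).symm
  refine ⟨D0 + (-1 / 2 : ℝ) • B.wedge fun X => B.wedge (c X), Submodule.add_mem _ hD0m
    (Submodule.smul_mem _ _ (Frame.wedge_mem fun X => Frame.wedge_mem (l := 0) (hcm X))), ?_⟩
  rintro X b (⟨f, rfl⟩ | ⟨Y, rfl⟩)
  · change _ = scomm (1 - 1) (-0) (scomm 1 (-1) _ (ins X)) (contractOp R P (algebraMap R _ f))
    rw [neg_zero, sub_self, contractOp_algebraMap, scomm_add_left, scomm_add_left, hD0,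
      scomm_smul_left, scomm_smul_left, e2, scomm_smul_left,
      Frame.scomm_wedge_function (m := -1) (by norm_num)]
    simp only [B.scomm_function_of_mem (hcm _ _) rfl]
    rw [Frame.wedge_zero, smul_zero, smul_zero, add_zero, hV, contractOp_algebraMap]
  · change _ = scomm (1 - 1) (-1) (scomm 1 (-1) _ (ins X)) (ins Y)
    rw [sub_self, scomm_add_left, scomm_add_left, scomm_smul_left, scomm_smul_left, e2,
      scomm_smul_left, e1]
    simp only [hc]
    rw [lastArg_two]
    module

/-- Every differential quasi-Gerstenhaber algebra corresponds to exactly one quasi-Lie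
bialgebroid. -/
theorem Frame.existsUnique_corresponds' (B : Frame R P κ) (S : DiffQuasiGerstenhaber R P) :
    ∃! Q : QuasiLieBialgebroid R P, Corresponds Q S := by
  obtain ⟨G, hG, h1⟩ := B.exists_represents_one S.multiDerivations
  obtain ⟨D, hD, h2⟩ := B.exists_represents_two S.multiDerivations
  obtain ⟨F, hF, h3⟩ := B.exists_represents_three S.multiDerivations
  exact Represents.existsUnique B hG hD hF ⟨h1, h2, h3⟩

end RepresentingBracket

/-! ### The Jacobi identities on sections and functions -/

section SectionIdentities

variable {R : Type*} [CommRing R] [Algebra ℝ R] {P : Type*} [AddCommGroup P] [Module ℝ P]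
  [Module R P] [IsScalarTower ℝ R P]
  {l : ∀ k : ℕ, MultilinearMap ℝ (fun _ : Fin k => Multi R P) (Multi R P)}

theorem opList_singleton (a : ℤ × Multi R P) : opList l [a] = l 1 ![a.2] :=
  (apply_eq_opList _ _ rfl fun i => by fin_cases i; rfl).symm

theorem opList_pair (a b : ℤ × Multi R P) : opList l [a, b] = l 2 ![a.2, b.2] :=
  (apply_eq_opList _ _ rfl fun i => by fin_cases i <;> rfl).symm

theorem opList_triple (a b c : ℤ × Multi R P) : opList l [a, b, c] = l 3 ![a.2, b.2, c.2] :=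
  (apply_eq_opList _ _ rfl fun i => by fin_cases i <;> rfl).symm

/-- In the intended uses the shifted degrees are 0 for sections and -1 for at most one function. All
products of degrees then vanish, and only the signs of the unshuffles remain. -/
theorem nested_three_zero (x y z : Multi R P) {d : Fin 3 → ℤ} (h01 : d 0 * d 1 = 0) (h02 : d 0 * d 2 = 0)
    (h12 : d 1 * d 2 = 0) :
    nested l 0 ![x, y, z] d = l 3 ![l 1 ![x], y, z] - l 3 ![l 1 ![y], x, z] + l 3 ![l 1 ![z], x, y] := by
  -- The integer entries of the lists do not affect `opList`, so they are set to zero.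
  rw [nested_eq_sum (0 : Fin 3) _ d (fun i => (0, ![x, y, z] i)) (fun _ => rfl) (fun _ => 0)]
  simp only [sum_bool_succ, part, chiExp, Fin.cons_zero, Fin.cons_succ, reduceIte, Bool.false_eq_true,
    Bool.true_eq_false, Fin.sum_univ_succ, Fin.sum_univ_zero]
  simp [opList_singleton, opList_triple, h01, h02, h12, Units.neg_smul,
    Int.negOnePow_even 2 (by decide)]
  abel

theorem nested_three_one (x y z : Multi R P) {d : Fin 3 → ℤ} (h01 : d 0 * d 1 = 0) (h02 : d 0 * d 2 = 0)
    (h12 : d 1 * d 2 = 0) :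
    nested l 1 ![x, y, z] d = l 2 ![l 2 ![x, y], z] - l 2 ![l 2 ![x, z], y] + l 2 ![l 2 ![y, z], x] := by
  rw [nested_eq_sum (1 : Fin 3) _ d (fun i => (0, ![x, y, z] i)) (fun _ => rfl) (fun _ => 0)]
  simp only [sum_bool_succ, part, chiExp, Fin.cons_zero, Fin.cons_succ, reduceIte, Bool.false_eq_true,
    Bool.true_eq_false, Fin.sum_univ_succ, Fin.sum_univ_zero]
  simp [opList_pair, h01, h02, h12, Units.neg_smul,
    Int.negOnePow_even 2 (by decide)]
  abel

theorem nested_three_two (x y z : Multi R P) (d : Fin 3 → ℤ) :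
    nested l 2 ![x, y, z] d = l 1 ![l 3 ![x, y, z]] := by
  rw [nested_eq_sum (2 : Fin 3) _ d (fun i => (0, ![x, y, z] i)) (fun _ => rfl) (fun _ => 0)]
  simp only [sum_bool_succ, part, chiExp, Fin.cons_zero, Fin.cons_succ, reduceIte, Bool.false_eq_true,
    Bool.true_eq_false, Fin.sum_univ_succ, Fin.sum_univ_zero]
  simp [opList_singleton, opList_triple]

theorem nested_four_one (x y z w : Multi R P) :
    nested l 1 ![x, y, z, w] (fun _ => 0) = 
      l 3 ![l 2 ![x, y], z, w] - l 3 ![l 2 ![x, z], y, w] + l 3 ![l 2 ![x, w], y, z] +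
        l 3 ![l 2 ![y, z], x, w] - l 3 ![l 2 ![y, w], x, z] + l 3 ![l 2 ![z, w], x, y] := by
  rw [nested_eq_sum (1 : Fin 4) _ (fun _ => 0) (fun i => (0, ![x, y, z, w] i)) (fun _ => rfl) (fun _ => 0)]
  simp only [sum_bool_succ, part, chiExp, Fin.cons_zero, Fin.cons_succ, reduceIte, Bool.false_eq_true,
    Bool.true_eq_false, Fin.sum_univ_succ, Fin.sum_univ_zero]
  simp [opList_pair, opList_triple, Units.neg_smul, Int.negOnePow_even 2 (by decide), Int.negOnePow_odd 3 (by decide),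
    Int.negOnePow_even 4 (by decide)]
  abel

theorem nested_four_two (x y z w : Multi R P) :
    nested l 2 ![x, y, z, w] (fun _ => 0) = 
      l 2 ![l 3 ![x, y, z], w] - l 2 ![l 3 ![x, y, w], z] + l 2 ![l 3 ![x, z, w], y] -
        l 2 ![l 3 ![y, z, w], x] := by
  rw [nested_eq_sum (2 : Fin 4) _ (fun _ => 0) (fun i => (0, ![x, y, z, w] i)) (fun _ => rfl) (fun _ => 0)]
  simp only [sum_bool_succ, part, chiExp, Fin.cons_zero, Fin.cons_succ, reduceIte, Bool.false_eq_true,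
    Bool.true_eq_false, Fin.sum_univ_succ, Fin.sum_univ_zero]
  simp [opList_pair, opList_triple, Units.neg_smul,
    Int.negOnePow_even 2 (by decide), Int.negOnePow_odd 3 (by decide)]
  abel

theorem nested_eq_zero_of_outer {n : ℕ} {p : Fin n} (h0 : l (n - (p + 1) + 1) = 0)
    (x : Fin n → Multi R P) (d : Fin n → ℤ) : nested l p x d = 0 :=
  Finset.sum_eq_zero fun σ _ => by rw [h0]; simp

theorem nested_eq_zero_of_inner {n : ℕ} {p : Fin n} (h0 : l (p + 1) = 0)
    (x : Fin n → Multi R P) (d : Fin n → ℤ) : nested l p x d = 0 :=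
  Finset.sum_eq_zero fun σ _ => by
    rw [h0]
    have : l (n - (p + 1) + 1) (Fin.cons
      ((0 : MultilinearMap ℝ (fun _ : Fin (p + 1) => Multi R P) (Multi R P))
        fun a => x (σ ⟨a, by omega⟩))
      (fun b : Fin (n - (p + 1)) => x (σ ⟨p + 1 + b, by omega⟩))) = 0 :=
      (l _).map_coord_zero 0 (Fin.cons_zero _ _)
    rw [this, smul_zero, ite_self]

/-- With a function and a section frozen, l_3 is a derivation in its remaining argument that
vanishes on generators by degree, hence everywhere. Skew-symmetry then moves the function to the
end. -/
theorem MultiDerivations.three_function_eq_zero (h : MultiDerivations l) {i : ℤ} {x : Multi R P}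
    (hx : x ∈ extDeg R P i) (Y : P) (f : R) :
    l 3 ![x, ExteriorAlgebra.ι R Y, algebraMap R _ f] = 0 := by
  have h0 : ∀ {y : Multi R P} {j : ℤ}, y ∈ extDeg R P j → j ≤ 1 →
      l 3 ![algebraMap R _ f, ExteriorAlgebra.ι R Y, y] = 0 := fun hy hj =>
    eq_zero_of_mem_extDeg_neg (h.mem_three (algebraMap_mem_extDeg f) (ι_mem_extDeg Y) hy)
      (by omega)
  have h1 : lastArg (l 3) ![algebraMap R _ f, ExteriorAlgebra.ι R Y] = 0 := by
    refine derivation_ext (0 + 1 - 3) (fun e y hy z => ?_) (fun e y hy z => ?_) (fun r => ?_)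
      fun X => ?_
    · simp only [lastArg_three]
      exact h.leibniz_three (algebraMap_mem_extDeg f) (ι_mem_extDeg Y) hy
    · simp
    · rw [lastArg_three, h0 (algebraMap_mem_extDeg r) (by norm_num)]
      rfl
    · rw [lastArg_three, h0 (ι_mem_extDeg X) le_rfl]
      rfl
  have h2 : l 3 ![algebraMap R _ f, ExteriorAlgebra.ι R Y, x] = 0 := by
    rw [← lastArg_three, h1]
    rfl
  have h3 := h.skew_three (algebraMap_mem_extDeg f) (ι_mem_extDeg Y) hx
  have h4 := h.skew_three' (ι_mem_extDeg Y) (algebraMap_mem_extDeg f) hx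
  have h5 := h.skew_three (ι_mem_extDeg Y) hx (algebraMap_mem_extDeg f)
  rw [h2, smul_zero, neg_zero] at h3
  rw [h3, smul_zero, neg_zero] at h4
  rw [h4, smul_zero, neg_zero] at h5
  exact h5

/-- The anchor relation is the ternary Jacobi identity on X, Y, f, and the Jacobiator is the same
identity on X, Y, Z. Coherence is the quaternary identity on X, Y, Z, W, from which the two terms
with l_4 drop out. -/
theorem DiffQuasiGerstenhaber.sectionRelations (S : DiffQuasiGerstenhaber R P) :
    SectionRelations S := by
  have h := S.multiDerivations
  have hι : ∀ X : P, ExteriorAlgebra.ι R X ∈ shiftedDeg R P 0 := ι_mem_extDeg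
  have hf : ∀ f : R, algebraMap R (Multi R P) f ∈ shiftedDeg R P (-1) := algebraMap_mem_extDeg
  have hsk : ∀ {i : ℤ} (X : P) {y : Multi R P}, y ∈ extDeg R P i →
      S.l 2 ![y, ExteriorAlgebra.ι R X] = -S.l 2 ![ExteriorAlgebra.ι R X, y] := fun X y hy => by
    rw [h.skew_two (ι_mem_extDeg X) hy, sub_self, zero_mul, Int.negOnePow_zero, one_smul]
  have h3 : ∀ (x y z : Multi R P) (d : Fin 3 → ℤ), (∀ i, ![x, y, z] i ∈ shiftedDeg R P (d i)) →
      d 0 * d 1 = 0 → d 0 * d 2 = 0 → d 1 * d 2 = 0 →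
      -(S.l 3 ![S.l 1 ![x], y, z] - S.l 3 ![S.l 1 ![y], x, z] + S.l 3 ![S.l 1 ![z], x, y]) +
        (S.l 2 ![S.l 2 ![x, y], z] - S.l 2 ![S.l 2 ![x, z], y] + S.l 2 ![S.l 2 ![y, z], x]) -
          S.l 1 ![S.l 3 ![x, y, z]] = 0 := by
    intro x y z d hd h01 h02 h12
    have := S.jacobi 3 ![x, y, z] d hd
    rw [Fin.sum_univ_three, nested_three_zero x y z h01 h02 h12,
      nested_three_one x y z h01 h02 h12, nested_three_two] at this
    have e0 : (((0 : Fin 3) : ℤ) + 1).negOnePow = -1 := Int.negOnePow_odd 1 (by decide)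
    have e1 : (((1 : Fin 3) : ℤ) + 1).negOnePow = 1 := Int.negOnePow_even 2 (by decide)
    have e2 : (((2 : Fin 3) : ℤ) + 1).negOnePow = -1 := Int.negOnePow_odd 3 (by decide)
    rw [e0, e1, e2] at this
    simp only [Units.neg_smul, one_smul] at this
    rw [sub_eq_add_neg _ (S.l 1 _)]
    exact this
  refine ⟨fun X Y f => ?_, fun X Y Z => ?_, fun X Y Z W => ?_⟩
  · have := h3 (ExteriorAlgebra.ι R X) (ExteriorAlgebra.ι R Y) (algebraMap R _ f) ![0, 0, -1]
      (fun i => by fin_cases i; exacts [hι X, hι Y, hf f]) (by simp) (by simp) (by simp)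
    have hdf := h.mem_one (algebraMap_mem_extDeg f)
    have hXf := h.mem_two (ι_mem_extDeg X) (algebraMap_mem_extDeg f)
    have hYf := h.mem_two (ι_mem_extDeg Y) (algebraMap_mem_extDeg f)
    rw [h.three_function_eq_zero (h.mem_one (ι_mem_extDeg X)),
      h.three_function_eq_zero (h.mem_one (ι_mem_extDeg Y)),
      h.three_function_eq_zero (ι_mem_extDeg X), hsk Y hXf, hsk X hYf,
      h.skew_three (ι_mem_extDeg X) hdf (ι_mem_extDeg Y),
      h.skew_three' (ι_mem_extDeg X) (ι_mem_extDeg Y) hdf] at this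
    have e : S.l 1 ![(0 : Multi R P)] = 0 := (S.l 1).map_coord_zero 0 rfl
    simp only [e, sub_self, zero_mul, zero_add, Int.negOnePow_zero, one_smul, neg_neg, sub_zero,
      sub_neg_eq_add] at this
    dsimp only
    rw [← sub_eq_zero, ← this]
    abel
  · have := h3 (ExteriorAlgebra.ι R X) (ExteriorAlgebra.ι R Y) (ExteriorAlgebra.ι R Z) (fun _ => 0)
      (fun i => by fin_cases i; exacts [hι X, hι Y, hι Z]) (by simp) (by simp) (by simp)
    have e : S.l 2 ![S.l 2 ![ExteriorAlgebra.ι R Z, ExteriorAlgebra.ι R X], ExteriorAlgebra.ι R Y] =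
        -S.l 2 ![S.l 2 ![ExteriorAlgebra.ι R X, ExteriorAlgebra.ι R Z], ExteriorAlgebra.ι R Y] := by
      rw [hsk X (ι_mem_extDeg Z)]
      have := (S.l 2).cons_smul ![ExteriorAlgebra.ι R Y] (-1 : ℝ)
        (S.l 2 ![ExteriorAlgebra.ι R X, ExteriorAlgebra.ι R Z])
      rw [neg_one_smul, neg_one_smul] at this
      exact this
    dsimp only
    rw [e]
    rw [← sub_eq_zero, ← this]
    abel
  · have := S.jacobi 4 ![ExteriorAlgebra.ι R X, ExteriorAlgebra.ι R Y, ExteriorAlgebra.ι R Z,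
      ExteriorAlgebra.ι R W] (fun _ => 0)
      (fun i => by fin_cases i; exacts [hι X, hι Y, hι Z, hι W])
    rw [Fin.sum_univ_four, nested_four_one, nested_four_two,
      nested_eq_zero_of_outer (p := (0 : Fin 4)) (S.higher_zero 4 (by norm_num)),
      nested_eq_zero_of_inner (p := (3 : Fin 4)) (S.higher_zero 4 (by norm_num))] at this
    have e1 : (((1 : Fin 4) : ℤ) + 1).negOnePow = 1 := Int.negOnePow_even 2 (by decide)
    have e2 : (((2 : Fin 4) : ℤ) + 1).negOnePow = -1 := Int.negOnePow_odd 3 (by decide)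
    rw [e1, e2] at this
    simp only [Units.neg_smul, one_smul, smul_zero, zero_add, add_zero] at this
    dsimp only
    rw [← neg_eq_zero, ← this]
    abel

end SectionIdentities

/-! ### Brackets of forms as double commutators -/

section GerstenhaberOperators

variable {R : Type*} [CommRing R] [Algebra ℝ R] {P : Type*} [AddCommGroup P] [Module ℝ P]
  [Module R P] [IsScalarTower ℝ R P]

theorem mem_diffOp_of_scomm {n n' : ℕ} {m : ℤ} {K : Module.End ℝ (Form R P)}
    (hK : K ∈ diffOp R (Module.Dual R P) n' m)
    (h : ∀ j, ∀ a ∈ extDeg R (Module.Dual R P) j,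
      scomm j m (mulOp a) K ∈ diffOp R (Module.Dual R P) n (j + m)) :
    K ∈ diffOp R (Module.Dual R P) (n + 1) m := by
  refine ⟨fun i x hx => diffOp_degree hK hx, fun j a ha => ?_⟩
  rw [scomm_swap, add_comm]
  exact Submodule.neg_mem _ (negOnePow_smul_mem _ _ (h j a ha))

theorem eq_zero_of_mem_zero {m : ℤ} {K : Module.End ℝ (Form R P)}
    (hK : K ∈ diffOp R (Module.Dual R P) 0 m) : K = 0 := (Submodule.mem_bot ℝ).1 hK

theorem scomm_mulOp_mem {n : ℕ} {m j u : ℤ} {K : Module.End ℝ (Form R P)}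
    (hK : K ∈ diffOp R (Module.Dual R P) (n + 1) m) {a : Form R P}
    (ha : a ∈ extDeg R (Module.Dual R P) j) (hu : m + j = u) :
    scomm m j K (mulOp a) ∈ diffOp R (Module.Dual R P) n u := hu ▸ hK.2 j a ha

theorem mulOp_scomm_mem {n : ℕ} {m j u : ℤ} {K : Module.End ℝ (Form R P)}
    (hK : K ∈ diffOp R (Module.Dual R P) (n + 1) m) {a : Form R P}
    (ha : a ∈ extDeg R (Module.Dual R P) j) (hu : j + m = u) :
    scomm j m (mulOp a) K ∈ diffOp R (Module.Dual R P) n u := by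
  rw [scomm_swap]
  exact Submodule.neg_mem _ (negOnePow_smul_mem _ _ (scomm_mulOp_mem hK ha (by rw [add_comm, hu])))

/-- The derivation `{a, γ}` of degree `i - 1` of the forms, for `a` of degree `i`. -/
def adOp (G : Module.End ℝ (Form R P)) (i : ℤ) (a : Form R P) : Module.End ℝ (Form R P) :=
  scomm i (-1) (mulOp a) G

/-- The operator `{{a, γ}, b}` of multiplication with `[a, b]_γ`. -/
def bracketOp (G : Module.End ℝ (Form R P)) (i j : ℤ) (a b : Form R P) :
    Module.End ℝ (Form R P) :=
  scomm (i - 1) j (adOp G i a) (mulOp b)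

variable {G D F : Module.End ℝ (Form R P)} {i j k : ℤ} {a b c : Form R P}

theorem adOp_mem {n : ℕ} (hG : G ∈ diffOp R (Module.Dual R P) (n + 1) (-1))
    (ha : a ∈ extDeg R (Module.Dual R P) i) :
    adOp G i a ∈ diffOp R (Module.Dual R P) n (i - 1) :=
  mulOp_scomm_mem hG ha rfl

theorem bracketOp_mem {n : ℕ} (hG : G ∈ diffOp R (Module.Dual R P) (n + 2) (-1))
    (ha : a ∈ extDeg R (Module.Dual R P) i) (hb : b ∈ extDeg R (Module.Dual R P) j) :
    bracketOp G i j a b ∈ diffOp R (Module.Dual R P) n (i + j - 1) :=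
  scomm_mulOp_mem (adOp_mem hG ha) hb (by ring)

/-- Multiplications by forms supercommute, so the Jacobi identity lets a and b change places around
G. -/
theorem bracketOp_skew (ha : a ∈ extDeg R (Module.Dual R P) i)
    (hb : b ∈ extDeg R (Module.Dual R P) j) :
    bracketOp G i j a b = -(((i - 1) * (j - 1)).negOnePow • bracketOp G j i b a) := by
  have h := scomm_jacobi i (-1) j (mulOp a) G (mulOp b)
  rw [scomm_mulLeft ha hb, scomm_zero_left, smul_zero, add_zero,
    scomm_swap (-1) j G, scomm_neg_right, scomm_units_smul_right,
    scomm_swap i (-1 + j)] at h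
  change scomm (i + -1) j (scomm i (-1) (mulOp a) G) (mulOp b) = _
  rw [h, smul_neg, neg_neg, smul_smul, ← Int.negOnePow_add, show (-1 : ℤ) + j = j - 1 by ring,
    ← Units.neg_smul, ← Int.negOnePow_succ]
  exact congrArg (fun u : ℤˣ => u • bracketOp G j i b a) (negOnePow_congr ⟨-1, by ring⟩)

theorem bracketOp_mul :
    bracketOp G i (j + k) a (b * c) = bracketOp G i j a b * mulOp c +
      ((i - 1) * j).negOnePow • (mulOp b * bracketOp G i k a c) := by
  have h : mulOp (b * c) = mulOp b * mulOp c := (mulLeft_mul_mulLeft b c).symm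
  rw [bracketOp, h, scomm_mul_right]
  rfl

/-- The square of `γ` measures the failure of `{·, γ}` to be a homomorphism. -/
theorem two_smul_scomm_adOp (G : Module.End ℝ (Form R P)) (i : ℤ) (a : Form R P) :
    (2 : ℝ) • scomm (i - 1) (-1) (adOp G i a) G =
      scomm i (-2) (mulOp a) (scomm (-1) (-1) G G) := by
  have h := scomm_jacobi i (-1) (-1) (mulOp a) G G
  rw [neg_one_mul, neg_neg, Int.negOnePow_one, Units.neg_smul, one_smul] at h
  rw [two_smul]
  nth_rewrite 1 [adOp]
  exact eq_add_neg_iff_add_eq.1 h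

/-- The last term is the obstruction to the Jacobi identity of the bracket; by `two_smul_scomm_adOp`
it is controlled by [G,G]. -/
theorem scomm_adOp_adOp :
    scomm (i - 1) (j - 1) (adOp G i a) (adOp G j b) =
      scomm (i + j - 1) (-1) (bracketOp G i j a b) G +
        ((i - 1) * j).negOnePow • scomm j (i - 2) (mulOp b) (scomm (i - 1) (-1) (adOp G i a) G) := by
  have h := scomm_jacobi_right (i - 1) j (-1) (adOp G i a) (mulOp b) G
  rw [show i - 1 + j = i + j - 1 by ring, show i - 1 + -1 = i - 2 by ring] at h
  exact h

theorem scomm_adOp_bracketOp :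
    scomm (i - 1) (j + k - 1) (adOp G i a) (bracketOp G j k b c) =
      scomm (i + j - 2) k (scomm (i - 1) (j - 1) (adOp G i a) (adOp G j b)) (mulOp c) +
        ((i - 1) * (j - 1)).negOnePow •
          scomm (j - 1) (i + k - 1) (adOp G j b) (bracketOp G i k a c) := by
  have h := scomm_jacobi_right (i - 1) (j - 1) k (adOp G i a) (adOp G j b) (mulOp c)
  rw [show i - 1 + (j - 1) = i + j - 2 by ring, show i - 1 + k = i + k - 1 by ring,
    show j - 1 + k = j + k - 1 by ring] at h
  exact h

/-- The term with [D,G] is the obstruction to D acting as a derivation of the bracket. -/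
theorem scomm_adOp : scomm 1 (i - 1) D (adOp G i a) =
    scomm (i + 1) (-1) (scomm 1 i D (mulOp a)) G +
      i.negOnePow • scomm i 0 (mulOp a) (scomm 1 (-1) D G) := by
  have h := scomm_jacobi_right 1 i (-1) D (mulOp a) G
  rw [add_comm 1 i, one_mul, show (1 : ℤ) + -1 = 0 by ring] at h
  exact h

theorem scomm_bracketOp : scomm 1 (i + j - 1) D (bracketOp G i j a b) =
    scomm i j (scomm 1 (i - 1) D (adOp G i a)) (mulOp b) +
      (i - 1).negOnePow • scomm (i - 1) (j + 1) (adOp G i a) (scomm 1 j D (mulOp b)) := by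
  have h := scomm_jacobi_right 1 (i - 1) j D (adOp G i a) (mulOp b)
  rw [one_mul, show 1 + (i - 1) = i by ring, show i - 1 + j = i + j - 1 by ring,
    add_comm 1 j] at h
  exact h

theorem scomm_scomm_self (D : Module.End ℝ (Form R P)) (i : ℤ) (a : Form R P) :
    (2 : ℝ) • scomm 1 (i + 1) D (scomm 1 i D (mulOp a)) =
      scomm 2 i (scomm 1 1 D D) (mulOp a) := by
  have h := scomm_jacobi_right 1 1 i D D (mulOp a)
  rw [mul_one, Int.negOnePow_one, Units.neg_smul, one_smul, add_comm 1 i,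
    show (1 : ℤ) + 1 = 2 by norm_num] at h
  rw [two_smul]
  exact eq_add_neg_iff_add_eq.1 h

end GerstenhaberOperators

/-! ### Quasi-differential Gerstenhaber algebras represented by operators -/

section DualRepresentation

variable {R : Type*} [CommRing R] [Algebra ℝ R] {P : Type*} [AddCommGroup P] [Module ℝ P]
  [Module R P] [IsScalarTower ℝ R P]

/-- The operators `G`, `D`, `F` represent the bracket, the quasi-differential and the element `φ`
of a quasi-differential Gerstenhaber algebra. -/
structure DualRepresents (T : QuasiDiffGerstenhaber R P) (G D F : Module.End ℝ (Form R P)) :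
    Prop where
  bracket : ∀ i j : ℤ, ∀ a ∈ extDeg R (Module.Dual R P) i, ∀ b ∈ extDeg R (Module.Dual R P) j,
    mulOp (T.bracket a b) = bracketOp G i j a b
  δ : ∀ i : ℤ, ∀ a ∈ extDeg R (Module.Dual R P) i, mulOp (T.δ a) = scomm 1 i D (mulOp a)
  φ : mulOp T.φ = F

theorem lowerOps_zero_left (l : ℤ) : lowerOps R P 0 l = ⊥ := rfl

theorem symb_zero_inj {l : ℤ} {D D' : Module.End ℝ (Form R P)} {h : D ∈ ops R P 0 l}
    {h' : D' ∈ ops R P 0 l} : symb 0 l D h = symb 0 l D' h' ↔ D = D' := by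
  rw [symb_eq_symb, lowerOps_zero_left, Submodule.mem_bot, sub_eq_zero]

section

variable {G D F : Module.End ℝ (Form R P)} (hG : G ∈ ops R P 2 1) (hD : D ∈ ops R P 1 2)
  (hF : F ∈ ops R P 0 3) {i j : ℤ} {a b : Form R P}

theorem poisson_vbar_vbar (ha : a ∈ extDeg R (Module.Dual R P) i)
    (hb : b ∈ extDeg R (Module.Dual R P) j) : ∃ hm : bracketOp G i j a b ∈ ops R P 0 (i + j - 1),
      poisson R P (poisson R P (vbar R P a) (symb 2 1 G hG)) (vbar R P b) =
        symb 0 (i + j - 1) (bracketOp G i j a b) hm := by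
  obtain ⟨hm, e⟩ := poisson_symb_eq (K := 1) (L := i) (m := i) (m' := -1) (mulOp_mem ha) hG
    (by norm_num) (by ring) (by ring) (by norm_num)
  rw [vbar_apply ha, vbar_apply hb, e]
  exact poisson_symb_eq hm (mulOp_mem hb) (by norm_num) rfl rfl (sub_zero j)

theorem poisson_symb_vbar (ha : a ∈ extDeg R (Module.Dual R P) i) :
    ∃ hm : scomm 1 i D (mulOp a) ∈ ops R P 0 (i + 1),
      poisson R P (symb 1 2 D hD) (vbar R P a) = symb 0 (i + 1) (scomm 1 i D (mulOp a)) hm := by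
  rw [vbar_apply ha]
  exact poisson_symb_eq hD (mulOp_mem ha) (by norm_num) (by ring) (by norm_num) (sub_zero i)

/-- In bidegree (0,l) there are no lower order terms, so equations between functions are equations
between multiplication operators. No frame is needed. -/
theorem dualCorresponds_iff {Q : QuasiLieBialgebroid R P}
    (hγ : symb 2 1 G hG = Fun.toHam R P 2 1 Q.γ) (hμ : symb 1 2 D hD = Fun.toHam R P 1 2 Q.μ)
    (hφ : symb 0 3 F hF = Fun.toHam R P 0 3 Q.φ) (T : QuasiDiffGerstenhaber R P) :
    DuallyCorresponds Q T ↔ DualRepresents T G D F := by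
  constructor
  · refine fun h => ⟨fun i j a ha b hb => ?_, fun i a ha => ?_, ?_⟩
    · obtain ⟨hm, e⟩ := poisson_vbar_vbar hG ha hb
      have := h.bracket a b
      rw [← hγ, e, vbar_apply (T.bracket_degree i j a ha b hb)] at this
      exact symb_zero_inj.1 this
    · obtain ⟨hm, e⟩ := poisson_symb_vbar hD ha
      have := h.δ a
      rw [← hμ, e, vbar_apply (T.δ_degree i a ha)] at this
      exact symb_zero_inj.1 this
    · have := h.φ
      rw [← hφ, vbar_apply T.φ_degree] at this
      exact symb_zero_inj.1 this
  · refine fun h => ⟨fun a b => ?_, fun a => ?_, ?_⟩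
    · rw [← hγ]
      induction a using ext_induction with
      | h0 => simp only [map_zero, LinearMap.zero_apply]
      | hadd x y hx hy => simp only [map_add, LinearMap.add_apply, hx, hy]
      | hom i a ha =>
        induction b using ext_induction with
        | h0 => simp only [map_zero]
        | hadd x y hx hy => simp only [map_add, hx, hy]
        | hom j b hb =>
          obtain ⟨hm, e⟩ := poisson_vbar_vbar hG ha hb
          rw [e, vbar_apply (T.bracket_degree i j a ha b hb)]
          exact symb_zero_inj.2 (h.bracket i j a ha b hb)
    · rw [← hμ]
      induction a using ext_induction with
      | h0 => simp only [map_zero]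
      | hadd x y hx hy => simp only [map_add, hx, hy]
      | hom i a ha =>
        obtain ⟨hm, e⟩ := poisson_symb_vbar hD ha
        rw [e, vbar_apply (T.δ_degree i a ha)]
        exact symb_zero_inj.2 (h.δ i a ha)
    · rw [← hφ, vbar_apply T.φ_degree]
      exact symb_zero_inj.2 h.φ

end

theorem mulOp_add (a b : Form R P) : mulOp (a + b) = mulOp a + mulOp b := mulLeft_add' a b

theorem mulOp_units_smul (u : ℤˣ) (a : Form R P) : mulOp (u • a) = u • mulOp a := by
  rcases Int.units_eq_one_or u with rfl | rfl
  · rw [one_smul, one_smul]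
  · rw [Units.neg_smul, one_smul, Units.neg_smul, one_smul]
    exact map_neg (LinearMap.mul ℝ (Form R P)) a

theorem units_smul_eq_zero {V : Type*} [AddCommGroup V] (u : ℤˣ) {x : V} : u • x = 0 ↔ x = 0 :=
  smul_eq_zero_iff_eq u

section

variable {T : QuasiDiffGerstenhaber R P} {G D F : Module.End ℝ (Form R P)}

/-- The commutator of ½[D,D] + [G,F] with a is multiplication by δ²a + [φ,a] = 0. An operator
commuting with all multiplications in this way has order zero, which is the vanishing of its symbol
in bidegree (1,3). -/
theorem DualRepresents.mem_sq (h : DualRepresents T G D F)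
    (hG : G ∈ diffOp R (Module.Dual R P) 3 (-1)) (hD : D ∈ diffOp R (Module.Dual R P) 2 1)
    (hF : F ∈ diffOp R (Module.Dual R P) 1 3) :
    (1 / 2 : ℝ) • scomm 1 1 D D + scomm (-1) 3 G F ∈ diffOp R (Module.Dual R P) 1 2 := by
  have hDD : scomm 1 1 D D ∈ diffOp R (Module.Dual R P) 2 2 := diffOp_scomm (by norm_num) hD hD
  have hGF : scomm (-1) 3 G F ∈ diffOp R (Module.Dual R P) 2 2 := diffOp_scomm (by norm_num) hG hF
  refine mem_diffOp_of_scomm (n := 0)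
    (Submodule.add_mem _ (Submodule.smul_mem _ (1 / 2 : ℝ) hDD) hGF) fun i a ha => ?_
  have e1 := h.δ _ _ (T.δ_degree i a ha)
  have e2 := h.bracket 3 i _ T.φ_degree a ha
  rw [bracketOp, adOp, h.φ, scomm_odd 3 (-1) (by decide), show (3 : ℤ) - 1 = 2 by norm_num] at e2
  have h1 : scomm 2 i ((1 / 2 : ℝ) • scomm 1 1 D D + scomm (-1) 3 G F) (mulOp a) = 0 := by
    rw [scomm_add_left, scomm_smul_left, ← scomm_scomm_self, ← h.δ i a ha, ← e1, ← e2, smul_smul,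
      one_div, inv_mul_cancel₀ two_ne_zero, one_smul, ← mulOp_add, T.δ_sq, mulOp_zero]
  rw [scomm_swap, h1, smul_zero, neg_zero]
  exact Submodule.zero_mem _

/-- Comparing the commutator expansion with the Jacobi identity of the bracket leaves exactly the
obstruction term. -/
theorem DualRepresents.scomm_eq_zero (h : DualRepresents T G D F) {i j k : ℤ} {a b c : Form R P}
    (ha : a ∈ extDeg R (Module.Dual R P) i) (hb : b ∈ extDeg R (Module.Dual R P) j)
    (hc : c ∈ extDeg R (Module.Dual R P) k) :
    scomm (i + j - 2) k (scomm j (i - 2) (mulOp b) (scomm (i - 1) (-1) (adOp G i a) G))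
      (mulOp c) = 0 := by
  have h1 := scomm_adOp_bracketOp (G := G) (i := i) (j := j) (k := k) (a := a) (b := b) (c := c)
  have h2 : ∀ {u v : ℤ} {x y : Form R P}, x ∈ extDeg R (Module.Dual R P) u →
      y ∈ extDeg R (Module.Dual R P) v →
      scomm (u - 1) v (adOp G u x) (mulOp y) = mulOp (T.bracket x y) := fun {u v x y} hx hy =>
    (h.bracket u v x hx y hy).symm
  have hab := T.bracket_degree i j a ha b hb
  have h3 : scomm (i + j - 2) k (scomm (i + j - 1) (-1) (mulOp (T.bracket a b)) G) (mulOp c) =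
      mulOp (T.bracket (T.bracket a b) c) := by
    rw [← h2 hab hc, show i + j - 1 - 1 = i + j - 2 by ring]
    rfl
  rw [scomm_adOp_adOp, scomm_add_left, ← h.bracket i j a ha b hb, ← h.bracket j k b hb c hc,
    ← h.bracket i k a ha c hc, h2 ha (T.bracket_degree j k b hb c hc),
    h2 hb (T.bracket_degree i k a ha c hc), h3, T.bracket_jacobi i j a ha b hb c, mulOp_add,
    scomm_units_smul_left, mulOp_units_smul, add_left_inj, left_eq_add, units_smul_eq_zero] at h1
  exact h1

/-- A priori [G,G] has order at most three. Its commutator with three forms is twice the Jacobi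
obstruction up to sign, so it vanishes and the order drops to two. -/
theorem DualRepresents.mem_bracket (h : DualRepresents T G D F)
    (hG : G ∈ diffOp R (Module.Dual R P) 3 (-1)) :
    scomm (-1) (-1) G G ∈ diffOp R (Module.Dual R P) 3 (-2) := by
  have hGG : scomm (-1) (-1) G G ∈ diffOp R (Module.Dual R P) 4 (-2) :=
    diffOp_scomm (by norm_num) hG hG
  refine mem_diffOp_of_scomm (n := 2) hGG fun i a ha => ?_
  rw [← two_smul_scomm_adOp]
  refine Submodule.smul_mem _ _ ?_
  have hY : scomm (i - 1) (-1) (adOp G i a) G ∈ diffOp R (Module.Dual R P) 3 (i - 2) := by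
    rw [show i - 2 = i - 1 + -1 by ring]
    exact diffOp_scomm (by norm_num) (adOp_mem hG ha) hG
  rw [← sub_eq_add_neg]
  refine mem_diffOp_of_scomm (n := 1) hY fun j b hb => ?_
  have hZ : scomm j (i - 2) (mulOp b) (scomm (i - 1) (-1) (adOp G i a) G) ∈
      diffOp R (Module.Dual R P) 2 (i + j - 2) := mulOp_scomm_mem hY hb (by ring)
  rw [show j + (i - 2) = i + j - 2 by ring]
  refine mem_diffOp_of_scomm (n := 0) hZ fun k c hc => ?_
  rw [scomm_swap, h.scomm_eq_zero ha hb hc, smul_zero, neg_zero]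
  exact Submodule.zero_mem _

/-- The commutator of [D,G] with two forms measures the failure of δ to be a derivation of the
bracket; since it vanishes, the order drops from two to one. -/
theorem DualRepresents.mem_derivation (h : DualRepresents T G D F)
    (hG : G ∈ diffOp R (Module.Dual R P) 3 (-1)) (hD : D ∈ diffOp R (Module.Dual R P) 2 1) :
    scomm 1 (-1) D G ∈ diffOp R (Module.Dual R P) 2 0 := by
  have hDG : scomm 1 (-1) D G ∈ diffOp R (Module.Dual R P) 3 0 := diffOp_scomm (by norm_num) hD hG
  refine mem_diffOp_of_scomm (n := 1) hDG fun i a ha => ?_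
  have hZ : scomm i 0 (mulOp a) (scomm 1 (-1) D G) ∈ diffOp R (Module.Dual R P) 2 (i + 0) :=
    mulOp_scomm_mem hDG ha rfl
  refine mem_diffOp_of_scomm (n := 0) hZ fun j b hb => ?_
  have h1 := scomm_bracketOp (D := D) (G := G) (i := i) (j := j) (a := a) (b := b)
  have hab := T.bracket_degree i j a ha b hb
  have h2 := h.bracket (i + 1) j _ (T.δ_degree i a ha) b hb
  have h3 := h.bracket i (j + 1) a ha _ (T.δ_degree j b hb)
  rw [bracketOp, add_sub_cancel_right, adOp] at h2
  rw [bracketOp] at h3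
  rw [← h.bracket i j a ha b hb, ← h.δ _ _ hab, scomm_adOp, scomm_add_left, ← h.δ i a ha, ← h2,
    ← h.δ j b hb, ← h3, T.δ_bracket i a ha, mulOp_add, mulOp_units_smul, add_left_inj,
    left_eq_add, scomm_units_smul_left, units_smul_eq_zero] at h1
  rw [scomm_swap, add_zero, h1, smul_zero, neg_zero]
  exact Submodule.zero_mem _

theorem DualRepresents.mcOps (h : DualRepresents T G D F) (hG : G ∈ ops R P 2 1)
    (hD : D ∈ ops R P 1 2) (hF : F ∈ ops R P 0 3) : MCOps G D F := by
  have h1 := h.mem_sq hG hD hF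
  have h2 := h.mem_bracket hG
  have h3 := h.mem_derivation hG hD
  have h4 : scomm 1 3 D F = 0 := by rw [← h.φ, ← h.δ 3 _ T.φ_degree, T.δ_φ, mulOp_zero]
  exact ⟨h1, h2, h3, by rw [h4]; exact Submodule.zero_mem _⟩

end

end DualRepresentation

/-! ### The quasi-differential Gerstenhaber algebra generated by operators -/

section DualConstruction

variable {R : Type*} [CommRing R] [Algebra ℝ R] {P : Type*} [AddCommGroup P] [Module ℝ P]
  [Module R P] [IsScalarTower ℝ R P]

/-- The bracket of forms generated by an operator `G`: the failure of `G` to be a derivation. -/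
def generatedBracket (G : Module.End ℝ (Form R P)) : Form R P →ₗ[ℝ] Form R P →ₗ[ℝ] Form R P :=
  LinearMap.mk₂ ℝ (fun a b => a * G b - G (gradingInv R (Module.Dual R P) a * b) +
      G (gradingInv R (Module.Dual R P) a) * b)
    (fun a a' b => by simp only [map_add, add_mul]; abel)
    (fun c a b => by simp only [map_smul, smul_mul_assoc, smul_add, smul_sub])
    (fun a b b' => by simp only [map_add, mul_add]; abel)
    (fun c a b => by simp only [map_smul, mul_smul_comm, smul_add, smul_sub])

/-- The derivation which differs from an operator `D` of order one by a multiplication. -/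
def generatedDifferential (D : Module.End ℝ (Form R P)) : Form R P →ₗ[ℝ] Form R P :=
  D - mulOp (D 1)

variable {G D F : Module.End ℝ (Form R P)} {i j k : ℤ} {a b c : Form R P}

theorem map_units_smul_form (G : Module.End ℝ (Form R P)) (u : ℤˣ) (x : Form R P) :
    G (u • x) = u • G x := by
  rcases Int.units_eq_one_or u with rfl | rfl
  · rw [one_smul, one_smul]
  · rw [Units.neg_smul, one_smul, Units.neg_smul, one_smul, map_neg]

/-- The double commutator has order zero, so it is multiplication by its value at 1. As G(1) = 0 by
degree, this value is the defining formula; the grading involution absorbs the sign that depends on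
the degree of a and keeps the formula bilinear. -/
theorem mulOp_generatedBracket (hG : G ∈ diffOp R (Module.Dual R P) 3 (-1))
    (ha : a ∈ extDeg R (Module.Dual R P) i) (hb : b ∈ extDeg R (Module.Dual R P) j) :
    mulOp (generatedBracket G a b) = bracketOp G i j a b := by
  rw [eq_mulLeft_of_mem_diffOp_one (bracketOp_mem hG ha hb)]
  refine congrArg mulOp ?_
  have h1 : G 1 = 0 := by
    have := diffOp_degree hG one_mem_extDeg
    exact eq_zero_of_mem_extDeg_neg this (by norm_num)
  have h2 : G a ∈ extDeg R (Module.Dual R P) (i - 1) := diffOp_degree hG ha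
  simp only [bracketOp, adOp, scomm, LinearMap.sub_apply, Module.End.mul_apply,
    LinearMap.mulLeft_apply, LinearMap.smul_apply, mul_one, h1, mul_zero, zero_sub]
  change a * G b - G (gradingInv R (Module.Dual R P) a * b) +
      G (gradingInv R (Module.Dual R P) a) * b = _
  rw [gradingInv_apply ha, smul_mul_assoc, map_units_smul_form, map_units_smul_form, mul_neg_one,
    Int.negOnePow_neg]
  have h3 := ext_mul_comm h2 hb
  rcases Int.units_eq_one_or ((i - 1) * j).negOnePow with e | e <;>
  rcases Int.units_eq_one_or i.negOnePow with e' | e' <;> rw [e] at h3 ⊢ <;> rw [e'] <;> simp [h3, ← sub_eq_add_neg]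

theorem mulOp_generatedDifferential (hD : D ∈ diffOp R (Module.Dual R P) 2 1)
    (ha : a ∈ extDeg R (Module.Dual R P) i) :
    mulOp (generatedDifferential D a) = scomm 1 i D (mulOp a) := by
  rw [eq_mulLeft_of_mem_diffOp_one (hD.2 i a ha)]
  refine congrArg mulOp ?_
  have h1 : D 1 ∈ extDeg R (Module.Dual R P) 1 := by
    simpa using diffOp_degree hD one_mem_extDeg
  simp only [scomm, LinearMap.sub_apply, Module.End.mul_apply, LinearMap.mulLeft_apply,
    LinearMap.smul_apply, mul_one]
  rw [ext_mul_comm h1 ha, smul_smul, negOnePow_mul_self, one_smul]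
  rfl

theorem generatedBracket_mem (hG : G ∈ diffOp R (Module.Dual R P) 3 (-1))
    (ha : a ∈ extDeg R (Module.Dual R P) i) (hb : b ∈ extDeg R (Module.Dual R P) j) :
    generatedBracket G a b ∈ extDeg R (Module.Dual R P) (i + j - 1) := by
  have h := diffOp_degree (bracketOp_mem hG ha hb) (one_mem_extDeg (R := R))
  rwa [← mulOp_generatedBracket hG ha hb, LinearMap.mulLeft_apply, mul_one, zero_add] at h

theorem generatedDifferential_mem (hD : D ∈ diffOp R (Module.Dual R P) 2 1)
    (ha : a ∈ extDeg R (Module.Dual R P) i) :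
    generatedDifferential D a ∈ extDeg R (Module.Dual R P) (i + 1) := by
  have h := diffOp_degree (hD.2 i a ha) (one_mem_extDeg (R := R))
  have e := mulOp_generatedDifferential hD ha
  rwa [← e, LinearMap.mulLeft_apply, mul_one, zero_add, add_comm] at h

theorem generatedBracket_skew (hG : G ∈ diffOp R (Module.Dual R P) 3 (-1))
    (ha : a ∈ extDeg R (Module.Dual R P) i) (hb : b ∈ extDeg R (Module.Dual R P) j) :
    generatedBracket G a b =
      -(((i - 1) * (j - 1)).negOnePow • generatedBracket G b a) := by
  refine mulOp_injective ?_
  rw [mulOp_generatedBracket hG ha hb, bracketOp_skew ha hb, ← mulOp_generatedBracket hG hb ha,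
    ← Units.neg_smul, ← Units.neg_smul, mulOp_units_smul]

theorem generatedBracket_mul (hG : G ∈ diffOp R (Module.Dual R P) 3 (-1))
    (ha : a ∈ extDeg R (Module.Dual R P) i) (hb : b ∈ extDeg R (Module.Dual R P) j)
    (c : Form R P) : generatedBracket G a (b * c) = generatedBracket G a b * c +
      ((i - 1) * j).negOnePow • (b * generatedBracket G a c) := by
  induction c using ext_induction with
  | h0 => simp only [mul_zero, map_zero, smul_zero, add_zero]
  | hadd x y hx hy => simp only [mul_add, map_add, hx, hy, smul_add]; abel
  | hom k c hc =>
    refine mulOp_injective ?_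
    rw [mulOp_generatedBracket hG ha (extDeg_mul hb hc), bracketOp_mul,
      ← mulOp_generatedBracket hG ha hb, ← mulOp_generatedBracket hG ha hc, mulOp_add,
      mulOp_units_smul]
    congr 2 <;> exact mulLeft_mul_mulLeft _ _

/-- When the symbol of [G,G] vanishes, [G,G] has order at most two. The obstruction is a commutator
with three forms and is therefore zero. -/
theorem generatedBracket_jacobi (hG : G ∈ diffOp R (Module.Dual R P) 3 (-1))
    (hGG : scomm (-1) (-1) G G ∈ diffOp R (Module.Dual R P) 3 (-2))
    (ha : a ∈ extDeg R (Module.Dual R P) i) (hb : b ∈ extDeg R (Module.Dual R P) j)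
    (c : Form R P) : generatedBracket G a (generatedBracket G b c) =
      generatedBracket G (generatedBracket G a b) c +
        ((i - 1) * (j - 1)).negOnePow • generatedBracket G b (generatedBracket G a c) := by
  induction c using ext_induction with
  | h0 => simp only [map_zero, smul_zero, add_zero]
  | hadd x y hx hy => simp only [map_add, hx, hy, smul_add]; abel
  | hom k c hc =>
    refine mulOp_injective ?_
    have hab := generatedBracket_mem hG ha hb
    have h1 := scomm_adOp_bracketOp (G := G) (i := i) (j := j) (k := k) (a := a) (b := b) (c := c)
    have hY : scomm (i - 1) (-1) (adOp G i a) G ∈ diffOp R (Module.Dual R P) 2 (i - 2) := by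
      have : (2 : ℝ) • scomm (i - 1) (-1) (adOp G i a) G ∈
          diffOp R (Module.Dual R P) 2 (i - 2) := by
        rw [two_smul_scomm_adOp]
        exact mulOp_scomm_mem hGG ha rfl
      exact (smul_mem_iff_two _).1 this
    have hZ : scomm (i + j - 2) k (scomm j (i - 2) (mulOp b) (scomm (i - 1) (-1) (adOp G i a) G))
        (mulOp c) = 0 :=
      eq_zero_of_mem_zero (scomm_mulOp_mem (mulOp_scomm_mem hY hb (by ring)) hc rfl)
    have h3 : scomm (i + j - 2) k (scomm (i + j - 1) (-1) (mulOp (generatedBracket G a b)) G)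
        (mulOp c) = mulOp (generatedBracket G (generatedBracket G a b) c) := by
      rw [mulOp_generatedBracket hG hab hc, bracketOp, show i + j - 1 - 1 = i + j - 2 by ring]
      rfl
    rw [scomm_adOp_adOp, scomm_add_left, ← mulOp_generatedBracket hG ha hb,
      ← mulOp_generatedBracket hG hb hc, ← mulOp_generatedBracket hG ha hc, h3,
      scomm_units_smul_left, hZ, smul_zero, add_zero] at h1
    rw [mulOp_add, mulOp_units_smul, mulOp_generatedBracket hG ha (generatedBracket_mem hG hb hc),
      mulOp_generatedBracket hG hb (generatedBracket_mem hG ha hc)]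
    exact h1

theorem generatedDifferential_mul (hD : D ∈ diffOp R (Module.Dual R P) 2 1)
    (ha : a ∈ extDeg R (Module.Dual R P) i) (b : Form R P) :
    generatedDifferential D (a * b) = generatedDifferential D a * b +
      i.negOnePow • (a * generatedDifferential D b) := by
  have h1 : D 1 ∈ extDeg R (Module.Dual R P) 1 := by
    simpa using diffOp_degree hD one_mem_extDeg
  have h := apply_mul_of_scomm (mulOp_generatedDifferential hD ha).symm b
  change D (a * b) - D 1 * (a * b) = _ + _ • (a * (D b - D 1 * b))
  rw [h, one_mul, mul_sub, smul_sub, ← mul_assoc a, ext_mul_comm h1 ha, one_mul, smul_mul_assoc,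
    smul_smul, negOnePow_mul_self, one_smul, mul_assoc]
  abel

theorem generatedDifferential_bracket (hG : G ∈ diffOp R (Module.Dual R P) 3 (-1))
    (hD : D ∈ diffOp R (Module.Dual R P) 2 1)
    (hDG : scomm 1 (-1) D G ∈ diffOp R (Module.Dual R P) 2 0)
    (ha : a ∈ extDeg R (Module.Dual R P) i) (b : Form R P) :
    generatedDifferential D (generatedBracket G a b) =
      generatedBracket G (generatedDifferential D a) b +
        (i - 1).negOnePow • generatedBracket G a (generatedDifferential D b) := by
  induction b using ext_induction with
  | h0 => simp only [map_zero, smul_zero, add_zero]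
  | hadd x y hx hy => simp only [map_add, hx, hy, smul_add]; abel
  | hom j b hb =>
    refine mulOp_injective ?_
    have h1 := scomm_bracketOp (D := D) (G := G) (i := i) (j := j) (a := a) (b := b)
    have hab := generatedBracket_mem hG ha hb
    have hZ : scomm i j (scomm i 0 (mulOp a) (scomm 1 (-1) D G)) (mulOp b) = 0 :=
      eq_zero_of_mem_zero (scomm_mulOp_mem (mulOp_scomm_mem hDG ha (add_zero i)) hb rfl)
    have h2 := mulOp_generatedBracket hG (generatedDifferential_mem hD ha) hb
    have h3 := mulOp_generatedBracket hG ha (generatedDifferential_mem hD hb)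
    rw [bracketOp, add_sub_cancel_right, adOp] at h2
    rw [bracketOp] at h3
    rw [← mulOp_generatedBracket hG ha hb, ← mulOp_generatedDifferential hD hab, scomm_adOp,
      scomm_add_left, ← mulOp_generatedDifferential hD ha, ← h2,
      ← mulOp_generatedDifferential hD hb, ← h3, scomm_units_smul_left, hZ, smul_zero,
      add_zero] at h1
    rw [mulOp_add, mulOp_units_smul]
    exact h1

theorem generatedDifferential_sq (hG : G ∈ diffOp R (Module.Dual R P) 3 (-1))
    (hD : D ∈ diffOp R (Module.Dual R P) 2 1) (hF : F ∈ diffOp R (Module.Dual R P) 1 3)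
    (hm : (1 / 2 : ℝ) • scomm 1 1 D D + scomm (-1) 3 G F ∈ diffOp R (Module.Dual R P) 1 2)
    (a : Form R P) :
    generatedDifferential D (generatedDifferential D a) + generatedBracket G (F 1) a = 0 := by
  induction a using ext_induction with
  | h0 => simp only [map_zero, add_zero]
  | hadd x y hx hy =>
    simp only [map_add]
    rw [add_add_add_comm, hx, hy, add_zero]
  | hom i a ha =>
    refine mulOp_injective ?_
    have h3 : F 1 ∈ extDeg R (Module.Dual R P) 3 := by
      simpa using diffOp_degree hF one_mem_extDeg
    have e1 := mulOp_generatedDifferential hD (generatedDifferential_mem hD ha)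
    have e2 := mulOp_generatedBracket hG h3 ha
    have e3 : mulOp (F 1) = F := (eq_mulLeft_of_mem_diffOp_one hF).symm
    rw [bracketOp, adOp, e3, scomm_odd 3 (-1) (by decide), show (3 : ℤ) - 1 = 2 by norm_num] at e2
    have h := eq_zero_of_mem_zero (scomm_mulOp_mem hm ha rfl)
    rw [scomm_add_left, scomm_smul_left, ← scomm_scomm_self, ← mulOp_generatedDifferential hD ha,
      ← e1, ← e2, smul_smul, one_div, inv_mul_cancel₀ two_ne_zero, one_smul, ← mulOp_add] at h
    rw [h, mulOp_zero]

/-- The quasi-differential Gerstenhaber algebra of operators which satisfy the Maurer-Cartan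
equation. -/
def generatedAlgebra (hG : G ∈ ops R P 2 1) (hD : D ∈ ops R P 1 2) (hF : F ∈ ops R P 0 3)
    (h : MCOps G D F) : QuasiDiffGerstenhaber R P where
  bracket := generatedBracket G
  δ := generatedDifferential D
  φ := F 1
  bracket_degree _ _ _ ha _ hb := generatedBracket_mem hG ha hb
  bracket_skew _ _ _ ha _ hb := generatedBracket_skew hG ha hb
  bracket_leibniz _ _ _ ha _ hb c := generatedBracket_mul hG ha hb c
  bracket_jacobi _ _ _ ha _ hb c := generatedBracket_jacobi hG h.2.1 ha hb c
  δ_degree _ _ ha := generatedDifferential_mem hD ha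
  δ_mul _ _ ha b := generatedDifferential_mul hD ha b
  δ_bracket _ _ ha b := generatedDifferential_bracket hG hD h.2.2.1 ha b
  φ_degree := by
    have h1 : F ∈ diffOp R (Module.Dual R P) 1 3 := hF
    simpa using diffOp_degree h1 one_mem_extDeg
  δ_sq a := generatedDifferential_sq hG hD hF h.1 a
  δ_φ := by
    have h1 : F ∈ diffOp R (Module.Dual R P) 1 3 := hF
    have h3 : F 1 ∈ extDeg R (Module.Dual R P) 3 := by
      simpa using diffOp_degree h1 one_mem_extDeg
    have e3 : mulOp (F 1) = F := (eq_mulLeft_of_mem_diffOp_one h1).symm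
    have h4 : scomm 1 3 D F = 0 := (Submodule.mem_bot ℝ).1 h.2.2.2
    refine mulOp_injective ?_
    rw [mulOp_generatedDifferential hD h3, e3, h4, mulOp_zero]

theorem generatedAlgebra_represents (hG : G ∈ ops R P 2 1) (hD : D ∈ ops R P 1 2)
    (hF : F ∈ ops R P 0 3) (h : MCOps G D F) :
    DualRepresents (generatedAlgebra hG hD hF h) G D F where
  bracket _ _ _ ha _ hb := mulOp_generatedBracket hG ha hb
  δ _ _ ha := mulOp_generatedDifferential hD ha
  φ := (eq_mulLeft_of_mem_diffOp_one (m := 3) hF).symm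

theorem DualRepresents.ext {T T' : QuasiDiffGerstenhaber R P} (h : DualRepresents T G D F)
    (h' : DualRepresents T' G D F) : T = T' := by
  refine QuasiDiffGerstenhaber.ext (LinearMap.ext fun a => ?_)
    (ext_hom_ext fun i a ha => ?_) (mulOp_injective (h.φ.trans h'.φ.symm))
  · induction a using ext_induction with
    | h0 => simp only [map_zero]
    | hadd x y hx hy => simp only [map_add, hx, hy]
    | hom i a ha =>
      refine ext_hom_ext fun j b hb => ?_
      exact mulOp_injective ((h.bracket i j a ha b hb).trans (h'.bracket i j a ha b hb).symm)
  · exact mulOp_injective ((h.δ i a ha).trans (h'.δ i a ha).symm)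

/-- Every quasi-Lie bialgebroid corresponds to exactly one quasi-differential Gerstenhaber
algebra. -/
theorem existsUnique_dualCorresponds (Q : QuasiLieBialgebroid R P) :
    ∃! T : QuasiDiffGerstenhaber R P, DuallyCorresponds Q T := by
  obtain ⟨G, D, F, hG, hD, hF, hγ, hμ, hφ⟩ := Q.exists_rep
  have hmc : MCOps G D F := by
    rw [← poisson_theta_eq_zero_iff hG hD hF, hγ, hμ, hφ]
    exact Q.self_commuting
  have h := generatedAlgebra_represents hG hD hF hmc
  exact ⟨generatedAlgebra hG hD hF hmc, (dualCorresponds_iff hG hD hF hγ hμ hφ _).2 h,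
    fun T hT => ((dualCorresponds_iff hG hD hF hγ hμ hφ T).1 hT).ext h⟩

end DualConstruction

/-! ### Biderivations of forms are generated by second order operators -/

section DualGenerators

variable {R : Type*} [CommRing R] [Algebra ℝ R] {P : Type*} [AddCommGroup P] [Module ℝ P]
  [Module R P] [IsScalarTower ℝ R P] {κ : Type*} [Fintype κ]

/-- Graded skew-symmetric biderivations of degree `-1` of the forms. -/
structure IsBiderivation (b : Form R P →ₗ[ℝ] Form R P →ₗ[ℝ] Form R P) : Prop where
  degree : ∀ i j : ℤ, ∀ x ∈ extDeg R (Module.Dual R P) i, ∀ y ∈ extDeg R (Module.Dual R P) j,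
    b x y ∈ extDeg R (Module.Dual R P) (i + j - 1)
  skew : ∀ i j : ℤ, ∀ x ∈ extDeg R (Module.Dual R P) i, ∀ y ∈ extDeg R (Module.Dual R P) j,
    b x y = -(((i - 1) * (j - 1)).negOnePow • b y x)
  leibniz : ∀ i j : ℤ, ∀ x ∈ extDeg R (Module.Dual R P) i,
    ∀ y ∈ extDeg R (Module.Dual R P) j, ∀ z,
    b x (y * z) = b x y * z + ((i - 1) * j).negOnePow • (y * b x z)

theorem QuasiDiffGerstenhaber.isBiderivation (T : QuasiDiffGerstenhaber R P) :
    IsBiderivation T.bracket :=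
  ⟨T.bracket_degree, T.bracket_skew, T.bracket_leibniz⟩

theorem generatedBracket_isBiderivation {G : Module.End ℝ (Form R P)}
    (hG : G ∈ diffOp R (Module.Dual R P) 3 (-1)) : IsBiderivation (generatedBracket G) :=
  ⟨fun _ _ _ ha _ hb => generatedBracket_mem hG ha hb,
    fun _ _ _ ha _ hb => generatedBracket_skew hG ha hb,
    fun _ _ _ ha _ hb c => generatedBracket_mul hG ha hb c⟩

variable {b b' : Form R P →ₗ[ℝ] Form R P →ₗ[ℝ] Form R P}

theorem IsBiderivation.sub (h : IsBiderivation b) (h' : IsBiderivation b') :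
    IsBiderivation (b - b') where
  degree i j x hx y hy := Submodule.sub_mem _ (h.degree i j x hx y hy) (h'.degree i j x hx y hy)
  skew i j x hx y hy := by
    simp only [LinearMap.sub_apply]
    rw [h.skew i j x hx y hy, h'.skew i j x hx y hy, smul_sub]
    abel
  leibniz i j x hx y hy z := by
    simp only [LinearMap.sub_apply]
    rw [h.leibniz i j x hx y hy, h'.leibniz i j x hx y hy, mul_sub, smul_sub]
    have : (b x y - b' x y) * z = b x y * z - b' x y * z := sub_mul _ _ _
    rw [this]
    abel

theorem IsBiderivation.function_function (h : IsBiderivation b) (f g : R) :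
    b (algebraMap R _ f) (algebraMap R _ g) = 0 :=
  eq_zero_of_mem_extDeg_neg (h.degree 0 0 _ (algebraMap_mem_extDeg f) _ (algebraMap_mem_extDeg g))
    (by norm_num)

theorem IsBiderivation.function_ι (h : IsBiderivation b) (f : R) (α : Module.Dual R P) :
    b (algebraMap R _ f) (ExteriorAlgebra.ι R α) =
      -b (ExteriorAlgebra.ι R α) (algebraMap R _ f) := by
  rw [h.skew 0 1 _ (algebraMap_mem_extDeg f) _ (ι_mem_extDeg α), sub_self, mul_zero,
    Int.negOnePow_zero, one_smul]

theorem IsBiderivation.ι_ι (h : IsBiderivation b) (α β : Module.Dual R P) :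
    b (ExteriorAlgebra.ι R α) (ExteriorAlgebra.ι R β) =
      -b (ExteriorAlgebra.ι R β) (ExteriorAlgebra.ι R α) := by
  rw [h.skew 1 1 _ (ι_mem_extDeg α) _ (ι_mem_extDeg β), sub_self, mul_zero,
    Int.negOnePow_zero, one_smul]

theorem IsBiderivation.ι_smul (h : IsBiderivation b) (α β : Module.Dual R P) (f : R) :
    b (ExteriorAlgebra.ι R α) (ExteriorAlgebra.ι R (f • β)) =
      b (ExteriorAlgebra.ι R α) (algebraMap R _ f) * ExteriorAlgebra.ι R β +
        f • b (ExteriorAlgebra.ι R α) (ExteriorAlgebra.ι R β) := by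
  rw [map_smul, Algebra.smul_def, h.leibniz 1 0 _ (ι_mem_extDeg α) _ (algebraMap_mem_extDeg f),
    mul_zero, Int.negOnePow_zero, one_smul, Algebra.smul_def]

theorem IsBiderivation.eq_zero_left (h : IsBiderivation b) {i : ℤ} {x : Form R P}
    (hx : x ∈ extDeg R (Module.Dual R P) i) (h0 : ∀ f, b x (algebraMap R _ f) = 0)
    (h1 : ∀ β, b x (ExteriorAlgebra.ι R β) = 0) : b x = 0 := by
  refine derivation_ext (i - 1) (D := b x) (D' := 0) (fun e y hy z => h.leibniz i e x hx y hy z)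
    (fun e y hy z => ?_) h0 h1
  simp only [LinearMap.zero_apply, zero_mul, mul_zero, smul_zero, add_zero]

theorem IsBiderivation.eq_zero (h : IsBiderivation b)
    (h0 : ∀ α f, b (ExteriorAlgebra.ι R α) (algebraMap R _ f) = 0)
    (h1 : ∀ α β, b (ExteriorAlgebra.ι R α) (ExteriorAlgebra.ι R β) = 0) : b = 0 := by
  have hf : ∀ f, b (algebraMap R _ f) = 0 := fun f =>
    h.eq_zero_left (algebraMap_mem_extDeg f) (h.function_function f) fun β => by
      rw [h.function_ι, h0, neg_zero]
  have hα : ∀ α, b (ExteriorAlgebra.ι R α) = 0 := fun α =>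
    h.eq_zero_left (ι_mem_extDeg α) (h0 α) (h1 α)
  refine LinearMap.ext fun x => ?_
  rw [LinearMap.zero_apply]
  induction x using ext_induction with
  | h0 => exact map_zero _
  | hadd x y hx hy => rw [map_add, hx, hy, add_zero]
  | hom i x hx =>
    refine h.eq_zero_left hx (fun f => ?_) fun β => ?_
    · rw [h.skew i 0 x hx _ (algebraMap_mem_extDeg f), hf, LinearMap.zero_apply, smul_zero,
        neg_zero]
    · rw [h.skew i 1 x hx _ (ι_mem_extDeg β), hα, LinearMap.zero_apply, smul_zero, neg_zero]

theorem algebraMap_form_injective : Function.Injective (algebraMap R (Form R P)) :=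
  ExteriorAlgebra.algebraMap_leftInverse (Module.Dual R P) |>.injective

theorem algebraMap_form_smul (r : ℝ) (f : R) :
    algebraMap R (Form R P) (r • f) = r • algebraMap R (Form R P) f := by
  rw [Algebra.algebraMap_eq_smul_one, Algebra.algebraMap_eq_smul_one, smul_assoc]

/-- The anchor of a biderivation. -/
theorem IsBiderivation.exists_anchor (h : IsBiderivation b) :
    ∃ ρ : Module.Dual R P →ₗ[R] R → R,
      (∀ α f, b (ExteriorAlgebra.ι R α) (algebraMap R _ f) = algebraMap R _ (ρ α f)) ∧
      (∀ α f g, ρ α (f + g) = ρ α f + ρ α g) ∧ (∀ α (r : ℝ) f, ρ α (r • f) = r • ρ α f) ∧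
      ∀ α f g, ρ α (f * g) = f * ρ α g + g * ρ α f := by
  have hρ : ∀ (α : Module.Dual R P) (f : R), ∃ r : R,
      b (ExteriorAlgebra.ι R α) (algebraMap R _ f) = algebraMap R _ r := fun α f =>
    exists_algebraMap_eq (h.degree 1 0 _ (ι_mem_extDeg α) _ (algebraMap_mem_extDeg f))
  choose ρ hρ using hρ
  refine ⟨{ toFun := ρ, map_add' := fun α β => ?_, map_smul' := fun r α => ?_ }, hρ,
    fun α f g => ?_, fun α r f => ?_, fun α f g => ?_⟩
  · funext f
    refine algebraMap_form_injective (R := R) (P := P) ?_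
    rw [Pi.add_apply, map_add, ← hρ, ← hρ, ← hρ, map_add, map_add, LinearMap.add_apply]
  · funext f
    refine algebraMap_form_injective (R := R) (P := P) ?_
    rw [RingHom.id_apply, Pi.smul_apply, smul_eq_mul, map_mul, ← hρ, ← hρ,
      ← neg_neg (b _ (algebraMap R _ f)), ← h.function_ι, map_smul, Algebra.smul_def,
      h.leibniz 0 0 _ (algebraMap_mem_extDeg f) _ (algebraMap_mem_extDeg r),
      h.function_function, zero_mul, zero_add, mul_zero, Int.negOnePow_zero, one_smul,
      h.function_ι, mul_neg, neg_neg]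
  · refine algebraMap_form_injective (R := R) (P := P) ?_
    change algebraMap R _ (ρ α (f + g)) = algebraMap R _ (ρ α f + ρ α g)
    rw [map_add, ← hρ, ← hρ, ← hρ, map_add, map_add]
  · refine algebraMap_form_injective (R := R) (P := P) ?_
    change algebraMap R _ (ρ α (r • f)) = algebraMap R _ (r • ρ α f)
    rw [algebraMap_form_smul, ← hρ, ← hρ, algebraMap_form_smul, map_smul]
  · refine algebraMap_form_injective (R := R) (P := P) ?_
    change algebraMap R _ (ρ α (f * g)) = algebraMap R _ (f * ρ α g + g * ρ α f)
    rw [map_add, map_mul, map_mul, ← hρ, ← hρ, ← hρ, map_mul,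
      h.leibniz 1 0 _ (ι_mem_extDeg α) _ (algebraMap_mem_extDeg f), mul_zero, Int.negOnePow_zero,
      one_smul, add_comm, Algebra.commutes g]

/-- The anchor ρ(α)f is linear in α, so it is α(V f) with V f = ∑ ρ(ε_i)f e_i. This V is a
derivation with values in sections and lifts to an operator. -/
theorem Frame.exists_represents_anchor (B : Frame R P κ) (h : IsBiderivation b) :
    ∃ G ∈ ops R P 2 1, ∀ α f, generatedBracket G (ExteriorAlgebra.ι R α) (algebraMap R _ f) =
      b (ExteriorAlgebra.ι R α) (algebraMap R _ f) := by
  obtain ⟨ρ, hρ, hadd, hsmul, hmul⟩ := h.exists_anchor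
  let V : R →ₗ[ℝ] P :=
    { toFun := fun f => ∑ i, ρ (B.ε i) f • B.e i
      map_add' := fun f g => by simp only [hadd, add_smul, Finset.sum_add_distrib]
      map_smul' := fun r f => by
        simp only [hsmul, RingHom.id_apply, Finset.smul_sum, smul_assoc] }
  have hV : ∀ α f, α (V f) = ρ α f := fun α f => by
    have h1 : ρ α f = ρ (∑ i, α (B.e i) • B.ε i) f :=
      congrArg (fun β => ρ β f) (B.dual.sum_smul α).symm
    rw [h1, map_sum, Finset.sum_apply]
    change α (∑ i, ρ (B.ε i) f • B.e i) = _
    rw [map_sum]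
    refine Finset.sum_congr rfl fun i _ => ?_
    rw [map_smul, map_smul, Pi.smul_apply, smul_eq_mul, smul_eq_mul, mul_comm]
  obtain ⟨G, hG, hGV⟩ := B.exists_lift_section V fun f g => by
    change ∑ i, ρ (B.ε i) (f * g) • B.e i =
      f • ∑ i, ρ (B.ε i) g • B.e i + g • ∑ i, ρ (B.ε i) f • B.e i
    simp only [hmul, add_smul, Finset.sum_add_distrib, Finset.smul_sum, smul_smul]
  refine ⟨G, hG, fun α f => mulOp_injective ?_⟩
  have e := mulOp_generatedBracket hG (algebraMap_mem_extDeg f) (ι_mem_extDeg α)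
  rw [bracketOp, adOp, scomm_swap 0 (-1), hGV, mul_neg_one, neg_zero, Int.negOnePow_zero, one_smul, scomm_neg_left,
    zero_sub, scomm_ins_mulOp (V f) (ι_mem_extDeg α), ins_ι, hV, ← hρ,
    (generatedBracket_isBiderivation hG).function_ι] at e
  have hn : ∀ x : Form R P, mulOp (-x) = -mulOp x := fun x => map_neg (LinearMap.mul ℝ (Form R P)) x
  rw [hn] at e
  exact neg_injective e

theorem generatedBracket_ι (G : Module.End ℝ (Form R P)) (α : Module.Dual R P) (x : Form R P) :
    generatedBracket G (ExteriorAlgebra.ι R α) x = ExteriorAlgebra.ι R α * G x +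
      G (ExteriorAlgebra.ι R α * x) - G (ExteriorAlgebra.ι R α) * x := by
  change _ * G x - G (gradingInv R (Module.Dual R P) _ * x) +
      G (gradingInv R (Module.Dual R P) _) * x = _
  rw [gradingInv_apply (ι_mem_extDeg α), Int.negOnePow_one, Units.neg_smul, one_smul, neg_mul,
    map_neg, map_neg, neg_mul, sub_neg_eq_add, sub_eq_add_neg]

theorem ins_smul_apply (X : P) (f : R) (x : Form R P) :
    ins X (algebraMap R _ f * x) = algebraMap R _ f * ins X x := by
  rw [ins_apply, ins_apply, ← Algebra.smul_def, ← Algebra.smul_def, map_smul]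

theorem ins_ι_mul_ι (X Y : P) (α β : Module.Dual R P) :
    ins X (ins Y (ExteriorAlgebra.ι R α * ExteriorAlgebra.ι R β)) =
      algebraMap R _ (α Y * β X - α X * β Y) := by
  have h := apply_mul_of_scomm (scomm_ins_mulOp Y (ι_mem_extDeg α)) (ExteriorAlgebra.ι R β)
  rw [ins_ι, ins_ι, mul_one, Int.negOnePow_odd (-1) (by decide), Units.neg_smul, one_smul,
    ← Algebra.commutes] at h
  rw [h, map_add, map_neg, ins_smul_apply, ins_smul_apply, ins_ι, ins_ι, ← map_mul, ← map_mul,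
    ← map_neg, ← map_add]
  congr 1
  ring

/-- A tensorial biderivation is generated by an operator. -/
theorem Frame.exists_represents_tensorial (B : Frame R P κ) (h : IsBiderivation b)
    (h0 : ∀ α f, b (ExteriorAlgebra.ι R α) (algebraMap R _ f) = 0) :
    ∃ H ∈ ops R P 2 1, generatedBracket H = b := by
  -- The candidate is H = -½ ∑ b(ε_i,ε_j) ι_{e_i} ι_{e_j}. It kills functions and one-forms, so the
  -- bracket it generates on α, β is H(αβ). The sum over i, j gives b(β,α) - b(α,β) = -2b(α,β).
  set K : κ → κ → Module.End ℝ (Form R P) := fun i j =>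
    mulOp (b (ExteriorAlgebra.ι R (B.ε i)) (ExteriorAlgebra.ι R (B.ε j))) *
      (ins (B.e i) * ins (B.e j)) with hK
  have hKm : ∀ i j, K i j ∈ diffOp R (Module.Dual R P) 3 (-1) := fun i j => by
    have h1 : ins (B.e i) * ins (B.e j) ∈ diffOp R (Module.Dual R P) 3 (-1 + -1) :=
      diffOp_mul (by norm_num) (ins_mem (B.e i)) (ins_mem (B.e j))
    have h2 := h.degree 1 1 _ (ι_mem_extDeg (B.ε i)) _ (ι_mem_extDeg (B.ε j))
    have h3 := diffOp_mul (c := 3) (by norm_num) (mulLeft_mem_diffOp h2) h1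
    exact h3
  have hK0 : ∀ i j, ∀ f, K i j (algebraMap R _ f) = 0 := fun i j f =>
    eq_zero_of_mem_extDeg_neg (diffOp_degree (hKm i j) (algebraMap_mem_extDeg f)) (by norm_num)
  have hK1 : ∀ i j α, K i j (ExteriorAlgebra.ι R α) = 0 := fun i j α => by
    change mulOp _ (ins (B.e i) (ins (B.e j) _)) = 0
    rw [LinearMap.mulLeft_apply]
    rw [ins_ι, Algebra.algebraMap_eq_smul_one, ins_apply, map_smul, ← ins_apply, ins_one,
      smul_zero, mul_zero]
  set H : Module.End ℝ (Form R P) := (-1 / 2 : ℝ) • ∑ i, ∑ j, K i j with hH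
  have hHm : H ∈ diffOp R (Module.Dual R P) 3 (-1) := Submodule.smul_mem _ _
    (Submodule.sum_mem _ fun i _ => Submodule.sum_mem _ fun j _ => hKm i j)
  have happ : ∀ x, H x = (-1 / 2 : ℝ) • ∑ i, ∑ j, K i j x := fun x => by
    simp only [hH, LinearMap.smul_apply, LinearMap.sum_apply]
  have hH0 : ∀ f, H (algebraMap R _ f) = 0 := fun f => by
    simp only [happ, hK0, Finset.sum_const_zero, smul_zero]
  have hH1 : ∀ α, H (ExteriorAlgebra.ι R α) = 0 := fun α => by
    simp only [happ, hK1, Finset.sum_const_zero, smul_zero]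
  have hlin : ∀ α β, ∑ j, β (B.e j) • b (ExteriorAlgebra.ι R α) (ExteriorAlgebra.ι R (B.ε j)) =
      b (ExteriorAlgebra.ι R α) (ExteriorAlgebra.ι R β) := fun α β => by
    have h1 : ∀ j, β (B.e j) • b (ExteriorAlgebra.ι R α) (ExteriorAlgebra.ι R (B.ε j)) =
        b (ExteriorAlgebra.ι R α) (ExteriorAlgebra.ι R (β (B.e j) • B.ε j)) := fun j => by
      rw [h.ι_smul, h0, zero_mul, zero_add]
    simp only [h1]
    rw [← map_sum, ← map_sum]
    congr 2
    exact B.dual.sum_smul β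
  have hlin' : ∀ α β, ∑ i, α (B.e i) • b (ExteriorAlgebra.ι R (B.ε i)) (ExteriorAlgebra.ι R β) =
      b (ExteriorAlgebra.ι R α) (ExteriorAlgebra.ι R β) := fun α β => by
    rw [h.ι_ι, ← hlin, ← Finset.sum_neg_distrib]
    refine Finset.sum_congr rfl fun i _ => ?_
    rw [h.ι_ι, smul_neg]
  refine ⟨H, hHm, sub_eq_zero.1 (((generatedBracket_isBiderivation hHm).sub h).eq_zero
    (fun α f => ?_) fun α β => ?_)⟩
  · rw [LinearMap.sub_apply, LinearMap.sub_apply, h0, generatedBracket_ι, hH0, hH1,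
      ← Algebra.commutes, ← Algebra.smul_def, ← map_smul, hH1]
    simp only [mul_zero, zero_mul, add_zero, sub_zero]
  · have hKK : ∀ i j, K i j (ExteriorAlgebra.ι R α * ExteriorAlgebra.ι R β) =
        β (B.e i) • α (B.e j) • b (ExteriorAlgebra.ι R (B.ε i)) (ExteriorAlgebra.ι R (B.ε j)) -
          α (B.e i) • β (B.e j) •
            b (ExteriorAlgebra.ι R (B.ε i)) (ExteriorAlgebra.ι R (B.ε j)) := fun i j => by
      change mulOp _ (ins (B.e i) (ins (B.e j) _)) = _
      rw [LinearMap.mulLeft_apply]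
      rw [ins_ι_mul_ι, ← Algebra.commutes, ← Algebra.smul_def, smul_smul, smul_smul, sub_smul,
        mul_comm (β _)]
    rw [LinearMap.sub_apply, LinearMap.sub_apply, generatedBracket_ι, hH1, hH1, mul_zero, zero_mul,
      zero_add, sub_zero, happ]
    simp only [hKK, Finset.sum_sub_distrib, ← Finset.smul_sum, hlin, hlin']
    rw [h.ι_ι β α]
    module

theorem generatedBracket_add (G H : Module.End ℝ (Form R P)) :
    generatedBracket (G + H) = generatedBracket G + generatedBracket H := by
  refine LinearMap.ext fun a => LinearMap.ext fun x => ?_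
  change a * (G x + H x) - (G _ + H _) + (G _ + H _) * x = (_ - G _ + G _ * x) + (_ - H _ + H _ * x)
  rw [mul_add, add_mul]
  abel

/-- After the bracket generated by a lift of the anchor is subtracted, the remaining biderivation is
linear over functions. -/
theorem Frame.exists_generatedBracket_eq (B : Frame R P κ) (h : IsBiderivation b) :
    ∃ G ∈ ops R P 2 1, generatedBracket G = b := by
  obtain ⟨G, hG, hGb⟩ := B.exists_represents_anchor h
  obtain ⟨H, hH, hHb⟩ := B.exists_represents_tensorial
    (h.sub (generatedBracket_isBiderivation hG)) fun α f => by
      rw [LinearMap.sub_apply, LinearMap.sub_apply, hGb, sub_self]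
  exact ⟨G + H, Submodule.add_mem _ hG hH, by
    rw [generatedBracket_add, hHb]
    exact add_sub_cancel (generatedBracket G) b⟩

variable {T : QuasiDiffGerstenhaber R P}

theorem Frame.exists_dualRepresents (B : Frame R P κ) (T : QuasiDiffGerstenhaber R P) :
    ∃ G ∈ ops R P 2 1, ∃ D ∈ ops R P 1 2, ∃ F ∈ ops R P 0 3, DualRepresents T G D F := by
  obtain ⟨G, hG, hGb⟩ := B.exists_generatedBracket_eq T.isBiderivation
  have hδ : ∀ j, ∀ a ∈ extDeg R (Module.Dual R P) j,
      scomm 1 j T.δ (mulOp a) = mulOp (T.δ a) := fun j a ha => by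
    ext z
    simp only [scomm, LinearMap.sub_apply, Module.End.mul_apply, LinearMap.mulLeft_apply,
      LinearMap.smul_apply]
    rw [T.δ_mul j a ha, one_mul, add_sub_cancel_right]
  have hD : T.δ ∈ diffOp R (Module.Dual R P) 2 1 := by
    refine ⟨T.δ_degree, fun j a ha => ?_⟩
    rw [hδ j a ha, add_comm]
    exact mulLeft_mem_diffOp (T.δ_degree j a ha)
  refine ⟨G, hG, T.δ, hD, mulOp T.φ, mulOp_mem T.φ_degree, fun i j a ha b hb => ?_,
    fun i a ha => (hδ i a ha).symm, rfl⟩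
  rw [← hGb]
  exact mulOp_generatedBracket hG ha hb

/-- Operators with the same double commutators differ by an operator of order at most one, and those
with the same simple commutators by one of order zero; neither difference is seen by the symbol. -/
theorem DualRepresents.unique {G D F G' D' F' : Module.End ℝ (Form R P)} (hG : G ∈ ops R P 2 1)
    (hD : D ∈ ops R P 1 2) (hG' : G' ∈ ops R P 2 1) (hD' : D' ∈ ops R P 1 2)
    (h : DualRepresents T G D F) (h' : DualRepresents T G' D' F') :
    G - G' ∈ lowerOps R P 2 1 ∧ D - D' ∈ lowerOps R P 1 2 ∧ F - F' ∈ lowerOps R P 0 3 := by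
  have hGG : G - G' ∈ diffOp R (Module.Dual R P) 3 (-1) := Submodule.sub_mem _ hG hG'
  have hDD : D - D' ∈ diffOp R (Module.Dual R P) 2 1 := Submodule.sub_mem _ hD hD'
  have h1 : G - G' ∈ diffOp R (Module.Dual R P) 2 (-1) := by
    refine mem_diffOp_of_scomm (n := 1) hGG fun i a ha => ?_
    have hm : scomm i (-1) (mulOp a) (G - G') ∈ diffOp R (Module.Dual R P) 2 (i - 1) :=
      adOp_mem hGG ha
    rw [← sub_eq_add_neg]
    refine mem_diffOp_of_scomm (n := 0) hm fun j c hc => ?_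
    have e := (h.bracket i j a ha c hc).symm.trans (h'.bracket i j a ha c hc)
    have e' : scomm (i - 1) j (scomm i (-1) (mulOp a) (G - G')) (mulOp c) = 0 := by
      rw [sub_eq_add_neg G, scomm_add_right, scomm_neg_right, scomm_add_left, scomm_neg_left]
      exact add_neg_eq_zero.2 e
    rw [scomm_swap, e', smul_zero, neg_zero]
    exact Submodule.zero_mem _
  have h2 : D - D' ∈ diffOp R (Module.Dual R P) 1 1 := by
    refine ⟨fun i x hx => diffOp_degree hDD hx, fun j a ha => ?_⟩
    rw [sub_eq_add_neg, scomm_add_left, scomm_neg_left, ← h.δ j a ha, ← h'.δ j a ha,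
      add_neg_cancel]
    exact Submodule.zero_mem _
  refine ⟨h1, h2, ?_⟩
  rw [← h.φ, ← h'.φ, sub_self]
  exact Submodule.zero_mem _

/-- Every quasi-differential Gerstenhaber algebra corresponds to exactly one quasi-Lie
bialgebroid. -/
theorem Frame.existsUnique_dualCorresponds (B : Frame R P κ) (T : QuasiDiffGerstenhaber R P) :
    ∃! Q : QuasiLieBialgebroid R P, DuallyCorresponds Q T := by
  obtain ⟨G, hG, D, hD, F, hF, h⟩ := B.exists_dualRepresents T
  have hmc := h.mcOps hG hD hF
  rw [← poisson_theta_eq_zero_iff hG hD hF] at hmc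
  refine ⟨⟨Subquot.mk _ D hD, Subquot.mk _ G hG, Subquot.mk _ F hF, hmc⟩,
    (dualCorresponds_iff hG hD hF rfl rfl rfl T).2 h, fun Q' hQ' => ?_⟩
  obtain ⟨G', D', F', hG', hD', hF', hγ, hμ, hφ⟩ := Q'.exists_rep
  obtain ⟨h1, h2, h3⟩ := ((dualCorresponds_iff hG' hD' hF' hγ hμ hφ T).1 hQ').unique
    hG' hD' hG hD h
  exact QuasiLieBialgebroid.ext (toHam_injective _ _ (hμ.symm.trans (symb_eq_symb.2 h2)))
    (toHam_injective _ _ (hγ.symm.trans (symb_eq_symb.2 h1)))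
    (toHam_injective _ _ (hφ.symm.trans (symb_eq_symb.2 h3)))

end DualGenerators

/-! ### Local frames and a dimension count for covectors -/

section SpanningSections

open Bundle Topology Module

variable {E : Type*} [NormedAddCommGroup E] [NormedSpace ℝ E] [FiniteDimensional ℝ E]
  {M : Type*} [TopologicalSpace M] [ChartedSpace E M] [IsManifold 𝓘(ℝ, E) ∞ M]
  [T2Space M] [SecondCountableTopology M]
  {F : Type*} [NormedAddCommGroup F] [NormedSpace ℝ F] [FiniteDimensional ℝ F]
  {A : M → Type*} [TopologicalSpace (TotalSpace F A)]
  [∀ x, AddCommGroup (A x)] [∀ x, Module ℝ (A x)] [∀ x, TopologicalSpace (A x)]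
  [FiberBundle F A] [VectorBundle ℝ F A] [ContMDiffVectorBundle ∞ F A 𝓘(ℝ, E)]

variable (F A) in
/-- The coordinates on the fibres of a vector bundle in the trivialization at a point. -/
def fibreCoord (x₀ : M) (i : Fin (finrank ℝ F)) (x : M) : Dual ℝ (A x) :=
  (finBasis ℝ F).coord i ∘ₗ (trivializationAt F A x₀).linearMapAt ℝ x

theorem contMDiffAt_fibreCoord {x₀ x : M} (hx : x ∈ (trivializationAt F A x₀).baseSet)
    (s : Cₛ^∞⟮𝓘(ℝ, E); F, A⟯) (i : Fin (finrank ℝ F)) :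
    ContMDiffAt 𝓘(ℝ, E) 𝓘(ℝ, ℝ) ∞ (fun y => fibreCoord F A x₀ i y (s y)) x := by
  have h₁ : ContMDiffAt 𝓘(ℝ, E) 𝓘(ℝ, F) ∞
      (fun y => (trivializationAt F A x₀ ⟨y, s y⟩).2) x :=
    ((trivializationAt F A x₀).contMDiffAt_section_iff hx).1 (s.contMDiff x)
  have h₂ : ContMDiffAt 𝓘(ℝ, F) 𝓘(ℝ, ℝ) ∞ ((finBasis ℝ F).coord i).toContinuousLinearMap
      (trivializationAt F A x₀ ⟨x, s x⟩).2 :=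
    contMDiffAt_iff_contDiffAt.2 (ContinuousLinearMap.contDiff _).contDiffAt
  refine (h₂.comp x h₁).congr_of_eventuallyEq ?_
  filter_upwards [(trivializationAt F A x₀).open_baseSet.mem_nhds hx] with y hy
  simp [fibreCoord, (trivializationAt F A x₀).coe_linearMapAt_of_mem hy]

theorem exists_eq_sum_fibreCoord {x₀ x : M} (hx : x ∈ (trivializationAt F A x₀).baseSet)
    (α : Dual ℝ (A x)) : ∃ a : Fin (finrank ℝ F) → ℝ, α = ∑ i, a i • fibreCoord F A x₀ i x := by
  let L := (trivializationAt F A x₀).linearEquivAt ℝ x hx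
  refine ⟨fun i => α (L.symm (finBasis ℝ F i)), LinearMap.ext fun v => ?_⟩
  have h := (finBasis ℝ F).sum_repr (L v)
  have h2 : v = L.symm (∑ i, (finBasis ℝ F).repr (L v) i • finBasis ℝ F i) := by
    rw [h, LinearEquiv.symm_apply_apply]
  conv_lhs => rw [h2]
  rw [map_sum, map_sum, LinearMap.sum_apply]
  refine Finset.sum_congr rfl fun i _ => ?_
  rw [map_smul, map_smul, LinearMap.smul_apply, smul_eq_mul, smul_eq_mul, mul_comm]
  congr 1
  simp [fibreCoord, (trivializationAt F A x₀).coe_linearMapAt_of_mem hx, L]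

/-- The sections `s` span the fibre over `x`. -/
def SpansAt {ι : Type*} (s : ι → Cₛ^∞⟮𝓘(ℝ, E); F, A⟯) (x : M) : Prop :=
  ∀ α : Dual ℝ (A x), (∀ i, α (s i x) = 0) → α = 0

/-- A local frame cut off by a bump function that equals one near the point. -/
theorem exists_spansAt_nhds (x₀ : M) : ∃ s : Fin (finrank ℝ F) → Cₛ^∞⟮𝓘(ℝ, E); F, A⟯,
    ∀ᶠ x in 𝓝 x₀, SpansAt s x := by
  have hx₀ := FiberBundle.mem_baseSet_trivializationAt' (F := F) (E := A) x₀
  obtain ⟨f, -, hf⟩ := (SmoothBumpFunction.nhds_basis_tsupport (I := 𝓘(ℝ, E)) x₀).mem_iff.1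
    ((trivializationAt F A x₀).open_baseSet.mem_nhds hx₀)
  have hs : ∀ i, ContMDiff 𝓘(ℝ, E) (𝓘(ℝ, E).prod 𝓘(ℝ, F)) ∞ fun x =>
      TotalSpace.mk' F x (f x • (trivializationAt F A x₀).localFrame (finBasis ℝ F) i x) :=
    fun i => ContMDiffOn.smul_section_of_tsupport f.contMDiff.contMDiffOn
      (trivializationAt F A x₀).open_baseSet hf
      ((trivializationAt F A x₀).contMDiffOn_localFrame_baseSet ∞ (finBasis ℝ F) i)
  refine ⟨fun i => ⟨_, hs i⟩, ?_⟩
  filter_upwards [f.eventuallyEq_one, (trivializationAt F A x₀).open_baseSet.mem_nhds hx₀]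
    with x hx hxb α hα
  refine ((trivializationAt F A x₀).basisAt (finBasis ℝ F) hxb).ext fun i => ?_
  have h : α (f x • (trivializationAt F A x₀).localFrame (finBasis ℝ F) i x) = 0 := hα i
  rw [hx, Pi.one_apply, one_smul,
    (trivializationAt F A x₀).localFrame_apply_of_mem_baseSet (finBasis ℝ F) hxb] at h
  exact h

/-- The values of the sections `s` on all covectors of the bundle do not fill their space. -/
theorem exists_forall_apply_ne {m : ℕ} (hm : finrank ℝ E + finrank ℝ F < m)
    (s : Fin m → Cₛ^∞⟮𝓘(ℝ, E); F, A⟯) :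
    ∃ v : Fin m → ℝ, ∀ x (α : Dual ℝ (A x)), (fun k => α (s k x)) ≠ v := by
  let U : M → Set M := fun x₀ => (chartAt E x₀).source ∩ (trivializationAt F A x₀).baseSet
  have hUo : ∀ x₀, IsOpen (U x₀) := fun x₀ =>
    (chartAt E x₀).open_source.inter (trivializationAt F A x₀).open_baseSet
  have hU : ∀ x₀, U x₀ ∈ 𝓝 x₀ := fun x₀ => (hUo x₀).mem_nhds
    ⟨mem_chart_source E x₀, FiberBundle.mem_baseSet_trivializationAt' (F := F) (E := A) x₀⟩
  obtain ⟨t, htc, htU⟩ := TopologicalSpace.countable_cover_nhds hU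
  -- The map (x,α) ↦ (α(s_k(x)))_k on the total space of the dual bundle, written in a chart and a
  -- trivialization. Its source has dimension dim M + rank, less than m.
  let f : M → E × (Fin (finrank ℝ F) → ℝ) → Fin m → ℝ := fun x₀ p k =>
    ∑ i, p.2 i • fibreCoord F A x₀ i ((chartAt E x₀).symm p.1) (s k ((chartAt E x₀).symm p.1))
  let W : M → Set (E × (Fin (finrank ℝ F) → ℝ)) := fun x₀ =>
    ((chartAt E x₀).target ∩ (chartAt E x₀).symm ⁻¹' U x₀) ×ˢ Set.univ
  have hf : ∀ x₀, ∀ p ∈ W x₀, ContDiffAt ℝ 1 (f x₀) p := by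
    rintro x₀ ⟨y, a⟩ ⟨⟨hy, hyU⟩, -⟩
    refine contDiffAt_pi.2 fun k => ContDiffAt.sum fun i _ => ?_
    have h0 : ContDiffAt ℝ 1 (fun p : E × (Fin (finrank ℝ F) → ℝ) => p.2 i) (y, a) :=
      ((ContinuousLinearMap.proj (R := ℝ) (φ := fun _ : Fin (finrank ℝ F) => ℝ) i).comp
        (ContinuousLinearMap.snd ℝ E (Fin (finrank ℝ F) → ℝ))).contDiff.contDiffAt
    have h1 := contMDiffAt_fibreCoord hyU.2 (s k) i
    have h2 : ContMDiffAt 𝓘(ℝ, E) 𝓘(ℝ, E) ∞ (chartAt E x₀).symm y :=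
        (contMDiffOn_chart_symm (I := 𝓘(ℝ, E)) (n := ∞)).contMDiffAt
          ((chartAt E x₀).open_target.mem_nhds hy)
    have h3 := (contMDiffAt_iff_contDiffAt.1 (h1.comp y h2)).of_le
        (show (1 : WithTop ℕ∞) ≤ ∞ by exact_mod_cast le_top)
    exact h0.smul (h3.comp (y, a) contDiffAt_fst)
  -- C¹ maps are locally Lipschitz and do not raise the Hausdorff dimension, and countably many
  -- charts cover M. So the image has dimension less than m, and its complement is dense.
  have hdim : dimH (⋃ x₀ ∈ t, f x₀ '' W x₀) < finrank ℝ (Fin m → ℝ) := by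
    rw [dimH_bUnion htc]
    refine lt_of_le_of_lt (iSup₂_le fun x₀ _ => ?_)
      (show ((finrank ℝ E + finrank ℝ F : ℕ) : ENNReal) < _ by
        rw [finrank_fin_fun]; exact_mod_cast hm)
    refine (dimH_image_le_of_locally_lipschitzOn fun p hp => ?_).trans
      ((dimH_mono (Set.subset_univ _)).trans ?_)
    · obtain ⟨C, u, hu, hC⟩ := (hf x₀ p hp).exists_lipschitzOnWith
      exact ⟨C, u, mem_nhdsWithin_of_mem_nhds hu, hC⟩
    · rw [Real.dimH_univ_eq_finrank, finrank_prod, finrank_fin_fun]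
  obtain ⟨v, hv⟩ := (dense_compl_of_dimH_lt_finrank hdim).nonempty
  refine ⟨v, fun x α h => hv ?_⟩
  obtain ⟨x₀, hx₀, hx⟩ := Set.mem_iUnion₂.1 (htU.symm ▸ Set.mem_univ x : x ∈ ⋃ x₀ ∈ t, U x₀)
  obtain ⟨a, rfl⟩ := exists_eq_sum_fibreCoord hx.2 α
  refine Set.mem_iUnion₂.2 ⟨x₀, hx₀, (chartAt E x₀ x, a), ⟨⟨(chartAt E x₀).map_source hx.1, ?_⟩,
    Set.mem_univ _⟩, ?_⟩
  · rw [Set.mem_preimage, (chartAt E x₀).left_inv hx.1]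
    exact hx
  · rw [← h]
    funext k
    simp only [f, LinearMap.sum_apply, LinearMap.smul_apply]
    exact Finset.sum_congr rfl fun i _ => congrArg
      (fun z => a i • fibreCoord F A x₀ i z (s k z)) ((chartAt E x₀).left_inv hx.1)

end SpanningSections

/-! ### Finitely many sections that span every fibre -/

section FinitelyManySections

open Bundle Topology Module

variable {E : Type*} [NormedAddCommGroup E] [NormedSpace ℝ E] [FiniteDimensional ℝ E]
  {M : Type*} [TopologicalSpace M] [ChartedSpace E M] [IsManifold 𝓘(ℝ, E) ∞ M]
  [T2Space M] [SecondCountableTopology M]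
  {F : Type*} [NormedAddCommGroup F] [NormedSpace ℝ F] [FiniteDimensional ℝ F]
  {A : M → Type*} [TopologicalSpace (TotalSpace F A)]
  [∀ x, AddCommGroup (A x)] [∀ x, Module ℝ (A x)] [∀ x, TopologicalSpace (A x)]
  [FiberBundle F A] [VectorBundle ℝ F A] [ContMDiffVectorBundle ∞ F A 𝓘(ℝ, E)]

/-- The sections are projected along a vector v that is not the value vector of any covector. A
covector that kills the projected sections has values proportional to v; unless these are zero,
rescaling it would give the value v. -/
theorem exists_spansAt_of_succ {m : ℕ} (hm : finrank ℝ E + finrank ℝ F < m + 1)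
    (s : Fin (m + 1) → Cₛ^∞⟮𝓘(ℝ, E); F, A⟯) :
    ∃ s' : Fin m → Cₛ^∞⟮𝓘(ℝ, E); F, A⟯, ∀ x, SpansAt s x → SpansAt s' x := by
  obtain ⟨v, hv⟩ := exists_forall_apply_ne hm s
  rcases isEmpty_or_nonempty M with hM | ⟨⟨x₀⟩⟩
  · exact ⟨fun _ => 0, fun x => hM.elim x⟩
  -- The zero covector has zero values, so v is not zero as soon as M has a point.
  obtain ⟨p, hp⟩ : ∃ p, v p ≠ 0 := by
    by_contra! h
    exact hv x₀ 0 (funext fun k => (h k).symm)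
  refine ⟨fun k => v p • s (p.succAbove k) - v (p.succAbove k) • s p, fun x hx α hα => ?_⟩
  have h1 : ∀ j, v p * α (s j x) = v j * α (s p x) := by
    intro j
    rcases p.eq_self_or_eq_succAbove j with rfl | ⟨k, rfl⟩
    · rfl
    · have h : α (v p • s (p.succAbove k) x - v (p.succAbove k) • s p x) = 0 := hα k
      rw [map_sub, map_smul, map_smul, smul_eq_mul, smul_eq_mul, sub_eq_zero] at h
      exact h
  have h2 : α (s p x) = 0 := by
    by_contra hne
    refine hv x ((v p / α (s p x)) • α) (funext fun k => ?_)
    rw [LinearMap.smul_apply, smul_eq_mul, div_mul_eq_mul_div, h1, mul_div_cancel_right₀ _ hne]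
  refine hx α fun j => ?_
  have := h1 j
  rw [h2, mul_zero] at this
  exact (mul_eq_zero.1 this).resolve_left hp

variable (E F A) in
/-- The bundle is spanned over `W` by as many sections as is its total dimension. -/
def IsSpannedOn (W : Set M) : Prop :=
  ∃ s : Fin (finrank ℝ E + finrank ℝ F) → Cₛ^∞⟮𝓘(ℝ, E); F, A⟯, ∀ x ∈ W, SpansAt s x

/-- The number of sections is bounded independently of W. This uniformity is what allows infinitely
many pieces to be glued with finitely many sections. -/
theorem isSpannedOn_of_spansAt {W : Set M} {m : ℕ} (s : Fin m → Cₛ^∞⟮𝓘(ℝ, E); F, A⟯)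
    (hs : ∀ x ∈ W, SpansAt s x) : IsSpannedOn E F A W := by
  rcases le_total m (finrank ℝ E + finrank ℝ F) with h | h
  · refine ⟨fun i => if hi : (i : ℕ) < m then s ⟨i, hi⟩ else 0, fun x hx α hα => hs x hx α
      fun i => ?_⟩
    have := hα (i.castLE h)
    simpa using this
  · induction m, h using Nat.le_induction with
    | base => exact ⟨s, hs⟩
    | succ m hm ih =>
      obtain ⟨s', hs'⟩ := exists_spansAt_of_succ (Nat.lt_succ_of_le hm) s
      exact ih s' fun x hx => hs' x (hs x hx)

theorem IsSpannedOn.union {W W' : Set M} (h : IsSpannedOn E F A W) (h' : IsSpannedOn E F A W') :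
    IsSpannedOn E F A (W ∪ W') := by
  obtain ⟨s, hs⟩ := h
  obtain ⟨s', hs'⟩ := h'
  refine isSpannedOn_of_spansAt (Fin.append s s') ?_
  rintro x (hx | hx) α hα
  · exact hs x hx α fun i => by
      have := hα (Fin.castAdd _ i)
      rwa [Fin.append_left] at this
  · exact hs' x hx α fun i => by
      have := hα (Fin.natAdd _ i)
      rwa [Fin.append_right] at this

theorem isSpannedOn_of_isCompact {K : Set M} (hK : IsCompact K) : IsSpannedOn E F A K := by
  refine hK.induction_on ⟨fun _ => 0, fun x hx => hx.elim⟩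
    (fun W W' hW => fun ⟨s, hs⟩ => ⟨s, fun x hx => hs x (hW hx)⟩)
    (fun W W' hW hW' => hW.union hW') fun x _ => ?_
  obtain ⟨s, hs⟩ := exists_spansAt_nhds (E := E) (F := F) (A := A) x
  exact ⟨_, mem_nhdsWithin_of_mem_nhds hs, isSpannedOn_of_spansAt s fun y hy => hy⟩

variable (E F A) in
/-- Finitely many sections span all fibres of a vector bundle. -/
theorem exists_spansAt : ∃ s : Fin 2 × Fin (finrank ℝ E + finrank ℝ F) → Cₛ^∞⟮𝓘(ℝ, E); F, A⟯,
    ∀ x, SpansAt s x := by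
  have : LocallyCompactSpace M := ChartedSpace.locallyCompactSpace E M
  -- The shift makes K 0 empty, so the shells W m cover M. A shell meets only those with index
  -- differing by at most one, so shells of equal parity are disjoint. The cut-off sections can then
  -- be added up separately over even and odd m without interfering.
  let K := (CompactExhaustion.choice M).shiftr
  let W : ℕ → Set M := fun m => interior (K (m + 2)) \ K m
  have hWo : ∀ m, IsOpen (W m) := fun m => isOpen_interior.sdiff (K.isCompact m).isClosed
  have hWc : ∀ x, ∃ m, x ∈ W m := fun x => by
    obtain ⟨h1, h2⟩ := (CompactExhaustion.choice M).mem_sdiff_shiftr_find x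
    exact ⟨_, K.subset_interior_succ _ h1, h2⟩
  have hWd : ∀ x m m', x ∈ W m → x ∈ W m' → m' < m + 2 := fun x m m' h h' => by
    by_contra! hle
    exact h'.2 (K.subset hle (interior_subset h.1))
  have hWf : LocallyFinite W := fun x => by
    obtain ⟨j, hj⟩ := K.exists_mem_nhds x
    refine ⟨K j, hj, (Set.finite_lt_nat j).subset ?_⟩
    rintro m ⟨y, hy, hy'⟩
    by_contra! hle
    exact hy.2 (K.subset (not_lt.1 hle) hy')
  choose ψ hψs hψ hψ0 using fun m => (hWo m).exists_contMDiff_support_eq 𝓘(ℝ, E) (n := ⊤)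
  choose t ht using fun m => isSpannedOn_of_isCompact (E := E) (F := F) (A := A)
    (K.isCompact (m + 2))
  let T : Fin 2 × Fin (finrank ℝ E + finrank ℝ F) → ℕ → ∀ x, A x := fun q m x =>
    if m % 2 = q.1 then ψ m x • t m q.2 x else 0
  have hT0 : ∀ q m x, T q m x ≠ 0 → x ∈ W m := fun q m x h => by
    rw [← hψs]
    intro h0
    apply h
    simp only [T, h0, zero_smul, ite_self]
  have hT : ∀ q, ContMDiff 𝓘(ℝ, E) (𝓘(ℝ, E).prod 𝓘(ℝ, F)) ∞ fun x =>
      TotalSpace.mk' F x (∑ᶠ m, T q m x) := fun q => by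
    refine ContMDiff.finsum_section_of_locallyFinite (hWf.subset fun m x hx => hT0 q m x hx)
      fun m => ?_
    by_cases h : m % 2 = q.1
    · simp only [T, if_pos h]
      exact (hψ m).smul_section (t m q.2).contMDiff
    · simp only [T, if_neg h]
      exact (0 : Cₛ^∞⟮𝓘(ℝ, E); F, A⟯).contMDiff
  refine ⟨fun q => ⟨_, hT q⟩, fun x α hα => ?_⟩
  obtain ⟨m, hm⟩ := hWc x
  refine ht m x (interior_subset hm.1) α fun i => ?_
  have h1 : α (∑ᶠ m', T (⟨m % 2, Nat.mod_lt _ two_pos⟩, i) m' x) = 0 := hα _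
  rw [finsum_eq_single _ m] at h1
  · simp only [T, if_pos, map_smul, smul_eq_mul] at h1
    have h2 : ψ m x ≠ 0 := by
      rw [← hψs] at hm
      exact hm
    exact (mul_eq_zero.1 h1).resolve_left h2
  · intro m' hne
    by_contra h
    have h2 : m' % 2 = m % 2 := by
      by_contra h3
      exact h (if_neg h3)
    have h3 := hWd x m m' hm (hT0 _ _ _ h)
    have h4 := hWd x m' m (hT0 _ _ _ h) hm
    omega

end FinitelyManySections

/-! ### The Gram map and the dual basis of the module of sections -/

section GlobalFrame

open Bundle Topology Module

variable {E : Type*} [NormedAddCommGroup E] [NormedSpace ℝ E] [FiniteDimensional ℝ E]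
  {M : Type*} [TopologicalSpace M] [ChartedSpace E M] [IsManifold 𝓘(ℝ, E) ∞ M]
  [T2Space M] [SecondCountableTopology M]
  {F : Type*} [NormedAddCommGroup F] [NormedSpace ℝ F] [FiniteDimensional ℝ F]
  {A : M → Type*} [TopologicalSpace (TotalSpace F A)]
  [∀ x, AddCommGroup (A x)] [∀ x, Module ℝ (A x)] [∀ x, TopologicalSpace (A x)]
  [FiberBundle F A] [VectorBundle ℝ F A] [ContMDiffVectorBundle ∞ F A 𝓘(ℝ, E)]
  {κ : Type*} [Fintype κ] {s : κ → Cₛ^∞⟮𝓘(ℝ, E); F, A⟯}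

/-- The map `∑ s_j ⊗ s_j` from the dual of a fibre to the fibre. -/
def gramMap (s : κ → Cₛ^∞⟮𝓘(ℝ, E); F, A⟯) (x : M) : Dual ℝ (A x) →ₗ[ℝ] A x :=
  ∑ j, (Dual.eval ℝ (A x) (s j x)).smulRight (s j x)

theorem gramMap_apply (x : M) (α : Dual ℝ (A x)) :
    gramMap s x α = ∑ j, α (s j x) • s j x := by
  simp [gramMap]

/-- Pairing the image of α with α gives ∑ α(s_j)², which vanishes only for α = 0 when the sections
span. Equality of dimensions gives surjectivity. -/
theorem gramMap_bijective (hs : ∀ x, SpansAt s x) (x : M) : Function.Bijective (gramMap s x) := by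
  have hx := FiberBundle.mem_baseSet_trivializationAt' (F := F) (E := A) x
  have : FiniteDimensional ℝ (A x) :=
    ((trivializationAt F A x).linearEquivAt ℝ x hx).symm.finiteDimensional
  have hinj : Function.Injective (gramMap s x) := by
    rw [← LinearMap.ker_eq_bot, Submodule.eq_bot_iff]
    intro α hα
    have h : ∑ j, α (s j x) * α (s j x) = 0 := by
      have := congrArg α (LinearMap.mem_ker.1 hα)
      rw [gramMap_apply, map_sum, map_zero] at this
      simpa only [map_smul, smul_eq_mul] using this
    rw [Finset.sum_eq_zero_iff_of_nonneg fun j _ => mul_self_nonneg _] at h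
    exact hs x α fun j => mul_self_eq_zero.1 (h j (Finset.mem_univ j))
  exact ⟨hinj, (LinearMap.injective_iff_surjective_of_finrank_eq_finrank
    Subspace.dual_finrank_eq).1 hinj⟩

/-- The inverse of `gramMap`. -/
def gramInv (hs : ∀ x, SpansAt s x) (x : M) : A x →ₗ[ℝ] Dual ℝ (A x) :=
  (LinearEquiv.ofBijective (gramMap s x) (gramMap_bijective hs x)).symm

theorem gramMap_gramInv (hs : ∀ x, SpansAt s x) (x : M) (v : A x) :
    gramMap s x (gramInv hs x v) = v :=
  (LinearEquiv.ofBijective (gramMap s x) (gramMap_bijective hs x)).apply_symm_apply v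

theorem exists_fibreCoord_eq {x₀ x : M} (hx : x ∈ (trivializationAt F A x₀).baseSet)
    (w : Fin (finrank ℝ F) → ℝ) : ∃ v : A x, ∀ k, fibreCoord F A x₀ k x v = w k := by
  refine ⟨((trivializationAt F A x₀).linearEquivAt ℝ x hx).symm ((finBasis ℝ F).equivFun.symm w),
    fun k => ?_⟩
  have h : (trivializationAt F A x₀).linearMapAt ℝ x
      (((trivializationAt F A x₀).linearEquivAt ℝ x hx).symm ((finBasis ℝ F).equivFun.symm w)) =
      (finBasis ℝ F).equivFun.symm w := by
    rw [(trivializationAt F A x₀).linearMapAt_def_of_mem hx]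
    exact LinearEquiv.apply_symm_apply _ _
  rw [fibreCoord, LinearMap.comp_apply, h, Basis.coord_apply, Basis.equivFun_symm_apply,
    Basis.repr_sum_self]

/-- The matrix of `gramMap` in the trivialization at a point. -/
def gramMatrix (s : κ → Cₛ^∞⟮𝓘(ℝ, E); F, A⟯) (x₀ x : M) :
    (Fin (finrank ℝ F) → ℝ) →L[ℝ] (Fin (finrank ℝ F) → ℝ) :=
  ∑ i, ∑ k, (∑ j, fibreCoord F A x₀ i x (s j x) * fibreCoord F A x₀ k x (s j x)) •
    (ContinuousLinearMap.proj (R := ℝ) (φ := fun _ : Fin (finrank ℝ F) => ℝ) i).smulRight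
      (Pi.single k (1 : ℝ) : Fin (finrank ℝ F) → ℝ)

theorem contMDiffAt_gramMatrix {x₀ x : M} (hx : x ∈ (trivializationAt F A x₀).baseSet) :
    ContMDiffAt 𝓘(ℝ, E) 𝓘(ℝ, (Fin (finrank ℝ F) → ℝ) →L[ℝ] (Fin (finrank ℝ F) → ℝ)) ∞
      (gramMatrix s x₀) x := by
  refine ContMDiffAt.sum fun i _ => ContMDiffAt.sum fun k _ => ?_
  have h : ContMDiffAt 𝓘(ℝ, E) 𝓘(ℝ, ℝ) ∞
      (fun x => ∑ j, fibreCoord F A x₀ i x (s j x) * fibreCoord F A x₀ k x (s j x)) x :=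
    ContMDiffAt.sum fun j _ => (contMDiffAt_fibreCoord hx (s j) i).mul
      (contMDiffAt_fibreCoord hx (s j) k)
  exact h.smul contMDiffAt_const

theorem gramMatrix_apply (hs : ∀ x, SpansAt s x) {x₀ x : M} {v : A x}
    {a : Fin (finrank ℝ F) → ℝ} (ha : gramInv hs x v = ∑ i, a i • fibreCoord F A x₀ i x) :
    gramMatrix s x₀ x a = fun k => fibreCoord F A x₀ k x v := by
  have h := gramMap_gramInv hs x v
  funext k
  conv_rhs => rw [← h]
  rw [gramMap_apply, ha, map_sum]
  simp only [gramMatrix, sum_apply, smul_apply,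
    ContinuousLinearMap.smulRight_apply, ContinuousLinearMap.proj_apply, Finset.sum_apply,
    Pi.smul_apply, Pi.single_apply, smul_eq_mul, mul_ite, mul_one, mul_zero, Finset.sum_ite_eq,
    Finset.mem_univ, if_true, map_smul, LinearMap.sum_apply, LinearMap.smul_apply, Finset.sum_mul]
  rw [Finset.sum_comm]
  exact Finset.sum_congr rfl fun j _ => Finset.sum_congr rfl fun i _ => by ring

theorem isUnit_gramMatrix (hs : ∀ x, SpansAt s x) {x₀ x : M}
    (hx : x ∈ (trivializationAt F A x₀).baseSet) : IsUnit (gramMatrix s x₀ x) := by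
  have hsurj : Function.Surjective (gramMatrix s x₀ x).toLinearMap := fun w => by
    obtain ⟨v, hv⟩ := exists_fibreCoord_eq hx w
    obtain ⟨a, ha⟩ := exists_eq_sum_fibreCoord hx (gramInv hs x v)
    exact ⟨a, (gramMatrix_apply hs ha).trans (funext hv)⟩
  rw [ContinuousLinearMap.isUnit_iff_bijective]
  exact ⟨LinearMap.injective_iff_surjective.2 hsurj, hsurj⟩

/-- In a trivialization the inverse of the Gram map is the inverse of a smooth family of invertible
matrices, and inversion is smooth at units. -/
theorem contMDiff_gramInv (hs : ∀ x, SpansAt s x) (X : Cₛ^∞⟮𝓘(ℝ, E); F, A⟯) (j : κ) :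
    ContMDiff 𝓘(ℝ, E) 𝓘(ℝ, ℝ) ∞ fun x => gramInv hs x (X x) (s j x) := by
  intro x₀
  have hx₀ := FiberBundle.mem_baseSet_trivializationAt' (F := F) (E := A) x₀
  have h1 : ContMDiffAt 𝓘(ℝ, E) 𝓘(ℝ, (Fin (finrank ℝ F) → ℝ) →L[ℝ] (Fin (finrank ℝ F) → ℝ)) ∞
      (fun x => Ring.inverse (gramMatrix s x₀ x)) x₀ := by
    obtain ⟨u, hu⟩ := isUnit_gramMatrix hs hx₀
    have h := contDiffAt_ringInverse (n := ∞) ℝ u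
    rw [hu] at h
    exact (contMDiffAt_iff_contDiffAt.2 h).comp x₀ (contMDiffAt_gramMatrix hx₀)
  have h2 : ContMDiffAt 𝓘(ℝ, E) 𝓘(ℝ, Fin (finrank ℝ F) → ℝ) ∞
      (fun x k => fibreCoord F A x₀ k x (X x)) x₀ :=
    contMDiffAt_pi_space.2 fun k => contMDiffAt_fibreCoord hx₀ X k
  have h3 := contMDiffAt_pi_space.1 (h1.clm_apply h2)
  have h4 : ContMDiffAt 𝓘(ℝ, E) 𝓘(ℝ, ℝ) ∞ (fun x => ∑ i,
      Ring.inverse (gramMatrix s x₀ x) (fun k => fibreCoord F A x₀ k x (X x)) i *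
        fibreCoord F A x₀ i x (s j x)) x₀ :=
    ContMDiffAt.sum fun i _ => (h3 i).mul (contMDiffAt_fibreCoord hx₀ (s j) i)
  refine h4.congr_of_eventuallyEq ?_
  filter_upwards [(trivializationAt F A x₀).open_baseSet.mem_nhds hx₀] with x hx
  obtain ⟨a, ha⟩ := exists_eq_sum_fibreCoord hx (gramInv hs x (X x))
  rw [← gramMatrix_apply hs ha, ← mul_apply_eq_comp,
    Ring.inverse_mul_cancel _ (isUnit_gramMatrix hs hx), ha, LinearMap.sum_apply]
  rfl

variable (E F A) in
/-- The sections of a vector bundle of finite rank are a finitely generated projective module. -/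
theorem exists_frame : Nonempty (Frame C^∞⟮𝓘(ℝ, E), M; 𝓘(ℝ, ℝ), ℝ⟯ Cₛ^∞⟮𝓘(ℝ, E); F, A⟯
    (Fin 2 × Fin (finrank ℝ E + finrank ℝ F))) := by
  obtain ⟨s, hs⟩ := exists_spansAt E F A
  -- Applying the Gram map to its inverse gives X = ∑ (gram⁻¹X)(s_j) s_j, so the coefficients are
  -- the dual basis.
  refine ⟨⟨s, fun j =>
    { toFun := fun X => ⟨_, contMDiff_gramInv hs X j⟩
      map_add' := fun X Y => ?_
      map_smul' := fun f X => ?_ }, fun X => ?_⟩⟩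
  · ext x
    change gramInv hs x (X x + Y x) (s j x) = _
    rw [map_add]
    rfl
  · ext x
    change gramInv hs x (f x • X x) (s j x) = _
    rw [map_smul]
    rfl
  · ext x
    have h := gramMap_gramInv hs x (X x)
    rw [gramMap_apply] at h
    refine (map_sum ((Pi.evalAddMonoidHom A x).comp
      (ContMDiffSection.coeAddHom 𝓘(ℝ, E) F ∞ A)) _ _).trans ?_
    exact h

end GlobalFrame

/-! ### All correspondences over a module with a frame -/

section Correspondences

variable {R : Type*} [CommRing R] [Algebra ℝ R] {P : Type*} [AddCommGroup P] [Module ℝ P]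
  [Module R P] [IsScalarTower ℝ R P] {κ : Type*} [Fintype κ]

/-- The correspondences over a finitely generated projective module. -/
theorem Frame.correspondences (B : Frame R P κ) :
    (∀ (μ : Fun R P 1 2) (γ : Fun R P 2 1) (φ : Fun R P 0 3),
      let m := Fun.toHam R P 1 2 μ
      let g := Fun.toHam R P 2 1 γ
      let h := Fun.toHam R P 0 3 φ
      poisson R P (theta μ γ φ) (theta μ γ φ) = 0 ↔
        (1 / 2 : ℝ) • poisson R P m m + poisson R P g h = 0 ∧ poisson R P g g = 0 ∧
          poisson R P m g = 0 ∧ poisson R P m h = 0) ∧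
    (∀ Q : QuasiLieBialgebroid R P, ∃! S : DiffQuasiGerstenhaber R P, Corresponds Q S) ∧
    (∀ S : DiffQuasiGerstenhaber R P, ∃! Q : QuasiLieBialgebroid R P, Corresponds Q S) ∧
    (∀ S : DiffQuasiGerstenhaber R P, SectionRelations S) ∧
    (∀ Q : QuasiLieBialgebroid R P, ∃! T : QuasiDiffGerstenhaber R P, DuallyCorresponds Q T) ∧
    (∀ T : QuasiDiffGerstenhaber R P, ∃! Q : QuasiLieBialgebroid R P, DuallyCorresponds Q T) := by
  exact ⟨fun μ γ φ => poisson_theta_iff μ γ φ, fun Q => B.existsUnique_corresponds Q,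
    fun S => B.existsUnique_corresponds' S, fun S => S.sectionRelations,
    fun Q => QuasiLieBialg.existsUnique_dualCorresponds Q, fun T => B.existsUnique_dualCorresponds T⟩

end Correspondences

end QuasiLieBialg

end

open QuasiLieBialg in
theorem mainTheorem1
    {E : Type*} [NormedAddCommGroup E] [NormedSpace ℝ E] [FiniteDimensional ℝ E]
    {M : Type*} [TopologicalSpace M] [ChartedSpace E M] [IsManifold 𝓘(ℝ, E) ∞ M]
    [T2Space M] [SecondCountableTopology M]
    {F : Type*} [NormedAddCommGroup F] [NormedSpace ℝ F] [FiniteDimensional ℝ F]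
    (A : M → Type*) [TopologicalSpace (Bundle.TotalSpace F A)]
    [∀ x, AddCommGroup (A x)] [∀ x, Module ℝ (A x)] [∀ x, TopologicalSpace (A x)]
    [FiberBundle F A] [VectorBundle ℝ F A] [ContMDiffVectorBundle ∞ F A 𝓘(ℝ, E)] :
    let R := C^∞⟮𝓘(ℝ, E), M; 𝓘(ℝ, ℝ), ℝ⟯
    let P := Cₛ^∞⟮𝓘(ℝ, E); F, A⟯
    -- the structure equation, split according to bidegrees
    (∀ (μ : Fun R P 1 2) (γ : Fun R P 2 1) (φ : Fun R P 0 3),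
      let m := Fun.toHam R P 1 2 μ
      let g := Fun.toHam R P 2 1 γ
      let h := Fun.toHam R P 0 3 φ
      poisson R P (theta μ γ φ) (theta μ γ φ) = 0 ↔
        (1 / 2 : ℝ) • poisson R P m m + poisson R P g h = 0 ∧ poisson R P g g = 0 ∧
          poisson R P m g = 0 ∧ poisson R P m h = 0) ∧
    -- quasi-Lie bialgebroids and differential quasi-Gerstenhaber algebras
    (∀ Q : QuasiLieBialgebroid R P, ∃! S : DiffQuasiGerstenhaber R P, Corresponds Q S) ∧
    (∀ S : DiffQuasiGerstenhaber R P, ∃! Q : QuasiLieBialgebroid R P, Corresponds Q S) ∧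
    (∀ S : DiffQuasiGerstenhaber R P, SectionRelations S) ∧
    -- quasi-Lie bialgebroids and quasi-differential Gerstenhaber algebras
    (∀ Q : QuasiLieBialgebroid R P, ∃! T : QuasiDiffGerstenhaber R P, DuallyCorresponds Q T) ∧
    (∀ T : QuasiDiffGerstenhaber R P, ∃! Q : QuasiLieBialgebroid R P, DuallyCorresponds Q T) := by
  exact (exists_frame E F A).elim fun B => B.correspondences
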